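/- Let $(M,I)$ be a complex manifold (Hausdorff, second countable), and let $(E,g,J)\to M$ be a holomorphic Hermitian vector bundle of finite rank: $E$ is a holomorphic vector bundle, $J$ is multiplication by $i$ on its fibres, and $g$ is a smooth positive definite real metric on $E$ with $g(J\cdot,J\cdot)=g(\cdot,\cdot)$. Put $E_{\mathbb C}=E\otimes_{\mathbb R}\mathbb C=E^{1,0}\oplus E^{0,1}$ (the $\pm i$ eigenbundles of $J$); $E^{1,0}\cong (E,J)$ is a holomorphic bundle and $\bar\partial$ denotes the induced operator on forms with values in $\wedge^2E^{*1,0}$. For $\beta\in\wedge^2E^{*1,0}$ let $g^{-1}\beta$ be the endomorphism of $E_{\mathbb C}$ with $g((g^{-1}\beta)a,b)=\beta(a^{1,0},b^{1,0})$, where $g$ is extended complex bilinearly and $a^{1,0}$ is the $E^{1,0}$ component of $a$. Let $\mathcal T(E,g)=\{A\in \mathrm{End}_{\mathbb R}(E_x) : x\in M,\ A^2=-1,\ g(A\cdot,A\cdot)=g(\cdot,\cdot)\}$, a submanifold of the total space of the bundle $\mathrm{End}_{\mathbb R}E$. A metric connection $\nabla$ on the real bundle $E$ splits the tangent spaces of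 $\mathcal T(E,g)$ into vertical and horizontal vectors. The almost complex structure $\mathcal J^{(\nabla,I)}$ maps, at $A\in\mathcal T(E,g)$, a vertical vector $B$ to $AB$ and the horizontal lift of $v$ to the horizontal lift of $Iv$. We say that $\mathcal J^{(\nabla,I)}$ is a complex structure if it comes from a holomorphic atlas on $\mathcal T(E,g)$ which is compatible with the smooth structure. Two complex structures on $\mathcal T(E,g)$ are isomorphic if there is a biholomorphism between them. The bundle has a Chern connection $\nabla^{Ch}$ (a connection on the real bundle $E$ with $\nabla^{Ch}g=0$, $\nabla^{Ch}J=0$ whose $(0,1)$ part is the operator $\bar\partial$ of $E$). For a smooth $(0,1)$-form $D\in\Gamma(T^{*0,1}\otimes\wedge^2E^{*1,0})$ let $\nabla_D=\nabla^{Ch}+g^{-1}D+\overline{g^{-1}D}$; this is the real metric connection on $E$ whose $(0,1)$ part on $E_{\mathbb C}$ is $\nabla^{Ch(0,1)}+g^{-1}D$. Then: 1. If $\bar\partial D=0$, then $\mathcal J^{(\nabla_D,I)}$ is a complex structure on $\mathcal T(E,g)$. 2. If $\bar\partial D=0$ and $B\in\Gamma(\wedge^2E^{*1,0})$ is a smooth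 section, then $D+\bar\partial B$ is $\bar\partial$-closed and $\exp(-g^{-1}B)$ induces a fibre preserving biholomorphism $$(\mathcal T(E,g),\mathcal J^{(\nabla_D,I)})\longrightarrow(\mathcal T(E,g),\mathcal J^{(\nabla_{D+\bar\partial B},I)}),$$ namely the map $A\mapsto A'$ with $E^{0,1}_{A'}=\exp(-g^{-1}B)\,E^{0,1}_{A}$, where $E^{0,1}_A\subset E_{\mathbb C}$ denotes the $-i$ eigenspace of $A$. 3. Consequently the assignment $[D]\mapsto[\mathcal J^{(\nabla_D,I)}]$ is a well defined map from the Dolbeault cohomology group $H^{0,1}(\wedge^2E^{*1,0})=\{D:\bar\partial D=0\}/\{\bar\partial B\}$ to the set of isomorphism classes of complex structures on $\mathcal T(E,g)$. -/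

import Mathlib

open Bundle Manifold Topology
open scoped ContDiff TensorProduct

section RealStructure
variable {EM : Type*} [NormedAddCommGroup EM] [NormedSpace ℂ EM]
  {M : Type*} [TopologicalSpace M] [ChartedSpace EM M]
  {F : Type*} [NormedAddCommGroup F] [NormedSpace ℂ F]
  {V : M → Type*} [TopologicalSpace (TotalSpace F V)]
  [∀ x, AddCommGroup (V x)] [∀ x, Module ℂ (V x)] [∀ x, TopologicalSpace (V x)]
  [FiberBundle F V]

instance realContinuousSMul (W : Type*) [AddCommGroup W] [Module ℂ W] [TopologicalSpace W]
    [ContinuousSMul ℂ W] : ContinuousSMul ℝ W :=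
  ⟨(continuous_smul (M := ℂ) (X := W)).comp
    ((Complex.continuous_ofReal.comp continuous_fst).prodMk continuous_snd)⟩

instance realIsManifold [h : IsManifold 𝓘(ℂ, EM) ∞ M] : IsManifold 𝓘(ℝ, EM) ∞ M := by
  refine isManifold_of_contDiffOn _ _ _ fun e e' he he' => ?_
  have := (contDiffGroupoid ∞ 𝓘(ℂ, EM)).compatible he he'
  rw [contDiffGroupoid, mem_groupoid_of_pregroupoid] at this
  exact this.1.restrict_scalars ℝ

theorem realContMDiffOn {G : Type*} [NormedAddCommGroup G] [NormedSpace ℂ G] {n : ℕ∞ω}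
    {f : M → G} {s : Set M} (h : ContMDiffOn 𝓘(ℂ, EM) 𝓘(ℂ, G) n f s) :
    ContMDiffOn 𝓘(ℝ, EM) 𝓘(ℝ, G) n f s := fun x hx =>
  ⟨(h x hx).1, (h x hx).2.restrict_scalars ℝ⟩

variable [VectorBundle ℂ F V]

theorem realTrivialization_linear (e : Trivialization F (π F V)) [MemTrivializationAtlas e] :
    e.IsLinear ℝ :=
  ⟨fun _ hb =>
    { map_add := (e.linear ℂ hb).map_add
      map_smul := fun c y => (e.linear ℂ hb).map_smul (c:ℂ) y }⟩

theorem real_coordChangeL (e e' : Trivialization F (π F V)) [MemTrivializationAtlas e]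
    [MemTrivializationAtlas e'] [e.IsLinear ℝ] [e'.IsLinear ℝ] {x : M}
    (hb : x ∈ e.baseSet ∩ e'.baseSet) :
    (e.coordChangeL ℝ e' x : F →L[ℝ] F) =
      ContinuousLinearMap.restrictScalarsL ℂ F F ℝ ℝ (e.coordChangeL ℂ e' x : F →L[ℂ] F) := by
  ext y
  simp [Trivialization.coordChangeL_apply _ _ hb]

instance realVectorBundle : VectorBundle ℝ F V where
  trivialization_linear' e _ := realTrivialization_linear e
  continuousOn_coordChange' e e' _ _ := by
    have := realTrivialization_linear e
    have := realTrivialization_linear e'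
    exact ((ContinuousLinearMap.restrictScalarsL ℂ F F ℝ ℝ).continuous.comp_continuousOn
      (continuousOn_coordChange ℂ e e')).congr fun b hb => real_coordChangeL e e' hb

instance realContMDiffVectorBundle [IsManifold 𝓘(ℂ, EM) ω M] [h : ContMDiffVectorBundle ω F V 𝓘(ℂ, EM)] :
    ContMDiffVectorBundle ∞ F V 𝓘(ℝ, EM) where
  contMDiffOn_coordChangeL e e' _ _ := by
    have h1 := realContMDiffOn ((h.contMDiffOn_coordChangeL e e').of_le (m := ∞) le_top)
    exact ((ContinuousLinearMap.restrictScalarsL ℂ F F ℝ ℝ).contMDiff.comp_contMDiffOn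
      h1).congr fun b hb => real_coordChangeL e e' hb

end RealStructure

noncomputable section HolomorphicTwistor

section LinearAlgebra

variable (W : Type*) [AddCommGroup W] [Module ℂ W]

/-- The complexification `W_ℂ = ℂ ⊗_ℝ W` of the real vector space underlying `W`. -/
abbrev Cplx : Type _ := ℂ ⊗[ℝ] W

/-- `Λ²(W^*)`: alternating complex bilinear forms on the complex vector space `W`. -/
abbrev Alt2 : Type _ := W [⋀^Fin 2]→ₗ[ℂ] ℂ

/-- Complex conjugation `z ⊗ w ↦ z̄ ⊗ w` of `W_ℂ`. -/
def cplxConj : Cplx W →ₗ[ℝ] Cplx W := LinearMap.rTensor W Complex.conjAe.toLinearMap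

/-- The real part `z ⊗ w ↦ (Re z) w` of an element of `W_ℂ`. -/
def cplxRe : Cplx W →ₗ[ℝ] W :=
  (TensorProduct.lid ℝ W).toLinearMap ∘ₗ LinearMap.rTensor W Complex.reLm

/-- The complex linear map `W_ℂ → W`, `z ⊗ w ↦ z • w`.  It vanishes on the `-i` eigenspace `W^{0,1}`
of the complex structure of `W`, and on the `+i` eigenspace `W^{1,0}` it is the inverse of the
standard isomorphism `W ≃ W^{1,0}`, `w ↦ w^{1,0} = (1 ⊗ w - i ⊗ (i w)) / 2`. So it is the projection
`W_ℂ → W^{1,0}` followed by the identification of `W^{1,0}` with the complex vector space `W`. -/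
def cplxProj : Cplx W →ₗ[ℂ] W := (LinearMap.id : W →ₗ[ℝ] W).liftBaseChange ℂ

variable {W}

/-- `β ∈ Λ²(W^{*1,0})`, seen as a map `W_ℂ → (W_ℂ)^*`, namely `a ↦ (b ↦ β(a^{1,0}, b^{1,0}))`. -/
def alt2Pull (β : Alt2 W) : Cplx W →ₗ[ℂ] Module.Dual ℂ (Cplx W) :=
  LinearMap.mk₂ ℂ (fun a b => β ![cplxProj W a, cplxProj W b])
    (fun a a' b => by
      have := β.map_update_add ![0, cplxProj W b] 0 (cplxProj W a) (cplxProj W a')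
      convert this using 2 <;> (try congr 1) <;> ext i <;> fin_cases i <;> simp)
    (fun c a b => by
      have := β.map_update_smul ![0, cplxProj W b] 0 c (cplxProj W a)
      convert this using 2 <;> (try congr 1) <;> ext i <;> fin_cases i <;> simp)
    (fun a b b' => by
      have := β.map_update_add ![cplxProj W a, 0] 1 (cplxProj W b) (cplxProj W b')
      convert this using 2 <;> (try congr 1) <;> ext i <;> fin_cases i <;> simp)
    (fun c a b => by
      have := β.map_update_smul ![cplxProj W a, 0] 1 c (cplxProj W b)
      convert this using 2 <;> (try congr 1) <;> ext i <;> fin_cases i <;> simp)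

theorem cplx_decomp (z : Cplx W) :
    ∃ a b : W, z = (1 : ℂ) ⊗ₜ[ℝ] a + Complex.I ⊗ₜ[ℝ] b := by
  induction z using TensorProduct.induction_on with
  | zero => exact ⟨0, 0, by simp⟩
  | tmul c w =>
    refine ⟨c.re • w, c.im • w, ?_⟩
    rw [← TensorProduct.smul_tmul, ← TensorProduct.smul_tmul, ← TensorProduct.add_tmul]
    congr 1
    apply Complex.ext <;> simp
  | add x y hx hy =>
    obtain ⟨a, b, rfl⟩ := hx
    obtain ⟨a', b', rfl⟩ := hy
    exact ⟨a + a', b + b', by simp only [TensorProduct.tmul_add]; abel⟩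

theorem baseChange_nondegenerate (q : LinearMap.BilinForm ℝ W) (hq : ∀ a, a ≠ 0 → 0 < q a a) :
    (q.baseChange ℂ).Nondegenerate := by
  refine ⟨fun z hz => ?_, fun z hz => ?_⟩ <;> obtain ⟨a, b, rfl⟩ := cplx_decomp z
  · have key : ∀ c, q a c = 0 ∧ q b c = 0 := fun c => by
      have := hz (1 ⊗ₜ c)
      simp [LinearMap.BilinForm.baseChange_tmul] at this
      have h1 := congrArg Complex.re this
      have h2 := congrArg Complex.im this
      simp at h1 h2
      exact ⟨h1, h2⟩
    have ha : a = 0 := by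
      by_contra h
      exact (hq a h).ne' (key a).1
    have hb : b = 0 := by
      by_contra h
      exact (hq b h).ne' (key b).2
    simp [ha, hb]
  · have key : ∀ c, q c a = 0 ∧ q c b = 0 := fun c => by
      have := hz (1 ⊗ₜ c)
      simp [LinearMap.BilinForm.baseChange_tmul] at this
      have h1 := congrArg Complex.re this
      have h2 := congrArg Complex.im this
      simp at h1 h2
      exact ⟨h1, h2⟩
    have ha : a = 0 := by
      by_contra h
      exact (hq a h).ne' (key a).1
    have hb : b = 0 := by
      by_contra h
      exact (hq b h).ne' (key b).2
    simp [ha, hb]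

/-- The endomorphism `q⁻¹β` of `W_ℂ` defined by a form `β ∈ Λ²(W^{*1,0})` and a positive definite
real bilinear form `q` on `W`: it is characterised by `q_ℂ((q⁻¹β) a, b) = β(a^{1,0}, b^{1,0})`, where
`q_ℂ` is the complex bilinear extension of `q`. -/
def raise [FiniteDimensional ℝ W] (q : LinearMap.BilinForm ℝ W) (hq : ∀ a, a ≠ 0 → 0 < q a a) :
    Alt2 W →ₗ[ℂ] Module.End ℂ (Cplx W) where
  toFun β := ((q.baseChange ℂ).toDual (baseChange_nondegenerate q hq)).symm.toLinearMap ∘ₗ alt2Pull β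
  map_add' β β' := by
    rw [← LinearMap.comp_add]; rfl
  map_smul' c β := by
    rw [RingHom.id_apply, ← LinearMap.comp_smul]; rfl

theorem raise_apply [FiniteDimensional ℝ W] (q : LinearMap.BilinForm ℝ W)
    (hq : ∀ a, a ≠ 0 → 0 < q a a) (β : Alt2 W) (a b : Cplx W) :
    q.baseChange ℂ (raise q hq β a) b = β ![cplxProj W a, cplxProj W b] := by
  exact LinearMap.BilinForm.apply_toDual_symm_apply (hB := baseChange_nondegenerate q hq) ..

/-- The complex conjugate `T̄ = conj ∘ T ∘ conj` of an endomorphism of `W_ℂ`. -/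
def cplxConjEnd (T : Module.End ℂ (Cplx W)) : Cplx W →ₗ[ℝ] Cplx W :=
  cplxConj W ∘ₗ T.restrictScalars ℝ ∘ₗ cplxConj W

/-- The endomorphism of the real vector space `W` whose complexification is the real endomorphism
`T + T̄` of `W_ℂ`. -/
def realEnd (T : Module.End ℂ (Cplx W)) : W →ₗ[ℝ] W :=
  cplxRe W ∘ₗ (T.restrictScalars ℝ + cplxConjEnd T) ∘ₗ TensorProduct.mk ℝ ℂ W 1

theorem one_tmul_realEnd (T : Module.End ℂ (Cplx W)) (w : W) :
    (1 : ℂ) ⊗ₜ[ℝ] realEnd T w = T (1 ⊗ₜ w) + cplxConjEnd T (1 ⊗ₜ w) := by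
  obtain ⟨a, b, h⟩ := cplx_decomp (T (1 ⊗ₜ w))
  simp [realEnd, cplxConjEnd, cplxConj, cplxRe, h, TensorProduct.tmul_add, TensorProduct.neg_tmul]
  abel

theorem realEnd_add (T T' : Module.End ℂ (Cplx W)) : realEnd (T + T') = realEnd T + realEnd T' := by
  ext w
  simp [realEnd, cplxConjEnd]
  abel

theorem realEnd_smul (c : ℝ) (T : Module.End ℂ (Cplx W)) : realEnd ((c : ℂ) • T) = c • realEnd T := by
  have h : ∀ z : Cplx W, (c : ℂ) • z = c • z := fun z => Complex.coe_smul c z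
  ext w
  simp only [realEnd, cplxConjEnd, LinearMap.comp_apply, LinearMap.add_apply,
    LinearMap.restrictScalars_apply, LinearMap.smul_apply, h, map_smul, map_add, smul_add]

/-- The space `W^{0,1}_J ⊆ W_ℂ`, the `-i` eigenspace of (the complexification of) `J`. -/
def eigen01 (J : W →ₗ[ℝ] W) : Submodule ℂ (Cplx W) :=
  Module.End.eigenspace (J.baseChange ℂ) (-Complex.I)

end LinearAlgebra

section Forms

/-- The conjugate linear part `v ↦ (L(v) + i L(i v)) / 2` of a real linear form `L` on a complex
vector space. -/
def conjPart {T : Type*} [NormedAddCommGroup T] [NormedSpace ℂ T] (L : T →L[ℝ] ℂ) : T →ₗ⋆[ℂ] ℂ where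
  toFun v := 2⁻¹ * (L v + Complex.I * L (Complex.I • v))
  map_add' v w := by
    rw [smul_add, map_add, map_add]; ring
  map_smul' c v := by
    have h0 : ∀ (c : ℂ) (u : T), L (c • u) = c.re * L u + c.im * L (Complex.I • u) := fun c u => by
      have : c • u = c.re • u + c.im • (Complex.I • u) := by
        rw [← Complex.coe_smul, ← Complex.coe_smul, smul_smul, ← add_smul, Complex.re_add_im]
      rw [this, map_add, map_smul, map_smul, Complex.real_smul, Complex.real_smul]
    have h2 : L (Complex.I • (c • v)) = c.re * L (Complex.I • v) - c.im * L v := by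
      rw [smul_smul, mul_comm, ← smul_smul, h0, smul_smul, Complex.I_mul_I, neg_one_smul, map_neg]
      ring
    have h3 : (starRingEnd ℂ) c = c.re - c.im * Complex.I := by
      apply Complex.ext <;> simp
    rw [h2, h0, h3, smul_eq_mul]
    linear_combination (2⁻¹ * (c.im : ℂ) * L (Complex.I • v)) * Complex.I_mul_I

variable {EM : Type*} [NormedAddCommGroup EM] [NormedSpace ℂ EM]
  {M : Type*} [TopologicalSpace M] [ChartedSpace EM M]

/-- The complex structure `I` of `M`, acting on the real tangent space at `x`. -/
def tangentI (x : M) : TangentSpace 𝓘(ℝ, EM) x →L[ℝ] TangentSpace 𝓘(ℝ, EM) x :=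
  (Complex.I • ContinuousLinearMap.id ℝ EM : EM →L[ℝ] EM)

/-- `∂̄f` at `x` for a function `f : M → ℂ`, as the conjugate linear form
`v ↦ (df(v) + i df(I v)) / 2` on the tangent space. -/
def dbarFun (f : M → ℂ) (x : M) : TangentSpace 𝓘(ℂ, EM) x →ₗ⋆[ℂ] ℂ :=
  (conjPart (mfderiv 𝓘(ℝ, EM) 𝓘(ℝ, ℂ) f x : EM →L[ℝ] ℂ) : EM →ₗ⋆[ℂ] ℂ)

theorem conjPart_add {T : Type*} [NormedAddCommGroup T] [NormedSpace ℂ T] (L L' : T →L[ℝ] ℂ) :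
    conjPart (L + L') = conjPart L + conjPart L' := by
  ext v; simp [conjPart]; ring

theorem conjPart_smul {T : Type*} [NormedAddCommGroup T] [NormedSpace ℂ T] (c : ℂ) (L : T →L[ℝ] ℂ) :
    conjPart (c • L) = c • conjPart L := by
  ext v; simp [conjPart]; ring

theorem dbarFun_add {f f' : M → ℂ} {x : M} (hf : MDifferentiableAt 𝓘(ℝ, EM) 𝓘(ℝ, ℂ) f x)
    (hf' : MDifferentiableAt 𝓘(ℝ, EM) 𝓘(ℝ, ℂ) f' x) :
    dbarFun (EM := EM) (fun y => f y + f' y) x = dbarFun f x + dbarFun f' x := by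
  let L : EM →L[ℝ] ℂ := mfderiv 𝓘(ℝ, EM) 𝓘(ℝ, ℂ) f x
  let L' : EM →L[ℝ] ℂ := mfderiv 𝓘(ℝ, EM) 𝓘(ℝ, ℂ) f' x
  have h : mfderiv 𝓘(ℝ, EM) 𝓘(ℝ, ℂ) (fun y => f y + f' y) x = (L + L' : EM →L[ℝ] ℂ) :=
    (hf.hasMFDerivAt.add hf'.hasMFDerivAt).mfderiv
  exact (congrArg (fun L : EM →L[ℝ] ℂ => conjPart L) h).trans (conjPart_add L L')

theorem dbarFun_smul {f : M → ℂ} {x : M} (hf : MDifferentiableAt 𝓘(ℝ, EM) 𝓘(ℝ, ℂ) f x) (c : ℂ) :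
    dbarFun (EM := EM) (fun y => c • f y) x = c • dbarFun f x := by
  let L : EM →L[ℝ] ℂ := mfderiv 𝓘(ℝ, EM) 𝓘(ℝ, ℂ) f x
  have h : mfderiv 𝓘(ℝ, EM) 𝓘(ℝ, ℂ) (fun y => c • f y) x = (c • L : EM →L[ℝ] ℂ) :=
    (((c • ContinuousLinearMap.id ℝ ℂ).hasMFDerivAt (x := f x)).comp x hf.hasMFDerivAt).mfderiv
  exact (congrArg (fun L : EM →L[ℝ] ℂ => conjPart L) h).trans (conjPart_smul c L)

theorem dbarFun_zero (x : M) : dbarFun (EM := EM) (fun _ : M => (0 : ℂ)) x = 0 := by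
  have := dbarFun_smul (EM := EM) (f := fun _ : M => (0 : ℂ)) (x := x) mdifferentiableAt_const 0
  simpa using this

end Forms

section Dolbeault

/-- The identification of the fibre over `x` with the fibre over `y` by the trivialization at `x`.
For `a ∈ V x`, `y ↦ frameExt F V x y a` is the local section through `a` with constant coordinates
in that trivialization; it is holomorphic if the bundle is. -/
def frameExt {M : Type*} [TopologicalSpace M] (F : Type*) [NormedAddCommGroup F] [NormedSpace ℂ F]
    (V : M → Type*) [TopologicalSpace (TotalSpace F V)] [∀ x, AddCommGroup (V x)]
    [∀ x, Module ℂ (V x)] [∀ x, TopologicalSpace (V x)] [FiberBundle F V] [VectorBundle ℂ F V]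
    (x y : M) : V x →ₗ[ℂ] V y :=
  (trivializationAt F V x).symmₗ ℂ y ∘ₗ (trivializationAt F V x).linearMapAt ℂ x

variable (EM : Type*) [NormedAddCommGroup EM] [NormedSpace ℂ EM]
  {M : Type*} [TopologicalSpace M] [ChartedSpace EM M] [IsManifold 𝓘(ℂ, EM) ω M]
  (F : Type*) [NormedAddCommGroup F] [NormedSpace ℂ F]
  (V : M → Type*) [TopologicalSpace (TotalSpace F V)]
  [∀ x, AddCommGroup (V x)] [∀ x, Module ℂ (V x)] [∀ x, TopologicalSpace (V x)]
  [FiberBundle F V] [VectorBundle ℂ F V]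

/-- `Γ(Λ²E^{*1,0})`: the smooth sections of the bundle of alternating complex bilinear forms.
Smoothness means that the components in local holomorphic frames are smooth. -/
def smoothSections : Submodule ℂ (Π x, Alt2 (V x)) where
  carrier := {B | ∀ (x : M) (c : Fin 2 → V x),
    ContMDiffAt 𝓘(ℝ, EM) 𝓘(ℝ, ℂ) ∞ (fun y => B y (fun i => frameExt F V x y (c i))) x}
  add_mem' h h' x c := (h x c).add (h' x c)
  zero_mem' _ _ := contMDiffAt_const
  smul_mem' k _ h x c := ((k • ContinuousLinearMap.id ℝ ℂ).contMDiff.contMDiffAt).comp x (h x c)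

/-- `Γ(T^{*0,1} ⊗ Λ²E^{*1,0})`: the smooth `(0,1)`-forms with values in `Λ²E^{*1,0}`. Such a form
assigns to every tangent vector, conjugate linearly, an alternating complex bilinear form. -/
def smoothForms : Submodule ℂ (Π x : M, TangentSpace 𝓘(ℂ, EM) x →ₗ⋆[ℂ] Alt2 (V x)) where
  carrier := {D | ∀ (x : M) (v : TangentSpace 𝓘(ℂ, EM) x) (c : Fin 2 → V x),
    ContMDiffAt 𝓘(ℝ, EM) 𝓘(ℝ, ℂ) ∞ (fun y => D y (frameExt EM (TangentSpace 𝓘(ℂ, EM)) x y v)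
      (fun i => frameExt F V x y (c i))) x}
  add_mem' h h' x v c := (h x v c).add (h' x v c)
  zero_mem' _ _ _ := contMDiffAt_const
  smul_mem' k _ h x v c := ((k • ContinuousLinearMap.id ℝ ℂ).contMDiff.contMDiffAt).comp x (h x v c)

/-- The operator `∂̄ : Γ(Λ²E^{*1,0}) → Γ(T^{*0,1} ⊗ Λ²E^{*1,0})` of the holomorphic bundle
`Λ²E^{*1,0}`: if `s`, `t` are local holomorphic sections of `E`, then
`(∂̄B)(s, t) = ∂̄ (B(s, t))`. -/
def dbar : smoothSections EM F V →ₗ[ℂ] Π x : M, TangentSpace 𝓘(ℂ, EM) x →ₗ⋆[ℂ] Alt2 (V x) where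
  toFun B x :=
    { toFun := fun v =>
        { toFun := fun c => dbarFun (fun y => B.1 y (fun i => frameExt F V x y (c i))) x v
          map_update_add' := fun {d} c i a a' => by
            obtain rfl := Subsingleton.elim d (instDecidableEqFin 2)
            have h := fun c => (B.2 x c).mdifferentiableAt (by simp)
            have e := dbarFun_add (EM := EM) (h (Function.update c i a)) (h (Function.update c i a'))
            refine Eq.trans ?_ ((congrArg (fun L => L v) e).trans rfl)
            congr 2
            ext y
            exact ((B.1 y).compLinearMap (frameExt F V x y)).map_update_add c i a a'
          map_update_smul' := fun {d} c i k a => by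
            obtain rfl := Subsingleton.elim d (instDecidableEqFin 2)
            have h := fun c => (B.2 x c).mdifferentiableAt (by simp)
            have e := dbarFun_smul (EM := EM) (h (Function.update c i a)) k
            refine Eq.trans ?_ ((congrArg (fun L => L v) e).trans rfl)
            congr 2
            ext y
            exact ((B.1 y).compLinearMap (frameExt F V x y)).map_update_smul c i k a
          map_eq_zero_of_eq' := fun c i j hij hne => by
            refine Eq.trans ?_ (congrArg (fun L => L v) (dbarFun_zero x))
            congr 2
            ext y
            exact ((B.1 y).compLinearMap (frameExt F V x y)).map_eq_zero_of_eq c hij hne }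
      map_add' := fun v w => by
        ext c
        exact (dbarFun (fun y => B.1 y (fun i => frameExt F V x y (c i))) x).map_add v w
      map_smul' := fun k v => by
        ext c
        exact (dbarFun (fun y => B.1 y (fun i => frameExt F V x y (c i))) x).map_smulₛₗ k v }
  map_add' B B' := by
    ext x v c
    exact congrArg (fun L => L v) (dbarFun_add (((B.2 x c).mdifferentiableAt (by simp)))
      (((B'.2 x c).mdifferentiableAt (by simp))))
  map_smul' k B := by
    ext x v c
    exact congrArg (fun L => L v) (dbarFun_smul (((B.2 x c).mdifferentiableAt (by simp))) k)

/-- The `∂̄`-closed forms. In terms of local holomorphic frames of `E` and `TM` the condition is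
`∂̄_v (D(w)) = ∂̄_w (D(v))` for constant vector fields `v`, `w`. -/
def closedForms : Submodule ℂ (Π x : M, TangentSpace 𝓘(ℂ, EM) x →ₗ⋆[ℂ] Alt2 (V x)) where
  carrier := {D | D ∈ smoothForms EM F V ∧
    ∀ (x : M) (v w : TangentSpace 𝓘(ℂ, EM) x) (c : Fin 2 → V x),
      dbarFun (fun y => D y (frameExt EM (TangentSpace 𝓘(ℂ, EM)) x y w)
        (fun i => frameExt F V x y (c i))) x v =
      dbarFun (fun y => D y (frameExt EM (TangentSpace 𝓘(ℂ, EM)) x y v)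
        (fun i => frameExt F V x y (c i))) x w}
  add_mem' := by
    rintro D D' ⟨h, hc⟩ ⟨h', hc'⟩
    refine ⟨add_mem h h', fun x v w c => ?_⟩
    have e : ∀ u, _ := fun u => dbarFun_add (EM := EM) ((h x u c).mdifferentiableAt (by simp))
      ((h' x u c).mdifferentiableAt (by simp))
    refine (congrArg (fun L => L v) (e w)).trans (Eq.trans ?_ (congrArg (fun L => L w) (e v)).symm)
    exact congrArg₂ (· + ·) (hc x v w c) (hc' x v w c)
  zero_mem' := by
    refine ⟨zero_mem _, fun x v w c => ?_⟩
    have := dbarFun_zero (EM := EM) x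
    exact (congrArg (fun L => L v) this).trans (congrArg (fun L => L w) this).symm
  smul_mem' := by
    rintro k D ⟨h, hc⟩
    refine ⟨Submodule.smul_mem _ k h, fun x v w c => ?_⟩
    have e : ∀ u, _ := fun u => dbarFun_smul (EM := EM) ((h x u c).mdifferentiableAt (by simp)) k
    refine (congrArg (fun L => L v) (e w)).trans (Eq.trans ?_ (congrArg (fun L => L w) (e v)).symm)
    exact congrArg (k • ·) (hc x v w c)

/-- The Dolbeault cohomology group `H^{0,1}(Λ²E^{*1,0})`. -/
abbrev DolbeaultH01 : Type _ :=
  closedForms EM F V ⧸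
    ((LinearMap.range (dbar EM F V)).comap (closedForms EM F V).subtype).toAddSubgroup

end Dolbeault

section Fibre

variable {M : Type*} [TopologicalSpace M] (F : Type*) [NormedAddCommGroup F] [NormedSpace ℂ F]
  (V : M → Type*) [TopologicalSpace (TotalSpace F V)]
  [∀ x, AddCommGroup (V x)] [∀ x, Module ℂ (V x)] [∀ x, TopologicalSpace (V x)]
  [FiberBundle F V] [VectorBundle ℂ F V]

theorem fibre_finiteDimensional [FiniteDimensional ℂ F] (x : M) : FiniteDimensional ℝ (V x) := by
  let e := (trivializationAt F V x).continuousLinearEquivAt ℝ x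
    (FiberBundle.mem_baseSet_trivializationAt' x)
  have : FiniteDimensional ℝ F := FiniteDimensional.complexToReal F
  exact e.symm.toLinearEquiv.finiteDimensional

theorem fibre_t2Space {M : Type*} [TopologicalSpace M] (F : Type*) [NormedAddCommGroup F]
    [NormedSpace ℂ F] (V : M → Type*) [TopologicalSpace (TotalSpace F V)]
    [∀ x, AddCommGroup (V x)] [∀ x, Module ℂ (V x)] [∀ x, TopologicalSpace (V x)]
    [FiberBundle F V] [VectorBundle ℂ F V] (x : M) : T2Space (V x) := by
  let e := (trivializationAt F V x).continuousLinearEquivAt ℝ x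
    (FiberBundle.mem_baseSet_trivializationAt' x)
  exact e.toHomeomorph.symm.t2Space

end Fibre

section Connections

variable {EM : Type*} [NormedAddCommGroup EM] [NormedSpace ℂ EM]
  {M : Type*} [TopologicalSpace M] [ChartedSpace EM M] [IsManifold 𝓘(ℂ, EM) ω M]
  {F : Type*} [NormedAddCommGroup F] [NormedSpace ℂ F]
  {V : M → Type*} [TopologicalSpace (TotalSpace F V)]
  [∀ x, AddCommGroup (V x)] [∀ x, Module ℂ (V x)] [∀ x, TopologicalSpace (V x)]
  [∀ x, IsTopologicalAddGroup (V x)] [∀ x, ContinuousSMul ℂ (V x)]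
  [FiberBundle F V] [VectorBundle ℂ F V]

/-- `g` is Hermitian: it is compatible with the complex structure `J` (multiplication by `i`) of
the fibres. -/
def IsHermitianMetric (g : ContMDiffRiemannianMetric 𝓘(ℝ, EM) ∞ F V) : Prop :=
  ∀ (x : M) (a b : V x), g.inner x (Complex.I • a) (Complex.I • b) = g.inner x a b

/-- The metric at `x` as a real bilinear form. -/
def metricForm (g : ContMDiffRiemannianMetric 𝓘(ℝ, EM) ∞ F V) (x : M) :
    LinearMap.BilinForm ℝ (V x) :=
  LinearMap.mk₂ ℝ (fun a b => g.inner x a b) (by simp) (by simp) (by simp) (by simp)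

/-- The endomorphism `g⁻¹β` of `E_ℂ` at `x`, for `β ∈ Λ²E^{*1,0}`; it maps `E^{1,0}` to `E^{0,1}`
and vanishes on `E^{0,1}`. -/
def metricRaise [FiniteDimensional ℂ F] (g : ContMDiffRiemannianMetric 𝓘(ℝ, EM) ∞ F V) (x : M) :
    Alt2 (V x) →ₗ[ℂ] Module.End ℂ (Cplx (V x)) :=
  haveI := fibre_finiteDimensional F V x
  raise (metricForm g x) (g.pos x)

/-- `∇` is the Chern connection of the holomorphic Hermitian bundle, as a connection on the
underlying real vector bundle: it preserves the metric `g` and the complex structure `J = i`, and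
`∇^{0,1} = ∂̄`, that is, `∇_{Iv} σ = J ∇_v σ` at every point where `σ` is complex differentiable. -/
structure IsChernConnection (g : ContMDiffRiemannianMetric 𝓘(ℝ, EM) ∞ F V)
    (cov : CovariantDerivative 𝓘(ℝ, EM) F V) : Prop where
  metric : ∀ (σ τ : Π x, V x) (x : M) (v : TangentSpace 𝓘(ℝ, EM) x),
    MDifferentiableAt 𝓘(ℝ, EM) (𝓘(ℝ, EM).prod 𝓘(ℝ, F)) (fun y => TotalSpace.mk' F y (σ y)) x →
    MDifferentiableAt 𝓘(ℝ, EM) (𝓘(ℝ, EM).prod 𝓘(ℝ, F)) (fun y => TotalSpace.mk' F y (τ y)) x →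
    mfderiv 𝓘(ℝ, EM) 𝓘(ℝ, ℝ) (fun y => g.inner y (σ y) (τ y)) x v =
      g.inner x (cov σ x v) (τ x) + g.inner x (σ x) (cov τ x v)
  complex : ∀ (σ : Π x, V x) (x : M) (v : TangentSpace 𝓘(ℝ, EM) x),
    MDifferentiableAt 𝓘(ℝ, EM) (𝓘(ℝ, EM).prod 𝓘(ℝ, F)) (fun y => TotalSpace.mk' F y (σ y)) x →
    cov (fun y => Complex.I • σ y) x v = Complex.I • cov σ x v
  holomorphic : ∀ (σ : Π x, V x) (x : M) (v : TangentSpace 𝓘(ℝ, EM) x),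
    MDifferentiableAt 𝓘(ℂ, EM) (𝓘(ℂ, EM).prod 𝓘(ℂ, F)) (fun y => TotalSpace.mk' F y (σ y)) x →
    cov σ x (tangentI x v) = Complex.I • cov σ x v

/-- The real one-form `g⁻¹D + conj(g⁻¹D)` with values in the skew endomorphisms of `E`. -/
def realOneForm [FiniteDimensional ℂ EM] [FiniteDimensional ℂ F]
    (g : ContMDiffRiemannianMetric 𝓘(ℝ, EM) ∞ F V)
    (D : Π x : M, TangentSpace 𝓘(ℂ, EM) x →ₗ⋆[ℂ] Alt2 (V x)) (x : M) :
    V x →L[ℝ] TangentSpace 𝓘(ℝ, EM) x →L[ℝ] V x :=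
  haveI := fibre_finiteDimensional F V x
  haveI := fibre_t2Space F V x
  haveI : FiniteDimensional ℝ (TangentSpace 𝓘(ℝ, EM) x) := FiniteDimensional.complexToReal EM
  haveI : T2Space (TangentSpace 𝓘(ℝ, EM) x) := inferInstanceAs (T2Space EM)
  LinearMap.toContinuousLinearMap
    { toFun := fun e => LinearMap.toContinuousLinearMap
        { toFun := fun v => realEnd (metricRaise g x (D x v)) e
          map_add' := fun v w => by
            have h : D x (v + w) = D x v + D x w := (D x).map_add v w
            have := congrArg (fun β => realEnd (metricRaise g x β) e) h
            rwa [map_add, realEnd_add] at this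
          map_smul' := fun c v => by
            have h : D x (c • v) = (c : ℂ) • D x v := by
              have := (D x).map_smulₛₗ (c : ℂ) v
              rw [Complex.conj_ofReal] at this
              exact this
            have := congrArg (fun β => realEnd (metricRaise g x β) e) h
            rwa [map_smul, realEnd_smul] at this }
      map_add' := fun e e' => by
        ext v
        exact map_add (realEnd (metricRaise g x (D x v))) e e'
      map_smul' := fun c e => by
        ext v
        exact map_smul (realEnd (metricRaise g x (D x v))) c e }

/-- The real connection `∇ = ∇^{Ch} + g⁻¹D + conj(g⁻¹D)` on `E`, whose `(0,1)` part on `E_ℂ` is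
`∇^{Ch(0,1)} + g⁻¹D`; here `cov` stands for the Chern connection. -/
def twistedConnection [FiniteDimensional ℂ EM] [FiniteDimensional ℂ F]
    (g : ContMDiffRiemannianMetric 𝓘(ℝ, EM) ∞ F V) (cov : CovariantDerivative 𝓘(ℝ, EM) F V)
    (D : Π x : M, TangentSpace 𝓘(ℂ, EM) x →ₗ⋆[ℂ] Alt2 (V x)) :
    CovariantDerivative 𝓘(ℝ, EM) F V :=
  cov.addOneForm (realOneForm g D)

end Connections

section Twistor

/-- The total space of the bundle `End E` of real endomorphisms of `E`. -/
abbrev EndTotal {M : Type*} (F : Type*) [NormedAddCommGroup F] [NormedSpace ℂ F]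
    (V : M → Type*) [∀ x, AddCommGroup (V x)] [∀ x, Module ℂ (V x)]
    [∀ x, TopologicalSpace (V x)] : Type _ :=
  TotalSpace (F →L[ℝ] F) (fun x => V x →L[ℝ] V x)

variable {EM : Type*} [NormedAddCommGroup EM] [NormedSpace ℂ EM]
  {M : Type*} [TopologicalSpace M] [ChartedSpace EM M]
  {F : Type*} [NormedAddCommGroup F] [NormedSpace ℂ F]
  {V : M → Type*} [TopologicalSpace (TotalSpace F V)]
  [∀ x, AddCommGroup (V x)] [∀ x, Module ℂ (V x)] [∀ x, TopologicalSpace (V x)]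
  [∀ x, IsTopologicalAddGroup (V x)] [∀ x, ContinuousSMul ℂ (V x)]
  [FiberBundle F V] [VectorBundle ℂ F V]

variable (EM F) in
/-- The model with corners of the real manifold `End E`. -/
abbrev endModel : ModelWithCorners ℝ (EM × (F →L[ℝ] F)) (ModelProd EM (F →L[ℝ] F)) :=
  𝓘(ℝ, EM).prod 𝓘(ℝ, F →L[ℝ] F)

/-- The twistor space `𝒯(E, g)` of orthogonal complex structures on the fibres of `E`, as a subset
of the total space of `End E`. -/
def twistorSpace (g : ContMDiffRiemannianMetric 𝓘(ℝ, EM) ∞ F V) : Set (EndTotal F V) :=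
  {A | A.2 ∘L A.2 = -ContinuousLinearMap.id ℝ (V A.1) ∧
    ∀ a b : V A.1, g.inner A.1 (A.2 a) (A.2 b) = g.inner A.1 a b}

/-- The vertical tangent vector at `A ∈ End E` defined by `B ∈ End E_{π(A)}`: the velocity of the
curve `t ↦ A + tB` at `t = 0`. -/
def verticalVector (A : EndTotal F V) (B : V A.1 →L[ℝ] V A.1) :
    TangentSpace (endModel EM F) A :=
  (mfderiv 𝓘(ℝ, ℝ) (endModel EM F) (fun t : ℝ => (⟨A.1, A.2 + t • B⟩ : EndTotal F V)) 0
    (1 : ℝ) : EM × (F →L[ℝ] F))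

/-- `X` is the horizontal lift to `A ∈ End E` of the tangent vector `v` at `π(A)`, with respect to
the connection `∇`: it is the image of `v` under the derivative of a section `S` of `End E`
through `A` which is parallel at the point in the direction `v`, i.e. for which
`∇_v (S σ) = S (∇_v σ)` for all sections `σ` of `E`. -/
def IsHorizontalLift (cov : CovariantDerivative 𝓘(ℝ, EM) F V) (A : EndTotal F V)
    (v : TangentSpace 𝓘(ℝ, EM) A.1) (X : TangentSpace (endModel EM F) A) : Prop :=
  ∃ S : Π y : M, V y →L[ℝ] V y,
    S A.1 = A.2 ∧
    MDifferentiableAt 𝓘(ℝ, EM) (endModel EM F) (fun y => (⟨y, S y⟩ : EndTotal F V)) A.1 ∧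
    (∀ σ : Π y, V y,
      MDifferentiableAt 𝓘(ℝ, EM) (𝓘(ℝ, EM).prod 𝓘(ℝ, F)) (fun y => TotalSpace.mk' F y (σ y)) A.1 →
      cov (fun y => S y (σ y)) A.1 v = A.2 (cov σ A.1 v)) ∧
    X = (mfderiv 𝓘(ℝ, EM) (endModel EM F) (fun y => (⟨y, S y⟩ : EndTotal F V)) A.1 v :
      EM × (F →L[ℝ] F))

/-- `Y = 𝒥 X` for the almost complex structure `𝒥 = 𝒥^{(∇,I)}`. It is defined by the splitting into
vertical and horizontal vectors: `𝒥` maps the vertical vector `B` to `A ∘ B`, and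
the horizontal lift of `v` to the horizontal lift of `I v`. -/
def IsTwistorImage (cov : CovariantDerivative 𝓘(ℝ, EM) F V) (A : EndTotal F V)
    (X Y : TangentSpace (endModel EM F) A) : Prop :=
  ∃ (v : TangentSpace 𝓘(ℝ, EM) A.1) (B : V A.1 →L[ℝ] V A.1)
    (h h' : TangentSpace (endModel EM F) A),
    IsHorizontalLift cov A v h ∧ IsHorizontalLift cov A (tangentI A.1 v) h' ∧
    X = h + verticalVector A B ∧ Y = h' + verticalVector A (A.2 ∘L B)

variable (EM F) in
/-- The model space of the complex manifold `𝒯(E, g)`, of complex dimension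
`dim M + n (n - 1) / 2` where `n` is the complex rank of `E`. -/
abbrev TwistorModel : Type _ := EM × (Fin ((Module.finrank ℂ F).choose 2) → ℂ)

/-- The inverse of `φ`, a chart of the topological space `𝒯 ⊆ End E`, is a smooth immersion into
the real manifold `End E`; so `φ` is a chart of `𝒯` as an embedded submanifold of `End E`. -/
structure IsSmoothChart (T : Set (EndTotal F V)) (φ : OpenPartialHomeomorph T (TwistorModel EM F)) :
    Prop where
  smooth : ContMDiffOn 𝓘(ℝ, TwistorModel EM F) (endModel EM F) ∞
    (fun z => (φ.symm z : EndTotal F V)) φ.target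
  immersion : ∀ z ∈ φ.target, Function.Injective
    (mfderiv 𝓘(ℝ, TwistorModel EM F) (endModel EM F) (fun z => (φ.symm z : EndTotal F V)) z)

/-- The charts of `𝒯 = 𝒯(E, g)` which are holomorphic for `𝒥 = 𝒥^{(∇,I)}`: the derivative of the
inverse of the chart intertwines multiplication by `i` and `𝒥`. -/
def twistorAtlas (g : ContMDiffRiemannianMetric 𝓘(ℝ, EM) ∞ F V)
    (cov : CovariantDerivative 𝓘(ℝ, EM) F V) :
    Set (OpenPartialHomeomorph (twistorSpace g) (TwistorModel EM F)) :=
  {φ | IsSmoothChart (twistorSpace g) φ ∧ ∀ z ∈ φ.target, ∀ ξ : TwistorModel EM F,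
    IsTwistorImage cov (φ.symm z : EndTotal F V)
      (mfderiv 𝓘(ℝ, TwistorModel EM F) (endModel EM F) (fun z => (φ.symm z : EndTotal F V)) z ξ)
      (mfderiv 𝓘(ℝ, TwistorModel EM F) (endModel EM F) (fun z => (φ.symm z : EndTotal F V)) z
        (Complex.I • ξ : TwistorModel EM F))}

/-- A complex structure on `𝒯(E, g)`: a holomorphic atlas on the topological space `𝒯(E, g)`, which
is compatible with its smooth structure as a submanifold of `End E`. -/
structure ComplexStructure (g : ContMDiffRiemannianMetric 𝓘(ℝ, EM) ∞ F V) where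
  charts : ChartedSpace (TwistorModel EM F) (twistorSpace g)
  isManifold : IsManifold 𝓘(ℂ, TwistorModel EM F) ω (twistorSpace g)
  smooth : ∀ φ ∈ charts.atlas, IsSmoothChart (twistorSpace g) φ

variable {g : ContMDiffRiemannianMetric 𝓘(ℝ, EM) ∞ F V}

/-- Biholomorphisms `(𝒯(E, g), S) → (𝒯(E, g), S')`. -/
abbrev Biholomorphism (S S' : ComplexStructure g) : Type _ :=
  @Diffeomorph ℂ _ (TwistorModel EM F) _ _ (TwistorModel EM F) _ _ (TwistorModel EM F) _
    (TwistorModel EM F) _ 𝓘(ℂ, TwistorModel EM F) 𝓘(ℂ, TwistorModel EM F)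
    (twistorSpace g) _ S.charts (twistorSpace g) _ S'.charts ω

variable (g) in
/-- Two complex structures on `𝒯(E, g)` are isomorphic if there is a biholomorphism. -/
def complexStructureSetoid : Setoid (ComplexStructure g) where
  r S S' := Nonempty (Biholomorphism S S')
  iseqv :=
    { refl := fun S => ⟨letI := S.charts; Diffeomorph.refl _ _ _⟩
      symm := fun {S S'} ⟨Φ⟩ =>
        ⟨@Diffeomorph.symm ℂ _ _ _ _ _ _ _ _ _ _ _ _ _ _ _ S.charts _ _ S'.charts _ Φ⟩
      trans := fun {S S' S''} ⟨Φ⟩ ⟨Ψ⟩ =>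
        ⟨@Diffeomorph.trans ℂ _ _ _ _ _ _ _ _ _ _ _ _ _ _ _ _ _ _ _ _ _ S.charts _ _ S'.charts
          _ _ S''.charts _ Φ Ψ⟩ }

variable (g) in
/-- The isomorphism classes of complex structures on `𝒯(E, g)`. -/
abbrev ComplexStructureClass : Type _ := Quotient (complexStructureSetoid g)

/-- `K` is the element of `𝒯(E, g)` over the same point as `J` that is induced from `J` by
`exp(-g⁻¹B)`, i.e. `E^{0,1}_K = exp(-g⁻¹B) E^{0,1}_J`. -/
def IsExpImage [FiniteDimensional ℂ F] (g : ContMDiffRiemannianMetric 𝓘(ℝ, EM) ∞ F V)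
    (B : Π x, Alt2 (V x)) (J K : EndTotal F V) : Prop :=
  ∃ K' : V J.1 →L[ℝ] V J.1, K = ⟨J.1, K'⟩ ∧
    eigen01 (K' : V J.1 →ₗ[ℝ] V J.1) =
      (eigen01 (J.2 : V J.1 →ₗ[ℝ] V J.1)).map (IsNilpotent.exp (-metricRaise g J.1 (B J.1)))

end Twistor

end HolomorphicTwistor

/-! ### Complex differentiable functions of several variables are analytic -/

section Osgood
open MeasureTheory Metric

variable {G : Type*} [NormedAddCommGroup G] [NormedSpace ℂ G]

/-! A point `A` of the twistor space over `x` is the same thing as the isotropic subspace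
`E^{0,1}_A` of `E_x ⊗ ℂ`. When `∂̄D = 0`, the (0,1) part of `∇_D` makes `E_ℂ` a holomorphic bundle
with a holomorphic quadratic form, and the twistor space is its bundle of maximal isotropic
subspaces; this is where the complex structure comes from. The proof does not integrate an almost
complex structure in general: it writes down holomorphic frames of `E_ℂ`, and from them holomorphic
charts.

Fix a chart of `M` and a holomorphic trivialization of `E` with fibre `F`. The `∂̄`-Poincaré lemma
(`exists_dbarAt_eq_of_closed`) gives a local potential, `D = ∂̄β` (`exists_isPotential`). Embed `F`
in the fixed complex quadratic space `F ⊕ F^*` by `T_β(u) = (u, h(u, ·) + β(u, ·))`, where `h` is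
half the Hermitian form of `g`, complex linear in its second argument. The form `β` is alternating,
so `T_β` is isometric for the dual pairing, and its complex linear extension identifies `E_ℂ` with a
constant quadratic space. The central computation is `fderiv_localFrame`: the (0,1) part of `dT_β`
is `T_β` composed with the (0,1) part of the connection form of `∇_D`. So the frame takes
`∇_D^{0,1}` to the ordinary `∂̄`. The metric part of this identity expresses the properties of the
Chern connection, and the shear contributes `∂̄β = D`, which is the effect of `g⁻¹D`.

In the constant space `F ⊕ F^*` the isotropic subspaces near a given one are graphs of skew maps
between two complementary isotropic subspaces; these maps form a vector space of dimension
`n(n-1)/2` (`exists_isotropicChart`). A point of the base together with a skew map parametrizes an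
open part of the twistor space. Differentiating the equation of the graph gives the derivative of
the structure in direction `iξ` in terms of that in direction `ξ` (`struct_fderiv_I`), and this is
the coordinate form of `𝒥` (`isTwistorImage_iff`). Hence these charts are holomorphic for `𝒥`, and
they cover.

Two charts with this property have a transition map with complex linear derivative, because both
inverses are immersions in `End E` which intertwine `i` with the same `𝒥`. A complex differentiable
map is analytic (`analyticOnNhd_of_differentiableOn`), so the atlas is holomorphic.

For the second claim, `g⁻¹B` has square zero and `T_{β+B} ∘ exp(-g⁻¹B) = T_β`
(`cplxLift_hermFrame_exp`). So the map induced by `exp(-g⁻¹B)` is the identity in the charts defined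
by `β` and `β + B`, which are potentials of `D` and `D + ∂̄B`; it is therefore biholomorphic, with
inverse induced by `-B`. The map on cohomology follows. The Chern connection is constructed point by
point from an explicit formula (`exists_chernForm`). -/

theorem torusMap_mem_closedBall {n : ℕ} (c : Fin n → ℂ) {r : ℝ} (hr : 0 ≤ r) (θ : Fin n → ℝ) :
    torusMap c (fun _ => r) θ ∈ closedBall c r := by
  rw [mem_closedBall, dist_pi_le_iff hr]
  intro i
  simp [torusMap, dist_eq_norm, Complex.norm_exp_ofReal_mul_I, abs_of_nonneg hr]

theorem torusMap_apply_ne {n : ℕ} {c w : Fin n → ℂ} {r : ℝ} (hw : w ∈ ball c r)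
    (θ : Fin n → ℝ) (i : Fin n) : torusMap c (fun _ => r) θ i - w i ≠ 0 := by
  have hr : 0 < r := pos_of_mem_ball hw
  intro h
  have h1 : dist (w i) (c i) < r := (dist_pi_lt_iff hr).1 hw i
  rw [← sub_eq_zero.1 h, dist_eq_norm] at h1
  simp [torusMap, Complex.norm_exp_ofReal_mul_I, abs_of_pos hr] at h1

theorem continuous_torusMap {n : ℕ} (c : Fin n → ℂ) (r : Fin n → ℝ) : Continuous (torusMap c r) := by
  unfold torusMap; fun_prop

/-- Cauchy's integral formula for polydiscs. -/
theorem torusIntegral_prod_sub_inv_smul [CompleteSpace G] {n : ℕ} {f : (Fin n → ℂ) → G}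
    {c w : Fin n → ℂ} {r : ℝ}
    (hf : DifferentiableOn ℂ f (closedBall c r)) (hw : w ∈ ball c r) :
    (∯ x in T(c, fun _ => r), (∏ i, (x i - w i)⁻¹) • f x) = (2 * Real.pi * Complex.I) ^ n • f w := by
  have hr : 0 < r := pos_of_mem_ball hw
  induction n with
  | zero =>
    rw [torusIntegral_dim0]
    simp [Subsingleton.elim c w]
  | succ n ih =>
    have hw' := (dist_pi_lt_iff hr).1 hw
    have hcont : Continuous fun θ : Fin (n + 1) → ℝ =>
        (∏ i, (torusMap c (fun _ => r) θ i - w i)⁻¹) • f (torusMap c (fun _ => r) θ) := by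
      refine Continuous.smul ?_ ?_
      · refine continuous_finsetProd _ fun i _ => Continuous.inv₀ ?_ fun θ => torusMap_apply_ne hw θ i
        exact Continuous.sub ((continuous_apply i).comp (continuous_torusMap c fun _ => r)) continuous_const
      · exact hf.continuousOn.comp_continuous (continuous_torusMap c _) fun θ =>
          torusMap_mem_closedBall c hr.le θ
    have hint : TorusIntegrable (fun x => (∏ i, (x i - w i)⁻¹) • f x) c (fun _ => r) :=
      hcont.continuousOn.integrableOn_compact isCompact_Icc
    -- Fubini separates the first circle from the remaining torus: the induction hypothesis
    -- evaluates the inner integral, and Cauchy's formula in one variable the outer one.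
    rw [torusIntegral_succ hint]
    have hcons : ∀ x ∈ closedBall (c 0) r, ∀ y ∈ closedBall (c ∘ Fin.succ) r,
        (Fin.cons x y : Fin (n + 1) → ℂ) ∈ closedBall c r := by
      intro x hx y hy
      rw [mem_closedBall, dist_pi_le_iff hr.le] at hy ⊢
      intro i
      induction i using Fin.cases with
      | zero => exact hx
      | succ j => exact hy j
    have hd1 : ∀ x, Differentiable ℂ fun y : Fin n → ℂ => (Fin.cons x y : Fin (n + 1) → ℂ) := by
      intro x
      rw [differentiable_pi]
      intro i
      induction i using Fin.cases with
      | zero => exact differentiable_const _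
      | succ j => exact differentiable_apply j
    have hd2 : ∀ y : Fin n → ℂ, Differentiable ℂ fun x : ℂ => (Fin.cons x y : Fin (n + 1) → ℂ) := by
      intro y
      rw [differentiable_pi]
      intro i
      induction i using Fin.cases with
      | zero => exact differentiable_id
      | succ j => exact differentiable_const _
    have hws : w ∘ Fin.succ ∈ ball (c ∘ Fin.succ) r := (dist_pi_lt_iff hr).2 fun i => hw' i.succ
    have hinner : ∀ x ∈ sphere (c 0) r,
        (∯ y in T(c ∘ Fin.succ, (fun _ => r) ∘ Fin.succ), (∏ i, ((Fin.cons x y : Fin (n + 1) → ℂ) i - w i)⁻¹) •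
          f (Fin.cons x y)) =
        (2 * Real.pi * Complex.I) ^ n • ((x - w 0)⁻¹ • f (Fin.cons x (w ∘ Fin.succ))) := by
      intro x hx
      have hx' := sphere_subset_closedBall hx
      have h1 := ih (f := fun y => f (Fin.cons x y)) (c := c ∘ Fin.succ) (w := w ∘ Fin.succ)
        (hf.comp (hd1 x).differentiableOn fun y hy => hcons x hx' y hy) hws
      simp only [Fin.prod_univ_succ, Fin.cons_zero, Fin.cons_succ, mul_smul]
      rw [torusIntegral_smul, smul_comm]
      congr 1
    rw [circleIntegral.integral_congr hr.le hinner, circleIntegral.integral_smul]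
    have h2 := DifferentiableOn.circleIntegral_sub_inv_smul (c := c 0) (R := r) (w := w 0)
      (f := fun x => f (Fin.cons x (w ∘ Fin.succ)))
      (hf.comp (hd2 _).differentiableOn fun x hx => hcons x hx _ (ball_subset_closedBall hws)) (hw' 0)
    rw [h2, smul_smul, pow_succ]
    congr 2
    exact Fin.cons_self_tail w

/-- Cauchy's formula reads `f w = const • Λ (K w)`. Here `K w` is the Cauchy kernel, an element of
the Banach algebra of continuous functions on the cube of angles, and `Λ` is a continuous linear
map, integration against `f`. The kernel is a product of inverses of affine functions of `w`, and
inversion is analytic in a Banach algebra, so no power series has to be expanded. -/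
theorem analyticAt_pi_of_differentiableOn [CompleteSpace G] {n : ℕ} {f : (Fin n → ℂ) → G}
    {U : Set (Fin n → ℂ)} (hU : IsOpen U) (hf : DifferentiableOn ℂ f U) {c : Fin n → ℂ} (hc : c ∈ U) :
    AnalyticAt ℂ f c := by
  obtain ⟨r, hr, hrU⟩ := nhds_basis_closedBall.mem_iff.1 (hU.mem_nhds hc)
  replace hf := hf.mono hrU
  let X := Set.Icc (0 : Fin n → ℝ) fun _ => 2 * Real.pi
  let τ : X → Fin n → ℂ := fun θ => torusMap c (fun _ => r) θ
  have hτ : Continuous τ := (continuous_torusMap c _).comp continuous_subtype_val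
  let k : Fin n → (Fin n → ℂ) → C(X, ℂ) := fun i w =>
    ⟨fun θ => τ θ i, (continuous_apply i).comp hτ⟩ - ContinuousMap.const X (w i)
  have hk : ∀ i w, AnalyticAt ℂ (k i) w := by
    intro i w
    refine analyticAt_const.sub ?_
    let A : (Fin n → ℂ) →L[ℂ] C(X, ℂ) := (Algebra.linearMap ℂ C(X, ℂ)).toContinuousLinearMap ∘L
      ContinuousLinearMap.proj i
    exact A.analyticAt w
  have hunit : ∀ i, ∀ w ∈ ball c r, IsUnit (k i w) := by
    intro i w hw
    rw [ContinuousMap.isUnit_iff_forall_ne_zero]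
    exact fun θ => torusMap_apply_ne hw θ i
  let K : (Fin n → ℂ) → C(X, ℂ) := fun w => ∏ i, Ring.inverse (k i w)
  have hK : AnalyticAt ℂ K c := by
    have hi : ∀ i, AnalyticAt ℂ (fun w => Ring.inverse (k i w)) c := fun i => by
      obtain ⟨u, hu⟩ := hunit i c (mem_ball_self hr)
      have := analyticAt_inverse (𝕜 := ℂ) u
      rw [hu] at this
      exact this.comp (hk i c)
    exact Finset.analyticAt_fun_prod _ fun i _ => hi i
  have hKapp : ∀ w ∈ ball c r, ∀ θ, K w θ = ∏ i, (τ θ i - w i)⁻¹ := by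
    intro w hw θ
    simp only [K, ContinuousMap.coe_prod, Finset.prod_apply]
    refine Finset.prod_congr rfl fun i _ => ?_
    have h1 := Ring.mul_inverse_cancel _ (hunit i w hw)
    have h2 : (τ θ i - w i) * Ring.inverse (k i w) θ = 1 := congrArg (fun φ => φ θ) h1
    exact eq_inv_of_mul_eq_one_right h2
  let μ : Measure X := Measure.comap Subtype.val volume
  have hμ : IsFiniteMeasure μ := by
    refine ⟨?_⟩
    rw [(MeasurableEmbedding.subtype_coe measurableSet_Icc).comap_apply]
    rw [Set.image_univ, Subtype.range_coe]
    exact isCompact_Icc.measure_lt_top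
  -- The Jacobian factor in the definition of the torus integral, times the values of `f` on the
  -- torus.
  let h : X → G := fun θ => (∏ i, (r : ℂ) * Complex.exp (θ.1 i * Complex.I) * Complex.I) • f (τ θ)
  have hh : Continuous h := by
    refine Continuous.smul ?_ (hf.continuousOn.comp_continuous hτ fun θ =>
      torusMap_mem_closedBall c hr.le _)
    refine continuous_finsetProd _ fun i _ => ?_
    have : Continuous fun θ : X => θ.1 i := (continuous_apply i).comp continuous_subtype_val
    exact (continuous_const.mul (Complex.continuous_exp.comp
      ((Complex.continuous_ofReal.comp this).mul continuous_const))).mul continuous_const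
  have hint : ∀ φ : C(X, ℂ), Integrable (fun θ => φ θ • h θ) μ := fun φ =>
    (φ.continuous.smul hh).integrable_of_hasCompactSupport (HasCompactSupport.of_compactSpace _)
  have hinth : Integrable h μ := hh.integrable_of_hasCompactSupport (HasCompactSupport.of_compactSpace _)
  let Λ : C(X, ℂ) →L[ℂ] G := LinearMap.mkContinuous
    { toFun := fun φ => ∫ θ, φ θ • h θ ∂μ
      map_add' := fun φ ψ => by
        rw [← integral_add (hint φ) (hint ψ)]
        simp [add_smul]
      map_smul' := fun a φ => by
        simp only [RingHom.id_apply]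
        rw [← integral_smul]
        simp [mul_smul] } (∫ θ, ‖h θ‖ ∂μ) fun φ => by
      simp only [LinearMap.coe_mk, AddHom.coe_mk]
      rw [mul_comm, ← integral_const_mul]
      refine norm_integral_le_of_norm_le (hinth.norm.const_mul _) (Filter.Eventually.of_forall fun θ => ?_)
      rw [norm_smul]
      gcongr
      exact φ.norm_coe_le_norm θ
  have hΛ : AnalyticAt ℂ (fun w => ((2 * Real.pi * Complex.I : ℂ) ^ n)⁻¹ • Λ (K w)) c :=
    ((Λ.analyticAt _).comp hK).fun_const_smul
  refine hΛ.congr ?_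
  filter_upwards [ball_mem_nhds c hr] with w hw
  have h1 := torusIntegral_prod_sub_inv_smul hf hw
  have h2 : Λ (K w) = (2 * Real.pi * Complex.I : ℂ) ^ n • f w := by
    rw [← h1, torusIntegral]
    change ∫ θ, K w θ • h θ ∂μ = _
    rw [← integral_subtype_comap measurableSet_Icc]
    refine integral_congr_ae (Filter.Eventually.of_forall fun θ => ?_)
    simp only [hKapp w hw, h, τ]
    rw [smul_comm]
  rw [h2, inv_smul_smul₀]
  exact pow_ne_zero _ Complex.two_pi_I_ne_zero

/-- A complex differentiable function on an open subset of a finite dimensional complex vector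
space is analytic. -/
theorem analyticOnNhd_of_differentiableOn [CompleteSpace G] {E : Type*} [NormedAddCommGroup E]
    [NormedSpace ℂ E] [FiniteDimensional ℂ E] {f : E → G} {U : Set E} (hU : IsOpen U)
    (hf : DifferentiableOn ℂ f U) : AnalyticOnNhd ℂ f U := by
  intro x hx
  let e : E ≃L[ℂ] (Fin (Module.finrank ℂ E) → ℂ) :=
    ContinuousLinearEquiv.ofFinrankEq (by simp)
  have h1 : AnalyticAt ℂ (f ∘ e.symm) (e x) := by
    refine analyticAt_pi_of_differentiableOn (hU.preimage e.symm.continuous) ?_ (by simpa using hx)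
    exact hf.comp e.symm.differentiable.differentiableOn fun y hy => hy
  have h2 := h1.comp (e.toContinuousLinearMap.analyticAt x)
  refine h2.congr (Filter.Eventually.of_forall fun y => ?_)
  simp

end Osgood

/-! ### The Cauchy-Pompeiu formula in the plane -/

section Pompeiu
open MeasureTheory Set

theorem integrableOn_polarTarget_of_continuous {G : Type*} [NormedAddCommGroup G]
    {h : ℝ × ℝ → G} (hc : Continuous h) {R : ℝ}
    (hR : ∀ p : ℝ × ℝ, R < p.1 → h p = 0) :
    IntegrableOn h (Ioi (0 : ℝ) ×ˢ Ioo (-Real.pi) Real.pi) := by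
  have h1 : IntegrableOn h (Icc 0 R ×ˢ Icc (-Real.pi) Real.pi) :=
    hc.continuousOn.integrableOn_compact (isCompact_Icc.prod isCompact_Icc)
  refine h1.of_forall_sdiff_eq_zero (measurableSet_Ioi.prod measurableSet_Ioo) fun p hp => hR p ?_
  by_contra hle
  exact hp.2 ⟨⟨le_of_lt hp.1.1, not_lt.1 hle⟩, ⟨hp.1.2.1.le, hp.1.2.2.le⟩⟩

variable {G : Type*} [NormedAddCommGroup G] [NormedSpace ℂ G]

/-- The Cauchy-Pompeiu formula for compactly supported functions: `-1 / (π w)` inverts `∂̄`. -/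
theorem integral_inv_smul_dbar [CompleteSpace G] {φ : ℂ → G} (hφ : ContDiff ℝ 1 φ)
    (hs : HasCompactSupport φ) :
    ∫ w : ℂ, w⁻¹ • (fderiv ℝ φ w 1 + Complex.I • fderiv ℝ φ w Complex.I) =
      -((2 * Real.pi : ℝ) • φ 0) := by
  obtain ⟨R, hR⟩ : ∃ R, ∀ w : ℂ, R < ‖w‖ → fderiv ℝ φ w = 0 := by
    obtain ⟨R, hR⟩ := (hs.fderiv (𝕜 := ℝ)).isCompact.isBounded.exists_norm_le
    refine ⟨R, fun w hw => ?_⟩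
    by_contra h0
    exact (hR w (subset_tsupport _ h0)).not_gt hw
  let c : ℝ × ℝ → ℂ := fun p => p.1 * (Real.cos p.2 + Real.sin p.2 * Complex.I)
  let d : ℝ → ℂ := fun t => Real.cos t + Real.sin t * Complex.I
  have hnorm : ∀ t, ‖d t‖ = 1 := fun t => by
    have := Complex.norm_exp_ofReal_mul_I t
    rwa [Complex.exp_mul_I, ← Complex.ofReal_cos, ← Complex.ofReal_sin] at this
  have hd : Continuous d := by fun_prop
  have hc : Continuous c := by fun_prop
  have hφd : Continuous (fderiv ℝ φ) := hφ.continuous_fderiv one_ne_zero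
  -- With `c (r, t) = r e^{it}`, `h1` is the radial derivative of `φ ∘ c`, and `h2` is `1/r` times
  -- its angular derivative.
  let h1 : ℝ × ℝ → G := fun p => fderiv ℝ φ (c p) (d p.2)
  let h2 : ℝ × ℝ → G := fun p => fderiv ℝ φ (c p) (Complex.I * d p.2)
  have h1c : Continuous h1 := (hφd.comp hc).clm_apply (hd.comp continuous_snd)
  have h2c : Continuous h2 :=
    (hφd.comp hc).clm_apply (continuous_const.mul (hd.comp continuous_snd))
  -- The bound `R` may be negative, while the norm of `c p` is `p.1` only for nonnegative `p.1`;
  -- hence the maximum.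
  have hzero : ∀ p : ℝ × ℝ, max R 0 < p.1 → fderiv ℝ φ (c p) = 0 := fun p hp => by
    have hp0 : 0 < p.1 := (le_max_right _ _).trans_lt hp
    refine hR _ ?_
    have : ‖c p‖ = p.1 := by
      change ‖(p.1 : ℂ) * d p.2‖ = _
      rw [norm_mul, hnorm, mul_one, Complex.norm_real, Real.norm_of_nonneg hp0.le]
    rw [this]
    exact (le_max_left _ _).trans_lt hp
  have i1 := integrableOn_polarTarget_of_continuous h1c (R := max R 0) fun p hp => by
    simp [h1, hzero p hp]
  have i2 := integrableOn_polarTarget_of_continuous h2c (R := max R 0) fun p hp => by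
    simp [h2, hzero p hp]
  -- The area factor `r` cancels the modulus of `w⁻¹`, and `e^{-it}` rotates the Cartesian `∂̄` to
  -- `∂_r + (i/r) ∂_t`.
  have key : ∀ p ∈ polarCoord.target,
      p.1 • ((Complex.polarCoord.symm p)⁻¹ • (fderiv ℝ φ (Complex.polarCoord.symm p) 1 +
        Complex.I • fderiv ℝ φ (Complex.polarCoord.symm p) Complex.I)) =
      h1 p + Complex.I • h2 p := by
    intro p hp
    have hp0 : (p.1 : ℂ) ≠ 0 := by exact_mod_cast (ne_of_gt hp.1 : p.1 ≠ 0)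
    rw [Complex.polarCoord_symm_apply]
    change p.1 • ((c p)⁻¹ • (fderiv ℝ φ (c p) 1 + Complex.I • fderiv ℝ φ (c p) Complex.I)) = _
    have hinv : (d p.2)⁻¹ = Real.cos p.2 - Real.sin p.2 * Complex.I := by
      rw [inv_eq_of_mul_eq_one_right]
      have := Real.sin_sq_add_cos_sq p.2
      have h : ((Real.sin p.2 : ℂ)) ^ 2 + (Real.cos p.2 : ℂ) ^ 2 = 1 := by exact_mod_cast this
      simp only [d]
      linear_combination h - (Real.sin p.2 : ℂ) ^ 2 * Complex.I_sq
    have hcd : c p = p.1 * d p.2 := rfl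
    rw [hcd, mul_inv, ← Complex.coe_smul, smul_smul, mul_inv_cancel_left₀ hp0, hinv, ← hcd]
    have e1 : d p.2 = Real.cos p.2 • (1 : ℂ) + Real.sin p.2 • Complex.I := by simp [d]
    have e2 : Complex.I * d p.2 = Real.cos p.2 • Complex.I - Real.sin p.2 • (1 : ℂ) := by
      simp only [d, Complex.real_smul, mul_one]
      linear_combination (Real.sin p.2 : ℂ) * Complex.I_sq
    have e3 : h1 p = (Real.cos p.2 : ℂ) • fderiv ℝ φ (c p) 1 +
        (Real.sin p.2 : ℂ) • fderiv ℝ φ (c p) Complex.I := by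
      simp only [h1]
      rw [e1, map_add, map_smul, map_smul, Complex.coe_smul, Complex.coe_smul]
    have e4 : h2 p = (Real.cos p.2 : ℂ) • fderiv ℝ φ (c p) Complex.I -
        (Real.sin p.2 : ℂ) • fderiv ℝ φ (c p) 1 := by
      simp only [h2]
      rw [e2, map_sub, map_smul, map_smul, Complex.coe_smul, Complex.coe_smul]
    rw [e3, e4]
    generalize (Real.cos p.2 : ℂ) = a, (Real.sin p.2 : ℂ) = b
    match_scalars
    · ring
    · linear_combination -b * Complex.I_mul_I
  rw [← Complex.integral_comp_polarCoord_symm,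
    setIntegral_congr_fun polarCoord.open_target.measurableSet key, polarCoord_target,
    integral_add i1 (g := fun p => Complex.I • h2 p) (i2.smul Complex.I), integral_smul]
  have hrad : ∀ p : ℝ × ℝ, HasFDerivAt φ (fderiv ℝ φ (c p)) (c p) := fun p =>
    (hφ.differentiable one_ne_zero _).hasFDerivAt
  -- On each ray the radial derivative integrates to `-φ 0`, by compact support; the angles
  -- contribute `2π`.
  have I1 : ∫ p in Ioi (0 : ℝ) ×ˢ Ioo (-Real.pi) Real.pi, h1 p = -((2 * Real.pi : ℝ) • φ 0) := by
    have i1' : Integrable (fun p : ℝ × ℝ => h1 p)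
        ((volume.restrict (Ioi (0 : ℝ))).prod (volume.restrict (Ioo (-Real.pi) Real.pi))) := by
      rw [Measure.prod_restrict]; exact i1
    rw [Measure.volume_eq_prod, ← Measure.prod_restrict, integral_prod_symm _ i1']
    have : ∀ t : ℝ, ∫ r in Ioi (0 : ℝ), h1 (r, t) = -φ 0 := by
      intro t
      have hder : ∀ r : ℝ, HasDerivAt (fun r : ℝ => φ (c (r, t))) (h1 (r, t)) r := by
        intro r
        have hcd : HasDerivAt (fun r : ℝ => c (r, t)) (d t) r := by
          have := (Complex.ofRealCLM.hasDerivAt (x := r)).mul_const (d t)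
          simpa [c, d] using this
        exact (hrad (r, t)).comp_hasDerivAt r hcd
      have hint : IntegrableOn (fun r : ℝ => h1 (r, t)) (Ioi 0) := by
        have hc' : Continuous fun r : ℝ => h1 (r, t) := h1c.comp (Continuous.prodMk_left t)
        refine (hc'.continuousOn.integrableOn_compact (isCompact_Icc (a := 0) (b := max R 0))
          ).of_forall_sdiff_eq_zero measurableSet_Ioi fun r hr => ?_
        have : max R 0 < r := by
          by_contra hle
          exact hr.2 ⟨le_of_lt hr.1, not_lt.1 hle⟩
        simp [h1, hzero (r, t) this]
      have htend : Filter.Tendsto (fun r : ℝ => φ (c (r, t))) Filter.atTop (𝓝 0) := by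
        obtain ⟨R', hR'⟩ := hs.isCompact.isBounded.exists_norm_le
        refine tendsto_const_nhds.congr' ?_
        filter_upwards [Filter.eventually_gt_atTop (max R' 0)] with r hr
        by_contra h0
        have := hR' (c (r, t)) (subset_tsupport _ (Ne.symm h0))
        have hn : ‖c (r, t)‖ = r := by
          change ‖(r : ℂ) * d t‖ = _
          rw [norm_mul, hnorm, mul_one, Complex.norm_real,
            Real.norm_of_nonneg ((le_max_right _ _).trans hr.le)]
        rw [hn] at this
        exact absurd hr (not_lt.2 (this.trans (le_max_left _ _)))
      rw [integral_Ioi_of_hasDerivAt_of_tendsto' (fun r _ => hder r) hint htend]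
      simp [c]
    simp only [this]
    rw [integral_const]
    simp [Real.pi_pos.le]
    ring_nf
  -- On each circle the angular derivative integrates to zero by periodicity.
  have I2 : ∫ p in Ioi (0 : ℝ) ×ˢ Ioo (-Real.pi) Real.pi, h2 p = 0 := by
    rw [Measure.volume_eq_prod, setIntegral_prod _ i2]
    refine (setIntegral_congr_fun measurableSet_Ioi fun r hr => ?_).trans (integral_zero _ _)
    have hr' : (r : ℝ) ≠ 0 := ne_of_gt hr
    have hder : ∀ t : ℝ, HasDerivAt (fun t : ℝ => r⁻¹ • φ (c (r, t))) (h2 (r, t)) t := by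
      intro t
      have hcd : HasDerivAt (fun t : ℝ => c (r, t)) (r • (Complex.I * d t)) t := by
        have h := ((((Real.hasDerivAt_cos t).ofReal_comp).add
          ((Real.hasDerivAt_sin t).ofReal_comp.mul_const Complex.I))).const_mul (r : ℂ)
        refine h.congr_deriv ?_
        simp only [d, Complex.real_smul, Complex.ofReal_neg]
        linear_combination -(r : ℂ) * (Real.sin t : ℂ) * Complex.I_sq
      have h := ((hrad (r, t)).comp_hasDerivAt t hcd).const_smul r⁻¹
      refine h.congr_deriv ?_
      simp only [h2]
      rw [map_smul, smul_smul, inv_mul_cancel₀ hr', one_smul]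
    rw [← integral_Ioc_eq_integral_Ioo, ← intervalIntegral.integral_of_le (by linarith [Real.pi_pos]),
      intervalIntegral.integral_eq_sub_of_hasDerivAt (fun t _ => hder t)
        ((h2c.comp (Continuous.prodMk_right r)).intervalIntegrable _ _)]
    simp [c]
  rw [I1, I2, smul_zero, add_zero]

/-- The order `1` of the pole is less than the real dimension `2`. -/
theorem locallyIntegrable_inv : LocallyIntegrable (fun w : ℂ => w⁻¹) := by
  refine locallyIntegrable_of_norm_le_rpow (C := 1) (α := 1) (by simp) (by simp) ?_
    measurable_inv.aestronglyMeasurable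
  exact Filter.Eventually.of_forall fun w => by
    rw [norm_inv, one_mul, Real.rpow_neg (norm_nonneg _), Real.rpow_one]

end Pompeiu

/-! ### Calculus of the `∂̄` operator on vector valued functions -/

noncomputable section DbarPoincare
open MeasureTheory Set Metric

variable {E : Type*} [NormedAddCommGroup E] [NormedSpace ℂ E]
  {G : Type*} [NormedAddCommGroup G] [NormedSpace ℂ G]

/-- The `(0,1)` part of the derivative of a function on a complex vector space, in direction `v`. -/
def dbarAt (f : E → G) (x v : E) : G :=
  (2⁻¹ : ℂ) • (fderiv ℝ f x v + Complex.I • fderiv ℝ f x (Complex.I • v))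

theorem dbarAt_congr {f f' : E → G} {x : E} (h : f =ᶠ[𝓝 x] f') (v : E) :
    dbarAt f x v = dbarAt f' x v := by
  simp only [dbarAt, h.fderiv_eq]

theorem dbarAt_sub {f f' : E → G} {x : E} (hf : DifferentiableAt ℝ f x)
    (hf' : DifferentiableAt ℝ f' x) (v : E) :
    dbarAt (fun y => f y - f' y) x v = dbarAt f x v - dbarAt f' x v := by
  simp only [dbarAt, fderiv_fun_sub hf hf', sub_apply]
  module

theorem dbarAt_add_right (f : E → G) (x v w : E) :
    dbarAt f x (v + w) = dbarAt f x v + dbarAt f x w := by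
  simp only [dbarAt, smul_add, map_add]
  module

theorem dbarAt_smul_right (f : E → G) (x v : E) (c : ℂ) :
    dbarAt f x (c • v) = (starRingEnd ℂ c) • dbarAt f x v := by
  have hc : ∀ (c : ℂ) (u : E), fderiv ℝ f x (c • u) =
      (c.re : ℂ) • fderiv ℝ f x u + (c.im : ℂ) • fderiv ℝ f x (Complex.I • u) := fun c u => by
    have : c • u = c.re • u + c.im • (Complex.I • u) := by
      rw [← Complex.coe_smul, ← Complex.coe_smul, smul_smul, ← add_smul, Complex.re_add_im]
    rw [this, map_add, map_smul, map_smul, Complex.coe_smul, Complex.coe_smul]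
  have h3 : (starRingEnd ℂ) c = c.re - c.im * Complex.I := by
    apply Complex.ext <;> simp
  simp only [dbarAt]
  rw [smul_smul Complex.I c, mul_comm Complex.I c, ← smul_smul c, hc c v, hc c (Complex.I • v),
    smul_smul Complex.I Complex.I v, Complex.I_mul_I, neg_one_smul, map_neg, h3]
  generalize (c.re : ℂ) = a, (c.im : ℂ) = b
  match_scalars
  · ring
  · linear_combination (2⁻¹ * b) * Complex.I_mul_I

theorem dbarAt_comp_linear {E' : Type*} [NormedAddCommGroup E'] [NormedSpace ℂ E'] {f : E → G}
    (A : E' →L[ℂ] E) (c : E) (x v : E') (hf : DifferentiableAt ℝ f (A x + c)) :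
    dbarAt (fun y => f (A y + c)) x v = dbarAt f (A x + c) (A v) := by
  have h : HasFDerivAt (fun y => f (A y + c)) ((fderiv ℝ f (A x + c)) ∘L A.restrictScalars ℝ) x :=
    HasFDerivAt.comp x hf.hasFDerivAt
      (((A.restrictScalars ℝ).hasFDerivAt (x := x)).add_const c)
  simp [dbarAt, h.fderiv]

theorem contDiffOn_dbarAt {f : E → G} {U : Set E} (hU : IsOpen U) (hf : ContDiffOn ℝ ∞ f U) (v : E) :
    ContDiffOn ℝ ∞ (fun x => dbarAt f x v) U := by
  have h := hf.fderiv_of_isOpen hU (m := ∞) (by simp)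
  exact ((h.clm_apply contDiffOn_const).add
    ((h.clm_apply contDiffOn_const).const_smul Complex.I)).const_smul (2⁻¹ : ℂ)

/-- Symmetry of the second real derivative, used for the four pairs formed from `v`, `iv` and `w`,
`iw`. This is `∂̄² = 0`. -/
theorem dbarAt_comm {f : E → G} {x : E} (hf : ContDiffAt ℝ 2 f x) (v w : E) :
    dbarAt (fun y => dbarAt f y v) x w = dbarAt (fun y => dbarAt f y w) x v := by
  have hs : IsSymmSndFDerivAt ℝ f x := hf.isSymmSndFDerivAt (by simp)
  have hd : DifferentiableAt ℝ (fderiv ℝ f) x :=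
    (hf.fderiv_right (m := 1) (by norm_num)).differentiableAt one_ne_zero
  have key : ∀ v, fderiv ℝ (fun y => dbarAt f y v) x = (2⁻¹ : ℂ) • ((fderiv ℝ (fderiv ℝ f) x).flip v +
      Complex.I • (fderiv ℝ (fderiv ℝ f) x).flip (Complex.I • v)) := by
    intro v
    have h1 : ∀ v, HasFDerivAt (fun y => fderiv ℝ f y v) ((fderiv ℝ (fderiv ℝ f) x).flip v) x :=
      fun v => by simpa using! hd.hasFDerivAt.clm_apply (hasFDerivAt_const v x)
    exact (((h1 v).add ((h1 _).const_smul Complex.I)).const_smul (2⁻¹ : ℂ)).fderiv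
  rw [dbarAt, dbarAt, key, key]
  simp only [add_apply, smul_apply,
    ContinuousLinearMap.flip_apply]
  rw [hs w v, hs w (Complex.I • v), hs (Complex.I • w) v, hs (Complex.I • w) (Complex.I • v)]
  module

theorem dbarAt_const_smul {f : E → G} {x : E} (c : ℂ) (v : E) (hf : DifferentiableAt ℝ f x) :
    dbarAt (fun y => c • f y) x v = c • dbarAt f x v := by
  simp only [dbarAt, fderiv_fun_const_smul hf, smul_apply]
  module

/-- The cutoff depends on the coordinate `k` only, so its derivatives along `e_j` and `i e_j` vanish
and it behaves like a constant. -/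
theorem dbarAt_sub_const_smul_basis {n : ℕ} (k j : Fin n) (hjk : j ≠ k) {χ : ℂ → ℝ}
    {h : (Fin n → ℂ) → G} {z : Fin n → ℂ} (hχ : ContDiff ℝ 1 χ) (hh : DifferentiableAt ℝ h z) :
    dbarAt (fun y => χ (y k) • h y) z (Pi.single j 1) = χ (z k) • dbarAt h z (Pi.single j 1) := by
  have h1 : HasFDerivAt (fun y : Fin n → ℂ => χ (y k))
      (fderiv ℝ χ (z k) ∘L ContinuousLinearMap.proj k) z :=
    ((hχ.differentiable one_ne_zero (z k)).hasFDerivAt).comp z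
      ((ContinuousLinearMap.proj (R := ℝ) (φ := fun _ : Fin n => ℂ) k).hasFDerivAt)
  have h2 := (h1.smul hh.hasFDerivAt).fderiv
  have e0 : (Pi.single j (1 : ℂ) : Fin n → ℂ) k = 0 := by simp [hjk.symm]
  simp only [dbarAt]
  erw [h2]
  simp [e0, smul_smul, mul_comm]
  module

end DbarPoincare

/-! ### The `∂̄`-Poincaré lemma for (0,1)-forms -/

noncomputable section DbarPoincareLemma
open MeasureTheory Set Metric

variable {G : Type*} [NormedAddCommGroup G] [NormedSpace ℂ G] [CompleteSpace G]

set_option maxHeartbeats 800000 in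
/-- Solution of the `∂̄` equation in the direction of one coordinate, by the Cauchy transform. -/
theorem exists_dbarAt_basis_eq {n : ℕ} (k : Fin n) {r r' : ℝ} (hr' : 0 < r') (hrr : r' < r)
    {h : (Fin n → ℂ) → G} (hh : ContDiffOn ℝ ∞ h (ball 0 r)) :
    ∃ u : (Fin n → ℂ) → G, ContDiffOn ℝ ∞ u (ball 0 r) ∧
      (∀ z ∈ ball (0 : Fin n → ℂ) r', dbarAt u z (Pi.single k 1) = h z) ∧
      ∀ j, j ≠ k → (∀ z ∈ ball (0 : Fin n → ℂ) r, dbarAt h z (Pi.single j 1) = 0) →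
        ∀ z ∈ ball (0 : Fin n → ℂ) r, dbarAt u z (Pi.single j 1) = 0 := by
  have hr : 0 < r := hr'.trans hrr
  -- Equal to `1` on the closed disc of radius `r'`, where the equation must hold, and supported
  -- strictly inside radius `r`, so that `χ h` extends by zero.
  let χ : ContDiffBump (0 : ℂ) := ⟨r', (r' + r) / 2, hr', by linarith⟩
  have hχ0 : ∀ t : ℂ, r ≤ ‖t‖ → ∀ᶠ s in 𝓝 t, χ s = 0 := fun t ht => by
    have : t ∉ tsupport χ := by
      rw [χ.tsupport_eq, mem_closedBall_zero_iff, not_le]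
      exact lt_of_lt_of_le (show (r' + r) / 2 < r by linarith) ht
    exact notMem_tsupport_iff_eventuallyEq.1 this
  let H : (Fin n → ℂ) → G := fun q => χ (q k) • h q
  -- The cylinder in which the coordinate `k` is unrestricted. The extension by zero is smooth
  -- there, so it can be integrated over the whole complex line in direction `e_k`.
  let W : Set (Fin n → ℂ) := {q | Function.update q k 0 ∈ ball (0 : Fin n → ℂ) r}
  have hW : IsOpen W := isOpen_ball.preimage (continuous_id.update k continuous_const)
  have hWball : ∀ q ∈ W, ‖q k‖ < r → q ∈ ball (0 : Fin n → ℂ) r := by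
    intro q hq hk
    have hq : Function.update q k 0 ∈ ball (0 : Fin n → ℂ) r := hq
    rw [mem_ball_zero_iff, pi_norm_lt_iff hr] at hq ⊢
    intro i
    by_cases hi : i = k
    · rw [hi]; exact hk
    · simpa [hi] using hq i
  have hH0 : ∀ q : Fin n → ℂ, r ≤ ‖q k‖ → H =ᶠ[𝓝 q] fun _ => 0 := fun q hq => by
    filter_upwards [(continuous_apply k).continuousAt.eventually (hχ0 (q k) hq)] with y hy
    simp only [H]; rw [hy, zero_smul]
  have hHsm : ContDiffOn ℝ ∞ H W := by
    intro q hq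
    refine ContDiffAt.contDiffWithinAt ?_
    by_cases hk : ‖q k‖ < r
    · have h1 := hh.contDiffAt (isOpen_ball.mem_nhds (hWball q hq hk))
      exact ((χ.contDiff.comp (contDiff_apply ℝ ℂ k)).contDiffAt).smul h1
    · exact contDiffAt_const.congr_of_eventuallyEq (hH0 q (not_lt.1 hk))
  let ek : Fin n → ℂ := Pi.single k 1
  let A : (Fin n → ℂ) × ℂ →L[ℝ] (Fin n → ℂ) :=
    ContinuousLinearMap.fst ℝ _ _ + ((ContinuousLinearMap.id ℝ ℂ).smulRight ek) ∘L ContinuousLinearMap.snd ℝ _ _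
  have hA : ∀ p x, A (p, x) = p + x • ek := fun p x => rfl
  have hAW : ∀ p ∈ ball (0 : Fin n → ℂ) r, ∀ x : ℂ, A (p, x) ∈ W := by
    intro p hp x
    change Function.update (A (p, x)) k 0 ∈ ball (0 : Fin n → ℂ) r
    rw [mem_ball_zero_iff, pi_norm_lt_iff hr] at hp ⊢
    intro i
    by_cases hi : i = k
    · subst hi; simpa using hr
    · simpa [hA, ek, hi] using hp i
  let g : (Fin n → ℂ) → ℂ → G := fun p x => H (A (p, x))
  have hgsm : ContDiffOn ℝ ∞ (Function.uncurry g) (ball 0 r ×ˢ univ) :=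
    hHsm.comp A.contDiff.contDiffOn fun q hq => hAW q.1 hq.1 q.2
  -- The radius `2r`: if `|p_k| < r` and `|x| > 2r`, then `|p_k + x| > r`, where the cutoff
  -- vanishes.
  have hgs : ∀ p, ∀ x, p ∈ ball (0 : Fin n → ℂ) r → x ∉ closedBall (0 : ℂ) (2 * r) → g p x = 0 := by
    intro p x hp hx
    rw [mem_closedBall_zero_iff, not_le] at hx
    have h1 : ‖p k‖ < r := (pi_norm_lt_iff hr).1 (mem_ball_zero_iff.1 hp) k
    have h2 : r ≤ ‖A (p, x) k‖ := by
      have h3 : ‖x‖ ≤ ‖p k + x‖ + ‖p k‖ := by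
        have := norm_sub_le (p k + x) (p k)
        rwa [add_sub_cancel_left] at this
      simp only [hA, ek, Pi.add_apply, Pi.smul_apply, Pi.single_eq_same, smul_eq_mul, mul_one]
      linarith
    exact (hH0 _ h2).self_of_nhds
  let f : ℂ → ℂ := fun t => t⁻¹
  have hf : LocallyIntegrable f := locallyIntegrable_inv
  let L : ℂ →L[ℝ] G →L[ℝ] G := ContinuousLinearMap.lsmul ℝ ℂ
  -- The Cauchy transform `π⁻¹ ∫ t⁻¹ H(z - t e_k) dt`. It is written as a convolution with parameter
  -- `z`, evaluated at `0`, so that the theorems on differentiation of such convolutions apply.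
  let u : (Fin n → ℂ) → G := fun z => ((Real.pi)⁻¹ : ℝ) • (convolution f (g z) L volume) 0
  have husm : ContDiffOn ℝ ∞ u (ball 0 r) := by
    have h1 := contDiffOn_convolution_right_with_param (n := ⊤) (μ := volume) L isOpen_ball
      (isCompact_closedBall (0 : ℂ) (2 * r)) hgs hf hgsm
    exact (h1.comp ((contDiff_id.prodMk contDiff_const).contDiffOn (f := fun z => (z, (0 : ℂ))))
      fun z hz => ⟨hz, mem_univ _⟩).const_smul _
  have hgder : ∀ z ∈ ball (0 : Fin n → ℂ) r, ∀ x : ℂ, fderiv ℝ (Function.uncurry g) (z, x) =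
      fderiv ℝ H (A (z, x)) ∘L A := by
    intro z hz x
    have h1 : DifferentiableAt ℝ H (A (z, x)) :=
      (hHsm.contDiffAt (hW.mem_nhds (hAW z hz x))).differentiableAt (by simp)
    exact (h1.hasFDerivAt.comp (z, x) A.hasFDerivAt).fderiv
  have hcont : ∀ z ∈ ball (0 : Fin n → ℂ) r, ∀ v, Continuous fun x : ℂ => fderiv ℝ H (A (z, x)) v := by
    intro z hz v
    have h1 : ContinuousOn (fderiv ℝ H) W := (hHsm.fderiv_of_isOpen hW (m := 0) (by simp)).continuousOn
    exact (h1.comp_continuous (A.continuous.comp (Continuous.prodMk_right z)) fun x =>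
      hAW z hz x).clm_apply continuous_const
  have hzero : ∀ z ∈ ball (0 : Fin n → ℂ) r, ∀ x ∉ closedBall (0 : ℂ) (2 * r),
      fderiv ℝ H (A (z, x)) = 0 := by
    intro z hz x hx
    rw [mem_closedBall_zero_iff, not_le] at hx
    have h1 : ‖z k‖ < r := (pi_norm_lt_iff hr).1 (mem_ball_zero_iff.1 hz) k
    have h2 : r ≤ ‖A (z, x) k‖ := by
      have h3 : ‖x‖ ≤ ‖z k + x‖ + ‖z k‖ := by
        have := norm_sub_le (z k + x) (z k)
        rwa [add_sub_cancel_left] at this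
      simp only [hA, ek, Pi.add_apply, Pi.smul_apply, Pi.single_eq_same, smul_eq_mul, mul_one]
      linarith
    rw [(hH0 _ h2).fderiv_eq]
    simp
  have hsupp : ∀ z ∈ ball (0 : Fin n → ℂ) r, ∀ v,
      HasCompactSupport fun x : ℂ => fderiv ℝ H (A (z, x)) v := fun z hz v =>
    HasCompactSupport.intro (isCompact_closedBall (0 : ℂ) (2 * r)) fun x hx => by
      rw [hzero z hz x hx]; rfl
  have huder : ∀ z ∈ ball (0 : Fin n → ℂ) r, ∀ v, fderiv ℝ u z v =
      ((Real.pi)⁻¹ : ℝ) • ∫ t, f t • fderiv ℝ H (A (z, 0 - t)) v := by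
    intro z hz v
    have h1 := hasFDerivAt_convolution_right_with_param (μ := volume) L isOpen_ball
      (isCompact_closedBall (0 : ℂ) (2 * r)) hgs hf (hgsm.of_le (by simp)) (z, 0) hz
    have h2 : HasFDerivAt (fun z : Fin n → ℂ => (z, (0 : ℂ))) (ContinuousLinearMap.inl ℝ _ _) z :=
      (hasFDerivAt_id z).prodMk (hasFDerivAt_const _ _)
    have h3 := (HasFDerivAt.comp z h1 h2).const_smul ((Real.pi)⁻¹ : ℝ)
    have h4 : (fun x : ℂ => fderiv ℝ (Function.uncurry g) (z, x)) =
        fun x => fderiv ℝ H (A (z, x)) ∘L A := funext fun x => hgder z hz x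
    refine (congrArg (fun T => T v) h3.fderiv).trans ?_
    simp only [smul_apply, ContinuousLinearMap.comp_apply]
    congr 1
    erw [h4]
    rw [convolution_precompR_apply L hf (HasCompactSupport.intro (isCompact_closedBall (0 : ℂ) (2 * r))
      fun x hx => by rw [hzero z hz x hx]; rfl)]
    · simp only [convolution, ContinuousLinearMap.comp_apply, ContinuousLinearMap.inl_apply]
      refine integral_congr_ae (Filter.Eventually.of_forall fun t => ?_)
      simp [L, hA]
    · have h1 : ContinuousOn (fderiv ℝ H) W := (hHsm.fderiv_of_isOpen hW (m := 0) (by simp)).continuousOn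
      exact (h1.comp_continuous (A.continuous.comp (Continuous.prodMk_right z)) fun x =>
        hAW z hz x).clm_comp continuous_const
  have hint : ∀ z ∈ ball (0 : Fin n → ℂ) r, ∀ v,
      Integrable fun t : ℂ => f t • fderiv ℝ H (A (z, 0 - t)) v := fun z hz v =>
    ((hsupp z hz v).convolutionExists_right L hf (hcont z hz v) 0)
  have hudbar : ∀ z ∈ ball (0 : Fin n → ℂ) r, ∀ v, dbarAt u z v =
      ((Real.pi)⁻¹ : ℝ) • ∫ t, f t • dbarAt H (A (z, 0 - t)) v := by
    intro z hz v
    simp only [dbarAt]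
    rw [huder z hz, huder z hz, smul_comm Complex.I, ← smul_add, smul_comm (2⁻¹ : ℂ),
      ← integral_smul, ← integral_add (hint z hz v) (g := fun t => Complex.I • f t • fderiv ℝ H (A (z, 0 - t)) (Complex.I • v))
        ((hint z hz _).smul Complex.I), ← integral_smul]
    congr 2
    funext t
    module
  refine ⟨u, husm, fun z hz' => ?_, fun j hjk hj z hz => ?_⟩
  · have hz : z ∈ ball (0 : Fin n → ℂ) r := ball_subset_ball hrr.le hz'
    have hφ : ContDiff ℝ ∞ (g z) := by
      have h1 : ContDiff ℝ ∞ fun x : ℂ => A (z, x) := A.contDiff.comp (contDiff_prodMk_right z)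
      exact contDiffOn_univ.1 (hHsm.comp h1.contDiffOn fun x _ => hAW z hz x)
    have hφs : HasCompactSupport (g z) :=
      HasCompactSupport.intro (isCompact_closedBall (0 : ℂ) (2 * r)) fun x hx => hgs z x hz hx
    have hφder : ∀ x y, fderiv ℝ (g z) x y = fderiv ℝ H (A (z, x)) (y • ek) := by
      intro x y
      have h1 : DifferentiableAt ℝ H (A (z, x)) :=
        (hHsm.contDiffAt (hW.mem_nhds (hAW z hz x))).differentiableAt (by simp)
      have h2 : HasFDerivAt (fun x : ℂ => (z, x)) (ContinuousLinearMap.inr ℝ _ _) x :=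
        (hasFDerivAt_const _ _).prodMk (hasFDerivAt_id x)
      have h3 := h1.hasFDerivAt.comp x (A.hasFDerivAt.comp x h2)
      refine (congrArg (fun T => T y) h3.fderiv).trans ?_
      simp [hA]
    have h1 := integral_inv_smul_dbar (hφ.of_le (by simp)) hφs
    -- The substitution `t ↦ -t` gives the Cauchy-Pompeiu integral of `x ↦ H(z + x e_k)` at the
    -- origin.
    rw [hudbar z hz, ← integral_neg_eq_self]
    have h2 : ∀ t : ℂ, f (-t) • dbarAt H (A (z, 0 - -t)) (Pi.single k 1) =
        (-2⁻¹ : ℂ) • (t⁻¹ • (fderiv ℝ (g z) t 1 + Complex.I • fderiv ℝ (g z) t Complex.I)) := by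
      intro t
      rw [hφder, hφder, one_smul, zero_sub, neg_neg]
      simp only [f, dbarAt, ek, inv_neg]
      module
    simp only [h2]
    rw [integral_smul, h1]
    have hg0 : g z 0 = h z := by
      have hA0 : A (z, 0) = z := by simp [hA]
      have : χ (z k) = 1 := χ.one_of_mem_closedBall <| by
        rw [mem_closedBall_zero_iff]
        exact ((pi_norm_lt_iff hr').1 (mem_ball_zero_iff.1 hz') k).le
      simp only [g, hA0, H, this, one_smul]
    rw [hg0, ← Complex.coe_smul, ← Complex.coe_smul]
    have hpi : (Real.pi : ℂ) ≠ 0 := by exact_mod_cast Real.pi_ne_zero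
    match_scalars
    field_simp
  · rw [hudbar z hz]
    have : ∀ t : ℂ, dbarAt H (A (z, 0 - t)) (Pi.single j 1) = 0 := by
      intro t
      -- Either the translated point is in the ball, where `h` is holomorphic in `z_j`, or `H`
      -- vanishes near it.
      by_cases hk : ‖A (z, 0 - t) k‖ < r
      · have hb := hWball _ (hAW z hz _) hk
        rw [dbarAt_sub_const_smul_basis k j hjk (χ.contDiff (n := 1))
          ((hh.contDiffAt (isOpen_ball.mem_nhds hb)).differentiableAt (by simp)), hj _ hb, smul_zero]
      · rw [dbarAt_congr (hH0 _ (not_lt.1 hk))]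
        simp [dbarAt]
    simp only [this, smul_zero, integral_zero]

/-- Induction on the number `m` of components that may be nonzero. The last of them is removed by
subtracting `∂̄u` from the form, with `u` its Cauchy transform. Closedness keeps the higher
components zero, at the cost of half the radius. -/
theorem exists_dbarAt_basis_eq_of_closed {n : ℕ} (m : ℕ) {r : ℝ} (hr : 0 < r)
    {a : Fin n → (Fin n → ℂ) → G} (ha : ∀ j, ContDiffOn ℝ ∞ (a j) (ball 0 r))
    (hcl : ∀ j l, ∀ z ∈ ball (0 : Fin n → ℂ) r,
      dbarAt (a j) z (Pi.single l 1) = dbarAt (a l) z (Pi.single j 1))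
    (hm : ∀ j : Fin n, m ≤ j → ∀ z ∈ ball (0 : Fin n → ℂ) r, a j z = 0) :
    ∃ r' > 0, r' ≤ r ∧ ∃ u : (Fin n → ℂ) → G, ContDiffOn ℝ ∞ u (ball 0 r') ∧
      ∀ j, ∀ z ∈ ball (0 : Fin n → ℂ) r', dbarAt u z (Pi.single j 1) = a j z := by
  induction m generalizing r a with
  | zero =>
    refine ⟨r, hr, le_rfl, fun _ => 0, contDiffOn_const, fun j z hz => ?_⟩
    rw [hm j (Nat.zero_le _) z hz]
    simp [dbarAt]
  | succ m ih =>
    by_cases hmn : m < n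
    swap
    · exact ih hr ha hcl fun j hj => absurd j.2 (by omega)
    let k : Fin n := ⟨m, hmn⟩
    obtain ⟨u, hu, huk, huj⟩ := exists_dbarAt_basis_eq k (half_pos hr) (half_lt_self hr) (ha k)
    have hsub : ball (0 : Fin n → ℂ) (r / 2) ⊆ ball 0 r := ball_subset_ball (half_le_self hr.le)
    have hdu : ∀ j, ContDiffOn ℝ ∞ (fun z => dbarAt u z (Pi.single j 1)) (ball 0 r) := fun j =>
      contDiffOn_dbarAt isOpen_ball hu _
    have hda : ∀ {f : (Fin n → ℂ) → G}, ContDiffOn ℝ ∞ f (ball 0 r) →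
        ∀ z ∈ ball (0 : Fin n → ℂ) (r / 2), DifferentiableAt ℝ f z := fun hf z hz =>
      (hf.contDiffAt (isOpen_ball.mem_nhds (hsub hz))).differentiableAt (by simp)
    obtain ⟨r', hr', hle, w, hw, hwj⟩ := ih (half_pos hr)
      (a := fun j z => a j z - dbarAt u z (Pi.single j 1))
      (fun j => ((ha j).sub (hdu j)).mono hsub)
      (fun j l z hz => by
        rw [dbarAt_sub (hda (ha j) z hz) (hda (hdu j) z hz),
          dbarAt_sub (hda (ha l) z hz) (hda (hdu l) z hz), hcl j l z (hsub hz), dbarAt_comm]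
        exact (hu.contDiffAt (isOpen_ball.mem_nhds (hsub hz))).of_le (by norm_cast))
      (fun j hj z hz => by
        by_cases hjk : j = k
        · rw [hjk, huk z hz, sub_self]
        · have hj' : m + 1 ≤ j := by
            have : (j : ℕ) ≠ m := fun h => hjk (Fin.ext h)
            omega
          -- By closedness `∂̄_j a_k = ∂̄_k a_j = 0` for `j > k`. So `a_k` is holomorphic in `z_j`,
          -- and `u` inherits this.
          rw [hm j hj' z (hsub hz), huj j hjk _ z (hsub hz), sub_zero]
          intro y hy
          rw [hcl k j y hy, dbarAt_congr (f' := fun _ => 0)]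
          · simp [dbarAt]
          · filter_upwards [isOpen_ball.mem_nhds hy] with x hx using hm j hj' x hx)
    -- The solution is `u + w`, written as a difference so that `dbarAt_sub` applies.
    refine ⟨r', hr', hle.trans (half_le_self hr.le), fun z => u z - (-1 : ℂ) • w z, ?_, ?_⟩
    · exact (hu.mono (ball_subset_ball (hle.trans (half_le_self hr.le)))).sub (hw.const_smul _)
    · intro j z hz
      have hz2 := ball_subset_ball hle hz
      have hw' := (hw.contDiffAt (isOpen_ball.mem_nhds hz)).differentiableAt (n := ∞) (by simp)
      rw [dbarAt_sub (hda hu z hz2) (f' := fun z => (-1 : ℂ) • w z) (hw'.const_smul (-1 : ℂ)), dbarAt_const_smul _ _ hw', hwj j z hz]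
      module

/-- The `∂̄`-Poincaré lemma for `(0,1)`-forms on a finite dimensional complex vector space. -/
theorem exists_dbarAt_eq_of_closed {E : Type*} [NormedAddCommGroup E] [NormedSpace ℂ E]
    [FiniteDimensional ℂ E] {U : Set E} (hU : IsOpen U) {x₀ : E} (hx₀ : x₀ ∈ U)
    (α : E → E →ₗ⋆[ℂ] G) (hα : ∀ v, ContDiffOn ℝ ∞ (fun x => α x v) U)
    (hcl : ∀ x ∈ U, ∀ v w, dbarAt (fun y => α y v) x w = dbarAt (fun y => α y w) x v) :
    ∃ U' ⊆ U, IsOpen U' ∧ x₀ ∈ U' ∧ ∃ u : E → G, ContDiffOn ℝ ∞ u U' ∧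
      ∀ x ∈ U', ∀ v, dbarAt u x v = α x v := by
  let e : E ≃L[ℂ] (Fin (Module.finrank ℂ E) → ℂ) := ContinuousLinearEquiv.ofFinrankEq (by simp)
  let A : (Fin (Module.finrank ℂ E) → ℂ) →L[ℂ] E := e.symm
  have hAc : Continuous fun y => A y + x₀ := A.continuous.add continuous_const
  have hAs : ContDiff ℝ ∞ fun y => A y + x₀ := (A.restrictScalars ℝ).contDiff.add contDiff_const
  obtain ⟨r, hr, hrU⟩ := Metric.mem_nhds_iff.1
    ((hU.preimage hAc).mem_nhds (show (0 : Fin (Module.finrank ℂ E) → ℂ) ∈ _ by simpa using hx₀))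
  have hd : ∀ v, ∀ z ∈ ball (0 : Fin (Module.finrank ℂ E) → ℂ) r,
      DifferentiableAt ℝ (fun x => α x v) (A z + x₀) := fun v z hz =>
    ((hα v).contDiffAt (hU.mem_nhds (hrU hz))).differentiableAt (by simp)
  obtain ⟨r', hr', hle, u, hu, huj⟩ := exists_dbarAt_basis_eq_of_closed (Module.finrank ℂ E) hr
    (a := fun j z => α (A z + x₀) (A (Pi.single j 1)))
    (fun j => (hα _).comp hAs.contDiffOn fun z hz => hrU hz)
    (fun j l z hz => by
      rw [dbarAt_comp_linear (f := fun x => α x (A (Pi.single j 1))) A x₀ z _ (hd _ z hz),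
        dbarAt_comp_linear (f := fun x => α x (A (Pi.single l 1))) A x₀ z _ (hd _ z hz)]
      exact hcl _ (hrU hz) _ _)
    (fun j hj => absurd j.2 (not_lt.2 hj))
  have hes : ∀ x, e.toContinuousLinearMap x + -e x₀ = e (x - x₀) := fun x => by
    simp [sub_eq_add_neg]
  have hcont : Continuous fun x => e x + -e x₀ := by fun_prop
  refine ⟨(fun x => e x + -e x₀) ⁻¹' ball 0 r', fun x hx => ?_, isOpen_ball.preimage hcont,
    by simpa using hr', fun x => u (e.toContinuousLinearMap x + -e x₀), ?_, fun x hx v => ?_⟩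
  · have := hrU (ball_subset_ball hle hx)
    simpa [A] using this
  · refine hu.comp (ContDiff.contDiffOn ?_) fun x hx => hx
    exact (e.toContinuousLinearMap.restrictScalars ℝ).contDiff.add contDiff_const
  · have hud := (hu.contDiffAt (isOpen_ball.mem_nhds hx)).differentiableAt (n := ∞) (by simp)
    rw [dbarAt_comp_linear e.toContinuousLinearMap _ x v hud]
    have hv : ∀ w : Fin (Module.finrank ℂ E) → ℂ, dbarAt u (e.toContinuousLinearMap x + -e x₀) w = α x (A w) := by
      intro w
      -- Both sides are conjugate linear in the direction, so the basis vectors suffice.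
      let S₁ : (Fin (Module.finrank ℂ E) → ℂ) →ₗ⋆[ℂ] G :=
        { toFun := fun w => dbarAt u (e.toContinuousLinearMap x + -e x₀) w
          map_add' := dbarAt_add_right _ _
          map_smul' := fun c w => dbarAt_smul_right _ _ _ _ }
      let S₂ : (Fin (Module.finrank ℂ E) → ℂ) →ₗ⋆[ℂ] G := (α x).comp A.toLinearMap
      have : S₁ = S₂ := by
        refine (Pi.basisFun ℂ (Fin (Module.finrank ℂ E))).ext fun j => ?_
        rw [Pi.basisFun_apply]
        have := huj j _ hx
        simp only [A] at this
        simpa [S₁, S₂, A] using this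
      exact congrArg (fun S => S w) this
    rw [hv]
    simp [A]

end DbarPoincareLemma

/-! ### Orthogonal complex structures as graphs in the isotropic Grassmannian -/

noncomputable section IsotropicCharts

variable {F : Type*} [NormedAddCommGroup F] [NormedSpace ℂ F]
  {C : Type*} [NormedAddCommGroup C] [NormedSpace ℂ C]

/-- The complex linear extension `F × F → C`, `(a, b) ↦ T a + i T b` of a real linear map. -/
def cplxExt (T : F →L[ℝ] C) : F × F →L[ℝ] C := T.coprod (Complex.I • T)

/-- `T` is an isometric embedding of `(F, G)` in the complex quadratic space `(C, q)`. -/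
def IsIsometricFrame (q : LinearMap.BilinForm ℂ C) (G : F → F → ℝ) (T : F →L[ℝ] C) : Prop :=
  ∀ a b, q (T a) (T b) = (G a b : ℂ)

section Frame
variable {q : LinearMap.BilinForm ℂ C} {G : F → F → ℝ} {T : F →L[ℝ] C}

/-- Pairing with `T u` and separating real and imaginary parts gives `G a u = G b u = 0` for all
`u`; definiteness does the rest. -/
theorem IsIsometricFrame.cplxExt_inj (hT : IsIsometricFrame q G T) (hG : ∀ a, a ≠ 0 → 0 < G a a)
    {a b : F} (h : T a + Complex.I • T b = 0) : a = 0 ∧ b = 0 := by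
  have key : ∀ u, G a u = 0 ∧ G b u = 0 := fun u => by
    have h1 : q (T a + Complex.I • T b) (T u) = 0 := by rw [h]; simp
    rw [map_add, map_smul, LinearMap.add_apply, LinearMap.smul_apply, hT, hT, smul_eq_mul] at h1
    have h2 := congrArg Complex.re h1
    have h3 := congrArg Complex.im h1
    simp at h2 h3
    exact ⟨h2, h3⟩
  refine ⟨by_contra fun h0 => (hG a h0).ne' (key a).1, by_contra fun h0 => (hG b h0).ne' (key b).2⟩

variable [FiniteDimensional ℂ F] [FiniteDimensional ℂ C]

theorem IsIsometricFrame.isInvertible (hT : IsIsometricFrame q G T) (hG : ∀ a, a ≠ 0 → 0 < G a a)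
    (hd : Module.finrank ℂ C = 2 * Module.finrank ℂ F) : (cplxExt T).IsInvertible := by
  have : FiniteDimensional ℝ F := FiniteDimensional.complexToReal F
  have : FiniteDimensional ℝ C := FiniteDimensional.complexToReal C
  have hinj : Function.Injective (cplxExt T).toLinearMap := by
    rw [← LinearMap.ker_eq_bot, LinearMap.ker_eq_bot']
    rintro ⟨a, b⟩ h
    obtain ⟨rfl, rfl⟩ := hT.cplxExt_inj hG (a := a) (b := b) h
    rfl
  have hfr : Module.finrank ℝ (F × F) = Module.finrank ℝ C := by
    rw [Module.finrank_prod, finrank_real_of_complex, finrank_real_of_complex, hd]; ring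
  refine ⟨(LinearEquiv.ofInjectiveOfFinrankEq _ hinj hfr).toContinuousLinearEquiv, ?_⟩
  ext x <;> rfl

end Frame

/-- The components of `z ∈ C` with respect to the real structure `T F`: `z = T (re z) + i T (im z)`. -/
def rePart (T : F →L[ℝ] C) : C →L[ℝ] F := ContinuousLinearMap.fst ℝ F F ∘L (cplxExt T).inverse

/-- See `rePart`. -/
def imPart (T : F →L[ℝ] C) : C →L[ℝ] F := ContinuousLinearMap.snd ℝ F F ∘L (cplxExt T).inverse

theorem rePart_add_imPart {T : F →L[ℝ] C} (hT : (cplxExt T).IsInvertible) (z : C) :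
    T (rePart T z) + Complex.I • T (imPart T z) = z :=
  hT.self_apply_inverse z

theorem rePart_apply {T : F →L[ℝ] C} (hT : (cplxExt T).IsInvertible) (a b : F) :
    rePart T (T a + Complex.I • T b) = a :=
  congrArg Prod.fst (hT.inverse_apply_self (a, b))

theorem imPart_apply {T : F →L[ℝ] C} (hT : (cplxExt T).IsInvertible) (a b : F) :
    imPart T (T a + Complex.I • T b) = b :=
  congrArg Prod.snd (hT.inverse_apply_self (a, b))

/-- The data of an affine chart of the isotropic Grassmannian of `(C, q)`: complementary maximal
isotropic subspaces `range τ` and `ker P`, where `τ` and `P` are complex linear for the complex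
structure `-A` on `F`, and linear coordinates `S` on the space of skew maps `range τ → ker P`. -/
structure IsotropicChart (F : Type*) [NormedAddCommGroup F] [NormedSpace ℂ F]
    {C : Type*} [NormedAddCommGroup C] [NormedSpace ℂ C] (q : LinearMap.BilinForm ℂ C) (N : ℕ) where
  τ : F →L[ℝ] C
  P : C →L[ℝ] F
  A : F →L[ℝ] F
  S : (Fin N → ℂ) →L[ℝ] (C →L[ℝ] C)
  A_A : ∀ w, A (A w) = -w
  τ_A : ∀ w, τ (A w) = -(Complex.I • τ w)
  P_τ : ∀ w, P (τ w) = w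
  P_I : ∀ z, P (Complex.I • z) = -(A (P z))
  isotropic_τ : ∀ w w', q (τ w) (τ w') = 0
  isotropic_P : ∀ z z', P z = 0 → P z' = 0 → q z z' = 0
  P_S : ∀ c z, P (S c z) = 0
  S_ker : ∀ c z, P z = 0 → S c z = 0
  S_skew : ∀ c z z', q (S c z) z' + q z (S c z') = 0
  S_I_smul : ∀ c z, S (Complex.I • c) z = Complex.I • S c z
  S_smul_I : ∀ c z, S c (Complex.I • z) = Complex.I • S c z
  S_inj : Function.Injective S
  S_surj : ∀ X : C →L[ℝ] C, (∀ z, X (Complex.I • z) = Complex.I • X z) → (∀ z, P (X z) = 0) →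
    (∀ z, P z = 0 → X z = 0) → (∀ z z', q (X z) z' + q z (X z') = 0) → ∃ c, S c = X

namespace IsotropicChart

variable {q : LinearMap.BilinForm ℂ C} {N : ℕ} (κ : IsotropicChart F q N)

/-- The real part of the parametrization `(1 + S c) τ` of the isotropic subspace with coordinates
`c`. -/
def frame (T : F →L[ℝ] C) (c : Fin N → ℂ) : F →L[ℝ] F :=
  rePart T ∘L (ContinuousLinearMap.id ℝ C + κ.S c) ∘L κ.τ

/-- The complex structure on `F` whose `-i` eigenspace in `C` is the isotropic subspace with
coordinates `c`. -/
def struct (T : F →L[ℝ] C) (c : Fin N → ℂ) : F →L[ℝ] F :=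
  κ.frame T c ∘L κ.A ∘L (κ.frame T c).inverse

/-- The projection to `F` of the parametrization `T + i T A` of the `-i` eigenspace of `A`. -/
def proj (T : F →L[ℝ] C) (A : F →L[ℝ] F) : F →L[ℝ] F := κ.P ∘L (T + Complex.I • (T ∘L A))

/-- The skew map `range τ → ker P` with graph the `-i` eigenspace of `A`. -/
def skew (T : F →L[ℝ] C) (A : F →L[ℝ] F) : C →L[ℝ] C :=
  ((T + Complex.I • (T ∘L A)) ∘L (κ.proj T A).inverse - κ.τ) ∘L κ.P

/-- The diagonal terms vanish because both complementary subspaces are isotropic, and the mixed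
terms cancel because `S c` is skew. -/
theorem isotropic_graph (c : Fin N → ℂ) (w w' : F) :
    q (κ.τ w + κ.S c (κ.τ w)) (κ.τ w' + κ.S c (κ.τ w')) = 0 := by
  have h := κ.S_skew c (κ.τ w) (κ.τ w')
  have h1 := κ.isotropic_P _ _ (κ.P_S c (κ.τ w)) (κ.P_S c (κ.τ w'))
  simp only [map_add, LinearMap.add_apply]
  rw [κ.isotropic_τ, h1]
  linear_combination h

variable {κ} {T : F →L[ℝ] C} {G : F → F → ℝ}

theorem isInvertible_of_comp_τ {p r : F →L[ℝ] F} (h : ∀ w, p (r w) = w) [FiniteDimensional ℂ F] :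
    p.IsInvertible ∧ r.IsInvertible ∧ p.inverse = r := by
  have : FiniteDimensional ℝ F := FiniteDimensional.complexToReal F
  have h1 : p.toLinearMap ∘ₗ r.toLinearMap = LinearMap.id := LinearMap.ext h
  have h2 := LinearMap.ext_iff.1 ((LinearMap.comp_eq_id_comm ℝ F).1 h1)
  have hp : p = (ContinuousLinearEquiv.equivOfInverse p r h2 h : F ≃L[ℝ] F) := by ext; rfl
  have hr : r = (ContinuousLinearEquiv.equivOfInverse r p h h2 : F ≃L[ℝ] F) := by ext; rfl
  refine ⟨⟨_, hp.symm⟩, ⟨_, hr.symm⟩, ?_⟩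
  conv_lhs => rw [hp]
  rw [ContinuousLinearMap.inverse_equiv]
  ext; rfl

variable [FiniteDimensional ℂ F]

/-- A nonzero vector `i T b` is not isotropic, since `q (i T b) (i T b) = -G b b`. So an isotropic
subspace meets `i T F` only in zero, and its real part is injective. -/
theorem frame_isInvertible (hT : IsIsometricFrame q G T) (hG : ∀ a, a ≠ 0 → 0 < G a a)
    (hI : (cplxExt T).IsInvertible) (c : Fin N → ℂ) : (κ.frame T c).IsInvertible := by
  have : FiniteDimensional ℝ F := FiniteDimensional.complexToReal F
  have hinj : Function.Injective (κ.frame T c).toLinearMap := by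
    rw [← LinearMap.ker_eq_bot, LinearMap.ker_eq_bot']
    intro w hw
    have h1 := rePart_add_imPart hI (κ.τ w + κ.S c (κ.τ w))
    have hw' : rePart T (κ.τ w + κ.S c (κ.τ w)) = 0 := hw
    rw [hw', map_zero, zero_add] at h1
    have h2 := κ.isotropic_graph c w w
    rw [← h1] at h2
    simp only [map_smul, LinearMap.smul_apply, smul_eq_mul, hT _ _, ← mul_assoc] at h2
    rw [Complex.I_mul_I, neg_one_mul, neg_eq_zero, Complex.ofReal_eq_zero] at h2
    have h3 : imPart T (κ.τ w + κ.S c (κ.τ w)) = 0 := by_contra fun h0 => (hG _ h0).ne' h2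
    rw [h3, map_zero, smul_zero] at h1
    have h4 := congrArg κ.P h1.symm
    simpa [κ.P_τ, κ.P_S] using h4
  exact ⟨(LinearEquiv.ofInjectiveEndo _ hinj).toContinuousLinearEquiv, by ext; rfl⟩

variable (hT : IsIsometricFrame q G T) (hG : ∀ a, a ≠ 0 → 0 < G a a)
  (hI : (cplxExt T).IsInvertible)

include hT hG hI

/-- The isotropic subspace is complex, and multiplication by `-i` on it corresponds to `κ.A` on the
parameter. Since `-i (T a + i T b) = T b - i T a`, the imaginary part of a vector is the real part
of `-i` times it. So the subspace is the graph of `κ.struct` over its real part, that is, its `-i`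
eigenspace. -/
theorem graph_eq (c : Fin N → ℂ) (w : F) : κ.τ w + κ.S c (κ.τ w) =
    T (κ.frame T c w) + Complex.I • T (κ.struct T c (κ.frame T c w)) := by
  have hR := frame_isInvertible (κ := κ) hT hG hI c
  have h1 := rePart_add_imPart hI (κ.τ w + κ.S c (κ.τ w))
  have h2 : κ.struct T c (κ.frame T c w) = κ.frame T c (κ.A w) := by
    simp [struct, hR.inverse_apply_self]
  have h3 : κ.frame T c (κ.A w) = imPart T (κ.τ w + κ.S c (κ.τ w)) := by
    change rePart T (κ.τ (κ.A w) + κ.S c (κ.τ (κ.A w))) = _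
    have : κ.τ (κ.A w) + κ.S c (κ.τ (κ.A w)) = T (imPart T (κ.τ w + κ.S c (κ.τ w))) +
        Complex.I • T (-rePart T (κ.τ w + κ.S c (κ.τ w))) := by
      rw [κ.τ_A, map_neg, κ.S_smul_I, ← neg_add, ← smul_add]
      conv_lhs => rw [← h1]
      rw [smul_add, smul_smul, Complex.I_mul_I, map_neg]
      module
    rw [this, rePart_apply hI]
  rw [h2, h3]
  exact h1.symm

theorem struct_struct (c : Fin N → ℂ) (w : F) : κ.struct T c (κ.struct T c w) = -w := by
  have hR := frame_isInvertible (κ := κ) hT hG hI c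
  simp [struct, hR.inverse_apply_self, κ.A_A, hR.self_apply_inverse]

theorem frame_surjective (c : Fin N → ℂ) (w : F) : ∃ u, κ.frame T c u = w :=
  ⟨_, (frame_isInvertible (κ := κ) hT hG hI c).self_apply_inverse w⟩

/-- This is the real part of isotropy: for vectors `T a + i T (A a)` and `T b + i T (A b)` it is `G
a b - G (A a) (A b) = 0`. -/
theorem struct_isometry (c : Fin N → ℂ) (a b : F) :
    G (κ.struct T c a) (κ.struct T c b) = G a b := by
  obtain ⟨u, rfl⟩ := frame_surjective (κ := κ) hT hG hI c a
  obtain ⟨v, rfl⟩ := frame_surjective (κ := κ) hT hG hI c b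
  have h := κ.isotropic_graph c u v
  rw [graph_eq hT hG hI, graph_eq hT hG hI] at h
  simp only [map_add, LinearMap.add_apply, map_smul, LinearMap.smul_apply, smul_eq_mul, hT _ _] at h
  have := congrArg Complex.re h
  simp at this
  linarith

theorem proj_struct_frame (c : Fin N → ℂ) (w : F) :
    κ.proj T (κ.struct T c) (κ.frame T c w) = w := by
  have h := congrArg κ.P (graph_eq (κ := κ) hT hG hI c w)
  rw [map_add, κ.P_τ, κ.P_S, add_zero] at h
  exact h.symm

/-- By `proj_struct_frame` the map `frame` inverts `proj`, so the graph over `range τ` of the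
eigenspace is the map it was made from; `skew` thus recovers the coordinates. -/
theorem skew_struct (c : Fin N → ℂ) : κ.skew T (κ.struct T c) = κ.S c := by
  obtain ⟨h1, -, h2⟩ := isInvertible_of_comp_τ (proj_struct_frame (κ := κ) hT hG hI c)
  ext z
  have h3 := graph_eq (κ := κ) hT hG hI c (κ.P z)
  have h4 : κ.S c z = κ.S c (κ.τ (κ.P z)) := by
    rw [← sub_eq_zero, ← map_sub]
    exact κ.S_ker c _ (by rw [map_sub, κ.P_τ, sub_self])
  rw [h4]
  simp only [skew, h2, ContinuousLinearMap.comp_apply, sub_apply, add_apply, smul_apply]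
  rw [← h3]
  abel

/-- If the `-i` eigenspace of `A` projects isomorphically along `ker P`, it is a graph over `range
τ`. The graph map is complex linear because the eigenspace is, and skew because the eigenspace is
isotropic, so `S_surj` provides coordinates. -/
theorem exists_skew_eq {A : F →L[ℝ] F} (hA : ∀ w, A (A w) = -w) (hAG : ∀ a b, G (A a) (A b) = G a b)
    (hp : (κ.proj T A).IsInvertible) : ∃ c, κ.skew T A = κ.S c ∧ κ.struct T c = A := by
  set t : F →L[ℝ] C := T + Complex.I • (T ∘L A) with ht
  have htA : ∀ w, t (A w) = -(Complex.I • t w) := fun w => by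
    simp only [ht, add_apply, smul_apply, ContinuousLinearMap.comp_apply, hA, map_neg]
    rw [smul_add, smul_smul, Complex.I_mul_I]
    module
  have hpA : ∀ w, κ.proj T A (A w) = κ.A (κ.proj T A w) := fun w => by
    change κ.P (t (A w)) = _
    rw [htA, map_neg, κ.P_I, neg_neg]; rfl
  have hpinv : ∀ w, (κ.proj T A).inverse (κ.A w) = A ((κ.proj T A).inverse w) := fun w => by
    obtain ⟨u, rfl⟩ : ∃ u, κ.proj T A u = w := ⟨_, hp.self_apply_inverse w⟩
    rw [← hpA, hp.inverse_apply_self, hp.inverse_apply_self]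
  have hsk : ∀ z, κ.skew T A z = t ((κ.proj T A).inverse (κ.P z)) - κ.τ (κ.P z) := fun z => rfl
  have hπ : ∀ z, κ.P (κ.skew T A z) = 0 := fun z => by
    rw [hsk, map_sub, κ.P_τ]
    exact sub_eq_zero.2 (hp.self_apply_inverse (κ.P z))
  -- Nothing is known about `G` as a function except through the frame, so the sign is taken from
  -- the bilinearity of `q`.
  have hAG' : ∀ a b, G (A a) b = -G a (A b) := fun a b => by
    have h1 : q (T (A (A a))) (T (A b)) = -q (T a) (T (A b)) := by rw [hA]; simp
    rw [hT, hT, hAG] at h1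
    exact_mod_cast h1
  have htiso : ∀ a b, q (t a) (t b) = 0 := fun a b => by
    simp only [ht, add_apply, smul_apply, ContinuousLinearMap.comp_apply, map_add, LinearMap.add_apply,
      map_smul, LinearMap.smul_apply, smul_eq_mul, hT _ _, hAG, hAG']
    push_cast
    linear_combination (G a b : ℂ) * Complex.I_mul_I
  obtain ⟨c, hc⟩ := κ.S_surj (κ.skew T A)
    (fun z => by
      rw [hsk, hsk, κ.P_I, map_neg, map_neg, map_neg, hpinv, htA, κ.τ_A]
      module)
    hπ
    (fun z hz => by rw [hsk, hz]; simp)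
    -- The skew map takes values in the isotropic space `ker P`, so `z` and `z'` may be replaced by
    -- `τ (P z)` and `τ (P z')`; then the claim is isotropy of the eigenspace.
    (fun z z' => by
      have hk : ∀ z, κ.P (z - κ.τ (κ.P z)) = 0 := fun z => by rw [map_sub, κ.P_τ, sub_self]
      have h1 := κ.isotropic_P _ _ (hπ z) (hk z')
      have h2 := κ.isotropic_P _ _ (hk z) (hπ z')
      have h3 := κ.isotropic_P _ _ (hπ z) (hπ z')
      have h4 := htiso ((κ.proj T A).inverse (κ.P z)) ((κ.proj T A).inverse (κ.P z'))
      have e : ∀ z, t ((κ.proj T A).inverse (κ.P z)) = κ.τ (κ.P z) + κ.skew T A z := fun z => by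
        rw [hsk]; abel
      rw [e, e, map_add, map_add, LinearMap.add_apply, LinearMap.add_apply, κ.isotropic_τ,
        h3] at h4
      rw [map_sub] at h1
      rw [map_sub, LinearMap.sub_apply] at h2
      linear_combination h1 + h2 + h4)
  refine ⟨c, hc.symm, ?_⟩
  have hgr : ∀ w, κ.τ w + κ.S c (κ.τ w) = T ((κ.proj T A).inverse w) +
      Complex.I • T (A ((κ.proj T A).inverse w)) := fun w => by
    rw [hc, hsk, κ.P_τ, ht]
    simp
  have hR : ∀ w, κ.frame T c w = (κ.proj T A).inverse w := fun w => by
    change rePart T (κ.τ w + κ.S c (κ.τ w)) = _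
    rw [hgr, rePart_apply hI]
  ext a
  obtain ⟨u, rfl⟩ := frame_surjective (κ := κ) hT hG hI c a
  have h1 := graph_eq (κ := κ) hT hG hI c u
  have h2 := imPart_apply hI (κ.frame T c u) (κ.struct T c (κ.frame T c u))
  rw [← h1, hgr, imPart_apply hI, ← hR] at h2
  exact h2.symm

end IsotropicChart

end IsotropicCharts

/-! ### Existence of isotropic charts, and their dimension -/

noncomputable section IsotropicChartExistence

/-- A real linear map commuting with multiplication by `i`, as a complex linear map. -/
def cplxLinear {E E' : Type*} [AddCommGroup E] [Module ℂ E] [AddCommGroup E'] [Module ℂ E']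
    (f : E →ₗ[ℝ] E') (h : ∀ z, f (Complex.I • z) = Complex.I • f z) : E →ₗ[ℂ] E' where
  toFun := f
  map_add' := f.map_add
  map_smul' c z := by
    have e1 : c • z = c.re • z + c.im • (Complex.I • z) := by
      rw [← Complex.coe_smul, ← Complex.coe_smul, smul_smul, ← add_smul, Complex.re_add_im]
    have e2 : c • f z = c.re • f z + c.im • (Complex.I • f z) := by
      rw [← Complex.coe_smul, ← Complex.coe_smul, smul_smul, ← add_smul, Complex.re_add_im]
    rw [RingHom.id_apply, e1, e2, map_add, map_smul, map_smul, h]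

theorem finrank_alternatingMap_two (W : Type*) [AddCommGroup W] [Module ℂ W] [FiniteDimensional ℂ W] :
    Module.finrank ℂ (W [⋀^Fin 2]→ₗ[ℂ] ℂ) = (Module.finrank ℂ W).choose 2 := by
  rw [(exteriorPower.alternatingMapLinearEquiv (R := ℂ) (M := W) (N := ℂ) (n := 2)).finrank_eq,
    Subspace.dual_finrank_eq, exteriorPower.finrank_eq]

variable {F : Type*} [NormedAddCommGroup F] [NormedSpace ℂ F]
  {C : Type*} [NormedAddCommGroup C] [NormedSpace ℂ C]
  {q : LinearMap.BilinForm ℂ C} {G : F → F → ℝ} {T : F →L[ℝ] C}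

theorem IsIsometricFrame.skew_of_isometry (hT : IsIsometricFrame q G T) {A : F →L[ℝ] F}
    (hA : ∀ w, A (A w) = -w) (hAG : ∀ a b, G (A a) (A b) = G a b) (a b : F) :
    G (A a) b = -G a (A b) := by
  have h1 : q (T (A (A a))) (T (A b)) = -q (T a) (T (A b)) := by rw [hA]; simp
  rw [hT, hT, hAG] at h1
  exact_mod_cast h1

/-- An alternating form in two variables, as a bilinear map. -/
def alt2Bilin {W : Type*} [AddCommGroup W] [Module ℂ W] (s : W [⋀^Fin 2]→ₗ[ℂ] ℂ) :
    W →ₗ[ℂ] W →ₗ[ℂ] ℂ :=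
  LinearMap.mk₂ ℂ (fun a b => s ![a, b])
    (fun a a' b => by
      have := s.map_update_add ![0, b] 0 a a'
      convert this using 2 <;> (try congr 1) <;> ext i <;> fin_cases i <;> simp)
    (fun c a b => by
      have := s.map_update_smul ![0, b] 0 c a
      convert this using 2 <;> (try congr 1) <;> ext i <;> fin_cases i <;> simp)
    (fun a b b' => by
      have := s.map_update_add ![a, 0] 1 b b'
      convert this using 2 <;> (try congr 1) <;> ext i <;> fin_cases i <;> simp)
    (fun c a b => by
      have := s.map_update_smul ![a, 0] 1 c b
      convert this using 2 <;> (try congr 1) <;> ext i <;> fin_cases i <;> simp)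

theorem alt2Bilin_apply {W : Type*} [AddCommGroup W] [Module ℂ W] (s : W [⋀^Fin 2]→ₗ[ℂ] ℂ) (a b : W) :
    alt2Bilin s a b = s ![a, b] := rfl

theorem alt2Bilin_self {W : Type*} [AddCommGroup W] [Module ℂ W] (s : W [⋀^Fin 2]→ₗ[ℂ] ℂ) (a : W) :
    alt2Bilin s a a = 0 :=
  s.map_eq_zero_of_eq ![a, a] (i := 0) (j := 1) rfl (by decide)

theorem alt2Bilin_swap {W : Type*} [AddCommGroup W] [Module ℂ W] (s : W [⋀^Fin 2]→ₗ[ℂ] ℂ) (a b : W) :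
    alt2Bilin s a b = -alt2Bilin s b a := by
  have h := alt2Bilin_self s (a + b)
  simp only [map_add, LinearMap.add_apply, alt2Bilin_self] at h
  linear_combination h

/-- The alternating form `(z, z') ↦ q (X z) z'` of a skew endomorphism, on a subspace. -/
def skewForm (q : LinearMap.BilinForm ℂ C) (L : Submodule ℂ C) (X : C →ₗ[ℂ] C)
    (h : ∀ z ∈ L, q (X z) z = 0) : L [⋀^Fin 2]→ₗ[ℂ] ℂ where
  toFun c := q (X (c 0)) (c 1)
  map_update_add' {d} c i a b := by
    obtain rfl := Subsingleton.elim d (instDecidableEqFin 2)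
    fin_cases i <;> simp
  map_update_smul' {d} c i k a := by
    obtain rfl := Subsingleton.elim d (instDecidableEqFin 2)
    fin_cases i <;> simp
  map_eq_zero_of_eq' c i j hij hne := by
    have : c 0 = c 1 := by
      fin_cases i <;> fin_cases j <;> simp_all
    rw [this]
    exact h _ (c 1).2

variable [FiniteDimensional ℂ F] [FiniteDimensional ℂ C]

/-- Around every orthogonal complex structure there is an affine chart of the isotropic
Grassmannian. -/
theorem exists_isotropicChart (hq : q.Nondegenerate) (hqs : ∀ z z', q z z' = q z' z) (hT : IsIsometricFrame q G T)
    (hI : (cplxExt T).IsInvertible) {A : F →L[ℝ] F} (hA : ∀ w, A (A w) = -w)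
    (hAG : ∀ a b, G (A a) (A b) = G a b) :
    ∃ κ : IsotropicChart F q ((Module.finrank ℂ F).choose 2), (κ.proj T A).IsInvertible := by
  have : FiniteDimensional ℝ F := FiniteDimensional.complexToReal F
  have : FiniteDimensional ℝ C := FiniteDimensional.complexToReal C
  have hAG' := hT.skew_of_isometry hA hAG
  -- The complementary subspaces are the two eigenspaces of `A`: `τ` parametrizes the `-i`
  -- eigenspace, and `P`, which maps `T a + i T b` to `a - A b`, has the `+i` eigenspace as kernel.
  -- The factor `1/2` gives `P ∘ τ = id`.
  let τ : F →L[ℝ] C := (2⁻¹ : ℝ) • (T + Complex.I • (T ∘L A))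
  let P : C →L[ℝ] F := rePart T - A ∘L imPart T
  have hP : ∀ a b, P (T a + Complex.I • T b) = a - A b := fun a b => by
    simp only [P, sub_apply, ContinuousLinearMap.comp_apply, rePart_apply hI, imPart_apply hI]
  have hdec : ∀ z, ∃ a b, z = T a + Complex.I • T b := fun z =>
    ⟨_, _, (rePart_add_imPart hI z).symm⟩
  have hτ : ∀ w, τ w = (2⁻¹ : ℝ) • (T w + Complex.I • T (A w)) := fun w => rfl
  have P_τ : ∀ w, P (τ w) = w := fun w => by
    rw [hτ, map_smul, hP, hA, sub_neg_eq_add, ← two_smul ℝ w, smul_smul]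
    norm_num
  have hIz : ∀ a b, Complex.I • (T a + Complex.I • T b) = T (-b) + Complex.I • T a := fun a b => by
    rw [smul_add, smul_smul, Complex.I_mul_I, map_neg]; module
  have τ_A : ∀ w, τ (A w) = -(Complex.I • τ w) := fun w => by
    rw [hτ, hτ, smul_comm, hIz, hA, map_neg, map_neg]
    module
  have P_I : ∀ z, P (Complex.I • z) = -(A (P z)) := fun z => by
    obtain ⟨a, b, rfl⟩ := hdec z
    rw [hIz, hP, hP, map_sub, hA]
    abel
  have hqq : ∀ a b c d, q (T a + Complex.I • T b) (T c + Complex.I • T d) =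
      (G a c - G b d : ℝ) + Complex.I * (G a d + G b c : ℝ) := fun a b c d => by
    simp only [map_add, LinearMap.add_apply, map_smul, LinearMap.smul_apply, smul_eq_mul, hT _ _]
    push_cast
    linear_combination (G b d : ℂ) * Complex.I_mul_I
  have hreal : ∀ (r : ℝ) z z', q (r • z) z' = r * q z z' := fun r z z' => by
    rw [← Complex.coe_smul, map_smul]; rfl
  have hreal' : ∀ (r : ℝ) z z', q z (r • z') = r * q z z' := fun r z z' => by
    rw [← Complex.coe_smul, map_smul]; rfl
  have isotropic_τ : ∀ w w', q (τ w) (τ w') = 0 := fun w w' => by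
    rw [hτ, hτ, hreal, hreal', hqq, hAG, hAG']
    simp
  have isotropic_P : ∀ z z', P z = 0 → P z' = 0 → q z z' = 0 := fun z z' hz hz' => by
    obtain ⟨a, b, rfl⟩ := hdec z
    obtain ⟨c, d, rfl⟩ := hdec z'
    rw [hP, sub_eq_zero] at hz hz'
    rw [hqq, hz, hz', hAG, hAG']
    simp
  let L : Submodule ℂ C :=
    { carrier := {z | τ (P z) = z}
      add_mem' := fun {a b} ha hb => by
        simp only [Set.mem_ofPred_eq] at *
        rw [map_add, map_add, ha, hb]
      zero_mem' := by simp
      smul_mem' := fun c z hz => by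
        simp only [Set.mem_ofPred_eq] at *
        have : c • z = c.re • z + c.im • (Complex.I • z) := by
          rw [← Complex.coe_smul, ← Complex.coe_smul, smul_smul, ← add_smul, Complex.re_add_im]
        rw [this]
        simp only [map_add, map_smul, P_I, map_neg, τ_A, hz, neg_neg] }
  have hL : ∀ z, τ (P z) ∈ L := fun z => by
    change τ (P (τ (P z))) = τ (P z)
    rw [P_τ]
  let p : C →ₗ[ℂ] C := cplxLinear (τ ∘L P).toLinearMap fun z => by
    change τ (P (Complex.I • z)) = Complex.I • τ (P z)
    rw [P_I, map_neg, τ_A, neg_neg]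
  have hp : ∀ z, p z = τ (P z) := fun z => rfl
  have hkerp : ∀ z, P (z - p z) = 0 := fun z => by rw [map_sub, hp, P_τ, sub_self]
  have hLfin : Module.finrank ℂ L = Module.finrank ℂ F := by
    let e : F ≃ₗ[ℝ] L :=
      { toFun := fun w => ⟨τ w, by change τ (P (τ w)) = τ w; rw [P_τ]⟩
        map_add' := fun a b => Subtype.ext (map_add τ a b)
        map_smul' := fun c a => Subtype.ext (map_smul τ c a)
        invFun := fun z => P z
        left_inv := P_τ
        right_inv := fun z => Subtype.ext z.2 }
    have h1 := e.finrank_eq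
    rw [finrank_real_of_complex, finrank_real_of_complex] at h1
    omega
  let 𝔫 : Submodule ℂ (C →ₗ[ℂ] C) :=
    { carrier := {X | (∀ z, P (X z) = 0) ∧ (∀ z, P z = 0 → X z = 0) ∧
        ∀ z z', q (X z) z' + q z (X z') = 0}
      add_mem' := fun {X Y} hX hY => by
        refine ⟨fun z => ?_, fun z hz => ?_, fun z z' => ?_⟩
        · rw [LinearMap.add_apply, map_add, hX.1, hY.1, add_zero]
        · rw [LinearMap.add_apply, hX.2.1 z hz, hY.2.1 z hz, add_zero]
        · simp only [LinearMap.add_apply, map_add]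
          linear_combination hX.2.2 z z' + hY.2.2 z z'
      zero_mem' := by simp
      smul_mem' := fun c X hX => by
        refine ⟨fun z => ?_, fun z hz => ?_, fun z z' => ?_⟩
        · have : c • X z = c.re • X z + c.im • (Complex.I • X z) := by
            rw [← Complex.coe_smul, ← Complex.coe_smul, smul_smul, ← add_smul, Complex.re_add_im]
          rw [LinearMap.smul_apply, this]
          simp only [map_add, map_smul, P_I, hX.1, map_zero, neg_zero, smul_zero, add_zero]
        · rw [LinearMap.smul_apply, hX.2.1 z hz, smul_zero]
        · simp only [LinearMap.smul_apply, map_smul, smul_eq_mul]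
          linear_combination c * hX.2.2 z z' }
  -- Pairing with `q` turns a skew map from `L = range τ` to `ker P` into an alternating form on
  -- `L`. That this is bijective gives the dimension `n choose 2`.
  let Ψ : 𝔫 →ₗ[ℂ] (L [⋀^Fin 2]→ₗ[ℂ] ℂ) :=
    { toFun := fun X => skewForm q L X.1 fun z hz => by
        have := X.2.2.2 z z
        rw [hqs z] at this
        linear_combination (1 / 2) * this
      map_add' := fun X Y => by
        ext c
        simp [skewForm]
      map_smul' := fun k X => by
        ext c
        simp [skewForm] }
  have hXp : ∀ X ∈ 𝔫, ∀ z, X z = X (p z) := fun X hX z => by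
    rw [← sub_eq_zero, ← map_sub]
    exact hX.2.1 _ (hkerp z)
  have hΨinj : Function.Injective Ψ := by
    rw [← LinearMap.ker_eq_bot, LinearMap.ker_eq_bot']
    intro X hX
    refine Subtype.ext (LinearMap.ext fun z => hq.1 _ fun z' => ?_)
    have h1 : q (X.1 (p z)) (p z') = 0 :=
      congrArg (fun s => s ![⟨p z, hL z⟩, ⟨p z', hL z'⟩]) hX
    have h2 := isotropic_P _ _ (X.2.1 z) (hkerp z')
    rw [map_sub, hXp X.1 X.2, h1, sub_zero] at h2
    rw [hXp X.1 X.2]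
    exact h2
  have hΨsurj : Function.Surjective Ψ := by
    intro s
    let pL : C →ₗ[ℂ] L := p.codRestrict L hL
    let B : C →ₗ[ℂ] C →ₗ[ℂ] ℂ := (alt2Bilin s).compl₁₂ pL pL
    -- The form is pulled back to `C` along the projection to `L`, and one index is raised with `q`.
    let X : C →ₗ[ℂ] C := (q.toDual hq).symm.toLinearMap ∘ₗ B
    have hX : ∀ z z', q (X z) z' = alt2Bilin s (pL z) (pL z') := fun z z' =>
      LinearMap.BilinForm.apply_toDual_symm_apply (hB := hq) ..
    have hpL0 : ∀ z, P z = 0 → pL z = 0 := fun z hz => Subtype.ext (by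
      change p z = 0
      rw [hp, hz, map_zero])
    have h1 : ∀ z, P (X z) = 0 := fun z => by
      have hk : ∀ k, P k = 0 → q (p (X z)) k = 0 := fun k hk => by
        have e := isotropic_P _ _ (hkerp (X z)) hk
        rw [map_sub, LinearMap.sub_apply, hX, hpL0 k hk, map_zero, zero_sub, neg_eq_zero] at e
        exact e
      -- The vector `p (X z)` is orthogonal to `ker P` by construction and to `L` by isotropy;
      -- together they span, and `q` is nondegenerate.
      have h0 : p (X z) = 0 := hq.1 _ fun z' => by
        have e := hk _ (hkerp z')
        rw [map_sub, hp (X z), hp z', isotropic_τ, sub_zero] at e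
        exact e
      rw [← P_τ (P (X z)), ← hp, h0, map_zero]
    have h2 : ∀ z, P z = 0 → X z = 0 := fun z hz => hq.1 _ fun z' => by
      rw [hX, hpL0 z hz, map_zero, LinearMap.zero_apply]
    refine ⟨⟨X, h1, h2, fun z z' => ?_⟩, ?_⟩
    · rw [hqs z, hX, hX, alt2Bilin_swap]
      ring
    · ext c
      change q (X (c 0)) (c 1) = _
      have hpc : ∀ ℓ : L, pL ℓ = ℓ := fun ℓ => Subtype.ext ℓ.2
      rw [hX, hpc, hpc, alt2Bilin_apply]
      congr 1
      ext i
      fin_cases i <;> rfl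
  have hfin : Module.finrank ℂ 𝔫 = (Module.finrank ℂ F).choose 2 := by
    rw [(LinearEquiv.ofBijective Ψ ⟨hΨinj, hΨsurj⟩).finrank_eq, finrank_alternatingMap_two, hLfin]
  let e : (Fin ((Module.finrank ℂ F).choose 2) → ℂ) ≃ₗ[ℂ] 𝔫 :=
    LinearEquiv.ofFinrankEq _ _ (by simp [hfin])
  let S : (Fin ((Module.finrank ℂ F).choose 2) → ℂ) →L[ℝ] (C →L[ℝ] C) :=
    LinearMap.toContinuousLinearMap
      { toFun := fun c => LinearMap.toContinuousLinearMap ((e c).1.restrictScalars ℝ)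
        map_add' := fun c d => by
          ext z
          simp
        map_smul' := fun r c => by
          ext z
          have h : e (r • c) = (r : ℂ) • e c := by
            rw [← map_smul]
            rfl
          simp [h] }
  have hS : ∀ c z, S c z = (e c).1 z := fun c z => rfl
  refine ⟨⟨τ, P, A, S, hA, τ_A, P_τ, P_I, isotropic_τ, isotropic_P, fun c => (e c).2.1,
    fun c => (e c).2.2.1, fun c => (e c).2.2.2, fun c z => ?_, fun c z => ?_, fun c d h => ?_,
    fun X hXI hX1 hX2 hX3 => ?_⟩, ?_⟩
  · rw [hS, hS, map_smul]; rfl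
  · rw [hS, hS, map_smul]
  · refine e.injective (Subtype.ext (LinearMap.ext fun z => ?_))
    exact congrArg (fun Y => Y z) h
  · refine ⟨e.symm ⟨cplxLinear X.toLinearMap hXI, hX1, hX2, hX3⟩, ?_⟩
    ext z
    rw [hS, LinearEquiv.apply_symm_apply]
    rfl
  -- At the centre of the chart `proj` is multiplication by `2`.
  · have h : ∀ w, P ((T + Complex.I • (T ∘L A)) w) = (2 : ℝ) • w := fun w => by
      have : (T + Complex.I • (T ∘L A)) w = (2 : ℝ) • τ w := by
        rw [hτ, smul_smul]; norm_num
      rw [this, map_smul, P_τ]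
    refine (IsotropicChart.isInvertible_of_comp_τ (r := (2⁻¹ : ℝ) • ContinuousLinearMap.id ℝ F)
      fun w => ?_).1
    refine (h _).trans ?_
    simp

end IsotropicChartExistence

/-! ### Derivatives of the parametrized family of complex structures -/

noncomputable section IsotropicChartAnalysis

set_option linter.unusedSectionVars false

variable {F : Type*} [NormedAddCommGroup F] [NormedSpace ℂ F] [FiniteDimensional ℂ F]
  {C : Type*} [NormedAddCommGroup C] [NormedSpace ℂ C]
  {q : LinearMap.BilinForm ℂ C} {N : ℕ} {E : Type*} [NormedAddCommGroup E] [NormedSpace ℂ E]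

-- The linear algebra behind `struct_fderiv_I`. Indices `1` and `2` stand for derivatives in
-- directions `ξ` and `iξ`: of the frame `T`, of the real part (`r`), and of the structure `A`
-- (`x`). Comparing `i` times `h₁` with `h₂` and inserting `hΓ` leaves an identity between vectors
-- of `C`; its components along `T F` and `i T F` are two equations, from which `r₂` is eliminated.
omit [FiniteDimensional ℂ F] in
theorem cplxStructure_image_aux {T T₁ T₂ : F →L[ℝ] C} (hT : (cplxExt T).IsInvertible)
    {A x₁ x₂ Γ₁ Γ₂ : F →L[ℝ] F} (hA : ∀ w, A (A w) = -w) {ρ r₁ r₂ : F}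
    (hΓ : ∀ u, T₂ u - Complex.I • T₁ u = T (Γ₂ u) - Complex.I • T (Γ₁ u)) {s : C}
    (h₁ : s = T₁ ρ + T r₁ + Complex.I • (T₁ (A ρ) + T (x₁ ρ) + T (A r₁)))
    (h₂ : Complex.I • s = T₂ ρ + T r₂ + Complex.I • (T₂ (A ρ) + T (x₂ ρ) + T (A r₂))) :
    x₂ ρ = A (x₁ ρ + (Γ₁ (A ρ) - A (Γ₁ ρ))) - (Γ₂ (A ρ) - A (Γ₂ ρ)) := by
  have e1 := hΓ ρ
  have e2 := hΓ (A ρ)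
  have h : T (Γ₂ ρ + Γ₁ (A ρ) + r₂ + x₁ ρ + A r₁) +
      Complex.I • T (-Γ₁ ρ + Γ₂ (A ρ) + x₂ ρ + A r₂ - r₁) = T 0 + Complex.I • T 0 := by
    rw [h₁] at h₂
    have e1' : T₂ ρ = T (Γ₂ ρ) - Complex.I • T (Γ₁ ρ) + Complex.I • T₁ ρ := by rw [← e1]; abel
    have e2' : T₂ (A ρ) = T (Γ₂ (A ρ)) - Complex.I • T (Γ₁ (A ρ)) + Complex.I • T₁ (A ρ) := by
      rw [← e2]; abel
    rw [e1', e2'] at h₂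
    simp only [smul_add, smul_sub, smul_smul, Complex.I_mul_I, neg_one_smul] at h₂
    simp only [map_add, map_sub, map_neg, map_zero, smul_add, smul_sub, smul_neg, smul_zero, add_zero]
    rw [← sub_eq_zero] at h₂
    rw [← neg_eq_zero, ← h₂]
    module
  have h3 := rePart_apply hT (Γ₂ ρ + Γ₁ (A ρ) + r₂ + x₁ ρ + A r₁)
    (-Γ₁ ρ + Γ₂ (A ρ) + x₂ ρ + A r₂ - r₁)
  have h4 := imPart_apply hT (Γ₂ ρ + Γ₁ (A ρ) + r₂ + x₁ ρ + A r₁)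
    (-Γ₁ ρ + Γ₂ (A ρ) + x₂ ρ + A r₂ - r₁)
  rw [h, rePart_apply hT] at h3
  rw [h, imPart_apply hT] at h4
  have h5 := congrArg A h3
  simp only [map_add, map_zero, hA] at h5
  have h6 : x₂ ρ = Γ₁ ρ - Γ₂ (A ρ) - A r₂ + r₁ := by
    rw [← sub_eq_zero, h4]; abel
  have h7 : A r₂ = -(A (Γ₂ ρ) + A (Γ₁ (A ρ)) + A (x₁ ρ) + -r₁) := by
    rw [eq_neg_iff_add_eq_zero, h5]; abel
  rw [h6, h7, map_add, map_sub, hA]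
  abel

variable [FiniteDimensional ℂ C]

theorem contDiffOn_rePart {T : E → F →L[ℝ] C} {U : Set E} (hT : ContDiffOn ℝ ∞ T U)
    (hI : ∀ z ∈ U, (cplxExt (T z)).IsInvertible) :
    ContDiffOn ℝ ∞ (fun z => rePart (T z)) U := by
  have : FiniteDimensional ℝ F := FiniteDimensional.complexToReal F
  have : CompleteSpace F := FiniteDimensional.complete ℝ F
  have h1 : ContDiffOn ℝ ∞ (fun z => cplxExt (T z)) U := by
    have : ∀ z, cplxExt (T z) = T z ∘L ContinuousLinearMap.fst ℝ F F +
        (Complex.I • T z) ∘L ContinuousLinearMap.snd ℝ F F := fun z => by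
      ext <;> simp [cplxExt]
    simp only [this]
    exact (hT.clm_comp contDiffOn_const).add ((hT.const_smul Complex.I).clm_comp contDiffOn_const)
  exact contDiffOn_const.clm_comp fun z hz =>
    ContDiffAt.comp_contDiffWithinAt (g := ContinuousLinearMap.inverse) z
      (hI z hz).contDiffAt_map_inverse (h1 z hz)

namespace IsotropicChart

variable {κ : IsotropicChart F q N} {T : E → F →L[ℝ] C} {U : Set E}

theorem contDiffOn_frame (hT : ContDiffOn ℝ ∞ T U) (hI : ∀ z ∈ U, (cplxExt (T z)).IsInvertible) :
    ContDiffOn ℝ ∞ (fun p : E × (Fin N → ℂ) => κ.frame (T p.1) p.2) (U ×ˢ Set.univ) := by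
  have h1 : ContDiffOn ℝ ∞ (fun p : E × (Fin N → ℂ) => rePart (T p.1)) (U ×ˢ Set.univ) :=
    (contDiffOn_rePart hT hI).comp contDiff_fst.contDiffOn fun p hp => hp.1
  have h2 : ContDiff ℝ ∞ (fun p : E × (Fin N → ℂ) => κ.S p.2) := κ.S.contDiff.comp contDiff_snd
  exact h1.clm_comp ((contDiffOn_const.add h2.contDiffOn).clm_comp contDiffOn_const)

variable {G : E → F → F → ℝ} (hTq : ∀ z ∈ U, IsIsometricFrame q (G z) (T z))
  (hG : ∀ z ∈ U, ∀ a, a ≠ 0 → 0 < G z a a) (hI : ∀ z ∈ U, (cplxExt (T z)).IsInvertible)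

include hTq hG hI

theorem contDiffOn_struct (hT : ContDiffOn ℝ ∞ T U) :
    ContDiffOn ℝ ∞ (fun p : E × (Fin N → ℂ) => κ.struct (T p.1) p.2) (U ×ˢ Set.univ) := by
  have : FiniteDimensional ℝ F := FiniteDimensional.complexToReal F
  have : CompleteSpace F := FiniteDimensional.complete ℝ F
  have h1 := contDiffOn_frame (κ := κ) hT hI
  refine h1.clm_comp (contDiffOn_const.clm_comp fun p hp => ?_)
  exact ((frame_isInvertible (κ := κ) (hTq _ hp.1) (hG _ hp.1)
    (hI _ hp.1) p.2).contDiffAt_map_inverse).comp_contDiffWithinAt p (h1 p hp)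

variable (hU : IsOpen U) (hT : ContDiffOn ℝ ∞ T U)

include hU hT

/-- The derivative of `graph_eq` at a fixed parameter `w`. Since `τ w` is constant, the left side
involves neither the point of the base nor its variation `v`: the isotropic subspace with fixed
coordinates is constant in `C`. -/
theorem graph_fderiv {z : E} (hz : z ∈ U) (c : Fin N → ℂ) (v : E) (d : Fin N → ℂ) (w : F) :
    κ.S d (κ.τ w) = fderiv ℝ T z v (κ.frame (T z) c w) +
      T z (fderiv ℝ (fun p : E × (Fin N → ℂ) => κ.frame (T p.1) p.2) (z, c) (v, d) w) +
      Complex.I • (fderiv ℝ T z v (κ.struct (T z) c (κ.frame (T z) c w)) +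
        T z (fderiv ℝ (fun p : E × (Fin N → ℂ) => κ.struct (T p.1) p.2) (z, c) (v, d)
          (κ.frame (T z) c w)) +
        T z (κ.struct (T z) c
          (fderiv ℝ (fun p : E × (Fin N → ℂ) => κ.frame (T p.1) p.2) (z, c) (v, d) w))) := by
  have hO : U ×ˢ (Set.univ : Set (Fin N → ℂ)) ∈ 𝓝 (z, c) :=
    (hU.prod isOpen_univ).mem_nhds ⟨hz, trivial⟩
  have dT : HasFDerivAt (fun p : E × (Fin N → ℂ) => T p.1)
      (fderiv ℝ T z ∘L ContinuousLinearMap.fst ℝ E (Fin N → ℂ)) (z, c) :=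
    HasFDerivAt.comp (z, c) (f := Prod.fst)
      (((hT.contDiffAt (hU.mem_nhds hz)).differentiableAt (by simp)).hasFDerivAt) hasFDerivAt_fst
  have dR := (((contDiffOn_frame (κ := κ) hT hI).contDiffAt hO).differentiableAt
    (by simp)).hasFDerivAt
  have dA := (((contDiffOn_struct (κ := κ) hTq hG hI hT).contDiffAt hO).differentiableAt
    (by simp)).hasFDerivAt
  have dw := hasFDerivAt_const (𝕜 := ℝ) w (z, c)
  have dRw := dR.clm_apply dw
  have h1 := (dT.clm_apply dRw).add ((dT.clm_apply (dA.clm_apply dRw)).const_smul Complex.I)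
  have dS : HasFDerivAt (fun p : E × (Fin N → ℂ) => κ.S p.2)
      (κ.S ∘L ContinuousLinearMap.snd ℝ E (Fin N → ℂ)) (z, c) :=
    HasFDerivAt.comp (z, c) (f := Prod.snd) κ.S.hasFDerivAt hasFDerivAt_snd
  have h2 := (hasFDerivAt_const (𝕜 := ℝ) (κ.τ w) (z, c)).add
    (dS.clm_apply (hasFDerivAt_const (𝕜 := ℝ) (κ.τ w) (z, c)))
  have h3 := h2.congr_of_eventuallyEq (f₁ := fun p : E × (Fin N → ℂ) =>
      T p.1 (κ.frame (T p.1) p.2 w) +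
        Complex.I • T p.1 (κ.struct (T p.1) p.2 (κ.frame (T p.1) p.2 w))) (by
    filter_upwards [hO] with p hp
    exact (graph_eq (κ := κ) (hTq _ hp.1) (hG _ hp.1) (hI _ hp.1) p.2 w).symm)
  have h4 := DFunLike.congr_fun (h3.unique h1) (v, d)
  simp at h4
  rw [h4]
  simp only [smul_add]
  abel

/-- The hypothesis `hΓ` says that the (0,1) part of `dT` is `T` composed with that of `Γ`. The left
side of `graph_fderiv` is complex linear in the variation of the coordinates, so its instances for
`ξ` and `iξ` differ by the factor `i`, and `cplxStructure_image_aux` solves for the derivative of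
the structure. The outcome is the coordinate form of `𝒥`. -/
theorem struct_fderiv_I {z : E} (hz : z ∈ U) (c : Fin N → ℂ) {Γ : E → F →L[ℝ] F}
    (hΓ : ∀ v u, fderiv ℝ T z (Complex.I • v) u - Complex.I • fderiv ℝ T z v u =
      T z (Γ (Complex.I • v) u) - Complex.I • T z (Γ v u)) (ξ : E × (Fin N → ℂ)) :
    fderiv ℝ (fun p : E × (Fin N → ℂ) => κ.struct (T p.1) p.2) (z, c) (Complex.I • ξ) =
      κ.struct (T z) c ∘L
        (fderiv ℝ (fun p : E × (Fin N → ℂ) => κ.struct (T p.1) p.2) (z, c) ξ +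
          (Γ ξ.1 ∘L κ.struct (T z) c - κ.struct (T z) c ∘L Γ ξ.1)) -
        (Γ (Complex.I • ξ.1) ∘L κ.struct (T z) c - κ.struct (T z) c ∘L Γ (Complex.I • ξ.1)) := by
  ext a
  obtain ⟨w, rfl⟩ := frame_surjective (κ := κ) (hTq z hz) (hG z hz) (hI z hz) c a
  have h1 := graph_fderiv (κ := κ) hTq hG hI hU hT hz c ξ.1 ξ.2 w
  have h2 := graph_fderiv (κ := κ) hTq hG hI hU hT hz c (Complex.I • ξ.1) (Complex.I • ξ.2) w
  rw [κ.S_I_smul] at h2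
  exact cplxStructure_image_aux (hI z hz) (struct_struct (hTq z hz) (hG z hz) (hI z hz) c)
    (hΓ ξ.1) h1 h2

/-- If the structure does not move to first order along `d`, then `S d (τ w)` lies in the isotropic
subspace itself. It also lies in `ker P`, which meets that subspace only in zero. -/
theorem struct_fderiv_inj {z : E} (hz : z ∈ U) (c d : Fin N → ℂ)
    (h : fderiv ℝ (fun p : E × (Fin N → ℂ) => κ.struct (T p.1) p.2) (z, c) (0, d) = 0) : d = 0 := by
  apply κ.S_inj
  have key : ∀ w, κ.S d (κ.τ w) = 0 := fun w => by
    have h1 := graph_fderiv (κ := κ) hTq hG hI hU hT hz c 0 d w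
    obtain ⟨u, hu⟩ := frame_surjective (κ := κ) (hTq z hz) (hG z hz) (hI z hz) c
      (fderiv ℝ (fun p : E × (Fin N → ℂ) => κ.frame (T p.1) p.2) (z, c) (0, d) w)
    rw [h, ← hu] at h1
    simp only [map_zero, zero_apply, zero_add, add_zero] at h1
    rw [← graph_eq (κ := κ) (hTq z hz) (hG z hz) (hI z hz)] at h1
    have h2 := congrArg κ.P h1
    rw [κ.P_S, map_add, κ.P_S, κ.P_τ, add_zero] at h2
    rw [h1, ← h2]; simp
  rw [map_zero]
  ext z'
  have h4 : κ.S d z' = κ.S d (κ.τ (κ.P z')) := by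
    rw [← sub_eq_zero, ← map_sub]
    exact κ.S_ker d _ (by rw [map_sub, κ.P_τ, sub_self])
  rw [h4, key]; rfl

omit hTq hG hI hU hT

variable (κ) in
theorem exists_leftInverse_S : ∃ s : (C →L[ℝ] C) →L[ℝ] (Fin N → ℂ), ∀ c, s (κ.S c) = c := by
  have : FiniteDimensional ℝ C := FiniteDimensional.complexToReal C
  obtain ⟨g, hg⟩ := κ.S.toLinearMap.exists_leftInverse_of_injective
    (LinearMap.ker_eq_bot.2 κ.S_inj)
  exact ⟨LinearMap.toContinuousLinearMap g, fun c => DFunLike.congr_fun hg c⟩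

theorem isOpen_isInvertible : IsOpen {p : F →L[ℝ] F | p.IsInvertible} := by
  have : FiniteDimensional ℝ F := FiniteDimensional.complexToReal F
  have : CompleteSpace F := FiniteDimensional.complete ℝ F
  exact ContinuousLinearEquiv.isOpen

omit [FiniteDimensional ℂ F] [FiniteDimensional ℂ C] in
theorem continuous_proj : Continuous fun p : (F →L[ℝ] C) × (F →L[ℝ] F) => κ.proj p.1 p.2 := by
  unfold proj
  fun_prop

theorem continuousAt_skew {p : (F →L[ℝ] C) × (F →L[ℝ] F)} (hp : (κ.proj p.1 p.2).IsInvertible) :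
    ContinuousAt (fun p : (F →L[ℝ] C) × (F →L[ℝ] F) => κ.skew p.1 p.2) p := by
  have : FiniteDimensional ℝ F := FiniteDimensional.complexToReal F
  have : CompleteSpace F := FiniteDimensional.complete ℝ F
  have h1 : ContinuousAt (fun p : (F →L[ℝ] C) × (F →L[ℝ] F) => (κ.proj p.1 p.2).inverse) p :=
    ContinuousAt.comp (g := ContinuousLinearMap.inverse)
      (f := fun p : (F →L[ℝ] C) × (F →L[ℝ] F) => κ.proj p.1 p.2)
      (hp.contDiffAt_map_inverse (n := 0)).continuousAt continuous_proj.continuousAt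
  have h2 : Continuous fun p : (F →L[ℝ] C) × (F →L[ℝ] F) => p.1 + Complex.I • (p.1 ∘L p.2) := by
    fun_prop
  exact ((h2.continuousAt.clm_comp h1).sub continuousAt_const).clm_comp continuousAt_const

end IsotropicChart

end IsotropicChartAnalysis

/-! ### Coordinates on the base and on total spaces of bundles -/

noncomputable section LocalCoordinates

set_option linter.unusedSectionVars false

section Functions
variable {EM : Type*} [NormedAddCommGroup EM] [NormedSpace ℝ EM]
  {M : Type*} [TopologicalSpace M] [ChartedSpace EM M] [IsManifold 𝓘(ℝ, EM) ∞ M]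
  {F' : Type*} [NormedAddCommGroup F'] [NormedSpace ℝ F']

theorem mdifferentiableAt_extChartAt_real {x₀ y : M} (hy : y ∈ (chartAt EM x₀).source) :
    MDifferentiableAt 𝓘(ℝ, EM) 𝓘(ℝ, EM) (extChartAt 𝓘(ℝ, EM) x₀) y :=
  (contMDiffAt_extChartAt' (n := ∞) hy).mdifferentiableAt (by simp)

/-- The derivative of the preferred chart at `x₀`, with values in the model space. -/
def chartDeriv (x₀ y : M) : TangentSpace 𝓘(ℝ, EM) y →L[ℝ] EM :=
  mfderiv 𝓘(ℝ, EM) 𝓘(ℝ, EM) (extChartAt 𝓘(ℝ, EM) x₀) y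

theorem chartDeriv_isInvertible {x₀ y : M} (hy : y ∈ (chartAt EM x₀).source) :
    (chartDeriv (EM := EM) x₀ y).IsInvertible := by
  have : IsManifold 𝓘(ℝ, EM) 1 M := IsManifold.of_le (n := ∞) (by simp)
  exact isInvertible_mfderiv_extChartAt (by rwa [extChartAt_source])

theorem mdifferentiableAt_extChartAt_symm_real {x₀ y : M} (hy : y ∈ (chartAt EM x₀).source) :
    MDifferentiableAt 𝓘(ℝ, EM) 𝓘(ℝ, EM) (extChartAt 𝓘(ℝ, EM) x₀).symm
      (extChartAt 𝓘(ℝ, EM) x₀ y) := by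
  refine ((contMDiffOn_extChartAt_symm (n := ∞) x₀).contMDiffAt ?_).mdifferentiableAt (by simp)
  exact extChartAt_target_mem_nhds' ((extChartAt _ _).map_source (by rwa [extChartAt_source]))

theorem eventually_extChartAt_symm {x₀ y : M} (hy : y ∈ (chartAt EM x₀).source) {p : M → Prop}
    (hp : ∀ᶠ y' in 𝓝 y, p y') :
    ∀ᶠ z in 𝓝 (extChartAt 𝓘(ℝ, EM) x₀ y), p ((extChartAt 𝓘(ℝ, EM) x₀).symm z) := by
  have h := (mdifferentiableAt_extChartAt_symm_real hy).continuousAt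
  refine h.eventually ?_
  rwa [(extChartAt 𝓘(ℝ, EM) x₀).left_inv (by rwa [extChartAt_source])]

theorem mdifferentiableAt_iff_comp_extChartAt_symm {x₀ y : M} (hy : y ∈ (chartAt EM x₀).source)
    (f : M → F') : MDifferentiableAt 𝓘(ℝ, EM) 𝓘(ℝ, F') f y ↔
      DifferentiableAt ℝ (fun z => f ((extChartAt 𝓘(ℝ, EM) x₀).symm z))
        (extChartAt 𝓘(ℝ, EM) x₀ y) := by
  have hy' : y ∈ (extChartAt 𝓘(ℝ, EM) x₀).source := by rwa [extChartAt_source]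
  rw [← mdifferentiableAt_iff_differentiableAt]
  constructor
  · intro h
    refine MDifferentiableAt.comp (g := f) _ ?_ (mdifferentiableAt_extChartAt_symm_real hy)
    rwa [(extChartAt 𝓘(ℝ, EM) x₀).left_inv hy']
  · intro h
    refine (MDifferentiableAt.comp y h (mdifferentiableAt_extChartAt_real hy)).congr_of_eventuallyEq ?_
    filter_upwards [extChartAt_source_mem_nhds' (I := 𝓘(ℝ, EM)) hy'] with y' hy'
    rw [Function.comp_apply, (extChartAt 𝓘(ℝ, EM) x₀).left_inv hy']

theorem mfderiv_eq_fderiv_comp_extChartAt_symm {x₀ y : M} (hy : y ∈ (chartAt EM x₀).source)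
    {f : M → F'} (hf : MDifferentiableAt 𝓘(ℝ, EM) 𝓘(ℝ, F') f y) (v : TangentSpace 𝓘(ℝ, EM) y) :
    mfderiv 𝓘(ℝ, EM) 𝓘(ℝ, F') f y v =
      fderiv ℝ (fun z => f ((extChartAt 𝓘(ℝ, EM) x₀).symm z)) (extChartAt 𝓘(ℝ, EM) x₀ y)
        (chartDeriv x₀ y v) := by
  have hy' : y ∈ (extChartAt 𝓘(ℝ, EM) x₀).source := by rwa [extChartAt_source]
  have h1 := ((mdifferentiableAt_iff_comp_extChartAt_symm hy f).1 hf)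
  rw [← mdifferentiableAt_iff_differentiableAt] at h1
  have h2 := mfderiv_comp y h1 (mdifferentiableAt_extChartAt_real hy)
  have h3 : f =ᶠ[𝓝 y] (fun z => f ((extChartAt 𝓘(ℝ, EM) x₀).symm z)) ∘ extChartAt 𝓘(ℝ, EM) x₀ := by
    filter_upwards [extChartAt_source_mem_nhds' (I := 𝓘(ℝ, EM)) hy'] with y' hy'
    rw [Function.comp_apply, (extChartAt 𝓘(ℝ, EM) x₀).left_inv hy']
  rw [h3.mfderiv_eq, h2, mfderiv_eq_fderiv]
  rfl

end Functions

section Sections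
variable {EM : Type*} [NormedAddCommGroup EM] [NormedSpace ℝ EM]
  {M : Type*} [TopologicalSpace M] [ChartedSpace EM M] [IsManifold 𝓘(ℝ, EM) ∞ M]
  {F' : Type*} [NormedAddCommGroup F'] [NormedSpace ℝ F']
  {W : M → Type*} [TopologicalSpace (TotalSpace F' W)]
  [∀ x, AddCommGroup (W x)] [∀ x, Module ℝ (W x)] [∀ x, TopologicalSpace (W x)]
  [FiberBundle F' W] [VectorBundle ℝ F' W] [ContMDiffVectorBundle ∞ F' W 𝓘(ℝ, EM)]

variable (EM F' W) in
/-- The domain of the coordinates on the base and the fibres defined by the preferred chart and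
trivialization at `x₀`. -/
def coordDomain (x₀ : M) : Set M :=
  (chartAt EM x₀).source ∩ (trivializationAt F' W x₀).baseSet

omit [IsManifold 𝓘(ℝ, EM) ∞ M] [∀ x, AddCommGroup (W x)] [∀ x, Module ℝ (W x)]
  [VectorBundle ℝ F' W] [ContMDiffVectorBundle ∞ F' W 𝓘(ℝ, EM)] [NormedSpace ℝ EM]
  [NormedSpace ℝ F'] in
theorem isOpen_coordDomain (x₀ : M) : IsOpen (coordDomain EM F' W x₀) :=
  (chartAt EM x₀).open_source.inter (trivializationAt F' W x₀).open_baseSet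

omit [IsManifold 𝓘(ℝ, EM) ∞ M] [∀ x, AddCommGroup (W x)] [∀ x, Module ℝ (W x)]
  [VectorBundle ℝ F' W] [ContMDiffVectorBundle ∞ F' W 𝓘(ℝ, EM)] [NormedSpace ℝ EM]
  [NormedSpace ℝ F'] in
theorem mem_coordDomain (x₀ : M) : x₀ ∈ coordDomain EM F' W x₀ :=
  ⟨mem_chart_source _ _, FiberBundle.mem_baseSet_trivializationAt' _⟩

variable (EM F') in
/-- The coordinate expression of a section. -/
def localRep (x₀ : M) (s : Π y, W y) (z : EM) : F' :=
  (trivializationAt F' W x₀ (⟨(extChartAt 𝓘(ℝ, EM) x₀).symm z,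
    s ((extChartAt 𝓘(ℝ, EM) x₀).symm z)⟩ : TotalSpace F' W)).2

theorem mdifferentiableAt_section_iff_localRep {x₀ y : M} (hy : y ∈ coordDomain EM F' W x₀)
    (s : Π y, W y) :
    MDifferentiableAt 𝓘(ℝ, EM) (𝓘(ℝ, EM).prod 𝓘(ℝ, F')) (fun y => TotalSpace.mk' F' y (s y)) y ↔
      DifferentiableAt ℝ (localRep EM F' x₀ s) (extChartAt 𝓘(ℝ, EM) x₀ y) := by
  have : ContMDiffVectorBundle 1 F' W 𝓘(ℝ, EM) := ContMDiffVectorBundle.of_le (n := ∞) (by simp)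
  have : IsManifold 𝓘(ℝ, EM) 1 M := IsManifold.of_le (n := ∞) (by simp)
  rw [Trivialization.mdifferentiableAt_section_iff 𝓘(ℝ, EM) (trivializationAt F' W x₀) s hy.2,
    mdifferentiableAt_iff_comp_extChartAt_symm hy.1]
  rfl

variable (EM F' W) in
/-- The coordinates on the total space near the fibre over `x₀`. -/
def totalCoord (x₀ : M) (p : TotalSpace F' W) : EM × F' :=
  (extChartAt 𝓘(ℝ, EM) x₀ p.1, (trivializationAt F' W x₀ p).2)

-- A chart of the total space depends only on the base point of its centre, so the zero vector over
-- `x₀` serves as centre for the whole domain.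
omit [IsManifold 𝓘(ℝ, EM) ∞ M] [VectorBundle ℝ F' W] [ContMDiffVectorBundle ∞ F' W 𝓘(ℝ, EM)] in
theorem totalCoord_eq (x₀ : M) {p : TotalSpace F' W} (hp : p.1 ∈ coordDomain EM F' W x₀) :
    totalCoord EM F' W x₀ p =
      extChartAt (𝓘(ℝ, EM).prod 𝓘(ℝ, F')) (⟨x₀, 0⟩ : TotalSpace F' W) p := by
  rw [FiberBundle.extChartAt]
  simp only [PartialEquiv.coe_trans, Function.comp_apply, PartialEquiv.prod_coe,
    PartialEquiv.refl_coe, id, totalCoord]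
  congr 2
  exact ((trivializationAt F' W x₀).coe_fst' hp.2).symm

omit [IsManifold 𝓘(ℝ, EM) ∞ M] [VectorBundle ℝ F' W] [ContMDiffVectorBundle ∞ F' W 𝓘(ℝ, EM)] in
theorem mem_source_totalCoord (x₀ : M) {p : TotalSpace F' W} (hp : p.1 ∈ coordDomain EM F' W x₀) :
    p ∈ (extChartAt (𝓘(ℝ, EM).prod 𝓘(ℝ, F')) (⟨x₀, 0⟩ : TotalSpace F' W)).source := by
  rw [FiberBundle.extChartAt]
  simp only [PartialEquiv.trans_source, PartialEquiv.prod_source, PartialEquiv.refl_source,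
    extChartAt_source, Set.mem_inter_iff, Set.mem_preimage, Set.mem_prod, Set.mem_univ, and_true]
  refine ⟨(Trivialization.mem_source _).2 hp.2, ?_⟩
  have := (trivializationAt F' W x₀).coe_fst' hp.2
  change ((trivializationAt F' W x₀) p).1 ∈ _
  rw [this]; exact hp.1

theorem mdifferentiableAt_totalCoord (x₀ : M) {p : TotalSpace F' W}
    (hp : p.1 ∈ coordDomain EM F' W x₀) :
    MDifferentiableAt (𝓘(ℝ, EM).prod 𝓘(ℝ, F')) 𝓘(ℝ, EM × F') (totalCoord EM F' W x₀) p ∧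
      Function.Bijective (mfderiv (𝓘(ℝ, EM).prod 𝓘(ℝ, F')) 𝓘(ℝ, EM × F')
        (totalCoord EM F' W x₀) p) := by
  have : ContMDiffVectorBundle 1 F' W 𝓘(ℝ, EM) := ContMDiffVectorBundle.of_le (n := ∞) (by simp)
  have : IsManifold 𝓘(ℝ, EM) 1 M := IsManifold.of_le (n := ∞) (by simp)
  have hs := mem_source_totalCoord x₀ hp
  have h1 : MDifferentiableAt (𝓘(ℝ, EM).prod 𝓘(ℝ, F')) 𝓘(ℝ, EM × F')
      (extChartAt (𝓘(ℝ, EM).prod 𝓘(ℝ, F')) (⟨x₀, 0⟩ : TotalSpace F' W)) p :=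
    (contMDiffAt_extChartAt' (n := 1) (by rwa [extChartAt_source] at hs)).mdifferentiableAt (by simp)
  have h2 : totalCoord EM F' W x₀ =ᶠ[𝓝 p]
      extChartAt (𝓘(ℝ, EM).prod 𝓘(ℝ, F')) (⟨x₀, 0⟩ : TotalSpace F' W) := by
    have hc : Continuous (TotalSpace.proj : TotalSpace F' W → M) := FiberBundle.continuous_proj F' W
    filter_upwards [((isOpen_coordDomain (EM := EM) (F' := F') (W := W) x₀).preimage hc).mem_nhds hp]
      with p' hp'
    exact totalCoord_eq x₀ hp'
  refine ⟨h1.congr_of_eventuallyEq h2, ?_⟩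
  rw [h2.mfderiv_eq]
  obtain ⟨L, hL⟩ := isInvertible_mfderiv_extChartAt (I := 𝓘(ℝ, EM).prod 𝓘(ℝ, F')) hs
  rw [← hL]
  exact L.bijective

/-- This converts velocities of sections, which define horizontal lifts, to ordinary derivatives of
components. -/
theorem totalCoord_mfderiv_section {x₀ y : M} (hy : y ∈ coordDomain EM F' W x₀) (s : Π y, W y)
    (hs : MDifferentiableAt 𝓘(ℝ, EM) (𝓘(ℝ, EM).prod 𝓘(ℝ, F'))
      (fun y => TotalSpace.mk' F' y (s y)) y) (v : TangentSpace 𝓘(ℝ, EM) y) :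
    mfderiv (𝓘(ℝ, EM).prod 𝓘(ℝ, F')) 𝓘(ℝ, EM × F') (totalCoord EM F' W x₀)
      (TotalSpace.mk' F' y (s y))
      (mfderiv 𝓘(ℝ, EM) (𝓘(ℝ, EM).prod 𝓘(ℝ, F')) (fun y => TotalSpace.mk' F' y (s y)) y v) =
    ((chartDeriv x₀ y v,
      fderiv ℝ (localRep EM F' x₀ s) (extChartAt 𝓘(ℝ, EM) x₀ y)
        (chartDeriv x₀ y v)) : EM × F') := by
  have h1 := mfderiv_comp y (g := totalCoord EM F' W x₀)
    (f := fun y => TotalSpace.mk' F' y (s y))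
    (mdifferentiableAt_totalCoord x₀ (p := TotalSpace.mk' F' y (s y)) hy).1 hs
  have h2 := DFunLike.congr_fun h1 v
  refine h2.symm.trans ?_
  have h3 := (mdifferentiableAt_section_iff_localRep hy s).1 hs
  have h4 := (mdifferentiableAt_iff_comp_extChartAt_symm (F' := F') hy.1
    (fun y => (trivializationAt F' W x₀ (⟨y, s y⟩ : TotalSpace F' W)).2)).2 h3
  have h0 := (mdifferentiableAt_extChartAt_real (EM := EM) hy.1).hasMFDerivAt
  have h5 : HasMFDerivAt 𝓘(ℝ, EM) 𝓘(ℝ, EM × F')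
      (totalCoord EM F' W x₀ ∘ fun y => TotalSpace.mk' F' y (s y)) y
      (ContinuousLinearMap.prod _ _) :=
    ⟨h0.1.prodMk h4.hasMFDerivAt.1, h0.2.prodMk h4.hasMFDerivAt.2⟩
  refine (DFunLike.congr_fun h5.mfderiv v).trans ?_
  refine Prod.ext rfl ?_
  exact mfderiv_eq_fderiv_comp_extChartAt_symm hy.1 h4 v

end Sections

end LocalCoordinates

/-! ### Connection forms, and horizontal and vertical vectors in coordinates -/

noncomputable section ConnectionForms

set_option linter.unusedSectionVars false

section Flat
variable {EM : Type*} [NormedAddCommGroup EM] [NormedSpace ℝ EM]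
  {M : Type*} [TopologicalSpace M] [ChartedSpace EM M] [IsManifold 𝓘(ℝ, EM) ∞ M]
  {F' : Type*} [NormedAddCommGroup F'] [NormedSpace ℝ F']
  {W : M → Type*} [TopologicalSpace (TotalSpace F' W)]
  [∀ x, AddCommGroup (W x)] [∀ x, Module ℝ (W x)] [∀ x, TopologicalSpace (W x)]
  [∀ x, IsTopologicalAddGroup (W x)] [∀ x, ContinuousSMul ℝ (W x)]
  [FiberBundle F' W] [VectorBundle ℝ F' W] [ContMDiffVectorBundle ∞ F' W 𝓘(ℝ, EM)]

theorem eventually_mem_coordDomain {x₀ y : M} (hy : y ∈ coordDomain EM F' W x₀) :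
    ∀ᶠ z in 𝓝 (extChartAt 𝓘(ℝ, EM) x₀ y),
      (extChartAt 𝓘(ℝ, EM) x₀).symm z ∈ coordDomain EM F' W x₀ :=
  eventually_extChartAt_symm hy.1 ((isOpen_coordDomain x₀).mem_nhds hy)

theorem trivialization_add {x₀ y : M} (hy : y ∈ coordDomain EM F' W x₀) (a b : W y) :
    (trivializationAt F' W x₀ (⟨y, a + b⟩ : TotalSpace F' W)).2 =
      (trivializationAt F' W x₀ (⟨y, a⟩ : TotalSpace F' W)).2 +
      (trivializationAt F' W x₀ (⟨y, b⟩ : TotalSpace F' W)).2 :=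
  ((trivializationAt F' W x₀).linear ℝ hy.2).map_add a b

theorem trivialization_smul {x₀ y : M} (hy : y ∈ coordDomain EM F' W x₀) (c : ℝ) (a : W y) :
    (trivializationAt F' W x₀ (⟨y, c • a⟩ : TotalSpace F' W)).2 =
      c • (trivializationAt F' W x₀ (⟨y, a⟩ : TotalSpace F' W)).2 :=
  ((trivializationAt F' W x₀).linear ℝ hy.2).map_smul c a

theorem localRep_add {x₀ y : M} (hy : y ∈ coordDomain EM F' W x₀) (σ τ : Π y, W y) :
    localRep EM F' x₀ (σ + τ) =ᶠ[𝓝 (extChartAt 𝓘(ℝ, EM) x₀ y)]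
      localRep EM F' x₀ σ + localRep EM F' x₀ τ := by
  filter_upwards [eventually_mem_coordDomain hy] with z hz
  exact trivialization_add hz _ _

theorem localRep_smul {x₀ y : M} (hy : y ∈ coordDomain EM F' W x₀) (g : M → ℝ) (σ : Π y, W y) :
    localRep EM F' x₀ (g • σ) =ᶠ[𝓝 (extChartAt 𝓘(ℝ, EM) x₀ y)]
      (fun z => g ((extChartAt 𝓘(ℝ, EM) x₀).symm z)) • localRep EM F' x₀ σ := by
  filter_upwards [eventually_mem_coordDomain hy] with z hz
  exact trivialization_smul hz _ _

theorem localRep_apply {x₀ y : M} (hy : y ∈ coordDomain EM F' W x₀) (σ : Π y, W y) :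
    localRep EM F' x₀ σ (extChartAt 𝓘(ℝ, EM) x₀ y) =
      (trivializationAt F' W x₀ (⟨y, σ y⟩ : TotalSpace F' W)).2 := by
  rw [localRep, (extChartAt 𝓘(ℝ, EM) x₀).left_inv (by rw [extChartAt_source]; exact hy.1)]

theorem localRep_symm {x₀ y : M} (hy : y ∈ coordDomain EM F' W x₀) (f : EM → F') :
    localRep EM F' x₀ (fun y' => (trivializationAt F' W x₀).symm y'
      (f (extChartAt 𝓘(ℝ, EM) x₀ y'))) =ᶠ[𝓝 (extChartAt 𝓘(ℝ, EM) x₀ y)] f := by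
  have hy' : y ∈ (extChartAt 𝓘(ℝ, EM) x₀).source := by rw [extChartAt_source]; exact hy.1
  filter_upwards [eventually_mem_coordDomain hy,
    extChartAt_target_mem_nhds' ((extChartAt 𝓘(ℝ, EM) x₀).map_source hy')] with z hz hz'
  rw [localRep, Trivialization.apply_mk_symm _ hz.2, (extChartAt 𝓘(ℝ, EM) x₀).right_inv hz']

variable (EM F' W) in
/-- The trivial connection on the part of the bundle over the domain of the trivialization
at `x₀`. -/
def flatConnection (x₀ : M) (σ : Π y, W y) (y : M) : TangentSpace 𝓘(ℝ, EM) y →L[ℝ] W y :=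
  (trivializationAt F' W x₀).symmL ℝ y ∘L (fderiv ℝ (localRep EM F' x₀ σ)
    (extChartAt 𝓘(ℝ, EM) x₀ y) ∘L chartDeriv x₀ y)

theorem flatConnection_apply (x₀ : M) (σ : Π y, W y) (y : M) (v : TangentSpace 𝓘(ℝ, EM) y) :
    flatConnection EM F' W x₀ σ y v = (trivializationAt F' W x₀).symmL ℝ y
      (fderiv ℝ (localRep EM F' x₀ σ) (extChartAt 𝓘(ℝ, EM) x₀ y)
        (chartDeriv x₀ y v)) := rfl

theorem isCovariantDerivativeOn_flatConnection (x₀ : M) :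
    IsCovariantDerivativeOn F' (flatConnection EM F' W x₀) (coordDomain EM F' W x₀) where
  add {σ σ' y} hσ hσ' hy := by
    have h1 := (mdifferentiableAt_section_iff_localRep hy σ).1 hσ
    have h2 := (mdifferentiableAt_section_iff_localRep hy σ').1 hσ'
    ext v
    rw [add_apply, flatConnection_apply, flatConnection_apply, flatConnection_apply,
      (localRep_add hy σ σ').fderiv_eq, fderiv_add h1 h2, ← map_add]
    rfl
  leibniz {σ g y} hσ hg hy := by
    have h1 := (mdifferentiableAt_section_iff_localRep hy σ).1 hσ
    have h2 := (mdifferentiableAt_iff_comp_extChartAt_symm hy.1 g).1 hg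
    have hy' : y ∈ (extChartAt 𝓘(ℝ, EM) x₀).source := by rw [extChartAt_source]; exact hy.1
    ext v
    have h3 := mfderiv_eq_fderiv_comp_extChartAt_symm hy.1 hg v
    rw [add_apply, smul_apply, flatConnection_apply, flatConnection_apply,
      (localRep_smul hy g σ).fderiv_eq, fderiv_smul h2 h1]
    have h4 : (extChartAt 𝓘(ℝ, EM) x₀).symm (extChartAt 𝓘(ℝ, EM) x₀ y) = y :=
      (extChartAt 𝓘(ℝ, EM) x₀).left_inv hy'
    have h5 : (trivializationAt F' W x₀).symmL ℝ y
        (localRep EM F' x₀ σ (extChartAt 𝓘(ℝ, EM) x₀ y)) = σ y := by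
      rw [localRep_apply hy, Trivialization.symmL_apply _ hy.2]
      exact Trivialization.symm_apply_apply_mk _ hy.2 _
    rw [add_apply, smul_apply, ContinuousLinearMap.smulRight_apply, ContinuousLinearMap.smulRight_apply,
      map_add, map_smul, map_smul, h5, h4, ← h3]
    rfl

/-- The fibre over `y` is identified with the model fibre by the trivialization at `x₀`. -/
theorem trivialization_symmL_apply {x₀ y : M} (hy : y ∈ coordDomain EM F' W x₀) (u : F') :
    (trivializationAt F' W x₀ (⟨y, (trivializationAt F' W x₀).symmL ℝ y u⟩ : TotalSpace F' W)).2 = u := by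
  rw [Trivialization.symmL_apply _ hy.2, Trivialization.apply_mk_symm _ hy.2]

theorem symmL_trivialization_apply {x₀ y : M} (hy : y ∈ coordDomain EM F' W x₀) (a : W y) :
    (trivializationAt F' W x₀).symmL ℝ y (trivializationAt F' W x₀ (⟨y, a⟩ : TotalSpace F' W)).2 = a := by
  rw [Trivialization.symmL_apply _ hy.2]
  exact Trivialization.symm_apply_apply_mk _ hy.2 _

theorem exists_localOneForm [FiniteDimensional ℝ EM] [FiniteDimensional ℝ F'] {x₀ y : M}
    (hy : y ∈ coordDomain EM F' W x₀) (Δ : W y →L[ℝ] TangentSpace 𝓘(ℝ, EM) y →L[ℝ] W y) :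
    ∃ Γ : EM →L[ℝ] F' →L[ℝ] F', ∀ (a : W y) (v : TangentSpace 𝓘(ℝ, EM) y),
      (trivializationAt F' W x₀ (⟨y, Δ a v⟩ : TotalSpace F' W)).2 =
        Γ (chartDeriv x₀ y v) (trivializationAt F' W x₀ (⟨y, a⟩ : TotalSpace F' W)).2 := by
  obtain ⟨L, hL⟩ := chartDeriv_isInvertible (EM := EM) hy.1
  have h3 : ∀ v, L.symm (chartDeriv x₀ y v) = v := fun v => by rw [← hL]; exact L.symm_apply_apply v
  let e : W y →ₗ[ℝ] F' :=
    { toFun := fun a => (trivializationAt F' W x₀ (⟨y, a⟩ : TotalSpace F' W)).2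
      map_add' := trivialization_add hy
      map_smul' := trivialization_smul hy }
  let i := (trivializationAt F' W x₀).symmL ℝ y
  let B : EM →ₗ[ℝ] F' →ₗ[ℝ] F' := LinearMap.mk₂ ℝ (fun w u => e (Δ (i u) (L.symm w)))
    (fun w w' u => by rw [map_add, map_add, map_add])
    (fun c w u => by rw [map_smul, map_smul, map_smul])
    (fun w u u' => by rw [map_add, map_add, add_apply, map_add])
    (fun c w u => by rw [map_smul, map_smul, smul_apply, map_smul])
  refine ⟨LinearMap.toContinuousLinearMap
    ((LinearMap.toContinuousLinearMap : (F' →ₗ[ℝ] F') ≃ₗ[ℝ] F' →L[ℝ] F').toLinearMap ∘ₗ B),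
    fun a v => ?_⟩
  change _ = e (Δ (i (e a)) (L.symm (chartDeriv x₀ y v)))
  rw [h3, show i (e a) = a from symmL_trivialization_apply hy a]
  rfl

/-- The difference between `cov` and the flat connection of the trivialization is tensorial, so at
`y` it is a linear form with values in the endomorphisms of the model fibre. -/
theorem exists_connectionForm [FiniteDimensional ℝ EM] [FiniteDimensional ℝ F']
    (cov : CovariantDerivative 𝓘(ℝ, EM) F' W) {x₀ y : M} (hy : y ∈ coordDomain EM F' W x₀) :
    ∃ Γ : EM →L[ℝ] F' →L[ℝ] F', ∀ σ : Π y, W y,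
      MDifferentiableAt 𝓘(ℝ, EM) (𝓘(ℝ, EM).prod 𝓘(ℝ, F')) (fun y => TotalSpace.mk' F' y (σ y)) y →
      ∀ v : TangentSpace 𝓘(ℝ, EM) y,
        (trivializationAt F' W x₀ (⟨y, cov σ y v⟩ : TotalSpace F' W)).2 =
          fderiv ℝ (localRep EM F' x₀ σ) (extChartAt 𝓘(ℝ, EM) x₀ y) (chartDeriv x₀ y v) +
          Γ (chartDeriv x₀ y v) (trivializationAt F' W x₀ (⟨y, σ y⟩ : TotalSpace F' W)).2 := by
  have : ContMDiffVectorBundle 1 F' W 𝓘(ℝ, EM) := ContMDiffVectorBundle.of_le (n := ∞) (by simp)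
  have h0 := cov.isCovariantDerivativeOn (s := coordDomain EM F' W x₀)
  have h0' := isCovariantDerivativeOn_flatConnection (EM := EM) (F' := F') (W := W) x₀
  obtain ⟨Γ, hΓ⟩ := exists_localOneForm hy (h0.difference h0' y)
  refine ⟨Γ, fun σ hσ v => ?_⟩
  have h1 := IsCovariantDerivativeOn.difference_apply h0 h0' hy hσ
  have h2 : cov σ y v = flatConnection EM F' W x₀ σ y v + h0.difference h0' y (σ y) v := by
    rw [h1, sub_apply]; abel
  rw [h2, trivialization_add hy, flatConnection_apply, trivialization_symmL_apply hy, hΓ]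

end Flat

section Endomorphisms
variable {EM : Type*} [NormedAddCommGroup EM] [NormedSpace ℂ EM] [FiniteDimensional ℂ EM]
  {M : Type*} [TopologicalSpace M] [ChartedSpace EM M] [IsManifold 𝓘(ℂ, EM) ω M]
  {F : Type*} [NormedAddCommGroup F] [NormedSpace ℂ F] [FiniteDimensional ℂ F]
  {V : M → Type*} [TopologicalSpace (TotalSpace F V)]
  [∀ x, AddCommGroup (V x)] [∀ x, Module ℂ (V x)] [∀ x, TopologicalSpace (V x)]
  [∀ x, IsTopologicalAddGroup (V x)] [∀ x, ContinuousSMul ℂ (V x)]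
  [FiberBundle F V] [VectorBundle ℂ F V] [ContMDiffVectorBundle ω F V 𝓘(ℂ, EM)]

theorem mem_coordDomain_end {x₀ y : M} :
    y ∈ coordDomain EM (F →L[ℝ] F) (fun x => V x →L[ℝ] V x) x₀ ↔ y ∈ coordDomain EM F V x₀ := by
  rw [coordDomain, coordDomain, hom_trivializationAt_baseSet, Set.inter_self]

/-- The matrix of an endomorphism of the fibre at `y`, in the trivialization at `x₀`. -/
def endCoord (x₀ y : M) (A : V y →L[ℝ] V y) : F →L[ℝ] F :=
  (trivializationAt (F →L[ℝ] F) (fun x => V x →L[ℝ] V x) x₀ (⟨y, A⟩ : EndTotal F V)).2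

theorem endCoord_apply {x₀ y : M} (hy : y ∈ coordDomain EM F V x₀) (A : V y →L[ℝ] V y) (a : V y) :
    endCoord x₀ y A (trivializationAt F V x₀ (⟨y, a⟩ : TotalSpace F V)).2 =
      (trivializationAt F V x₀ (⟨y, A a⟩ : TotalSpace F V)).2 := by
  rw [endCoord, hom_trivializationAt_apply, ContinuousLinearMap.inCoordinates]
  simp only [ContinuousLinearMap.comp_apply, symmL_trivialization_apply hy]
  rw [Trivialization.continuousLinearMapAt_apply]
  exact congrFun (Trivialization.coe_linearMapAt_of_mem _ hy.2) _

theorem endCoord_eq {x₀ y : M} (hy : y ∈ coordDomain EM F V x₀) {A : V y →L[ℝ] V y} {X : F →L[ℝ] F}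
    (h : ∀ a, X (trivializationAt F V x₀ (⟨y, a⟩ : TotalSpace F V)).2 =
      (trivializationAt F V x₀ (⟨y, A a⟩ : TotalSpace F V)).2) : endCoord x₀ y A = X := by
  ext u
  rw [← trivialization_symmL_apply (EM := EM) (W := V) hy u, endCoord_apply hy, h]

theorem endCoord_comp {x₀ y : M} (hy : y ∈ coordDomain EM F V x₀) (A B : V y →L[ℝ] V y) :
    endCoord x₀ y (A ∘L B) = endCoord (F := F) x₀ y A ∘L endCoord x₀ y B :=
  endCoord_eq hy fun a => by
    rw [ContinuousLinearMap.comp_apply, endCoord_apply hy, endCoord_apply hy]; rfl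

theorem localRep_clm_apply {x₀ y : M} (hy : y ∈ coordDomain EM F V x₀) (S : Π y, V y →L[ℝ] V y)
    (σ : Π y, V y) : localRep EM F x₀ (fun y => S y (σ y)) =ᶠ[𝓝 (extChartAt 𝓘(ℝ, EM) x₀ y)]
      fun z => localRep EM (F →L[ℝ] F) x₀ S z (localRep EM F x₀ σ z) := by
  filter_upwards [eventually_mem_coordDomain hy] with z hz
  exact (endCoord_apply hz _ _).symm

/-- `Γ` is the connection form of `cov` at `y` in the trivialization at `x₀`. -/
def IsConnectionForm (cov : CovariantDerivative 𝓘(ℝ, EM) F V) (x₀ y : M)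
    (Γ : EM →L[ℝ] F →L[ℝ] F) : Prop :=
  ∀ σ : Π y, V y,
    MDifferentiableAt 𝓘(ℝ, EM) (𝓘(ℝ, EM).prod 𝓘(ℝ, F)) (fun y => TotalSpace.mk' F y (σ y)) y →
    ∀ v : TangentSpace 𝓘(ℝ, EM) y,
      (trivializationAt F V x₀ (⟨y, cov σ y v⟩ : TotalSpace F V)).2 =
        fderiv ℝ (localRep EM F x₀ σ) (extChartAt 𝓘(ℝ, EM) x₀ y) (chartDeriv x₀ y v) +
        Γ (chartDeriv x₀ y v) (trivializationAt F V x₀ (⟨y, σ y⟩ : TotalSpace F V)).2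

theorem exists_isConnectionForm (cov : CovariantDerivative 𝓘(ℝ, EM) F V) {x₀ y : M}
    (hy : y ∈ coordDomain EM F V x₀) : ∃ Γ, IsConnectionForm cov x₀ y Γ := by
  have : FiniteDimensional ℝ EM := FiniteDimensional.complexToReal EM
  have : FiniteDimensional ℝ F := FiniteDimensional.complexToReal F
  exact exists_connectionForm cov hy

/-- The section which is constant in the trivialization at `x₀`. -/
def constSection (F : Type*) [NormedAddCommGroup F] [NormedSpace ℂ F] (V : M → Type*)
    [TopologicalSpace (TotalSpace F V)] [∀ x, AddCommGroup (V x)] [∀ x, Module ℂ (V x)]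
    [∀ x, TopologicalSpace (V x)] [FiberBundle F V] [VectorBundle ℂ F V] (x₀ : M) (u : F) (y : M) :
    V y := (trivializationAt F V x₀).symmₗ ℂ y u

theorem trivialization_constSection {x₀ y : M} (hy : y ∈ coordDomain EM F V x₀) (u : F) :
    (trivializationAt F V x₀ (⟨y, constSection F V x₀ u y⟩ : TotalSpace F V)).2 = u := by
  rw [constSection, Trivialization.symmₗ_apply _ hy.2, Trivialization.apply_mk_symm _ hy.2]

theorem localRep_constSection {x₀ y : M} (hy : y ∈ coordDomain EM F V x₀) (u : F) :
    localRep EM F x₀ (constSection F V x₀ u) =ᶠ[𝓝 (extChartAt 𝓘(ℝ, EM) x₀ y)] fun _ => u := by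
  filter_upwards [eventually_mem_coordDomain hy] with z hz
  exact trivialization_constSection hz u

theorem mdifferentiableAt_constSection {x₀ y : M} (hy : y ∈ coordDomain EM F V x₀) (u : F) :
    MDifferentiableAt 𝓘(ℝ, EM) (𝓘(ℝ, EM).prod 𝓘(ℝ, F))
      (fun y => TotalSpace.mk' F y (constSection F V x₀ u y)) y := by
  rw [mdifferentiableAt_section_iff_localRep hy]
  exact (differentiableAt_const u).congr_of_eventuallyEq (localRep_constSection hy u)

/-- By the Leibniz rule a section `S` of `End E` is parallel in direction `v` when `dS(v) = S Γ(v) -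
Γ(v) S`. One direction tests this on sections constant in the trivialization. The other needs a
section with the required value and derivative at one point. -/
theorem isHorizontalLift_iff {cov : CovariantDerivative 𝓘(ℝ, EM) F V} {A : EndTotal F V} {x₀ : M}
    (hy : A.1 ∈ coordDomain EM F V x₀) {Γ : EM →L[ℝ] F →L[ℝ] F} (hΓ : IsConnectionForm cov x₀ A.1 Γ)
    (v : TangentSpace 𝓘(ℝ, EM) A.1) (X : TangentSpace (endModel EM F) A) :
    IsHorizontalLift cov A v X ↔
      mfderiv (endModel EM F) 𝓘(ℝ, EM × (F →L[ℝ] F))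
        (totalCoord EM (F →L[ℝ] F) (fun x => V x →L[ℝ] V x) x₀) A X =
      ((chartDeriv x₀ A.1 v, endCoord x₀ A.1 A.2 ∘L Γ (chartDeriv x₀ A.1 v) -
        Γ (chartDeriv x₀ A.1 v) ∘L endCoord x₀ A.1 A.2) : EM × (F →L[ℝ] F)) := by
  obtain ⟨y, A⟩ := A
  change y ∈ _ at hy
  have hy' := mem_coordDomain_end.2 hy
  have key : ∀ S : Π y : M, V y →L[ℝ] V y, S y = A →
      MDifferentiableAt 𝓘(ℝ, EM) (endModel EM F) (fun y => (⟨y, S y⟩ : EndTotal F V)) y →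
      ∀ σ : Π y, V y, MDifferentiableAt 𝓘(ℝ, EM) (𝓘(ℝ, EM).prod 𝓘(ℝ, F))
        (fun y => TotalSpace.mk' F y (σ y)) y →
      (trivializationAt F V x₀ (⟨y, cov (fun y => S y (σ y)) y v⟩ : TotalSpace F V)).2 =
        fderiv ℝ (localRep EM (F →L[ℝ] F) x₀ S) (extChartAt 𝓘(ℝ, EM) x₀ y) (chartDeriv x₀ y v)
          (trivializationAt F V x₀ (⟨y, σ y⟩ : TotalSpace F V)).2 +
        endCoord x₀ y A (fderiv ℝ (localRep EM F x₀ σ) (extChartAt 𝓘(ℝ, EM) x₀ y)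
          (chartDeriv x₀ y v)) +
        Γ (chartDeriv x₀ y v) (endCoord x₀ y A
          (trivializationAt F V x₀ (⟨y, σ y⟩ : TotalSpace F V)).2) := by
    intro S hS hSd σ hσ
    have h1 := (mdifferentiableAt_section_iff_localRep hy' S).1 hSd
    have h2 := (mdifferentiableAt_section_iff_localRep hy σ).1 hσ
    have h3 := localRep_clm_apply hy S σ
    have h4 : MDifferentiableAt 𝓘(ℝ, EM) (𝓘(ℝ, EM).prod 𝓘(ℝ, F))
        (fun y => TotalSpace.mk' F y (S y (σ y))) y := by
      rw [mdifferentiableAt_section_iff_localRep hy]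
      exact (h1.clm_apply h2).congr_of_eventuallyEq h3
    have h5 := hΓ _ h4 v
    rw [h3.fderiv_eq, (h1.hasFDerivAt.clm_apply h2.hasFDerivAt).fderiv] at h5
    rw [h5]
    simp only [add_apply, ContinuousLinearMap.comp_apply, ContinuousLinearMap.flip_apply,
      localRep_apply hy, localRep_apply hy', hS]
    rw [endCoord_apply hy]
    change endCoord x₀ y A _ + _ + _ = _
    abel
  constructor
  · rintro ⟨S, hS0, hSd, hpar, rfl⟩
    change S y = A at hS0
    subst hS0
    have h1 := totalCoord_mfderiv_section hy' S hSd v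
    refine h1.trans (Prod.ext rfl ?_)
    ext u
    have h2 := congrArg (fun a => (trivializationAt F V x₀ (⟨y, a⟩ : TotalSpace F V)).2)
      (hpar _ (mdifferentiableAt_constSection hy u))
    simp only at h2
    rw [key S rfl hSd _ (mdifferentiableAt_constSection hy u), ← endCoord_apply hy,
      hΓ _ (mdifferentiableAt_constSection hy u), trivialization_constSection hy,
      (localRep_constSection hy u).fderiv_eq] at h2
    simp only [fderiv_fun_const, Pi.zero_apply, zero_apply, map_zero, add_zero, zero_add] at h2
    exact eq_sub_of_add_eq h2
  · intro hX
    -- The commutator with `Γ` that parallelism prescribes as derivative; `f` is the affine function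
    -- with this derivative and value `A`.
    let Λ : EM →L[ℝ] F →L[ℝ] F :=
      ContinuousLinearMap.compL ℝ F F F (endCoord x₀ y A) ∘L Γ -
        (ContinuousLinearMap.compL ℝ F F F).flip (endCoord x₀ y A) ∘L Γ
    let f : EM → F →L[ℝ] F := fun z => endCoord x₀ y A + Λ (z - extChartAt 𝓘(ℝ, EM) x₀ y)
    let S : Π y : M, V y →L[ℝ] V y := fun y' =>
      (trivializationAt (F →L[ℝ] F) (fun x => V x →L[ℝ] V x) x₀).symm y' (f (extChartAt 𝓘(ℝ, EM) x₀ y'))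
    have hf : HasFDerivAt f Λ (extChartAt 𝓘(ℝ, EM) x₀ y) := by
      have h0 := Λ.hasFDerivAt.comp (extChartAt 𝓘(ℝ, EM) x₀ y)
        (f := fun z => z - extChartAt 𝓘(ℝ, EM) x₀ y) (hasFDerivAt_sub_const _)
      exact h0.const_add _
    have hS := localRep_symm hy' f
    have hSd : MDifferentiableAt 𝓘(ℝ, EM) (endModel EM F) (fun y => (⟨y, S y⟩ : EndTotal F V)) y :=
      (mdifferentiableAt_section_iff_localRep hy' S).2
        (hf.differentiableAt.congr_of_eventuallyEq hS)
    have hSA : S y = A := by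
      have h1 : f (extChartAt 𝓘(ℝ, EM) x₀ y) = endCoord x₀ y A := by simp [f]
      have h2 := symmL_trivialization_apply hy' A
      rw [Trivialization.symmL_apply _ hy'.2] at h2
      simp only [S, h1]
      exact h2
    refine ⟨S, hSA, hSd, fun σ hσ => ?_, ?_⟩
    · have h1 := key S hSA hSd σ hσ
      have h2 := hΓ _ hσ v
      rw [← symmL_trivialization_apply hy (cov (fun y => S y (σ y)) y v),
        ← symmL_trivialization_apply hy (A (cov σ y v)), h1, ← endCoord_apply hy, h2, hS.fderiv_eq,
        hf.fderiv]
      congr 1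
      simp [Λ]
      abel
    · apply (mdifferentiableAt_totalCoord (EM := EM) x₀ (p := (⟨y, A⟩ : EndTotal F V)) hy').2.1
      have h1 := totalCoord_mfderiv_section hy' S hSd v
      rw [hSA] at h1
      refine hX.trans (Eq.trans ?_ h1.symm)
      rw [hS.fderiv_eq, hf.fderiv]
      rfl

theorem totalCoord_verticalVector {A : EndTotal F V} {x₀ : M} (hy : A.1 ∈ coordDomain EM F V x₀)
    (B : V A.1 →L[ℝ] V A.1) :
    mfderiv (endModel EM F) 𝓘(ℝ, EM × (F →L[ℝ] F))
      (totalCoord EM (F →L[ℝ] F) (fun x => V x →L[ℝ] V x) x₀) A (verticalVector A B) =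
    ((0, endCoord x₀ A.1 B) : EM × (F →L[ℝ] F)) := by
  have hy' := mem_coordDomain_end.2 hy
  obtain ⟨y, A⟩ := A
  change y ∈ _ at hy
  change V y →L[ℝ] V y at B
  have h1 : HasFDerivAt (fun t : ℝ => (extChartAt 𝓘(ℝ, EM) x₀ y,
      endCoord (F := F) x₀ y A + t • endCoord x₀ y B))
      (ContinuousLinearMap.prod 0 (ContinuousLinearMap.smulRight (1 : ℝ →L[ℝ] ℝ)
        (endCoord (F := F) x₀ y B))) 0 :=
    (hasFDerivAt_const _ _).prodMk (((hasFDerivAt_id (0 : ℝ)).smul_const _).const_add _)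
  have h2 : (totalCoord EM (F →L[ℝ] F) (fun x => V x →L[ℝ] V x) x₀) ∘
      (fun t : ℝ => (⟨y, A + t • B⟩ : EndTotal F V)) = fun t : ℝ => (extChartAt 𝓘(ℝ, EM) x₀ y,
      endCoord (F := F) x₀ y A + t • endCoord x₀ y B) := by
    funext t
    refine Prod.ext rfl ?_
    refine (trivialization_add hy' A (t • B)).trans (congrArg₂ (· + ·) rfl ?_)
    exact trivialization_smul hy' t B
  have h3 : MDifferentiableAt 𝓘(ℝ, ℝ) (endModel EM F)
      (fun t : ℝ => (⟨y, A + t • B⟩ : EndTotal F V)) 0 := by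
    have : ContMDiffVectorBundle 1 (F →L[ℝ] F) (fun x => V x →L[ℝ] V x) 𝓘(ℝ, EM) :=
      ContMDiffVectorBundle.of_le (n := ∞) (by simp)
    refine (Trivialization.mdifferentiableAt_totalSpace_iff 𝓘(ℝ, EM)
      (trivializationAt (F →L[ℝ] F) (fun x => V x →L[ℝ] V x) x₀)
      (fun t : ℝ => (⟨y, A + t • B⟩ : EndTotal F V)) (x₀ := 0)
      ((Trivialization.mem_source _).2 hy'.2)).2 ⟨mdifferentiableAt_const, ?_⟩
    have h4 := (congrArg (fun f => fun t => (f t).2) h2)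
    exact (congrArg (fun f => MDifferentiableAt 𝓘(ℝ, ℝ) 𝓘(ℝ, F →L[ℝ] F) f 0) h4).mpr
      h1.snd.differentiableAt.mdifferentiableAt
  have h4 := mfderiv_comp (0 : ℝ) (g := totalCoord EM (F →L[ℝ] F) (fun x => V x →L[ℝ] V x) x₀)
    (f := fun t : ℝ => (⟨y, A + t • B⟩ : EndTotal F V))
    (mdifferentiableAt_totalCoord (EM := EM) x₀ (p := (⟨y, A + (0 : ℝ) • B⟩ : EndTotal F V)) hy').1 h3
  rw [h2, mfderiv_eq_fderiv, h1.fderiv] at h4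
  have h5 := DFunLike.congr_fun h4 (1 : ℝ)
  have h6 : (⟨y, A + (0 : ℝ) • B⟩ : EndTotal F V) = ⟨y, A⟩ := by simp
  rw [h6] at h5
  refine h5.symm.trans ?_
  change ((0 : EM), (1 : ℝ) • endCoord (F := F) x₀ y B) = _
  rw [one_smul]

end Endomorphisms

end ConnectionForms

/-! ### The almost complex structure in coordinates -/

noncomputable section TwistorImages

set_option linter.unusedSectionVars false

variable {EM : Type*} [NormedAddCommGroup EM] [NormedSpace ℂ EM] [FiniteDimensional ℂ EM]
  {M : Type*} [TopologicalSpace M] [ChartedSpace EM M] [IsManifold 𝓘(ℂ, EM) ω M]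
  {F : Type*} [NormedAddCommGroup F] [NormedSpace ℂ F] [FiniteDimensional ℂ F]
  {V : M → Type*} [TopologicalSpace (TotalSpace F V)]
  [∀ x, AddCommGroup (V x)] [∀ x, Module ℂ (V x)] [∀ x, TopologicalSpace (V x)]
  [∀ x, IsTopologicalAddGroup (V x)] [∀ x, ContinuousSMul ℂ (V x)]
  [FiberBundle F V] [VectorBundle ℂ F V] [ContMDiffVectorBundle ω F V 𝓘(ℂ, EM)]

theorem exists_hasMFDerivAt_restrictScalars {G : Type*} [NormedAddCommGroup G] [NormedSpace ℂ G]
    {f : M → G} {y : M} (hf : MDifferentiableAt 𝓘(ℂ, EM) 𝓘(ℂ, G) f y) :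
    ∃ L : EM →L[ℂ] G, HasMFDerivAt 𝓘(ℝ, EM) 𝓘(ℝ, G) f y (L.restrictScalars ℝ) := by
  let L : EM →L[ℂ] G := mfderiv 𝓘(ℂ, EM) 𝓘(ℂ, G) f y
  have h1 := hf.hasMFDerivAt
  exact ⟨L, h1.1, HasFDerivWithinAt.restrictScalars ℝ h1.2⟩

/-- The chart is holomorphic, so its real derivative is the restriction of a complex linear map. -/
theorem chartDeriv_tangentI {x₀ y : M} (hy : y ∈ (chartAt EM x₀).source)
    (v : TangentSpace 𝓘(ℝ, EM) y) :
    chartDeriv x₀ y (tangentI y v) = Complex.I • chartDeriv (EM := EM) x₀ y v := by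
  obtain ⟨L, hL⟩ := exists_hasMFDerivAt_restrictScalars (f := extChartAt 𝓘(ℂ, EM) x₀)
    ((contMDiffAt_extChartAt' (n := ω) hy).mdifferentiableAt (by simp))
  have h1 : chartDeriv (EM := EM) x₀ y = L.restrictScalars ℝ := hL.mfderiv
  rw [h1]
  exact L.map_smul Complex.I v

/-- The derivative of the coordinates on the total space of the endomorphism bundle. -/
def totalDeriv (x₀ : M) (A : EndTotal F V) :
    TangentSpace (endModel EM F) A →L[ℝ] EM × (F →L[ℝ] F) :=
  mfderiv (endModel EM F) 𝓘(ℝ, EM × (F →L[ℝ] F))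
    (totalCoord EM (F →L[ℝ] F) (fun x => V x →L[ℝ] V x) x₀) A

/-- A vector with components `(v, a)` has vertical part `a + [Γ(v), A]`. Its image is `A` composed
with this, plus the horizontal lift of `iv`, whose endomorphism component is `-[Γ(iv), A]`. In
particular the image is determined by the vector. -/
theorem isTwistorImage_iff {cov : CovariantDerivative 𝓘(ℝ, EM) F V} {A : EndTotal F V} {x₀ : M}
    (hy : A.1 ∈ coordDomain EM F V x₀) {Γ : EM →L[ℝ] F →L[ℝ] F} (hΓ : IsConnectionForm cov x₀ A.1 Γ)
    (X Y : TangentSpace (endModel EM F) A) :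
    IsTwistorImage cov A X Y ↔ (totalDeriv x₀ A Y).1 = Complex.I • (totalDeriv x₀ A X).1 ∧
      (totalDeriv x₀ A Y).2 = endCoord x₀ A.1 A.2 ∘L ((totalDeriv x₀ A X).2 +
        (Γ (totalDeriv x₀ A X).1 ∘L endCoord x₀ A.1 A.2 -
          endCoord x₀ A.1 A.2 ∘L Γ (totalDeriv x₀ A X).1)) -
        (Γ (Complex.I • (totalDeriv x₀ A X).1) ∘L endCoord x₀ A.1 A.2 -
          endCoord x₀ A.1 A.2 ∘L Γ (Complex.I • (totalDeriv x₀ A X).1)) := by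
  have hy' := mem_coordDomain_end.2 hy
  have hinj : Function.Injective (totalDeriv (EM := EM) x₀ A) :=
    (mdifferentiableAt_totalCoord (EM := EM) x₀ hy').2.1
  have hlift := isHorizontalLift_iff hy hΓ
  have hvert : ∀ B, totalDeriv x₀ A (verticalVector (EM := EM) A B) = (0, endCoord x₀ A.1 B) :=
    totalCoord_verticalVector hy
  have hadd := (totalDeriv (EM := EM) x₀ A).map_add
  have hLI := fun v => chartDeriv_tangentI (EM := EM) hy.1 v
  constructor
  · rintro ⟨v, B, h, h', hh, hh', rfl, rfl⟩
    have e1 : totalDeriv x₀ A h = _ := (hlift v h).1 hh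
    have e2 : totalDeriv x₀ A h' = _ := (hlift _ h').1 hh'
    have e3 : totalDeriv x₀ A (h + verticalVector A B) = totalDeriv x₀ A h + _ := hadd _ _
    have e4 : totalDeriv x₀ A (h' + verticalVector A (A.2 ∘L B)) = totalDeriv x₀ A h' + _ :=
      hadd _ _
    rw [hvert, e1] at e3
    rw [hvert, e2, hLI, endCoord_comp hy] at e4
    rw [e3, e4]
    refine ⟨by simp, ?_⟩
    simp only [Prod.mk_add_mk, add_zero, ContinuousLinearMap.comp_add, ContinuousLinearMap.comp_sub]
    abel
  · rintro ⟨h1, h2⟩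
    obtain ⟨L, hL⟩ := chartDeriv_isInvertible (EM := EM) hy.1
    have hv : chartDeriv x₀ A.1 (L.symm (totalDeriv x₀ A X).1) = (totalDeriv x₀ A X).1 := by
      rw [← hL]; exact L.apply_symm_apply _
    have hsurj : Function.Surjective (totalDeriv (EM := EM) x₀ A) :=
      (mdifferentiableAt_totalCoord (EM := EM) x₀ hy').2.2
    set v := L.symm (totalDeriv x₀ A X).1
    obtain ⟨h, hh⟩ := hsurj (chartDeriv x₀ A.1 v, endCoord x₀ A.1 A.2 ∘L Γ (chartDeriv x₀ A.1 v) -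
        Γ (chartDeriv x₀ A.1 v) ∘L endCoord x₀ A.1 A.2)
    obtain ⟨h', hh'⟩ := hsurj (chartDeriv x₀ A.1 (tangentI A.1 v),
      endCoord x₀ A.1 A.2 ∘L Γ (chartDeriv x₀ A.1 (tangentI A.1 v)) -
        Γ (chartDeriv x₀ A.1 (tangentI A.1 v)) ∘L endCoord x₀ A.1 A.2)
    let P : F →L[ℝ] F := (totalDeriv x₀ A X).2 + (Γ (totalDeriv x₀ A X).1 ∘L endCoord x₀ A.1 A.2 -
          endCoord x₀ A.1 A.2 ∘L Γ (totalDeriv x₀ A X).1)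
    let B : V A.1 →L[ℝ] V A.1 :=
      (trivializationAt (F →L[ℝ] F) (fun x => V x →L[ℝ] V x) x₀).symmL ℝ A.1 P
    have hB : endCoord x₀ A.1 B = P := trivialization_symmL_apply hy' P
    refine ⟨v, B, h, h', (hlift v h).2 hh, (hlift _ h').2 hh', hinj ?_, hinj ?_⟩
    · have e3 : totalDeriv x₀ A (h + verticalVector A B) = totalDeriv x₀ A h + _ := hadd _ _
      rw [e3, hvert, hh, hB, hv]
      refine Prod.ext (by simp) ?_
      simp only [Prod.mk_add_mk, P]
      abel
    · have e4 : totalDeriv x₀ A (h' + verticalVector A (A.2 ∘L B)) = totalDeriv x₀ A h' + _ :=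
        hadd _ _
      rw [e4, hvert, hh', endCoord_comp hy, hB, hLI, hv]
      refine Prod.ext (by simp [h1]) ?_
      rw [h2]
      simp only [Prod.mk_add_mk, P]
      abel

end TwistorImages

/-! ### Isometric frames in `F ⊕ F^*`, sheared by alternating forms -/

noncomputable section HermitianFrames

set_option linter.unusedSectionVars false

section Model
variable {F : Type*} [NormedAddCommGroup F] [NormedSpace ℂ F] {ι : Type*} [Fintype ι]

/-- The pairing of `F` with its dual space, which is identified with `ι → ℂ` by a basis of `F`, as a
quadratic form. -/
def dualPairing (b : Module.Basis ι ℂ F) : LinearMap.BilinForm ℂ (F × (ι → ℂ)) :=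
  LinearMap.mk₂ ℂ (fun z z' => ∑ k, (z.2 k * b.repr z'.1 k + z'.2 k * b.repr z.1 k))
    (fun z₁ z₂ z' => by
      rw [← Finset.sum_add_distrib]; refine Finset.sum_congr rfl fun k _ => ?_
      simp only [Prod.snd_add, Prod.fst_add, map_add, Pi.add_apply, Finsupp.add_apply]; ring)
    (fun c z z' => by
      rw [Finset.smul_sum]; refine Finset.sum_congr rfl fun k _ => ?_
      simp only [Prod.smul_snd, Prod.smul_fst, map_smul, Pi.smul_apply, Finsupp.smul_apply,
        smul_eq_mul]; ring)
    (fun z z₁ z₂ => by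
      rw [← Finset.sum_add_distrib]; refine Finset.sum_congr rfl fun k _ => ?_
      simp only [Prod.snd_add, Prod.fst_add, map_add, Pi.add_apply, Finsupp.add_apply]; ring)
    (fun c z z' => by
      rw [Finset.smul_sum]; refine Finset.sum_congr rfl fun k _ => ?_
      simp only [Prod.smul_snd, Prod.smul_fst, map_smul, Pi.smul_apply, Finsupp.smul_apply,
        smul_eq_mul]; ring)

theorem dualPairing_apply (b : Module.Basis ι ℂ F) (z z' : F × (ι → ℂ)) :
    dualPairing b z z' = ∑ k, (z.2 k * b.repr z'.1 k + z'.2 k * b.repr z.1 k) := rfl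

theorem dualPairing_symm (b : Module.Basis ι ℂ F) (z z' : F × (ι → ℂ)) :
    dualPairing b z z' = dualPairing b z' z := by
  rw [dualPairing_apply, dualPairing_apply]
  exact Finset.sum_congr rfl fun k _ => add_comm _ _

theorem dualPairing_nondegenerate (b : Module.Basis ι ℂ F) : (dualPairing b).Nondegenerate := by
  classical
  have key : ∀ z, (∀ z', dualPairing b z z' = 0) → z = 0 := fun z hz => by
    refine Prod.ext (b.repr.injective (Finsupp.ext fun k => ?_)) (funext fun k => ?_)
    · have := hz (0, Pi.single k 1)
      simpa [dualPairing_apply, Pi.single_apply] using this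
    · have := hz (b k, 0)
      simpa [dualPairing_apply, Finsupp.single_apply] using this
  exact ⟨key, fun z hz => key z fun z' => by rw [dualPairing_symm]; exact hz z'⟩

/-- The complex linear part in the second variable of a real bilinear form. -/
def hermPart {W : Type*} [AddCommGroup W] [Module ℂ W] (Q : LinearMap.BilinForm ℝ W) (a : W) :
    W →ₗ[ℂ] ℂ where
  toFun c := 2⁻¹ * ((Q a c : ℂ) - Complex.I * (Q a (Complex.I • c) : ℂ))
  map_add' c c' := by
    rw [smul_add, map_add, map_add]; push_cast; ring
  map_smul' k c := by
    have e1 : ∀ (k : ℂ) (c : W), Q a (k • c) = k.re * Q a c + k.im * Q a (Complex.I • c) :=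
      fun k c => by
        have : k • c = k.re • c + k.im • (Complex.I • c) := by
          rw [← Complex.coe_smul, ← Complex.coe_smul, smul_smul, ← add_smul, Complex.re_add_im]
        rw [this, map_add, map_smul, map_smul, smul_eq_mul, smul_eq_mul]
    have e2 : Q a (Complex.I • k • c) = k.re * Q a (Complex.I • c) - k.im * Q a c := by
      rw [smul_smul, e1]; simp; ring
    rw [e1, e2, RingHom.id_apply, smul_eq_mul]
    conv_rhs => rw [← Complex.re_add_im k]
    push_cast
    linear_combination (2⁻¹ * (k.im : ℂ) * (Q a (Complex.I • c) : ℂ)) * Complex.I_mul_I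

theorem hermPart_apply {W : Type*} [AddCommGroup W] [Module ℂ W] (Q : LinearMap.BilinForm ℝ W)
    (a c : W) : hermPart Q a c = 2⁻¹ * ((Q a c : ℂ) - Complex.I * (Q a (Complex.I • c) : ℂ)) := rfl

variable [FiniteDimensional ℂ F]

/-- The isometric embedding of a Hermitian vector space in the sum of the space and its dual,
sheared by an alternating form `β`. -/
def hermFrame (b : Module.Basis ι ℂ F) (G : LinearMap.BilinForm ℝ F) (β : Alt2 F) :
    F →L[ℝ] F × (ι → ℂ) :=
  haveI : FiniteDimensional ℝ F := FiniteDimensional.complexToReal F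
  LinearMap.toContinuousLinearMap
    { toFun := fun u => (u, fun k => hermPart G u (b k) + β ![u, b k])
      map_add' := fun u u' => by
        refine Prod.ext rfl (funext fun k => ?_)
        have := (alt2Bilin β).map_add₂ u u' (b k)
        simp only [alt2Bilin_apply] at this
        simp only [Prod.mk_add_mk, Pi.add_apply, this, hermPart_apply, map_add, LinearMap.add_apply]
        push_cast; ring
      map_smul' := fun c u => by
        refine Prod.ext rfl (funext fun k => ?_)
        have := (alt2Bilin β).map_smul₂ (c : ℂ) u (b k)
        simp only [alt2Bilin_apply, Complex.coe_smul] at this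
        simp only [Prod.smul_mk, Pi.smul_apply, this, hermPart_apply, map_smul, LinearMap.smul_apply,
          RingHom.id_apply, smul_eq_mul, Complex.real_smul]
        push_cast; ring }

theorem hermFrame_apply (b : Module.Basis ι ℂ F) (G : LinearMap.BilinForm ℝ F) (β : Alt2 F) (u : F) :
    hermFrame b G β u = (u, fun k => hermPart G u (b k) + β ![u, b k]) := rfl

theorem dualPairing_hermFrame_aux (b : Module.Basis ι ℂ F) (G : LinearMap.BilinForm ℝ F) (β : Alt2 F)
    (u w : F) : ∑ k, (hermPart G u (b k) + β ![u, b k]) * b.repr w k =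
      hermPart G u w + β ![u, w] := by
  have h := congrArg (hermPart G u + alt2Bilin β u) (b.sum_repr w)
  rw [map_sum] at h
  simp only [map_smul, LinearMap.add_apply, alt2Bilin_apply, smul_eq_mul] at h
  rw [← h]
  exact Finset.sum_congr rfl fun k _ => mul_comm _ _

/-- The contributions of `β` cancel by antisymmetry, and the two Hermitian terms are conjugate with
sum `G u w`. -/
theorem isIsometricFrame_hermFrame (b : Module.Basis ι ℂ F) {G : LinearMap.BilinForm ℝ F}
    (hG : ∀ u w, G u w = G w u) (hI : ∀ u w, G (Complex.I • u) (Complex.I • w) = G u w) (β : Alt2 F) :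
    IsIsometricFrame (dualPairing b) (fun u w => G u w) (hermFrame b G β) := fun u w => by
  rw [dualPairing_apply, Finset.sum_add_distrib, hermFrame_apply, hermFrame_apply]
  simp only
  rw [dualPairing_hermFrame_aux, dualPairing_hermFrame_aux]
  have h1 : β ![w, u] = -β ![u, w] := alt2Bilin_swap β w u
  have h2 : G w (Complex.I • u) = -G u (Complex.I • w) := by
    rw [← hI, smul_smul, Complex.I_mul_I, neg_one_smul, map_neg, hG]
  rw [h1, hermPart_apply, hermPart_apply, h2, hG w u]
  push_cast; ring

theorem finrank_dualPairing (b : Module.Basis ι ℂ F) :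
    Module.finrank ℂ (F × (ι → ℂ)) = 2 * Module.finrank ℂ F := by
  rw [Module.finrank_prod, Module.finrank_fintype_fun_eq_card, Module.finrank_eq_card_basis b]; ring

end Model

section Raise
variable {W : Type*} [AddCommGroup W] [Module ℂ W] [FiniteDimensional ℝ W]
  {Q : LinearMap.BilinForm ℝ W} (hQ : ∀ a, a ≠ 0 → 0 < Q a a)

theorem cplxProj_tmul (c : ℂ) (w : W) : cplxProj W (c ⊗ₜ w) = c • w := by
  simp [cplxProj]

/-- The pairing of `q⁻¹γ z` with `b` depends only on `b^{1,0}`, so it vanishes on `W^{0,1}`; for a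
Hermitian `Q` only vectors of type (0,1) have this property. -/
theorem cplxProj_raise (hI : ∀ a c, Q (Complex.I • a) (Complex.I • c) = Q a c) (γ : Alt2 W)
    (z : Cplx W) : cplxProj W (raise Q hQ γ z) = 0 := by
  obtain ⟨s, t, h⟩ := cplx_decomp (raise Q hQ γ z)
  -- The test vectors `1 ⊗ c + i ⊗ ic` are of type (0,1).
  have h0 : ∀ c, cplxProj W (1 ⊗ₜ c + Complex.I ⊗ₜ (Complex.I • c)) = 0 := fun c => by
    rw [map_add, cplxProj_tmul, cplxProj_tmul, smul_smul, Complex.I_mul_I]; simp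
  have key : ∀ c, Q (s + Complex.I • t) c = 0 := fun c => by
    have h1 := raise_apply Q hQ γ z (1 ⊗ₜ c + Complex.I ⊗ₜ (Complex.I • c))
    rw [h0] at h1
    have h2 : γ ![cplxProj W z, 0] = 0 := by
      rw [← alt2Bilin_apply, map_zero]
    rw [h2, h] at h1
    simp only [map_add, LinearMap.add_apply, LinearMap.BilinForm.baseChange_tmul] at h1
    have h3 := congrArg Complex.re h1
    simp at h3
    have h4 : Q (Complex.I • t) c = -Q t (Complex.I • c) := by
      rw [← hI, smul_smul, Complex.I_mul_I, neg_one_smul, map_neg, LinearMap.neg_apply]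
    rw [map_add, LinearMap.add_apply, h4]
    linarith
  rw [h, map_add, cplxProj_tmul, cplxProj_tmul, one_smul]
  by_contra h5
  exact (hQ _ h5).ne' (key _)

theorem raise_raise (hI : ∀ a c, Q (Complex.I • a) (Complex.I • c) = Q a c) (γ γ' : Alt2 W)
    (z : Cplx W) : raise Q hQ γ (raise Q hQ γ' z) = 0 := by
  refine (baseChange_nondegenerate Q hQ).1 _ fun w => ?_
  rw [raise_apply, cplxProj_raise hQ hI, ← alt2Bilin_apply, map_zero, LinearMap.zero_apply]

/-- `q⁻¹γ` maps into `W^{0,1}`, where every such endomorphism vanishes; so its square is zero and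
the exponential series stops after the linear term. -/
theorem exp_neg_raise (hI : ∀ a c, Q (Complex.I • a) (Complex.I • c) = Q a c) (γ : Alt2 W) :
    IsNilpotent.exp (-raise Q hQ γ) = 1 - raise Q hQ γ := by
  have h : (-raise Q hQ γ) ^ 2 = 0 := by
    refine LinearMap.ext fun z => ?_
    change -(raise Q hQ γ (-(raise Q hQ γ z))) = 0
    rw [map_neg, raise_raise hQ hI, neg_zero, neg_zero]
  rw [IsNilpotent.exp_eq_sum h]
  simp [Finset.sum_range_succ, sub_eq_add_neg]

theorem cplx_decomp_inj {s t s' t' : W}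
    (h : (1 : ℂ) ⊗ₜ[ℝ] s + Complex.I ⊗ₜ[ℝ] t = (1 : ℂ) ⊗ₜ[ℝ] s' + Complex.I ⊗ₜ[ℝ] t') :
    s = s' ∧ t = t' := by
  have h1 := congrArg (cplxRe W) h
  have h2 := congrArg (fun z : Cplx W => cplxRe W (-Complex.I • z)) h
  simp [cplxRe, TensorProduct.smul_tmul'] at h1 h2
  exact ⟨h1, h2⟩

theorem mem_eigen01_iff {A : W →ₗ[ℝ] W} (hA : ∀ a, A (A a) = -a) (z : Cplx W) :
    z ∈ eigen01 A ↔ ∃ a, z = 1 ⊗ₜ a + Complex.I ⊗ₜ A a := by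
  rw [eigen01, Module.End.mem_eigenspace_iff]
  constructor
  · intro h
    obtain ⟨s, t, rfl⟩ := cplx_decomp z
    have h1 : (1 : ℂ) ⊗ₜ[ℝ] A s + Complex.I ⊗ₜ[ℝ] A t = 1 ⊗ₜ t + Complex.I ⊗ₜ (-s) := by
      simpa [smul_add, TensorProduct.smul_tmul', TensorProduct.neg_tmul, TensorProduct.tmul_neg,
        add_comm] using h
    exact ⟨s, by rw [(cplx_decomp_inj h1).1]⟩
  · rintro ⟨a, rfl⟩
    simp [smul_add, TensorProduct.smul_tmul', TensorProduct.neg_tmul, TensorProduct.tmul_neg, hA,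
      add_comm]

/-- The complex linear extension of a real linear map to a complex vector space. -/
def cplxLift {C : Type*} [AddCommGroup C] [Module ℂ C] (T : W →ₗ[ℝ] C) : Cplx W →ₗ[ℂ] C :=
  T.liftBaseChange ℂ

theorem cplxLift_tmul {C : Type*} [AddCommGroup C] [Module ℂ C] (T : W →ₗ[ℝ] C) (c : ℂ) (w : W) :
    cplxLift T (c ⊗ₜ w) = c • T w := by
  simp [cplxLift]

variable {F : Type*} [NormedAddCommGroup F] [NormedSpace ℂ F] [FiniteDimensional ℂ F]
  {ι : Type*} [Fintype ι] (b : Module.Basis ι ℂ F) (ε : W ≃ₗ[ℂ] F) {G : LinearMap.BilinForm ℝ F}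

/-- Since `q⁻¹γ z` has type (0,1), its first component and its `β` term vanish. What is left is its
pairing under `q_ℂ` with the (1,0) lifts of the basis vectors, and that is `γ` by definition. In the
frame, raising an index with `g` is undone. -/
theorem cplxLift_hermFrame_raise (hI : ∀ a c, Q (Complex.I • a) (Complex.I • c) = Q a c)
    (hG : ∀ a c, G (ε a) (ε c) = Q a c) (β : Alt2 F) (γ : Alt2 W) (z : Cplx W) :
    cplxLift ((hermFrame b G β).toLinearMap ∘ₗ ε.toLinearMap.restrictScalars ℝ) (raise Q hQ γ z) =
      (0, fun k => γ ![cplxProj W z, ε.symm (b k)]) := by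
  have h1 := cplxProj_raise hQ hI γ z
  have h2 := fun c => raise_apply Q hQ γ z c
  obtain ⟨s, t, h⟩ := cplx_decomp (raise Q hQ γ z)
  rw [h] at h1 h2 ⊢
  rw [map_add, cplxProj_tmul, cplxProj_tmul, one_smul] at h1
  rw [map_add, cplxLift_tmul, cplxLift_tmul, one_smul]
  have h3 : ε s + Complex.I • ε t = 0 := by rw [← map_smul, ← map_add, h1, map_zero]
  refine Prod.ext h3 (funext fun k => ?_)
  change hermPart G (ε s) (b k) + β ![ε s, b k] +
    Complex.I * (hermPart G (ε t) (b k) + β ![ε t, b k]) = _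
  have h4 : β ![ε s, b k] + Complex.I * β ![ε t, b k] = 0 := by
    have := congrArg (fun u => alt2Bilin β u (b k)) h3
    simpa [alt2Bilin_apply] using this
  -- The argument is `w^{1,0} = (1 ⊗ w - i ⊗ iw) / 2` for the basis vector `w`, up to moving
  -- scalars.
  have h5 := h2 ((2⁻¹ : ℂ) ⊗ₜ ε.symm (b k) + (-(2⁻¹ * Complex.I)) ⊗ₜ (Complex.I • ε.symm (b k)))
  have h6 : cplxProj W ((2⁻¹ : ℂ) ⊗ₜ ε.symm (b k) +
      (-(2⁻¹ * Complex.I)) ⊗ₜ (Complex.I • ε.symm (b k))) = ε.symm (b k) := by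
    rw [map_add, cplxProj_tmul, cplxProj_tmul, smul_smul, ← add_smul, neg_mul, mul_assoc,
      Complex.I_mul_I]
    norm_num
  rw [h6] at h5
  change _ = γ ![cplxProj W z, ε.symm (b k)]
  rw [← h5]
  have e1 : ∀ a, G (ε a) (b k) = Q a (ε.symm (b k)) := fun a => by
    rw [← hG, ε.apply_symm_apply]
  have e2 : ∀ a, G (ε a) (Complex.I • b k) = Q a (Complex.I • ε.symm (b k)) := fun a => by
    rw [← hG, ε.map_smul, ε.apply_symm_apply]
  rw [hermPart_apply, hermPart_apply, e1, e1, e2, e2]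
  simp only [map_add, LinearMap.add_apply, LinearMap.BilinForm.baseChange_tmul]
  simp only [Algebra.smul_def, Complex.coe_algebraMap]
  linear_combination h4

theorem cplxLift_hermFrame_add (β γ : Alt2 F) (z : Cplx W) :
    cplxLift ((hermFrame b G (β + γ)).toLinearMap ∘ₗ ε.toLinearMap.restrictScalars ℝ) z =
      cplxLift ((hermFrame b G β).toLinearMap ∘ₗ ε.toLinearMap.restrictScalars ℝ) z +
        (0, fun k => γ ![ε (cplxProj W z), b k]) := by
  have h0 : ∀ w, hermFrame b G (β + γ) w = hermFrame b G β w + (0, fun k => γ ![w, b k]) := fun w => by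
    refine Prod.ext (by simp [hermFrame_apply]) (funext fun k => ?_)
    simp [hermFrame_apply, add_assoc]
  induction z using TensorProduct.induction_on with
  | zero =>
    refine Prod.ext (by simp) (funext fun k => ?_)
    simp [← alt2Bilin_apply]
  | tmul c w =>
    rw [cplxLift_tmul, cplxLift_tmul, cplxProj_tmul]
    change c • hermFrame b G (β + γ) (ε w) = c • hermFrame b G β (ε w) + _
    rw [h0, smul_add]
    congr 1
    refine Prod.ext (by simp) (funext fun k => ?_)
    simp [← alt2Bilin_apply]
  | add x y hx hy =>
    rw [map_add, hx, hy, map_add, map_add, map_add]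
    have : ((0, fun k => γ ![ε (cplxProj W x) + ε (cplxProj W y), b k]) : F × (ι → ℂ)) =
        (0, fun k => γ ![ε (cplxProj W x), b k]) + (0, fun k => γ ![ε (cplxProj W y), b k]) := by
      refine Prod.ext (by simp) (funext fun k => ?_)
      simp [← alt2Bilin_apply]
    rw [this]; abel

/-- The shear added to the frame by `B` is cancelled by `1 - g⁻¹B`, because the image of `g⁻¹B z` in
the frame is exactly this shear. Hence `exp(-g⁻¹B)` preserves coordinates when the potential changes
by `B`. -/
theorem cplxLift_hermFrame_exp (hI : ∀ a c, Q (Complex.I • a) (Complex.I • c) = Q a c)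
    (hG : ∀ a c, G (ε a) (ε c) = Q a c) (β : Alt2 F) (B : Alt2 W) (z : Cplx W) :
    cplxLift ((hermFrame b G (β + B.compLinearMap ε.symm.toLinearMap)).toLinearMap ∘ₗ
        ε.toLinearMap.restrictScalars ℝ) (IsNilpotent.exp (-raise Q hQ B) z) =
      cplxLift ((hermFrame b G β).toLinearMap ∘ₗ ε.toLinearMap.restrictScalars ℝ) z := by
  rw [exp_neg_raise hQ hI]
  change cplxLift _ (z - raise Q hQ B z) = _
  rw [map_sub, cplxLift_hermFrame_raise hQ b ε hI hG, cplxLift_hermFrame_add]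
  have : ∀ k, (B.compLinearMap ε.symm.toLinearMap) ![ε (cplxProj W z), b k] =
      B ![cplxProj W z, ε.symm (b k)] := fun k => by
    rw [AlternatingMap.compLinearMap_apply]
    congr 1
    ext i; fin_cases i <;> simp
  simp only [this]
  abel

theorem cplxLift_hermFrame_injective (hG : ∀ u, u ≠ 0 → 0 < G u u)
    (hs : ∀ u w, G u w = G w u) (hI : ∀ u w, G (Complex.I • u) (Complex.I • w) = G u w) (β : Alt2 F) :
    Function.Injective
      (cplxLift ((hermFrame b G β).toLinearMap ∘ₗ ε.toLinearMap.restrictScalars ℝ)) := by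
  rw [← LinearMap.ker_eq_bot, LinearMap.ker_eq_bot']
  intro z hz
  obtain ⟨s, t, rfl⟩ := cplx_decomp z
  rw [map_add, cplxLift_tmul, cplxLift_tmul, one_smul] at hz
  obtain ⟨h1, h2⟩ := (isIsometricFrame_hermFrame b hs hI β).cplxExt_inj hG hz
  have h1' : s = 0 := ε.injective (h1.trans (map_zero ε).symm)
  have h2' : t = 0 := ε.injective (h2.trans (map_zero ε).symm)
  simp [h1', h2']

/-- Complex structures with the same coordinates in the isotropic charts defined by two frames that
differ by `B` are related by `exp(-g⁻¹B)`. -/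
theorem eigen01_eq_map_exp (hI : ∀ a c, Q (Complex.I • a) (Complex.I • c) = Q a c)
    (hs : ∀ a c, Q a c = Q c a) (hG : ∀ a c, G (ε a) (ε c) = Q a c) (β : Alt2 F) (B : Alt2 W)
    {N : ℕ} (κ : IsotropicChart F (dualPairing b) N) (c : Fin N → ℂ) {A A' : W →ₗ[ℝ] W}
    (hA : ∀ a, κ.struct (hermFrame b G β) c (ε a) = ε (A a))
    (hA' : ∀ a, κ.struct (hermFrame b G (β + B.compLinearMap ε.symm.toLinearMap)) c (ε a) =
      ε (A' a)) :
    eigen01 A' = (eigen01 A).map (IsNilpotent.exp (-raise Q hQ B)) := by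
  have hGQ : ∀ u w, G u w = Q (ε.symm u) (ε.symm w) := fun u w => by
    rw [← hG, ε.apply_symm_apply, ε.apply_symm_apply]
  have hGs : ∀ u w, G u w = G w u := fun u w => by rw [hGQ, hGQ, hs]
  have hGI : ∀ u w, G (Complex.I • u) (Complex.I • w) = G u w := fun u w => by
    rw [hGQ, hGQ, ε.symm.map_smul, ε.symm.map_smul, hI]
  have hGp : ∀ u, u ≠ 0 → 0 < G u u := fun u hu => by
    rw [hGQ]; exact hQ _ fun h => hu (ε.symm.injective (h.trans (map_zero _).symm))
  have hT := isIsometricFrame_hermFrame b hGs hGI β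
  have hT' := isIsometricFrame_hermFrame b hGs hGI (β + B.compLinearMap ε.symm.toLinearMap)
  have hd := finrank_dualPairing b
  have hi := hT.isInvertible hGp hd
  have hi' := hT'.isInvertible hGp hd
  have hAA : ∀ a, A (A a) = -a := fun a => ε.injective (by
    rw [← hA, ← hA, IsotropicChart.struct_struct hT hGp hi, map_neg])
  have hAA' : ∀ a, A' (A' a) = -a := fun a => ε.injective (by
    rw [← hA', ← hA', IsotropicChart.struct_struct hT' hGp hi', map_neg])
  have hgr : ∀ w, ∃ a, ε a = κ.frame (hermFrame b G β) c w ∧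
      cplxLift ((hermFrame b G β).toLinearMap ∘ₗ ε.toLinearMap.restrictScalars ℝ)
        (1 ⊗ₜ a + Complex.I ⊗ₜ A a) = κ.τ w + κ.S c (κ.τ w) := fun w => by
    refine ⟨ε.symm (κ.frame (hermFrame b G β) c w), ε.apply_symm_apply _, ?_⟩
    rw [IsotropicChart.graph_eq hT hGp hi, map_add, cplxLift_tmul, cplxLift_tmul, one_smul]
    simp [← hA]
  have hgr' : ∀ w, ∃ a, ε a = κ.frame (hermFrame b G (β + B.compLinearMap ε.symm.toLinearMap)) c w ∧
      cplxLift ((hermFrame b G (β + B.compLinearMap ε.symm.toLinearMap)).toLinearMap ∘ₗ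
        ε.toLinearMap.restrictScalars ℝ) (1 ⊗ₜ a + Complex.I ⊗ₜ A' a) = κ.τ w + κ.S c (κ.τ w) :=
      fun w => by
    refine ⟨ε.symm (κ.frame _ c w), ε.apply_symm_apply _, ?_⟩
    rw [IsotropicChart.graph_eq hT' hGp hi', map_add, cplxLift_tmul, cplxLift_tmul, one_smul]
    simp [← hA']
  have hinj := cplxLift_hermFrame_injective b ε hGp hGs hGI (β + B.compLinearMap ε.symm.toLinearMap)
  ext z
  rw [mem_eigen01_iff hAA', Submodule.mem_map]
  constructor
  · rintro ⟨a', rfl⟩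
    obtain ⟨w, hw⟩ := IsotropicChart.frame_surjective (κ := κ) hT' hGp hi' c (ε a')
    obtain ⟨a₁, h1, h2⟩ := hgr' w
    obtain rfl : a₁ = a' := ε.injective (h1.trans hw)
    obtain ⟨a, -, h3⟩ := hgr w
    refine ⟨_, (mem_eigen01_iff hAA _).2 ⟨a, rfl⟩, hinj ?_⟩
    rw [cplxLift_hermFrame_exp hQ b ε hI hG, h2, h3]
  · rintro ⟨z, hz, rfl⟩
    obtain ⟨a, rfl⟩ := (mem_eigen01_iff hAA _).1 hz
    obtain ⟨w, hw⟩ := IsotropicChart.frame_surjective (κ := κ) hT hGp hi c (ε a)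
    obtain ⟨a₁, h1, h2⟩ := hgr w
    obtain rfl : a₁ = a := ε.injective (h1.trans hw)
    obtain ⟨a', -, h3⟩ := hgr' w
    refine ⟨a', hinj ?_⟩
    rw [cplxLift_hermFrame_exp hQ b ε hI hG, h2, h3]

end Raise

end HermitianFrames

/-! ### The metric in coordinates, and its relation to the Chern connection form -/

noncomputable section LocalMetric

set_option linter.unusedSectionVars false

variable {EM : Type*} [NormedAddCommGroup EM] [NormedSpace ℂ EM] [FiniteDimensional ℂ EM]
  {M : Type*} [TopologicalSpace M] [ChartedSpace EM M] [IsManifold 𝓘(ℂ, EM) ω M]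
  {F : Type*} [NormedAddCommGroup F] [NormedSpace ℂ F] [FiniteDimensional ℂ F]
  {V : M → Type*} [TopologicalSpace (TotalSpace F V)]
  [∀ x, AddCommGroup (V x)] [∀ x, Module ℂ (V x)] [∀ x, TopologicalSpace (V x)]
  [∀ x, IsTopologicalAddGroup (V x)] [∀ x, ContinuousSMul ℂ (V x)]
  [FiberBundle F V] [VectorBundle ℂ F V] [ContMDiffVectorBundle ω F V 𝓘(ℂ, EM)]

/-- The identification of the fibre over `y` with the model fibre by the trivialization at `x₀`. -/
def fibreEquiv (x₀ : M) {y : M} (hy : y ∈ coordDomain EM F V x₀) : V y ≃ₗ[ℂ] F :=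
  (trivializationAt F V x₀).linearEquivAt ℂ y hy.2

theorem fibreEquiv_apply {x₀ y : M} (hy : y ∈ coordDomain EM F V x₀) (a : V y) :
    fibreEquiv x₀ hy a = (trivializationAt F V x₀ (⟨y, a⟩ : TotalSpace F V)).2 := rfl

theorem fibreEquiv_symm_apply {x₀ y : M} (hy : y ∈ coordDomain EM F V x₀) (u : F) :
    (fibreEquiv x₀ hy).symm u = constSection F V x₀ u y := by
  rw [constSection, Trivialization.symmₗ_apply _ hy.2]
  exact (trivializationAt F V x₀).linearEquivAt_symm_apply (R := ℂ) y hy.2 u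

/-- `constSection` as a complex linear map. -/
def constSectionₗ (F : Type*) [NormedAddCommGroup F] [NormedSpace ℂ F] (V : M → Type*)
    [TopologicalSpace (TotalSpace F V)] [∀ x, AddCommGroup (V x)] [∀ x, Module ℂ (V x)]
    [∀ x, TopologicalSpace (V x)] [FiberBundle F V] [VectorBundle ℂ F V] (x₀ y : M) : F →ₗ[ℂ] V y where
  toFun u := constSection F V x₀ u y
  map_add' := ((trivializationAt F V x₀).symmₗ ℂ y).map_add
  map_smul' := ((trivializationAt F V x₀).symmₗ ℂ y).map_smul

theorem constSection_smul (x₀ : M) (c : ℂ) (u : F) (y : M) :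
    constSection F V x₀ (c • u) y = c • constSection F V x₀ u y :=
  (constSectionₗ F V x₀ y).map_smul c u

theorem constSection_trivialization {x₀ y : M} (hy : y ∈ coordDomain EM F V x₀) (a : V y) :
    constSection F V x₀ (trivializationAt F V x₀ (⟨y, a⟩ : TotalSpace F V)).2 y = a := by
  rw [← fibreEquiv_symm_apply hy, ← fibreEquiv_apply hy, LinearEquiv.symm_apply_apply]

variable (g : ContMDiffRiemannianMetric 𝓘(ℝ, EM) ∞ F V)

/-- The metric of the fibre over `y`, on the model fibre. -/
def fibreMetric (x₀ y : M) : LinearMap.BilinForm ℝ F :=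
  (metricForm g y).comp ((constSectionₗ F V x₀ y).restrictScalars ℝ)
    ((constSectionₗ F V x₀ y).restrictScalars ℝ)

theorem fibreMetric_apply (x₀ y : M) (u w : F) : fibreMetric g x₀ y u w =
    g.inner y (constSection F V x₀ u y) (constSection F V x₀ w y) := rfl

theorem fibreMetric_trivialization {x₀ y : M} (hy : y ∈ coordDomain EM F V x₀) (a c : V y) :
    fibreMetric g x₀ y (trivializationAt F V x₀ (⟨y, a⟩ : TotalSpace F V)).2
      (trivializationAt F V x₀ (⟨y, c⟩ : TotalSpace F V)).2 = g.inner y a c := by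
  rw [fibreMetric_apply, constSection_trivialization hy, constSection_trivialization hy]

theorem fibreMetric_symm (x₀ y : M) (u w : F) : fibreMetric g x₀ y u w = fibreMetric g x₀ y w u :=
  g.symm y _ _

theorem fibreMetric_pos {x₀ y : M} (hy : y ∈ coordDomain EM F V x₀) (u : F) (hu : u ≠ 0) :
    0 < fibreMetric g x₀ y u u := by
  refine g.pos y _ fun h => hu ?_
  change constSection F V x₀ u y = 0 at h
  rw [← trivialization_constSection hy u, h]
  exact (fibreEquiv x₀ hy).map_zero

variable {g} in
theorem fibreMetric_hermitian (hg : IsHermitianMetric g) (x₀ y : M) (u w : F) :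
    fibreMetric g x₀ y (Complex.I • u) (Complex.I • w) = fibreMetric g x₀ y u w := by
  rw [fibreMetric_apply, constSection_smul, constSection_smul, hg, fibreMetric_apply]

theorem contMDiffAt_constSection {x₀ y : M} (hy : y ∈ coordDomain EM F V x₀) (u : F) :
    ContMDiffAt 𝓘(ℝ, EM) (𝓘(ℝ, EM).prod 𝓘(ℝ, F)) ∞
      (fun y => TotalSpace.mk' F y (constSection F V x₀ u y)) y := by
  rw [Trivialization.contMDiffAt_section_iff (trivializationAt F V x₀) hy.2]
  refine (contMDiffAt_const (c := u)).congr_of_eventuallyEq ?_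
  filter_upwards [(isOpen_coordDomain (EM := EM) (F' := F) (W := V) x₀).mem_nhds hy] with y' hy'
  exact trivialization_constSection hy' u

theorem contMDiffAt_fibreMetric {x₀ y : M} (hy : y ∈ coordDomain EM F V x₀) (u w : F) :
    ContMDiffAt 𝓘(ℝ, EM) 𝓘(ℝ, ℝ) ∞ (fun y => fibreMetric g x₀ y u w) y := by
  have h1 := ContMDiffAt.clm_bundle_apply₂ (F₁ := F) (F₂ := F) (F₃ := ℝ)
    (E₃ := Bundle.Trivial M ℝ) (b := fun y => y) (g.contMDiff y)
    (contMDiffAt_constSection hy u) (contMDiffAt_constSection hy w)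
  simp only [contMDiffAt_totalSpace] at h1
  exact h1.2

theorem contDiffAt_comp_extChartAt_symm {G : Type*} [NormedAddCommGroup G] [NormedSpace ℝ G]
    {x₀ y : M} (hy : y ∈ (chartAt EM x₀).source) {f : M → G}
    (hf : ContMDiffAt 𝓘(ℝ, EM) 𝓘(ℝ, G) ∞ f y) :
    ContDiffAt ℝ ∞ (fun z => f ((extChartAt 𝓘(ℝ, EM) x₀).symm z)) (extChartAt 𝓘(ℝ, EM) x₀ y) := by
  have hy' : y ∈ (extChartAt 𝓘(ℝ, EM) x₀).source := by rwa [extChartAt_source]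
  rw [← contMDiffAt_iff_contDiffAt]
  have h1 := (contMDiffOn_extChartAt_symm (I := 𝓘(ℝ, EM)) (n := ∞) x₀).contMDiffAt
    (extChartAt_target_mem_nhds' ((extChartAt 𝓘(ℝ, EM) x₀).map_source hy'))
  refine ContMDiffAt.comp (g := f) _ ?_ h1
  rwa [(extChartAt 𝓘(ℝ, EM) x₀).left_inv hy']

theorem contMDiffAt_of_comp_extChartAt_symm {G : Type*} [NormedAddCommGroup G] [NormedSpace ℝ G]
    {x₀ y : M} (hy : y ∈ (chartAt EM x₀).source) {f : M → G}
    (hf : ContDiffAt ℝ ∞ (fun z => f ((extChartAt 𝓘(ℝ, EM) x₀).symm z))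
      (extChartAt 𝓘(ℝ, EM) x₀ y)) :
    ContMDiffAt 𝓘(ℝ, EM) 𝓘(ℝ, G) ∞ f y := by
  have hy' : y ∈ (extChartAt 𝓘(ℝ, EM) x₀).source := by rwa [extChartAt_source]
  rw [← contMDiffAt_iff_contDiffAt] at hf
  refine (hf.comp y (contMDiffAt_extChartAt' (n := ∞) hy)).congr_of_eventuallyEq ?_
  filter_upwards [extChartAt_source_mem_nhds' (I := 𝓘(ℝ, EM)) hy'] with y' hy'
  rw [Function.comp_apply, (extChartAt 𝓘(ℝ, EM) x₀).left_inv hy']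

/-- The metric of the bundle in the coordinates defined by the preferred chart and trivialization
at `x₀`. -/
def localMetric (x₀ : M) (z : EM) : LinearMap.BilinForm ℝ F :=
  fibreMetric g x₀ ((extChartAt 𝓘(ℝ, EM) x₀).symm z)

theorem localMetric_extChartAt {x₀ y : M} (hy : y ∈ (chartAt EM x₀).source) :
    localMetric g x₀ (extChartAt 𝓘(ℝ, EM) x₀ y) = fibreMetric g x₀ y := by
  rw [localMetric, (extChartAt 𝓘(ℝ, EM) x₀).left_inv (by rwa [extChartAt_source])]

theorem contDiffAt_localMetric {x₀ y : M} (hy : y ∈ coordDomain EM F V x₀) (u w : F) :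
    ContDiffAt ℝ ∞ (fun z => localMetric g x₀ z u w) (extChartAt 𝓘(ℝ, EM) x₀ y) :=
  contDiffAt_comp_extChartAt_symm hy.1 (contMDiffAt_fibreMetric g hy u w)

variable {g} {cov : CovariantDerivative 𝓘(ℝ, EM) F V}

theorem IsConnectionForm.apply_constSection {x₀ y : M} (hy : y ∈ coordDomain EM F V x₀)
    {Γ : EM →L[ℝ] F →L[ℝ] F} (hΓ : IsConnectionForm cov x₀ y Γ) (v : TangentSpace 𝓘(ℝ, EM) y) (u : F) :
    (trivializationAt F V x₀ (⟨y, cov (constSection F V x₀ u) y v⟩ : TotalSpace F V)).2 =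
      Γ (chartDeriv x₀ y v) u := by
  rw [hΓ _ (mdifferentiableAt_constSection hy u), (localRep_constSection hy u).fderiv_eq,
    trivialization_constSection hy]
  simp

theorem chartDeriv_surjective {x₀ y : M} (hy : y ∈ (chartAt EM x₀).source) (v : EM) :
    ∃ v' : TangentSpace 𝓘(ℝ, EM) y, chartDeriv x₀ y v' = v := by
  obtain ⟨L, hL⟩ := chartDeriv_isInvertible (EM := EM) hy
  exact ⟨L.symm v, by rw [← hL]; exact L.apply_symm_apply v⟩

theorem IsChernConnection.connectionForm_apply_I (hc : IsChernConnection g cov) {x₀ y : M}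
    (hy : y ∈ coordDomain EM F V x₀) {Γ : EM →L[ℝ] F →L[ℝ] F} (hΓ : IsConnectionForm cov x₀ y Γ)
    (v : EM) (u : F) : Γ v (Complex.I • u) = Complex.I • Γ v u := by
  obtain ⟨v, rfl⟩ := chartDeriv_surjective hy.1 v
  rw [← hΓ.apply_constSection hy, ← hΓ.apply_constSection hy]
  have h1 := hc.complex _ y v (mdifferentiableAt_constSection hy u)
  rw [show constSection F V x₀ (Complex.I • u) = fun y => Complex.I • constSection F V x₀ u y from
    funext fun y => constSection_smul x₀ _ u y, h1]
  exact (fibreEquiv x₀ hy).map_smul Complex.I _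

/-- Sections constant in a holomorphic trivialization are holomorphic, so the connection form of the
Chern connection is of type (1,0). -/
theorem IsChernConnection.connectionForm_I_smul (hc : IsChernConnection g cov) {x₀ y : M}
    (hy : y ∈ coordDomain EM F V x₀) {Γ : EM →L[ℝ] F →L[ℝ] F} (hΓ : IsConnectionForm cov x₀ y Γ)
    (v : EM) (u : F) : Γ (Complex.I • v) u = Complex.I • Γ v u := by
  have : ContMDiffVectorBundle 1 F V 𝓘(ℂ, EM) := ContMDiffVectorBundle.of_le (n := ω) (by simp)
  have : IsManifold 𝓘(ℂ, EM) 1 M := IsManifold.of_le (n := ω) (by simp)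
  obtain ⟨v, rfl⟩ := chartDeriv_surjective hy.1 v
  rw [← chartDeriv_tangentI hy.1, ← hΓ.apply_constSection hy, ← hΓ.apply_constSection hy]
  have h0 : MDifferentiableAt 𝓘(ℂ, EM) (𝓘(ℂ, EM).prod 𝓘(ℂ, F))
      (fun y => TotalSpace.mk' F y (constSection F V x₀ u y)) y := by
    rw [Trivialization.mdifferentiableAt_section_iff 𝓘(ℂ, EM) (trivializationAt F V x₀) _ hy.2]
    refine (mdifferentiableAt_const (c := u)).congr_of_eventuallyEq ?_
    filter_upwards [(isOpen_coordDomain (EM := EM) (F' := F) (W := V) x₀).mem_nhds hy] with y' hy'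
    exact trivialization_constSection hy' u
  rw [hc.holomorphic _ y v h0]
  exact (fibreEquiv x₀ hy).map_smul Complex.I _

/-- This is `∇g = 0`, evaluated on sections constant in the trivialization. -/
theorem IsChernConnection.fderiv_localMetric (hc : IsChernConnection g cov) {x₀ y : M}
    (hy : y ∈ coordDomain EM F V x₀) {Γ : EM →L[ℝ] F →L[ℝ] F} (hΓ : IsConnectionForm cov x₀ y Γ)
    (v : EM) (u w : F) :
    fderiv ℝ (fun z => localMetric g x₀ z u w) (extChartAt 𝓘(ℝ, EM) x₀ y) v =
      fibreMetric g x₀ y (Γ v u) w + fibreMetric g x₀ y u (Γ v w) := by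
  obtain ⟨v, rfl⟩ := chartDeriv_surjective hy.1 v
  have h1 := hc.metric _ _ y v (mdifferentiableAt_constSection hy u)
    (mdifferentiableAt_constSection hy w)
  have h2 := mfderiv_eq_fderiv_comp_extChartAt_symm hy.1
    ((contMDiffAt_fibreMetric g hy u w).mdifferentiableAt (by simp)) v
  refine h2.symm.trans (Eq.trans h1 ?_)
  rw [← fibreMetric_trivialization g hy, ← fibreMetric_trivialization g hy,
    hΓ.apply_constSection hy, hΓ.apply_constSection hy, trivialization_constSection hy,
    trivialization_constSection hy]

end LocalMetric

/-! ### The frame of a potential takes the twisted connection to `∂̄` -/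

noncomputable section LocalFrames

set_option linter.unusedSectionVars false

section RealEnd
variable {W : Type*} [AddCommGroup W] [Module ℂ W] [FiniteDimensional ℝ W]

theorem cplxConj_smul (c : ℂ) (z : Cplx W) :
    cplxConj W (c • z) = (starRingEnd ℂ) c • cplxConj W z := by
  induction z using TensorProduct.induction_on with
  | zero => simp
  | tmul a w => simp [cplxConj, TensorProduct.smul_tmul']
  | add x y hx hy => rw [smul_add, map_add, hx, hy, map_add, smul_add]

theorem cplxConjEnd_smul (c : ℂ) (N : Module.End ℂ (Cplx W)) (z : Cplx W) :
    cplxConjEnd (c • N) z = (starRingEnd ℂ) c • cplxConjEnd N z := by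
  simp only [cplxConjEnd, LinearMap.comp_apply, LinearMap.restrictScalars_apply, LinearMap.smul_apply,
    cplxConj_smul]

/-- The conjugate of `-iN` is `i N̄`, so the conjugate parts cancel in the difference and only `-2i
N` remains. With `N = g⁻¹D(v)`, the endomorphism `-iN` is `g⁻¹D(iv)`, as `D` is conjugate linear;
this isolates the (0,1) part of the twist. -/
theorem cplxLift_realEnd {C : Type*} [AddCommGroup C] [Module ℂ C] (T : W →ₗ[ℝ] C)
    (N : Module.End ℂ (Cplx W)) (a : W) :
    T (realEnd (-Complex.I • N) a) - Complex.I • T (realEnd N a) =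
      (-2 * Complex.I) • cplxLift T (N (1 ⊗ₜ a)) := by
  have h : ∀ w, T w = cplxLift T (1 ⊗ₜ w) := fun w => by rw [cplxLift_tmul, one_smul]
  rw [h, h, one_tmul_realEnd, one_tmul_realEnd, cplxConjEnd_smul, LinearMap.smul_apply]
  simp only [map_add, map_smul, map_neg, Complex.conj_I, neg_neg]
  module

end RealEnd

variable {EM : Type*} [NormedAddCommGroup EM] [NormedSpace ℂ EM] [FiniteDimensional ℂ EM]
  {M : Type*} [TopologicalSpace M] [ChartedSpace EM M] [IsManifold 𝓘(ℂ, EM) ω M]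
  {F : Type*} [NormedAddCommGroup F] [NormedSpace ℂ F] [FiniteDimensional ℂ F]
  {V : M → Type*} [TopologicalSpace (TotalSpace F V)]
  [∀ x, AddCommGroup (V x)] [∀ x, Module ℂ (V x)] [∀ x, TopologicalSpace (V x)]
  [∀ x, IsTopologicalAddGroup (V x)] [∀ x, ContinuousSMul ℂ (V x)]
  [FiberBundle F V] [VectorBundle ℂ F V] [ContMDiffVectorBundle ω F V 𝓘(ℂ, EM)]
  {g : ContMDiffRiemannianMetric 𝓘(ℝ, EM) ∞ F V} {ι : Type*} [Fintype ι] (b : Module.Basis ι ℂ F)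

variable (EM F V) in
/-- The image of `coordDomain` in the chart. -/
def coordTarget (x₀ : M) : Set EM := extChartAt 𝓘(ℝ, EM) x₀ '' coordDomain EM F V x₀

theorem isOpen_coordTarget (x₀ : M) : IsOpen (coordTarget EM F V x₀) :=
  (chartAt EM x₀).isOpen_image_of_subset_source (isOpen_coordDomain x₀) Set.inter_subset_left

theorem symm_mem_of_mem_coordTarget {x₀ : M} {z : EM} (hz : z ∈ coordTarget EM F V x₀) :
    (extChartAt 𝓘(ℝ, EM) x₀).symm z ∈ coordDomain EM F V x₀ ∧
      extChartAt 𝓘(ℝ, EM) x₀ ((extChartAt 𝓘(ℝ, EM) x₀).symm z) = z := by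
  obtain ⟨y, hy, rfl⟩ := hz
  rw [(extChartAt 𝓘(ℝ, EM) x₀).left_inv (by rw [extChartAt_source]; exact hy.1)]
  exact ⟨hy, rfl⟩

variable (g) in
/-- The isometric frame defined by the metric and the potential `β`, in the coordinates at `x₀`. -/
def localFrame (x₀ : M) (β : EM → Alt2 F) (z : EM) : F →L[ℝ] F × (ι → ℂ) :=
  hermFrame b (localMetric g x₀ z) (β z)

theorem isIsometricFrame_localFrame (hg : IsHermitianMetric g) (x₀ : M) (β : EM → Alt2 F) (z : EM) :
    IsIsometricFrame (dualPairing b) (fun u w => localMetric g x₀ z u w) (localFrame g b x₀ β z) :=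
  isIsometricFrame_hermFrame b (fibreMetric_symm g x₀ _) (fibreMetric_hermitian hg x₀ _) _

theorem localMetric_pos {x₀ : M} {z : EM} (hz : z ∈ coordTarget EM F V x₀) (u : F) (hu : u ≠ 0) :
    0 < localMetric g x₀ z u u :=
  fibreMetric_pos g (symm_mem_of_mem_coordTarget hz).1 u hu

theorem isInvertible_cplxExt_localFrame (hg : IsHermitianMetric g) {x₀ : M} (β : EM → Alt2 F) {z : EM}
    (hz : z ∈ coordTarget EM F V x₀) : (cplxExt (localFrame g b x₀ β z)).IsInvertible :=
  (isIsometricFrame_localFrame b hg x₀ β z).isInvertible (localMetric_pos hz)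
    (finrank_dualPairing b)

theorem contDiffOn_localFrame {x₀ : M} {β : EM → Alt2 F} {U : Set EM}
    (hU : U ⊆ coordTarget EM F V x₀) (hβ : ∀ c, ContDiffOn ℝ ∞ (fun z => β z c) U) :
    ContDiffOn ℝ ∞ (localFrame g b x₀ β) U := by
  have : FiniteDimensional ℝ F := FiniteDimensional.complexToReal F
  have hG : ∀ u w, ContDiffOn ℝ ∞ (fun z => (localMetric g x₀ z u w : ℂ)) U := fun u w z hz => by
    obtain ⟨y, hy, rfl⟩ := hU hz
    exact (Complex.ofRealCLM.contDiff.contDiffAt.comp _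
      (contDiffAt_localMetric g hy u w)).contDiffWithinAt
  rw [contDiffOn_clm_apply]
  intro u
  refine contDiffOn_const.prodMk (contDiffOn_pi.2 fun k => ?_)
  exact (contDiffOn_const.mul ((hG _ _).sub (contDiffOn_const.mul (hG _ _)))).add (hβ _)

theorem twistedConnectionForm_apply {cov : CovariantDerivative 𝓘(ℝ, EM) F V}
    {D : Π x : M, TangentSpace 𝓘(ℂ, EM) x →ₗ⋆[ℂ] Alt2 (V x)} {x₀ y : M}
    (hy : y ∈ coordDomain EM F V x₀) {Γ Γ' : EM →L[ℝ] F →L[ℝ] F} (hΓ : IsConnectionForm cov x₀ y Γ)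
    (hΓ' : IsConnectionForm (twistedConnection g cov D) x₀ y Γ') (v : TangentSpace 𝓘(ℝ, EM) y) (u : F) :
    Γ' (chartDeriv x₀ y v) u = Γ (chartDeriv x₀ y v) u +
      fibreEquiv x₀ hy (realEnd (metricRaise g y (D y v)) (constSection F V x₀ u y)) := by
  rw [← hΓ.apply_constSection hy, ← hΓ'.apply_constSection hy]
  exact (fibreEquiv x₀ hy).map_add _ _

/-- Up to the factor `-2i` this says `∂̄T = T ∘ Γ'^{0,1}`. The Chern form has type (1,0) and
commutes with `i`, so its contribution to the right side is the Hermitian term that metric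
compatibility produces on the left. The shear gives `∂̄β = D` on the left, and `g⁻¹D` gives the same
by `cplxLift_hermFrame_raise`. -/
theorem fderiv_localFrame (hg : IsHermitianMetric g) {cov : CovariantDerivative 𝓘(ℝ, EM) F V}
    (hc : IsChernConnection g cov)
    {D : Π x : M, TangentSpace 𝓘(ℂ, EM) x →ₗ⋆[ℂ] Alt2 (V x)} {x₀ y : M}
    (hy : y ∈ coordDomain EM F V x₀) {Γ' : EM →L[ℝ] F →L[ℝ] F}
    (hΓ' : IsConnectionForm (twistedConnection g cov D) x₀ y Γ') {β : EM → Alt2 F}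
    (hβ : ∀ c, DifferentiableAt ℝ (fun z => β z c) (extChartAt 𝓘(ℝ, EM) x₀ y))
    (hT : DifferentiableAt ℝ (localFrame g b x₀ β) (extChartAt 𝓘(ℝ, EM) x₀ y))
    (hD : ∀ (v : TangentSpace 𝓘(ℝ, EM) y) (c : Fin 2 → F),
      dbarAt (fun z => β z c) (extChartAt 𝓘(ℝ, EM) x₀ y) (chartDeriv x₀ y v) =
        D y v (fun i => constSection F V x₀ (c i) y)) (v : EM) (u : F) :
    fderiv ℝ (localFrame g b x₀ β) (extChartAt 𝓘(ℝ, EM) x₀ y) (Complex.I • v) u -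
        Complex.I • fderiv ℝ (localFrame g b x₀ β) (extChartAt 𝓘(ℝ, EM) x₀ y) v u =
      localFrame g b x₀ β (extChartAt 𝓘(ℝ, EM) x₀ y) (Γ' (Complex.I • v) u) -
        Complex.I • localFrame g b x₀ β (extChartAt 𝓘(ℝ, EM) x₀ y) (Γ' v u) := by
  have := fibre_finiteDimensional F V y
  obtain ⟨Γ, hΓ⟩ := exists_isConnectionForm cov hy
  obtain ⟨v, rfl⟩ := chartDeriv_surjective hy.1 v
  set z₀ := extChartAt 𝓘(ℝ, EM) x₀ y with hz₀
  set G := fibreMetric g x₀ y with hGdef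
  have hGz : localMetric g x₀ z₀ = G := localMetric_extChartAt g hy.1
  have hG : ∀ u w, DifferentiableAt ℝ (fun z => localMetric g x₀ z u w) z₀ := fun u w =>
    (contDiffAt_localMetric g hy u w).differentiableAt (by simp)
  have hGC : ∀ u w, HasFDerivAt (fun z => (localMetric g x₀ z u w : ℂ))
      (Complex.ofRealCLM ∘L fderiv ℝ (fun z => localMetric g x₀ z u w) z₀) z₀ := fun u w =>
    Complex.ofRealCLM.hasFDerivAt.comp z₀ (hG u w).hasFDerivAt
  have hcomp : HasFDerivAt (fun z => localFrame g b x₀ β z u)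
      (ContinuousLinearMap.prod 0 (ContinuousLinearMap.pi fun k =>
        ((2⁻¹ : ℂ) • (Complex.ofRealCLM ∘L fderiv ℝ (fun z => localMetric g x₀ z u (b k)) z₀ -
          Complex.I • (Complex.ofRealCLM ∘L
            fderiv ℝ (fun z => localMetric g x₀ z u (Complex.I • b k)) z₀)) +
          fderiv ℝ (fun z => β z ![u, b k]) z₀))) z₀ := by
    refine (hasFDerivAt_const _ _).prodMk (hasFDerivAt_pi.2 fun k => ?_)
    exact (((hGC _ _).sub ((hGC _ _).const_mul Complex.I)).const_mul _).add (hβ _).hasFDerivAt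
  have hder : ∀ w : EM, fderiv ℝ (localFrame g b x₀ β) z₀ w u =
      (0, fun k => 2⁻¹ * ((fderiv ℝ (fun z => localMetric g x₀ z u (b k)) z₀ w : ℂ) -
        Complex.I * (fderiv ℝ (fun z => localMetric g x₀ z u (Complex.I • b k)) z₀ w : ℂ)) +
        fderiv ℝ (fun z => β z ![u, b k]) z₀ w) := fun w => by
    have h := DFunLike.congr_fun ((hT.hasFDerivAt.clm_apply (hasFDerivAt_const u z₀)).unique hcomp) w
    rw [add_apply, ContinuousLinearMap.comp_apply, zero_apply, map_zero, zero_add,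
      ContinuousLinearMap.flip_apply] at h
    exact h
  rw [hder, hder]
  have hcD := chartDeriv_tangentI (EM := EM) hy.1 v
  have e1 : Γ' (Complex.I • chartDeriv x₀ y v) u = Complex.I • Γ (chartDeriv x₀ y v) u +
      fibreEquiv x₀ hy (realEnd (-Complex.I • metricRaise g y (D y v)) (constSection F V x₀ u y)) := by
    rw [← hcD, twistedConnectionForm_apply hy hΓ hΓ', hcD, hc.connectionForm_I_smul hy hΓ]
    congr 4
    have h : D y (tangentI y v) = -Complex.I • D y v := by
      have := (D y).map_smulₛₗ Complex.I v
      rw [Complex.conj_I] at this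
      exact this
    exact (congrArg (metricRaise g y) h).trans (map_smul _ _ _)
  have e2 := twistedConnectionForm_apply hy hΓ hΓ' v u
  rw [e1, e2, map_add, map_add, smul_add]
  have e3 := cplxLift_realEnd ((localFrame g b x₀ β z₀).toLinearMap ∘ₗ
    (fibreEquiv x₀ hy).toLinearMap.restrictScalars ℝ) (metricRaise g y (D y v))
    (constSection F V x₀ u y)
  have e4 := cplxLift_hermFrame_raise (Q := metricForm g y) (g.pos y) b (fibreEquiv x₀ hy) (hg y)
    (G := localMetric g x₀ z₀) (fun a c => by
      rw [hGz]; exact fibreMetric_trivialization g hy a c) (β z₀) (D y v)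
    (1 ⊗ₜ constSection F V x₀ u y)
  have e5 := e3.trans (congrArg ((-2 * Complex.I) • ·) e4)
  change localFrame g b x₀ β z₀ (fibreEquiv x₀ hy (realEnd (-Complex.I • metricRaise g y (D y v))
    (constSection F V x₀ u y))) - Complex.I • localFrame g b x₀ β z₀ (fibreEquiv x₀ hy
      (realEnd (metricRaise g y (D y v)) (constSection F V x₀ u y))) = _ at e5
  -- The Chern terms and the twist terms are grouped separately; `e5` evaluates the latter.
  rw [show ∀ p q r s : F × (ι → ℂ), p + q - (r + s) = p - r + (q - s) from fun p q r s => by abel, e5]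
  set Γv := Γ (chartDeriv x₀ y v) with hΓv
  have hI := hc.connectionForm_apply_I hy hΓ
  refine Prod.ext ?_ (funext fun k => ?_)
  · change (0 : F) - Complex.I • 0 = Complex.I • Γv u - Complex.I • Γv u + (-2 * Complex.I) • 0
    simp
  · change _ - Complex.I * _ = (hermPart (localMetric g x₀ z₀) (Complex.I • Γv u) (b k) +
        β z₀ ![Complex.I • Γv u, b k]) - Complex.I * (hermPart (localMetric g x₀ z₀) (Γv u) (b k) +
        β z₀ ![Γv u, b k]) + (-2 * Complex.I) * D y v ![cplxProj (V y) (1 ⊗ₜ constSection F V x₀ u y),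
          (fibreEquiv x₀ hy).symm (b k)]
    -- By complex linearity of `β` the Chern form makes no contribution through the shear.
    have h1 : β z₀ ![Complex.I • Γv u, b k] = Complex.I * β z₀ ![Γv u, b k] := by
      rw [← alt2Bilin_apply, map_smul]; rfl
    have h2 : D y v ![cplxProj (V y) (1 ⊗ₜ constSection F V x₀ u y), (fibreEquiv x₀ hy).symm (b k)] =
        dbarAt (fun z => β z ![u, b k]) z₀ (chartDeriv x₀ y v) := by
      rw [hD, cplxProj_tmul, one_smul, fibreEquiv_symm_apply]
      congr 1
      ext i; fin_cases i <;> rfl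
    have h3 : ∀ (w : EM) (u' : F), fderiv ℝ (fun z => localMetric g x₀ z u u') z₀ w =
        G (Γ w u) u' + G u (Γ w u') := fun w u' => hc.fderiv_localMetric hy hΓ w u u'
    have hIs : ∀ w, Γ (Complex.I • chartDeriv x₀ y v) w = Complex.I • Γv w :=
      hc.connectionForm_I_smul hy hΓ _
    have hI' : ∀ w, Γv (Complex.I • w) = Complex.I • Γv w := hI _
    dsimp only
    rw [h1, h2, hermPart_apply, hermPart_apply, hGz, h3, h3, h3, h3, dbarAt, ← hΓv]
    simp only [hIs, hI']
    rw [smul_smul, Complex.I_mul_I, neg_one_smul, map_neg, smul_eq_mul, smul_eq_mul]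
    push_cast
    linear_combination (2⁻¹ * (G u (Complex.I • Γv (b k)) : ℂ) +
      fderiv ℝ (fun z => β z ![u, b k]) z₀ (Complex.I • chartDeriv x₀ y v)) * Complex.I_mul_I

end LocalFrames

/-! ### Existence of the Chern connection -/

noncomputable section ChernConnections

set_option linter.unusedSectionVars false

/-- A continuous bilinear form as a bilinear form. -/
def continuousBilinLM (E : Type*) [NormedAddCommGroup E] [NormedSpace ℝ E] :
    (E →L[ℝ] E →L[ℝ] ℝ) →ₗ[ℝ] E →ₗ[ℝ] E →ₗ[ℝ] ℝ where
  toFun L := LinearMap.mk₂ ℝ (fun u w => L u w)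
    (fun u u' w => by rw [map_add]; rfl) (fun c u w => by rw [map_smul]; rfl)
    (fun u w w' => map_add _ _ _) (fun c u w => map_smul _ _ _)
  map_add' _ _ := rfl
  map_smul' _ _ := rfl

variable {EM : Type*} [NormedAddCommGroup EM] [NormedSpace ℂ EM] [FiniteDimensional ℂ EM]
  {F : Type*} [NormedAddCommGroup F] [NormedSpace ℂ F] [FiniteDimensional ℂ F]

/-- If `θ` has these properties, then metric compatibility for `v` reads `d v u w = G (θ v u) w + G
u (θ v w)`, while for `iv` and `iw` it reads `d (iv) u (iw) = G (θ v u) w - G u (θ v w)`. Half the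
sum determines `θ`, and this formula is taken as its definition. -/
theorem exists_chernForm {G : LinearMap.BilinForm ℝ F} (hG : ∀ u w, G u w = G w u)
    (hpos : ∀ u, u ≠ 0 → 0 < G u u) (hI : ∀ u w, G (Complex.I • u) (Complex.I • w) = G u w)
    (d : EM →ₗ[ℝ] F →ₗ[ℝ] F →ₗ[ℝ] ℝ) (hd : ∀ v u w, d v u w = d v w u)
    (hdI : ∀ v u w, d v (Complex.I • u) (Complex.I • w) = d v u w) :
    ∃ θ : EM →L[ℝ] F →L[ℝ] F, (∀ v u w, G (θ v u) w + G u (θ v w) = d v u w) ∧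
      (∀ v u, θ v (Complex.I • u) = Complex.I • θ v u) ∧
      ∀ v u, θ (Complex.I • v) u = Complex.I • θ v u := by
  have : FiniteDimensional ℝ EM := FiniteDimensional.complexToReal EM
  have : FiniteDimensional ℝ F := FiniteDimensional.complexToReal F
  have hnd : G.Nondegenerate := by
    refine ⟨fun u hu => ?_, fun u hu => ?_⟩ <;> by_contra h <;> exact (hpos u h).ne' (hu u)
  have hII : ∀ u : F, Complex.I • Complex.I • u = -u := fun u => by
    rw [smul_smul, Complex.I_mul_I, neg_one_smul]
  let L : EM →ₗ[ℝ] F →ₗ[ℝ] F := LinearMap.mk₂ ℝ (fun v u => (G.toDual hnd).symm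
      ((2⁻¹ : ℝ) • (d v u + d (Complex.I • v) u ∘ₗ
        ((Complex.I • LinearMap.id : F →ₗ[ℂ] F).restrictScalars ℝ))))
    (fun v v' u => by
      rw [← map_add]; congr 1; ext w
      simp only [smul_add, map_add, LinearMap.add_apply, LinearMap.smul_apply, LinearMap.comp_apply,
        LinearMap.restrictScalars_apply, LinearMap.id_apply]
      abel)
    (fun c v u => by
      rw [← map_smul]; congr 1; ext w
      simp only [smul_comm Complex.I c, map_smul, LinearMap.add_apply, LinearMap.smul_apply,
        LinearMap.comp_apply, LinearMap.restrictScalars_apply, LinearMap.id_apply, smul_add,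
        smul_eq_mul]
      ring)
    (fun v u u' => by
      rw [← map_add]; congr 1; ext w
      simp only [smul_add, map_add, LinearMap.add_apply, LinearMap.smul_apply, LinearMap.comp_apply,
        LinearMap.restrictScalars_apply, LinearMap.id_apply]
      abel)
    (fun c v u => by
      rw [← map_smul]; congr 1; ext w
      simp only [map_smul, LinearMap.add_apply, LinearMap.smul_apply,
        LinearMap.comp_apply, LinearMap.restrictScalars_apply, LinearMap.id_apply, smul_add,
        smul_eq_mul]
      ring)
  have hL : ∀ v u w, G (L v u) w = 2⁻¹ * (d v u w + d (Complex.I • v) u (Complex.I • w)) :=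
    fun v u w => LinearMap.BilinForm.apply_toDual_symm_apply (hB := hnd) ..
  have hinj : ∀ u u', (∀ w, G u w = G u' w) → u = u' := fun u u' h => by
    rw [← sub_eq_zero]
    exact hnd.1 _ fun w => by rw [map_sub, LinearMap.sub_apply, h, sub_self]
  have hGI : ∀ u w, G (Complex.I • u) w = -G u (Complex.I • w) := fun u w => by
    have := hI u (Complex.I • w)
    rw [hII, map_neg] at this
    rw [← this, neg_neg]
  have hdI' : ∀ v u w, d v (Complex.I • u) w = -d v u (Complex.I • w) := fun v u w => by
    have := hdI v u (Complex.I • w)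
    rw [hII, map_neg] at this
    rw [← this, neg_neg]
  refine ⟨LinearMap.toContinuousLinearMap
    ((LinearMap.toContinuousLinearMap : (F →ₗ[ℝ] F) ≃ₗ[ℝ] F →L[ℝ] F).toLinearMap ∘ₗ L),
    fun v u w => ?_, fun v u => hinj _ _ fun w => ?_, fun v u => hinj _ _ fun w => ?_⟩
  · change G (L v u) w + G u (L v w) = _
    rw [hG u, hL, hL, hd v w, hd _ w, hdI']
    ring
  · change G (L v (Complex.I • u)) w = G (Complex.I • L v u) w
    rw [hGI, hL, hL, hII, map_neg, hdI', hdI]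
    ring
  · change G (L (Complex.I • v) u) w = G (Complex.I • L v u) w
    rw [hGI, hL, hL, hII, map_neg, smul_smul, Complex.I_mul_I, neg_one_smul, map_neg,
      LinearMap.neg_apply, LinearMap.neg_apply]
    ring

variable {M : Type*} [TopologicalSpace M] [ChartedSpace EM M] [IsManifold 𝓘(ℂ, EM) ω M]
  {V : M → Type*} [TopologicalSpace (TotalSpace F V)]
  [∀ x, AddCommGroup (V x)] [∀ x, Module ℂ (V x)] [∀ x, TopologicalSpace (V x)]
  [∀ x, IsTopologicalAddGroup (V x)] [∀ x, ContinuousSMul ℂ (V x)]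
  [FiberBundle F V] [VectorBundle ℂ F V] [ContMDiffVectorBundle ω F V 𝓘(ℂ, EM)]

/-- The axioms of a covariant derivative are conditions at single points, so at each `x` one may
take the flat connection of the trivialization at `x` and add the prescribed form. -/
theorem exists_covariantDerivative_isConnectionForm (θ : M → EM →L[ℝ] F →L[ℝ] F) :
    ∃ cov : CovariantDerivative 𝓘(ℝ, EM) F V, ∀ x, IsConnectionForm cov x x (θ x) := by
  have h0 : IsCovariantDerivativeOn F (fun (σ : Π x, V x) x => flatConnection EM F V x σ x)
      (Set.univ : Set M) :=
    { add := fun {σ σ' x} hσ hσ' _ =>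
        (isCovariantDerivativeOn_flatConnection (EM := EM) x).add hσ hσ' (mem_coordDomain x)
      leibniz := fun {σ f x} hσ hf _ =>
        (isCovariantDerivativeOn_flatConnection (EM := EM) x).leibniz hσ hf (mem_coordDomain x) }
  let Δ : Π x : M, V x →L[ℝ] TangentSpace 𝓘(ℝ, EM) x →L[ℝ] V x := fun x =>
    ((ContinuousLinearMap.postcomp _ ((trivializationAt F V x).symmL ℝ x)) ∘L
      (ContinuousLinearMap.precomp F (chartDeriv (EM := EM) x x))) ∘L (θ x).flip ∘L
      (trivializationAt F V x).continuousLinearMapAt ℝ x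
  refine ⟨CovariantDerivative.addOneForm ⟨_, h0⟩ Δ, fun x σ hσ v => ?_⟩
  have hx := mem_coordDomain (EM := EM) (F' := F) (W := V) x
  have h1 : CovariantDerivative.addOneForm ⟨_, h0⟩ Δ σ x v =
    flatConnection EM F V x σ x v + Δ x (σ x) v := rfl
  have h2 : Δ x (σ x) v = (trivializationAt F V x).symmL ℝ x (θ x (chartDeriv x x v)
      ((trivializationAt F V x).continuousLinearMapAt ℝ x (σ x))) := rfl
  rw [h1, trivialization_add hx, h2, flatConnection_apply, trivialization_symmL_apply hx,
    trivialization_symmL_apply hx, Trivialization.continuousLinearMapAt_apply,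
    Trivialization.coe_linearMapAt_of_mem _ hx.2]

variable (g : ContMDiffRiemannianMetric 𝓘(ℝ, EM) ∞ F V)

/-- The local metric as a continuous bilinear form. -/
def localMetricL (x₀ : M) (z : EM) : F →L[ℝ] F →L[ℝ] ℝ :=
  haveI : FiniteDimensional ℝ F := FiniteDimensional.complexToReal F
  LinearMap.toContinuousLinearMap
    ((LinearMap.toContinuousLinearMap : (F →ₗ[ℝ] ℝ) ≃ₗ[ℝ] F →L[ℝ] ℝ).toLinearMap ∘ₗ
      localMetric g x₀ z)

theorem localMetricL_apply (x₀ : M) (z : EM) (u w : F) :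
    localMetricL g x₀ z u w = localMetric g x₀ z u w := rfl

theorem differentiableAt_localMetricL {x₀ y : M} (hy : y ∈ coordDomain EM F V x₀) :
    DifferentiableAt ℝ (localMetricL g x₀) (extChartAt 𝓘(ℝ, EM) x₀ y) := by
  have : FiniteDimensional ℝ F := FiniteDimensional.complexToReal F
  have h : ContDiffOn ℝ ∞ (localMetricL g x₀) (coordTarget EM F V x₀) := by
    rw [contDiffOn_clm_apply]
    intro u
    rw [contDiffOn_clm_apply]
    rintro w _ ⟨y, hy, rfl⟩
    exact (contDiffAt_localMetric g hy u w).contDiffWithinAt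
  exact (h.contDiffAt ((isOpen_coordTarget x₀).mem_nhds ⟨y, hy, rfl⟩)).differentiableAt (by simp)

-- Everything is checked at `x` in the trivialization at `x`, where the three properties of `θ` from
-- `exists_chernForm` become the three properties of the Chern connection.
variable {g} in
theorem exists_isChernConnection (hg : IsHermitianMetric g) :
    ∃ cov : CovariantDerivative 𝓘(ℝ, EM) F V, IsChernConnection g cov := by
  have : ContMDiffVectorBundle 1 F V 𝓘(ℂ, EM) := ContMDiffVectorBundle.of_le (n := ω) (by simp)
  have : IsManifold 𝓘(ℂ, EM) 1 M := IsManifold.of_le (n := ω) (by simp)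
  have hdiff := fun x : M => differentiableAt_localMetricL g (mem_coordDomain (EM := EM) (F' := F) (W := V) x)
  have hd : ∀ (x : M) v u w, fderiv ℝ (localMetricL g x) (extChartAt 𝓘(ℝ, EM) x x) v u w =
      fderiv ℝ (fun z => localMetric g x z u w) (extChartAt 𝓘(ℝ, EM) x x) v := fun x v u w => by
    have h := (((hdiff x).hasFDerivAt.clm_apply (hasFDerivAt_const u _)).clm_apply
      (hasFDerivAt_const w _)).fderiv
    refine Eq.trans ?_ (DFunLike.congr_fun h v).symm
    simp
  have key : ∀ x : M, ∃ θ : EM →L[ℝ] F →L[ℝ] F,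
      (∀ v u w, fibreMetric g x x (θ v u) w + fibreMetric g x x u (θ v w) =
        fderiv ℝ (localMetricL g x) (extChartAt 𝓘(ℝ, EM) x x) v u w) ∧
      (∀ v u, θ v (Complex.I • u) = Complex.I • θ v u) ∧
      ∀ v u, θ (Complex.I • v) u = Complex.I • θ v u := fun x => by
    refine exists_chernForm (fibreMetric_symm g x x) (fibreMetric_pos g (mem_coordDomain x))
      (fibreMetric_hermitian hg x x)
      (continuousBilinLM F ∘ₗ (fderiv ℝ (localMetricL g x) (extChartAt 𝓘(ℝ, EM) x x)).toLinearMap)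
      (fun v u w => ?_) fun v u w => ?_
    · refine (hd x v _ _).trans (Eq.trans ?_ (hd x v _ _).symm)
      simp only [localMetric, fibreMetric_symm g x _ u w]
    · refine (hd x v _ _).trans (Eq.trans ?_ (hd x v _ _).symm)
      simp only [localMetric, fibreMetric_hermitian hg x _ u w]
  choose θ h1 h2 h3 using key
  obtain ⟨cov, hcov⟩ := exists_covariantDerivative_isConnectionForm (V := V) θ
  refine ⟨cov, fun σ τ x v hσ hτ => ?_, fun σ x v hσ => ?_, fun σ x v hσ => ?_⟩
  · have hx := mem_coordDomain (EM := EM) (F' := F) (W := V) x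
    have e1 := (mdifferentiableAt_section_iff_localRep hx σ).1 hσ
    have e2 := (mdifferentiableAt_section_iff_localRep hx τ).1 hτ
    have e3 : (fun z => g.inner ((extChartAt 𝓘(ℝ, EM) x).symm z) (σ ((extChartAt 𝓘(ℝ, EM) x).symm z))
        (τ ((extChartAt 𝓘(ℝ, EM) x).symm z))) =ᶠ[𝓝 (extChartAt 𝓘(ℝ, EM) x x)]
        fun z => localMetricL g x z (localRep EM F x σ z) (localRep EM F x τ z) := by
      filter_upwards [eventually_mem_coordDomain hx] with z hz
      exact (fibreMetric_trivialization g hz _ _).symm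
    have e6 := fibreMetric_trivialization g hx (cov σ x v) (τ x)
    have e7 := fibreMetric_trivialization g hx (σ x) (cov τ x v)
    have e4 := ((hdiff x).hasFDerivAt.clm_apply e1.hasFDerivAt).clm_apply e2.hasFDerivAt
    have e5 : MDifferentiableAt 𝓘(ℝ, EM) 𝓘(ℝ, ℝ) (fun y => g.inner y (σ y) (τ y)) x :=
      (mdifferentiableAt_iff_comp_extChartAt_symm hx.1 _).2
        (e4.differentiableAt.congr_of_eventuallyEq e3)
    refine (mfderiv_eq_fderiv_comp_extChartAt_symm hx.1 e5 v).trans ?_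
    rw [e3.fderiv_eq, e4.fderiv, ← e6, ← e7, hcov x σ hσ, hcov x τ hτ, map_add, map_add, LinearMap.add_apply]
    simp only [add_apply, ContinuousLinearMap.comp_apply, ContinuousLinearMap.flip_apply,
      localMetricL_apply, localMetric_extChartAt g hx.1, localRep_apply hx]
    rw [← h1]
    exact (fun a b c d => by ring : ∀ a b c d : ℝ, a + (b + (c + d)) = b + c + (a + d)) _ _ _ _
  · have hx := mem_coordDomain (EM := EM) (F' := F) (W := V) x
    have e1 := (mdifferentiableAt_section_iff_localRep hx σ).1 hσ
    have e0 : ∀ {y} (hy : y ∈ coordDomain EM F V x) (a : V y),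
        (trivializationAt F V x (⟨y, Complex.I • a⟩ : TotalSpace F V)).2 =
        Complex.I • (trivializationAt F V x (⟨y, a⟩ : TotalSpace F V)).2 := fun hy a =>
      (fibreEquiv x hy).map_smul Complex.I a
    have e2 : localRep EM F x (fun y => Complex.I • σ y) =ᶠ[𝓝 (extChartAt 𝓘(ℝ, EM) x x)]
        fun z => Complex.I • localRep EM F x σ z := by
      filter_upwards [eventually_mem_coordDomain hx] with z hz
      exact e0 hz _
    have e3 : HasFDerivAt (fun z => Complex.I • localRep EM F x σ z) _ _ :=
      e1.hasFDerivAt.const_smul Complex.I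
    have e4 : MDifferentiableAt 𝓘(ℝ, EM) (𝓘(ℝ, EM).prod 𝓘(ℝ, F))
        (fun y => TotalSpace.mk' F y (Complex.I • σ y)) x :=
      (mdifferentiableAt_section_iff_localRep hx _).2
        (e3.differentiableAt.congr_of_eventuallyEq e2)
    apply (fibreEquiv x hx).injective
    rw [map_smul, fibreEquiv_apply, fibreEquiv_apply, hcov x _ e4, hcov x _ hσ, e2.fderiv_eq,
      e3.fderiv, e0 hx, h2, smul_add]
    rfl
  · have hx := mem_coordDomain (EM := EM) (F' := F) (W := V) x
    rw [Trivialization.mdifferentiableAt_section_iff 𝓘(ℂ, EM) (trivializationAt F V x) _ hx.2] at hσ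
    obtain ⟨L, hL⟩ := exists_hasMFDerivAt_restrictScalars hσ
    have e1 := hL.mdifferentiableAt
    have e2 : ∀ v : TangentSpace 𝓘(ℝ, EM) x, fderiv ℝ (localRep EM F x σ) (extChartAt 𝓘(ℝ, EM) x x)
        (chartDeriv x x v) = L v := fun v =>
      (mfderiv_eq_fderiv_comp_extChartAt_symm hx.1 e1 v).symm.trans (DFunLike.congr_fun hL.mfderiv v)
    have e4 : MDifferentiableAt 𝓘(ℝ, EM) (𝓘(ℝ, EM).prod 𝓘(ℝ, F))
        (fun y => TotalSpace.mk' F y (σ y)) x :=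
      (mdifferentiableAt_section_iff_localRep hx _).2
        ((mdifferentiableAt_iff_comp_extChartAt_symm hx.1 _).1 e1)
    apply (fibreEquiv x hx).injective
    rw [map_smul, fibreEquiv_apply, fibreEquiv_apply, hcov x _ e4, hcov x _ e4, e2, e2,
      chartDeriv_tangentI hx.1, h3, smul_add]
    congr 1
    exact L.map_smul Complex.I v

end ChernConnections

/-! ### Holomorphic changes of frames and charts -/

noncomputable section CoordinateChanges

set_option linter.unusedSectionVars false

theorem contDiffAt_clm_of_apply {E F' G : Type*} [NormedAddCommGroup E] [NormedSpace ℝ E]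
    [NormedAddCommGroup F'] [NormedSpace ℝ F'] [NormedAddCommGroup G] [NormedSpace ℝ G]
    [FiniteDimensional ℝ F'] {f : E → F' →L[ℝ] G} {x : E} {n : ℕ∞ω}
    (h : ∀ u, ContDiffAt ℝ n (fun z => f z u) x) : ContDiffAt ℝ n f x := by
  let d := Module.finrank ℝ F'
  have hd : d = Module.finrank ℝ (Fin d → ℝ) := (Module.finrank_fin_fun ℝ).symm
  let e₁ := ContinuousLinearEquiv.ofFinrankEq hd
  let e₂ := (e₁.arrowCongr (1 : G ≃L[ℝ] G)).trans (ContinuousLinearEquiv.piRing (Fin d))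
  rw [← Function.id_comp f, ← e₂.symm_comp_self]
  exact e₂.symm.contDiff.contDiffAt.comp x (contDiffAt_pi.mpr fun i => h _)

section Analysis

variable {E : Type*} [NormedAddCommGroup E] [NormedSpace ℂ E]
  {B : Type*} [NormedAddCommGroup B] [NormedSpace ℂ B]
  {G : Type*} [NormedAddCommGroup G] [NormedSpace ℂ G]

theorem hasFDerivAt_holomorphic_apply {q : E → B →L[ℂ] G} {p : E → B} {x : E}
    (hq : DifferentiableAt ℂ q x) (hp : DifferentiableAt ℝ p x) :
    ∃ L : E →L[ℝ] G, HasFDerivAt (fun z => q z (p z)) L x ∧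
      ∀ w, L w = fderiv ℂ q x w (p x) + q x (fderiv ℝ p x w) := by
  have h1 := ((ContinuousLinearMap.restrictScalarsL ℂ B G ℝ ℝ).hasFDerivAt (x := q x)).comp x
    (hq.hasFDerivAt.restrictScalars ℝ)
  refine ⟨_, h1.clm_apply hp.hasFDerivAt, fun w => ?_⟩
  rw [add_comm]
  rfl

/-- In the Leibniz rule the derivative of the holomorphic coefficient is complex linear and drops
out of the (0,1) part. -/
theorem dbarAt_holomorphic_apply {q : E → B →L[ℂ] G} {p : E → B} {x : E}
    (hq : DifferentiableAt ℂ q x) (hp : DifferentiableAt ℝ p x) (w : E) :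
    dbarAt (fun z => q z (p z)) x w = q x (dbarAt p x w) := by
  obtain ⟨L, hL, hL'⟩ := hasFDerivAt_holomorphic_apply hq hp
  have e1 : fderiv ℂ q x (Complex.I • w) = Complex.I • fderiv ℂ q x w := map_smul _ _ _
  have e2 : ∀ (c : ℂ) b, q x (c • b) = c • q x b := fun c b => map_smul _ _ _
  rw [dbarAt, dbarAt, hL.fderiv, hL', hL', e1, e2, map_add, e2, smul_apply,
    smul_add Complex.I, smul_smul Complex.I Complex.I, Complex.I_mul_I]
  module

/-- Here `P` is conjugate linear at `x`, so the derivative of the holomorphic family `t` survives in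
the (0,1) part. The extra term is harmless for closedness if `fderiv ℂ t x` is symmetric. -/
theorem dbarAt_apply_holomorphic {P : E → E →L[ℝ] B} {t : E → E →L[ℂ] E} {x : E}
    (hP : DifferentiableAt ℝ P x) (ht : DifferentiableAt ℂ t x)
    (hI : ∀ u, P x (Complex.I • u) = -(Complex.I • P x u)) (v w : E) :
    DifferentiableAt ℝ (fun z => P z (t z v)) x ∧ dbarAt (fun z => P z (t z v)) x w =
      dbarAt (fun z => P z (t x v)) x w + P x (fderiv ℂ t x w v) := by
  have h1 : HasFDerivAt (fun z => t z v) ((fderiv ℂ t x).flip v) x := by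
    have := ht.hasFDerivAt.clm_apply (hasFDerivAt_const v x)
    simpa using this
  have h2 := hP.hasFDerivAt.clm_apply (h1.restrictScalars ℝ)
  have h3 := (hP.hasFDerivAt.clm_apply (hasFDerivAt_const (t x v) x))
  refine ⟨h2.differentiableAt, ?_⟩
  have e : ∀ w, fderiv ℝ (fun z => P z (t z v)) x w =
      fderiv ℝ (fun z => P z (t x v)) x w + P x (fderiv ℂ t x w v) := fun w => by
    rw [h2.fderiv, h3.fderiv]
    simp [add_comm]
  have e1 : fderiv ℂ t x (Complex.I • w) = Complex.I • fderiv ℂ t x w := map_smul _ _ _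
  rw [dbarAt, e, e, e1, smul_apply, hI, smul_add Complex.I, smul_neg, smul_smul Complex.I Complex.I,
    Complex.I_mul_I, dbarAt]
  module

end Analysis

variable {EM : Type*} [NormedAddCommGroup EM] [NormedSpace ℂ EM] [FiniteDimensional ℂ EM]
  {M : Type*} [TopologicalSpace M] [ChartedSpace EM M] [IsManifold 𝓘(ℂ, EM) ω M]
  {F : Type*} [NormedAddCommGroup F] [NormedSpace ℂ F] [FiniteDimensional ℂ F]
  {V : M → Type*} [TopologicalSpace (TotalSpace F V)]
  [∀ x, AddCommGroup (V x)] [∀ x, Module ℂ (V x)] [∀ x, TopologicalSpace (V x)]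
  [∀ x, IsTopologicalAddGroup (V x)] [∀ x, ContinuousSMul ℂ (V x)]
  [FiberBundle F V] [VectorBundle ℂ F V] [ContMDiffVectorBundle ω F V 𝓘(ℂ, EM)]

theorem contDiffAt_comp_extChartAt_symm_complex {G : Type*} [NormedAddCommGroup G] [NormedSpace ℂ G]
    {x₀ y : M} (hy : y ∈ (chartAt EM x₀).source) {f : M → G}
    (hf : ContMDiffAt 𝓘(ℂ, EM) 𝓘(ℂ, G) ω f y) :
    ContDiffAt ℂ ω (fun z => f ((extChartAt 𝓘(ℂ, EM) x₀).symm z)) (extChartAt 𝓘(ℂ, EM) x₀ y) := by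
  have hy' : y ∈ (extChartAt 𝓘(ℂ, EM) x₀).source := by rwa [extChartAt_source]
  rw [← contMDiffAt_iff_contDiffAt]
  have h1 := (contMDiffOn_extChartAt_symm (I := 𝓘(ℂ, EM)) (n := ω) x₀).contMDiffAt
    (extChartAt_target_mem_nhds' ((extChartAt 𝓘(ℂ, EM) x₀).map_source hy'))
  refine ContMDiffAt.comp (g := f) _ ?_ h1
  rwa [(extChartAt 𝓘(ℂ, EM) x₀).left_inv hy']

theorem exists_frameChange {x₀ y : M} (hy : y ∈ coordDomain EM F V x₀) :
    ∃ h : EM → F →L[ℂ] F, ContDiffAt ℂ ω h (extChartAt 𝓘(ℝ, EM) x₀ y) ∧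
      ∀ᶠ z in 𝓝 (extChartAt 𝓘(ℝ, EM) x₀ y), ∀ u,
        constSection F V x₀ u ((extChartAt 𝓘(ℝ, EM) x₀).symm z) =
          constSection F V y (h z u) ((extChartAt 𝓘(ℝ, EM) x₀).symm z) := by
  refine ⟨fun z => ((trivializationAt F V x₀).coordChangeL ℂ (trivializationAt F V y)
      ((extChartAt 𝓘(ℝ, EM) x₀).symm z) : F →L[ℂ] F), ?_, ?_⟩
  · have h1 := contMDiffAt_coordChangeL (n := ω) (IB := 𝓘(ℂ, EM)) (e := trivializationAt F V x₀)
      (e' := trivializationAt F V y) hy.2 (mem_coordDomain (EM := EM) (F' := F) (W := V) y).2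
    exact contDiffAt_comp_extChartAt_symm_complex hy.1 h1
  · filter_upwards [eventually_mem_coordDomain hy, eventually_extChartAt_symm hy.1
      ((isOpen_coordDomain (EM := EM) (F' := F) (W := V) y).mem_nhds (mem_coordDomain y))] with z h1 h2 u
    have h3 := Trivialization.coordChangeL_apply (R := ℂ) (trivializationAt F V x₀)
      (trivializationAt F V y) ⟨h1.2, h2.2⟩ u
    rw [← Trivialization.symmₗ_apply (R := ℂ) _ h1.2] at h3
    refine (constSection_trivialization h2 _).symm.trans ?_
    exact congrArg (fun u => constSection F V y u _) h3.symm

theorem mem_coordDomain_tangent {x₀ y : M} : y ∈ coordDomain EM EM (TangentSpace 𝓘(ℂ, EM)) x₀ ↔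
    y ∈ (chartAt EM x₀).source := by
  rw [coordDomain, TangentBundle.trivializationAt_baseSet, Set.inter_self]

theorem tangent_trivialization_eq {x₀ y : M} (hy : y ∈ (chartAt EM x₀).source)
    (v : TangentSpace 𝓘(ℂ, EM) y) :
    (trivializationAt EM (TangentSpace 𝓘(ℂ, EM)) x₀
      (⟨y, v⟩ : TotalSpace EM (TangentSpace 𝓘(ℂ, EM) : M → Type _))).2 =
      chartDeriv (EM := EM) x₀ y v := by
  have : IsManifold 𝓘(ℂ, EM) 1 M := IsManifold.of_le (n := ω) (by simp)
  have h2 := TangentBundle.continuousLinearMapAt_trivializationAt (I := 𝓘(ℂ, EM)) hy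
  have h3 := (trivializationAt EM (TangentSpace 𝓘(ℂ, EM) : M → Type _) x₀).coe_linearMapAt_of_mem
    (R := ℂ) (mem_coordDomain_tangent.2 hy).2
  have h4 := (mdifferentiableAt_extChartAt (I := 𝓘(ℂ, EM)) hy).hasMFDerivAt
  have h5 : HasMFDerivAt 𝓘(ℝ, EM) 𝓘(ℝ, EM) (extChartAt 𝓘(ℝ, EM) x₀) y
      ((mfderiv 𝓘(ℂ, EM) 𝓘(ℂ, EM) (extChartAt 𝓘(ℂ, EM) x₀) y : EM →L[ℂ] EM).restrictScalars ℝ) :=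
    ⟨h4.1, HasFDerivWithinAt.restrictScalars ℝ h4.2⟩
  have h6 := DFunLike.congr_fun h5.mfderiv v
  refine Eq.trans ?_ h6.symm
  exact (congrFun h3 v).symm.trans (DFunLike.congr_fun h2 v)

theorem chartDeriv_constSection {x₀ y : M} (hy : y ∈ (chartAt EM x₀).source) (v : EM) :
    chartDeriv (EM := EM) x₀ y (constSection EM (TangentSpace 𝓘(ℂ, EM)) x₀ v y) = v := by
  rw [← tangent_trivialization_eq hy]
  exact trivialization_constSection (EM := EM) (mem_coordDomain_tangent.2 hy) v

theorem constSection_chartDeriv {x₀ y : M} (hy : y ∈ (chartAt EM x₀).source)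
    (v : TangentSpace 𝓘(ℂ, EM) y) :
    constSection EM (TangentSpace 𝓘(ℂ, EM)) x₀ (chartDeriv (EM := EM) x₀ y v) y = v := by
  rw [← tangent_trivialization_eq hy]
  exact constSection_trivialization (EM := EM) (mem_coordDomain_tangent.2 hy) v

/-- The frame change is the derivative of the transition map between the charts. So its own
derivative is a second derivative, hence symmetric. -/
theorem exists_tangentFrameChange {x₀ y : M} (hy : y ∈ (chartAt EM x₀).source) :
    ∃ t : EM → EM →L[ℂ] EM, ContDiffAt ℂ ω t (extChartAt 𝓘(ℝ, EM) x₀ y) ∧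
      (∀ v w, fderiv ℂ t (extChartAt 𝓘(ℝ, EM) x₀ y) v w = fderiv ℂ t (extChartAt 𝓘(ℝ, EM) x₀ y) w v) ∧
      ∀ᶠ z in 𝓝 (extChartAt 𝓘(ℝ, EM) x₀ y), ∀ u,
        constSection EM (TangentSpace 𝓘(ℂ, EM)) x₀ u ((extChartAt 𝓘(ℝ, EM) x₀).symm z) =
          constSection EM (TangentSpace 𝓘(ℂ, EM)) y (t z u) ((extChartAt 𝓘(ℝ, EM) x₀).symm z) := by
  have : IsManifold 𝓘(ℂ, EM) 1 M := IsManifold.of_le (n := ω) (by simp)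
  let τ : EM → EM := fun z => extChartAt 𝓘(ℂ, EM) y ((extChartAt 𝓘(ℂ, EM) x₀).symm z)
  have hτ : ContDiffAt ℂ ω τ (extChartAt 𝓘(ℂ, EM) x₀ y) :=
    contDiffAt_comp_extChartAt_symm_complex hy (contMDiffAt_extChartAt (n := ω))
  refine ⟨fderiv ℂ τ, hτ.fderiv_right (m := ω) (by simp),
    fun v w => hτ.isSymmSndFDerivAt (by simp) v w, ?_⟩
  have hy2 : y ∈ (extChartAt 𝓘(ℝ, EM) x₀).source := by rwa [extChartAt_source]
  filter_upwards [eventually_extChartAt_symm hy ((chartAt EM x₀).open_source.mem_nhds hy),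
    eventually_extChartAt_symm hy
      ((chartAt EM y).open_source.mem_nhds (mem_chart_source EM y)),
    extChartAt_target_mem_nhds' ((extChartAt 𝓘(ℝ, EM) x₀).map_source hy2)] with z h1 h2 h3 u
  set y' := (extChartAt 𝓘(ℝ, EM) x₀).symm z with hy'
  have hz : z = extChartAt 𝓘(ℝ, EM) x₀ y' := ((extChartAt 𝓘(ℝ, EM) x₀).right_inv h3).symm
  rw [← constSection_chartDeriv h2 (constSection EM (TangentSpace 𝓘(ℂ, EM)) x₀ u y')]
  congr 1
  set w := constSection EM (TangentSpace 𝓘(ℂ, EM)) x₀ u y'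
  have hu : u = chartDeriv (EM := EM) x₀ y' w := (chartDeriv_constSection h1 u).symm
  have hd : MDifferentiableAt 𝓘(ℝ, EM) 𝓘(ℝ, EM) (extChartAt 𝓘(ℝ, EM) y) y' :=
    mdifferentiableAt_extChartAt_real h2
  have h4 := mfderiv_eq_fderiv_comp_extChartAt_symm (EM := EM) h1 hd w
  have h5 : ContDiffAt ℂ ω τ (extChartAt 𝓘(ℂ, EM) x₀ y') :=
    contDiffAt_comp_extChartAt_symm_complex h1 (contMDiffAt_extChartAt' (n := ω) h2)
  have h6 := (h5.differentiableAt (by simp)).fderiv_restrictScalars ℝ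
  refine h4.trans ?_
  rw [hu, hz]
  exact DFunLike.congr_fun h6 (chartDeriv x₀ y' w)

end CoordinateChanges

/-! ### Sections and forms in frames away from their centre; potentials -/

noncomputable section FormCoordinates

set_option linter.unusedSectionVars false

section Alternating

variable {F : Type*} [NormedAddCommGroup F] [NormedSpace ℂ F] [FiniteDimensional ℂ F]
  {ι : Type*} [Fintype ι] (b : Module.Basis ι ℂ F)

/-- The matrix of an alternating form. -/
def alt2Coef : Alt2 F →ₗ[ℂ] (ι × ι → ℂ) where
  toFun s p := s ![b p.1, b p.2]
  map_add' _ _ := rfl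
  map_smul' _ _ := rfl

/-- The value on `c` of the form with a given matrix. -/
def alt2Eval (c : Fin 2 → F) : (ι × ι → ℂ) →L[ℂ] ℂ :=
  ∑ p : ι × ι, (b.repr (c 0) p.1 * b.repr (c 1) p.2) • ContinuousLinearMap.proj p

theorem alt2Eval_alt2Coef (c : Fin 2 → F) (s : Alt2 F) : alt2Eval b c (alt2Coef b s) = s c := by
  have h1 : s c = alt2Bilin s (c 0) (c 1) := by
    rw [alt2Bilin_apply]; congr 1; ext i; fin_cases i <;> rfl
  rw [h1, ← LinearMap.sum_repr_mul_repr_mul b b, Finsupp.sum_fintype _ _ (by simp)]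
  simp only [Finsupp.sum_fintype, alt2Eval, sum_apply, smul_apply,
    ContinuousLinearMap.proj_apply, smul_eq_mul, alt2Coef, LinearMap.coe_mk, AddHom.coe_mk,
    Fintype.sum_prod_type, zero_mul, mul_zero, implies_true, alt2Bilin_apply]
  refine Finset.sum_congr rfl fun i _ => Finset.sum_congr rfl fun j _ => ?_
  ring

theorem contDiffAt_alt2Eval {E : Type*} [NormedAddCommGroup E] [NormedSpace ℂ E]
    {h : E → F →L[ℂ] F} {x : E} (hh : ContDiffAt ℂ ω h x) (c : Fin 2 → F) :
    ContDiffAt ℂ ω (fun z => alt2Eval b (fun i => h z (c i))) x := by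
  have h1 : ∀ i k, ContDiffAt ℂ ω (fun z => b.repr (h z (c i)) k) x := fun i k =>
    (LinearMap.toContinuousLinearMap (b.coord k)).contDiff.contDiffAt.comp x
      (hh.clm_apply contDiffAt_const)
  exact ContDiffAt.sum fun p _ => ((h1 0 p.1).mul (h1 1 p.2)).smul contDiffAt_const

end Alternating

variable {EM : Type*} [NormedAddCommGroup EM] [NormedSpace ℂ EM] [FiniteDimensional ℂ EM]
  {M : Type*} [TopologicalSpace M] [ChartedSpace EM M] [IsManifold 𝓘(ℂ, EM) ω M]
  {F : Type*} [NormedAddCommGroup F] [NormedSpace ℂ F] [FiniteDimensional ℂ F]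
  {V : M → Type*} [TopologicalSpace (TotalSpace F V)]
  [∀ x, AddCommGroup (V x)] [∀ x, Module ℂ (V x)] [∀ x, TopologicalSpace (V x)]
  [∀ x, IsTopologicalAddGroup (V x)] [∀ x, ContinuousSMul ℂ (V x)]
  [FiberBundle F V] [VectorBundle ℂ F V] [ContMDiffVectorBundle ω F V 𝓘(ℂ, EM)]

theorem frameExt_apply (x y : M) (a : V x) : frameExt F V x y a =
    constSection F V x ((trivializationAt F V x).linearMapAt ℂ x a) y := rfl

theorem linearMapAt_constSection (x : M) (u : F) :
    (trivializationAt F V x).linearMapAt ℂ x (constSection F V x u x) = u := by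
  have hx : x ∈ (trivializationAt F V x).baseSet := FiberBundle.mem_baseSet_trivializationAt' x
  rw [Trivialization.coe_linearMapAt_of_mem _ hx, constSection, Trivialization.symmₗ_apply _ hx]
  exact congrArg Prod.snd (Trivialization.apply_mk_symm _ hx u)

theorem frameExt_constSection (x y : M) (u : F) :
    frameExt F V x y (constSection F V x u x) = constSection F V x u y := by
  rw [frameExt_apply, linearMapAt_constSection]

/-- A section of `Λ²E^{*1,0}` in the trivialization at `x₀`. -/
def sectionCoord (B : Π x, Alt2 (V x)) (x₀ y : M) : Alt2 F :=
  (B y).compLinearMap (constSectionₗ F V x₀ y)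

theorem sectionCoord_apply (B : Π x, Alt2 (V x)) (x₀ y : M) (c : Fin 2 → F) :
    sectionCoord B x₀ y c = B y fun i => constSection F V x₀ (c i) y := rfl

/-- A `(0,1)`-form with values in `Λ²E^{*1,0}` in the trivializations at `x₀`. -/
def formCoord (D : Π x : M, TangentSpace 𝓘(ℂ, EM) x →ₗ⋆[ℂ] Alt2 (V x)) (x₀ y : M) :
    EM →ₗ⋆[ℂ] Alt2 F where
  toFun v := (D y (constSection EM (TangentSpace 𝓘(ℂ, EM)) x₀ v y)).compLinearMap
    (constSectionₗ F V x₀ y)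
  map_add' v w := by
    have h : constSection EM (TangentSpace 𝓘(ℂ, EM)) x₀ (v + w) y =
      constSection EM (TangentSpace 𝓘(ℂ, EM)) x₀ v y + constSection EM (TangentSpace 𝓘(ℂ, EM)) x₀ w y :=
      (constSectionₗ EM (TangentSpace 𝓘(ℂ, EM)) x₀ y).map_add v w
    rw [h, map_add]; rfl
  map_smul' k v := by
    rw [constSection_smul, LinearMap.map_smulₛₗ]; rfl

theorem formCoord_apply (D : Π x : M, TangentSpace 𝓘(ℂ, EM) x →ₗ⋆[ℂ] Alt2 (V x)) (x₀ y : M) (v : EM)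
    (c : Fin 2 → F) : formCoord D x₀ y v c =
      D y (constSection EM (TangentSpace 𝓘(ℂ, EM)) x₀ v y) fun i => constSection F V x₀ (c i) y := rfl

theorem mem_smoothSections_iff {B : Π x, Alt2 (V x)} : B ∈ smoothSections EM F V ↔
    ∀ (x : M) (c : Fin 2 → F),
      ContMDiffAt 𝓘(ℝ, EM) 𝓘(ℝ, ℂ) ∞ (fun y => sectionCoord B x y c) x := by
  refine ⟨fun h x c => ?_, fun h x c => h x _⟩
  have h1 := h x fun i => constSection F V x (c i) x
  simp only [frameExt_constSection] at h1
  exact h1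

theorem mem_smoothForms_iff {D : Π x : M, TangentSpace 𝓘(ℂ, EM) x →ₗ⋆[ℂ] Alt2 (V x)} :
    D ∈ smoothForms EM F V ↔ ∀ (x : M) (v : EM) (c : Fin 2 → F),
      ContMDiffAt 𝓘(ℝ, EM) 𝓘(ℝ, ℂ) ∞ (fun y => formCoord D x y v c) x := by
  refine ⟨fun h x v c => ?_, fun h x v c => h x _ _⟩
  have h1 := h x (constSection EM (TangentSpace 𝓘(ℂ, EM)) x v x) fun i => constSection F V x (c i) x
  simp only [frameExt_constSection] at h1
  exact h1

theorem dbarFun_eq_dbarAt {f : M → ℂ} {x₀ y : M} (hy : y ∈ (chartAt EM x₀).source)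
    (hf : MDifferentiableAt 𝓘(ℝ, EM) 𝓘(ℝ, ℂ) f y) (v : TangentSpace 𝓘(ℂ, EM) y) :
    dbarFun f y v = dbarAt (fun z => f ((extChartAt 𝓘(ℝ, EM) x₀).symm z)) (extChartAt 𝓘(ℝ, EM) x₀ y)
      (chartDeriv (EM := EM) x₀ y v) := by
  have h1 := mfderiv_eq_fderiv_comp_extChartAt_symm (EM := EM) hy hf v
  have h2 := mfderiv_eq_fderiv_comp_extChartAt_symm (EM := EM) hy hf (tangentI y v)
  have h3 := chartDeriv_tangentI (EM := EM) hy v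
  rw [h3] at h2
  rw [dbarAt, ← h1, ← h2]
  rfl

theorem mem_closedForms_iff {D : Π x : M, TangentSpace 𝓘(ℂ, EM) x →ₗ⋆[ℂ] Alt2 (V x)} :
    D ∈ closedForms EM F V ↔ D ∈ smoothForms EM F V ∧ ∀ (x : M) (v w : EM) (c : Fin 2 → F),
      dbarAt (fun z => formCoord D x ((extChartAt 𝓘(ℝ, EM) x).symm z) w c)
        (extChartAt 𝓘(ℝ, EM) x x) v =
      dbarAt (fun z => formCoord D x ((extChartAt 𝓘(ℝ, EM) x).symm z) v c)
        (extChartAt 𝓘(ℝ, EM) x x) w := by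
  refine and_congr_right fun hD => ?_
  have hs : ∀ (x : M) (v : EM) (c : Fin 2 → F),
      MDifferentiableAt 𝓘(ℝ, EM) 𝓘(ℝ, ℂ) (fun y => formCoord D x y v c) x := fun x v c =>
    (mem_smoothForms_iff.1 hD x v c).mdifferentiableAt (by simp)
  constructor
  · intro h x v w c
    have h1 := h x (constSection EM (TangentSpace 𝓘(ℂ, EM)) x v x)
      (constSection EM (TangentSpace 𝓘(ℂ, EM)) x w x) fun i => constSection F V x (c i) x
    simp only [frameExt_constSection] at h1
    have h2 := dbarFun_eq_dbarAt (mem_chart_source EM x) (hs x w c)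
      (constSection EM (TangentSpace 𝓘(ℂ, EM)) x v x)
    have h3 := dbarFun_eq_dbarAt (mem_chart_source EM x) (hs x v c)
      (constSection EM (TangentSpace 𝓘(ℂ, EM)) x w x)
    rw [chartDeriv_constSection (mem_chart_source EM x)] at h2 h3
    exact h2.symm.trans (h1.trans h3)
  · intro h x v w c
    have h2 := dbarFun_eq_dbarAt (mem_chart_source EM x)
      (hs x (chartDeriv (EM := EM) x x w) fun i => (trivializationAt F V x).linearMapAt ℂ x (c i)) v
    have h3 := dbarFun_eq_dbarAt (mem_chart_source EM x)
      (hs x (chartDeriv (EM := EM) x x v) fun i => (trivializationAt F V x).linearMapAt ℂ x (c i)) w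
    have h4 := h x (chartDeriv (EM := EM) x x v) (chartDeriv (EM := EM) x x w)
      fun i => (trivializationAt F V x).linearMapAt ℂ x (c i)
    have h5 : ∀ (v : TangentSpace 𝓘(ℂ, EM) x) (y : M),
        frameExt EM (TangentSpace 𝓘(ℂ, EM)) x y v =
        constSection EM (TangentSpace 𝓘(ℂ, EM)) x (chartDeriv (EM := EM) x x v) y := fun v y => by
      rw [frameExt_apply]
      congr 1
      rw [← tangent_trivialization_eq (mem_chart_source EM x)]
      exact congrFun (Trivialization.coe_linearMapAt_of_mem _
        (FiberBundle.mem_baseSet_trivializationAt' x)) v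
    simp only [h5, frameExt_apply (V := V)]
    exact h2.trans (h4.trans h3.symm)

theorem dbarAt_clm {E B G : Type*} [NormedAddCommGroup E] [NormedSpace ℂ E] [NormedAddCommGroup B]
    [NormedSpace ℂ B] [NormedAddCommGroup G] [NormedSpace ℂ G] (L : B →L[ℂ] G) {p : E → B} {x : E}
    (hp : DifferentiableAt ℝ p x) (w : E) : dbarAt (fun z => L (p z)) x w = L (dbarAt p x w) :=
  dbarAt_holomorphic_apply (q := fun _ => L) (differentiableAt_const L) hp w

/-- Smoothness and `∂̄` at `y` are defined in the frame centred at `y`. The change to the frame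
centred at `x₀` is holomorphic, so it preserves smoothness and commutes with `∂̄`. -/
theorem contDiffAt_sectionCoord {B : Π x, Alt2 (V x)} (hB : B ∈ smoothSections EM F V) {x₀ y : M}
    (hy : y ∈ coordDomain EM F V x₀) (c : Fin 2 → F) :
    ContDiffAt ℝ ∞ (fun z => sectionCoord B x₀ ((extChartAt 𝓘(ℝ, EM) x₀).symm z) c)
      (extChartAt 𝓘(ℝ, EM) x₀ y) ∧
    ∀ v : TangentSpace 𝓘(ℂ, EM) y,
      dbarAt (fun z => sectionCoord B x₀ ((extChartAt 𝓘(ℝ, EM) x₀).symm z) c)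
        (extChartAt 𝓘(ℝ, EM) x₀ y) (chartDeriv (EM := EM) x₀ y v) =
      dbar EM F V ⟨B, hB⟩ y v fun i => constSection F V x₀ (c i) y := by
  obtain ⟨h, hh, he⟩ := exists_frameChange hy
  set z₀ := extChartAt 𝓘(ℝ, EM) x₀ y with hz₀
  have hy0 : (extChartAt 𝓘(ℝ, EM) x₀).symm z₀ = y :=
    (extChartAt 𝓘(ℝ, EM) x₀).left_inv (by rw [extChartAt_source]; exact hy.1)
  let b := Module.finBasis ℂ F
  let p : EM → (Fin (Module.finrank ℂ F) × Fin (Module.finrank ℂ F) → ℂ) := fun z =>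
    alt2Coef b (sectionCoord B y ((extChartAt 𝓘(ℝ, EM) x₀).symm z))
  have hp : ContDiffAt ℝ ∞ p z₀ := contDiffAt_pi.2 fun _ =>
    contDiffAt_comp_extChartAt_symm hy.1 (mem_smoothSections_iff.1 hB y _)
  have hq := contDiffAt_alt2Eval b hh c
  have e1 : (fun z => sectionCoord B x₀ ((extChartAt 𝓘(ℝ, EM) x₀).symm z) c) =ᶠ[𝓝 z₀]
      fun z => alt2Eval b (fun i => h z (c i)) (p z) := by
    filter_upwards [he] with z hz
    simp only [p]
    rw [alt2Eval_alt2Coef, sectionCoord_apply, sectionCoord_apply]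
    simp only [hz]
  have e2 := fun w => dbarAt_holomorphic_apply (hq.differentiableAt (by simp))
    (hp.differentiableAt (by simp)) w
  refine ⟨ContDiffAt.congr_of_eventuallyEq ?_ e1, fun v => ?_⟩
  · have h1 := (ContinuousLinearMap.restrictScalarsL ℂ (Fin (Module.finrank ℂ F) ×
      Fin (Module.finrank ℂ F) → ℂ) ℂ ℝ ℝ).contDiff.contDiffAt.comp z₀
      ((hq.restrict_scalars ℝ).of_le (m := ∞) le_top)
    exact h1.clm_apply hp
  · rw [dbarAt_congr e1, e2, ← dbarAt_clm _ (hp.differentiableAt (by simp))]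
    have h1 : (fun z => alt2Eval b (fun i => h z₀ (c i)) (p z)) =
        fun z => sectionCoord B y ((extChartAt 𝓘(ℝ, EM) x₀).symm z) (fun i => h z₀ (c i)) :=
      funext fun z => alt2Eval_alt2Coef _ _ _
    rw [h1, hz₀, ← dbarFun_eq_dbarAt (f := fun y' => sectionCoord B y y' (fun i => h z₀ (c i))) hy.1
      ((mem_smoothSections_iff.1 hB y _).mdifferentiableAt (by simp))]
    change _ = dbarFun _ y v
    congr 2
    funext y'
    rw [sectionCoord_apply]
    have h3 := he.self_of_nhds
    rw [hy0] at h3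
    simp only [h3, frameExt_constSection]

/-- As for sections, but the direction changes as well: `∂̄` acquires the term with the derivative
of the tangent frame change, which is symmetric in `v` and `w` and cancels in the closedness
condition. -/
theorem contDiffAt_formCoord {D : Π x : M, TangentSpace 𝓘(ℂ, EM) x →ₗ⋆[ℂ] Alt2 (V x)}
    (hD : D ∈ smoothForms EM F V) {x₀ y : M} (hy : y ∈ coordDomain EM F V x₀) (v : EM)
    (c : Fin 2 → F) :
    ContDiffAt ℝ ∞ (fun z => formCoord D x₀ ((extChartAt 𝓘(ℝ, EM) x₀).symm z) v c)
      (extChartAt 𝓘(ℝ, EM) x₀ y) ∧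
    (D ∈ closedForms EM F V → ∀ w,
      dbarAt (fun z => formCoord D x₀ ((extChartAt 𝓘(ℝ, EM) x₀).symm z) v c)
        (extChartAt 𝓘(ℝ, EM) x₀ y) w =
      dbarAt (fun z => formCoord D x₀ ((extChartAt 𝓘(ℝ, EM) x₀).symm z) w c)
        (extChartAt 𝓘(ℝ, EM) x₀ y) v) := by
  have : FiniteDimensional ℝ EM := FiniteDimensional.complexToReal EM
  obtain ⟨h, hh, he⟩ := exists_frameChange hy
  obtain ⟨t, ht, hts, hte⟩ := exists_tangentFrameChange hy.1
  set z₀ := extChartAt 𝓘(ℝ, EM) x₀ y with hz₀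
  have hy0 : (extChartAt 𝓘(ℝ, EM) x₀).symm z₀ = y :=
    (extChartAt 𝓘(ℝ, EM) x₀).left_inv (by rw [extChartAt_source]; exact hy.1)
  let b := Module.finBasis ℂ F
  let B := Fin (Module.finrank ℂ F) × Fin (Module.finrank ℂ F) → ℂ
  let Pl : EM → EM →ₗ[ℝ] B := fun z =>
    { toFun := fun u => alt2Coef b (formCoord D y ((extChartAt 𝓘(ℝ, EM) x₀).symm z) u)
      map_add' := fun u u' => by rw [map_add, map_add]
      map_smul' := fun k u => by
        rw [← Complex.coe_smul, LinearMap.map_smulₛₗ, map_smul, Complex.conj_ofReal, Complex.coe_smul]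
        rfl }
  let P : EM → EM →L[ℝ] B := fun z => LinearMap.toContinuousLinearMap (Pl z)
  have hPapp : ∀ z u, P z u = alt2Coef b (formCoord D y ((extChartAt 𝓘(ℝ, EM) x₀).symm z) u) :=
    fun _ _ => rfl
  have hPu : ∀ u, ContDiffAt ℝ ∞ (fun z => P z u) z₀ := fun u => contDiffAt_pi.2 fun _ =>
    contDiffAt_comp_extChartAt_symm hy.1 (mem_smoothForms_iff.1 hD y u _)
  have hP : ContDiffAt ℝ ∞ P z₀ := contDiffAt_clm_of_apply hPu
  have hPI : ∀ u, P z₀ (Complex.I • u) = -(Complex.I • P z₀ u) := fun u => by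
    rw [hPapp, hPapp, LinearMap.map_smulₛₗ, map_smul, Complex.conj_I, neg_smul]
  have hq := contDiffAt_alt2Eval b hh c
  have e1 : ∀ v, (fun z => formCoord D x₀ ((extChartAt 𝓘(ℝ, EM) x₀).symm z) v c) =ᶠ[𝓝 z₀]
      fun z => alt2Eval b (fun i => h z (c i)) (P z (t z v)) := fun v => by
    filter_upwards [he, hte] with z hz hz'
    rw [hPapp, alt2Eval_alt2Coef, formCoord_apply, formCoord_apply, hz']
    simp only [hz]
  have e2 := fun v w => dbarAt_apply_holomorphic (hP.differentiableAt (by simp))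
    (ht.differentiableAt (by simp)) hPI v w
  refine ⟨ContDiffAt.congr_of_eventuallyEq ?_ (e1 v), fun hcl w => ?_⟩
  · have h1 := (ContinuousLinearMap.restrictScalarsL ℂ B ℂ ℝ ℝ).contDiff.contDiffAt.comp z₀
      ((hq.restrict_scalars ℝ).of_le (m := ∞) le_top)
    have h2 := (ContinuousLinearMap.restrictScalarsL ℂ EM EM ℝ ℝ).contDiff.contDiffAt.comp z₀
      ((ht.restrict_scalars ℝ).of_le (m := ∞) le_top)
    exact h1.clm_apply (hP.clm_apply (h2.clm_apply contDiffAt_const))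
  -- Closedness at `y` is known in the chart centred at `y`; both charts express `∂̄` in the
  -- direction of one and the same tangent vector.
  · have e3 : ∀ v w, dbarAt (fun z => P z (t z₀ v)) z₀ w = dbarAt (fun z => P z (t z₀ w)) z₀ v := by
      intro v w
      have e4 : ∀ u w p, dbarAt (fun z => P z u) z₀ w p =
          dbarAt (fun z => formCoord D y ((extChartAt 𝓘(ℝ, EM) y).symm z) u ![b p.1, b p.2])
            (extChartAt 𝓘(ℝ, EM) y y) (t z₀ w) := fun u w p => by
        have h1 := dbarAt_clm (ContinuousLinearMap.proj (R := ℂ) p)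
          ((hPu u).differentiableAt (by simp)) w
        refine h1.symm.trans ?_
        obtain ⟨w', rfl⟩ := chartDeriv_surjective (EM := EM) hy.1 w
        have h2 := (mem_smoothForms_iff.1 hD y u ![b p.1, b p.2]).mdifferentiableAt (by simp)
        have h3 := dbarFun_eq_dbarAt hy.1 h2 w'
        have h4 := dbarFun_eq_dbarAt (mem_chart_source EM y) h2 w'
        have h5 : t z₀ (chartDeriv (EM := EM) x₀ y w') = chartDeriv (EM := EM) y y w' := by
          have h6 := hte.self_of_nhds (chartDeriv (EM := EM) x₀ y w')
          rw [hy0] at h6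
          have h7 := (constSection_chartDeriv (EM := EM) hy.1 w').symm.trans h6
          exact (chartDeriv_constSection (EM := EM) (mem_chart_source EM y) _).symm.trans
            (congrArg (chartDeriv (EM := EM) y y) h7.symm)
        rw [h5, ← h4, h3]
        rfl
      funext p
      rw [e4, e4]
      exact (mem_closedForms_iff.1 hcl).2 y _ _ _
    rw [dbarAt_congr (e1 v), dbarAt_congr (e1 w),
      dbarAt_holomorphic_apply (hq.differentiableAt (by simp)) (e2 v w).1,
      dbarAt_holomorphic_apply (hq.differentiableAt (by simp)) (e2 w v).1, (e2 v w).2, (e2 w v).2,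
      e3, hts]

theorem eventually_coordTarget {x₀ y : M} (hy : y ∈ coordDomain EM F V x₀) {p : EM → Prop}
    (hp : ∀ y' ∈ coordDomain EM F V x₀, p (extChartAt 𝓘(ℝ, EM) x₀ y')) :
    ∀ᶠ z in 𝓝 (extChartAt 𝓘(ℝ, EM) x₀ y), p z := by
  filter_upwards [(isOpen_coordTarget (F := F) (V := V) x₀).mem_nhds ⟨y, hy, rfl⟩] with z hz
  obtain ⟨y', hy', rfl⟩ := hz
  exact hp y' hy'

theorem formCoord_dbar {B : Π x, Alt2 (V x)} (hB : B ∈ smoothSections EM F V) {x₀ y : M}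
    (hy : y ∈ coordDomain EM F V x₀) (v : EM) (c : Fin 2 → F) :
    formCoord (dbar EM F V ⟨B, hB⟩) x₀ y v c =
      dbarAt (fun z => sectionCoord B x₀ ((extChartAt 𝓘(ℝ, EM) x₀).symm z) c)
        (extChartAt 𝓘(ℝ, EM) x₀ y) v := by
  obtain ⟨v, rfl⟩ := chartDeriv_surjective (EM := EM) hy.1 v
  refine Eq.trans ?_ ((contDiffAt_sectionCoord hB hy c).2 v).symm
  exact congrArg (fun w => dbar EM F V ⟨B, hB⟩ y w fun i => constSection F V x₀ (c i) y)
    (constSection_chartDeriv (EM := EM) hy.1 v)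

/-- In the coordinates at `x` the form is the coordinate `∂̄` of the components, so closedness is
`dbarAt_comm`. -/
theorem dbar_mem_closedForms (B : smoothSections EM F V) : dbar EM F V B ∈ closedForms EM F V := by
  obtain ⟨B, hB⟩ := B
  have h1 : ∀ (x : M) (c : Fin 2 → F), ContDiffOn ℝ ∞
      (fun z => sectionCoord B x ((extChartAt 𝓘(ℝ, EM) x).symm z) c) (coordTarget EM F V x) := by
    rintro x c _ ⟨y, hy, rfl⟩
    exact (contDiffAt_sectionCoord hB hy c).1.contDiffWithinAt
  have h2 : ∀ (x : M) (v : EM) (c : Fin 2 → F),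
      (fun z => formCoord (dbar EM F V ⟨B, hB⟩) x ((extChartAt 𝓘(ℝ, EM) x).symm z) v c) =ᶠ[𝓝
        (extChartAt 𝓘(ℝ, EM) x x)] fun z =>
      dbarAt (fun z => sectionCoord B x ((extChartAt 𝓘(ℝ, EM) x).symm z) c) z v := fun x v c => by
    refine eventually_coordTarget (F := F) (V := V) (mem_coordDomain x) fun y hy => ?_
    have h0 := (extChartAt 𝓘(ℝ, EM) x).left_inv
      (show y ∈ (extChartAt 𝓘(ℝ, EM) x).source by rw [extChartAt_source]; exact hy.1)
    dsimp only
    rw [h0]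
    exact formCoord_dbar hB hy v c
  have h3 : ∀ x : M, extChartAt 𝓘(ℝ, EM) x x ∈ coordTarget EM F V x := fun x =>
    ⟨x, mem_coordDomain x, rfl⟩
  rw [mem_closedForms_iff, mem_smoothForms_iff]
  refine ⟨fun x v c => ?_, fun x v w c => ?_⟩
  · refine contMDiffAt_of_comp_extChartAt_symm (x₀ := x) (mem_chart_source EM x)
      (ContDiffAt.congr_of_eventuallyEq ?_ (h2 x v c))
    exact (contDiffOn_dbarAt (isOpen_coordTarget x) (h1 x c) v).contDiffAt
      ((isOpen_coordTarget x).mem_nhds (h3 x))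
  · rw [dbarAt_congr (h2 x v c), dbarAt_congr (h2 x w c)]
    exact dbarAt_comm (((contDiffAt_sectionCoord hB (mem_coordDomain x) c).1).of_le
      (WithTop.coe_le_coe.2 (le_top : (2 : ℕ∞) ≤ ⊤))) _ _

/-- `β` is a potential over `U` of the form `D`, in the trivializations at `x₀`. -/
structure IsPotential (D : Π x : M, TangentSpace 𝓘(ℂ, EM) x →ₗ⋆[ℂ] Alt2 (V x)) (x₀ : M) (U : Set EM)
    (β : EM → Alt2 F) : Prop where
  contDiffOn : ∀ c, ContDiffOn ℝ ∞ (fun z => β z c) U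
  dbar_eq : ∀ y ∈ coordDomain EM F V x₀, extChartAt 𝓘(ℝ, EM) x₀ y ∈ U → ∀ v c,
    dbarAt (fun z => β z c) (extChartAt 𝓘(ℝ, EM) x₀ y) v = formCoord D x₀ y v c

/-- The `∂̄`-Poincaré lemma is applied to the matrix of `D` in the coordinates at `x₀`. -/
theorem exists_isPotential {D : Π x : M, TangentSpace 𝓘(ℂ, EM) x →ₗ⋆[ℂ] Alt2 (V x)}
    (hD : D ∈ closedForms EM F V) (x₀ : M) :
    ∃ U ⊆ coordTarget EM F V x₀, IsOpen U ∧ extChartAt 𝓘(ℝ, EM) x₀ x₀ ∈ U ∧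
      ∃ β : EM → Alt2 F, IsPotential D x₀ U β := by
  let b := Module.finBasis ℂ F
  let B := Fin (Module.finrank ℂ F) × Fin (Module.finrank ℂ F) → ℂ
  let α : EM → EM →ₗ⋆[ℂ] B := fun z =>
    (alt2Coef b).comp (formCoord D x₀ ((extChartAt 𝓘(ℝ, EM) x₀).symm z))
  have hα : ∀ v, ContDiffOn ℝ ∞ (fun z => α z v) (coordTarget EM F V x₀) := by
    rintro v _ ⟨y, hy, rfl⟩
    exact (contDiffAt_pi.2 fun _ => (contDiffAt_formCoord hD.1 hy v _).1).contDiffWithinAt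
  have hcl : ∀ z ∈ coordTarget EM F V x₀, ∀ v w,
      dbarAt (fun z => α z v) z w = dbarAt (fun z => α z w) z v := by
    intro z hz v w
    have hd := fun u => ((hα u).contDiffAt ((isOpen_coordTarget x₀).mem_nhds hz)).differentiableAt
      (by simp)
    obtain ⟨y, hy, rfl⟩ := hz
    funext p
    have h1 := dbarAt_clm (ContinuousLinearMap.proj (R := ℂ) p) (hd v) w
    have h2 := dbarAt_clm (ContinuousLinearMap.proj (R := ℂ) p) (hd w) v
    exact h1.symm.trans (((contDiffAt_formCoord hD.1 hy v _).2 hD w).trans h2)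
  obtain ⟨U, hU, hUo, hx, u, hu, hu'⟩ := exists_dbarAt_eq_of_closed
    (isOpen_coordTarget (F := F) (V := V) x₀) ⟨x₀, mem_coordDomain x₀, rfl⟩ α hα hcl
  have hinj : LinearMap.ker (alt2Coef b) = ⊥ := by
    rw [LinearMap.ker_eq_bot']
    intro s hs
    ext c
    rw [← alt2Eval_alt2Coef b, hs, map_zero]
    rfl
  -- The solution is a matrix that need not be antisymmetric. A linear left inverse of the matrix
  -- map turns it into an alternating form and commutes with `∂̄`.
  obtain ⟨r, hr⟩ := LinearMap.exists_leftInverse_of_injective (alt2Coef b) hinj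
  let ev : (Fin 2 → F) → B →L[ℂ] ℂ := fun c => LinearMap.toContinuousLinearMap
    { toFun := fun w => r w c
      map_add' := fun w w' => by rw [map_add]; rfl
      map_smul' := fun k w => by rw [map_smul]; rfl }
  refine ⟨U, hU, hUo, hx, fun z => r (u z), fun c => ?_, fun y hy hyU v c => ?_⟩
  · exact ((ev c).restrictScalars ℝ).contDiff.comp_contDiffOn hu
  · have h1 := dbarAt_clm (ev c) ((hu.contDiffAt (hUo.mem_nhds hyU)).differentiableAt (by simp)) v
    refine h1.trans ?_
    rw [hu' _ hyU]
    have h2 := LinearMap.congr_fun hr (formCoord D x₀ y v)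
    have hy0 : (extChartAt 𝓘(ℝ, EM) x₀).symm (extChartAt 𝓘(ℝ, EM) x₀ y) = y :=
      (extChartAt 𝓘(ℝ, EM) x₀).left_inv (by rw [extChartAt_source]; exact hy.1)
    have h3 : ev c (α (extChartAt 𝓘(ℝ, EM) x₀ y) v) = r (alt2Coef b (formCoord D x₀
      ((extChartAt 𝓘(ℝ, EM) x₀).symm (extChartAt 𝓘(ℝ, EM) x₀ y)) v)) c := rfl
    rw [h3, hy0]
    exact congrArg (fun s : Alt2 F => s c) h2

theorem IsPotential.add_dbar {D : Π x : M, TangentSpace 𝓘(ℂ, EM) x →ₗ⋆[ℂ] Alt2 (V x)} {x₀ : M}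
    {U : Set EM} {β : EM → Alt2 F} (hβ : IsPotential D x₀ U β) (hU : U ⊆ coordTarget EM F V x₀)
    (hUo : IsOpen U) (B : smoothSections EM F V) :
    IsPotential (D + dbar EM F V B) x₀ U
      (fun z => β z + sectionCoord B.1 x₀ ((extChartAt 𝓘(ℝ, EM) x₀).symm z)) where
  contDiffOn c := (hβ.contDiffOn c).add fun z hz => by
    obtain ⟨y, hy, rfl⟩ := hU hz
    exact (contDiffAt_sectionCoord B.2 hy c).1.contDiffWithinAt
  dbar_eq y hy hyU v c := by
    have h1 := ((hβ.contDiffOn c).contDiffAt (hUo.mem_nhds hyU)).differentiableAt (by simp)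
    have h2 := (contDiffAt_sectionCoord B.2 hy c).1.differentiableAt (by simp)
    have h3 := hβ.dbar_eq y hy hyU v c
    have h4 := formCoord_dbar B.2 hy v c
    have h5 : formCoord (D + dbar EM F V B) x₀ y v c =
      formCoord D x₀ y v c + formCoord (dbar EM F V B) x₀ y v c := rfl
    rw [h5, ← h3, h4]
    have h6 := fderiv_fun_add h1 h2
    change (2⁻¹ : ℂ) • (fderiv ℝ (fun z => β z c + sectionCoord B.1 x₀
      ((extChartAt 𝓘(ℝ, EM) x₀).symm z) c) _ v + Complex.I • fderiv ℝ (fun z => β z c +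
        sectionCoord B.1 x₀ ((extChartAt 𝓘(ℝ, EM) x₀).symm z) c) _ (Complex.I • v)) = _
    rw [h6, dbarAt, dbarAt, add_apply, add_apply]
    module

end FormCoordinates

/-! ### Parametrizations of the twistor space -/

noncomputable section TwistorCharts

set_option linter.unusedSectionVars false

variable {EM : Type*} [NormedAddCommGroup EM] [NormedSpace ℂ EM] [FiniteDimensional ℂ EM]
  {M : Type*} [TopologicalSpace M] [ChartedSpace EM M] [IsManifold 𝓘(ℂ, EM) ω M]
  {F : Type*} [NormedAddCommGroup F] [NormedSpace ℂ F] [FiniteDimensional ℂ F]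
  {V : M → Type*} [TopologicalSpace (TotalSpace F V)]
  [∀ x, AddCommGroup (V x)] [∀ x, Module ℂ (V x)] [∀ x, TopologicalSpace (V x)]
  [∀ x, IsTopologicalAddGroup (V x)] [∀ x, ContinuousSMul ℂ (V x)]
  [FiberBundle F V] [VectorBundle ℂ F V] [ContMDiffVectorBundle ω F V 𝓘(ℂ, EM)]

variable (EM F V) in
/-- The chart of `End E` over `coordDomain EM F V x₀`. -/
def endChart (x₀ : M) : PartialEquiv (EndTotal F V) (EM × (F →L[ℝ] F)) :=
  extChartAt (endModel EM F) (⟨x₀, 0⟩ : EndTotal F V)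

theorem endChart_apply {x₀ : M} {A : EndTotal F V} (hA : A.1 ∈ coordDomain EM F V x₀) :
    endChart EM F V x₀ A = (extChartAt 𝓘(ℝ, EM) x₀ A.1, endCoord x₀ A.1 A.2) :=
  (totalCoord_eq (EM := EM) (F' := F →L[ℝ] F) (W := fun x => V x →L[ℝ] V x) x₀
    (mem_coordDomain_end.2 hA)).symm

theorem mem_endChart_source {x₀ : M} {A : EndTotal F V} (hA : A.1 ∈ coordDomain EM F V x₀) :
    A ∈ (endChart EM F V x₀).source :=
  mem_source_totalCoord (EM := EM) (F' := F →L[ℝ] F) (W := fun x => V x →L[ℝ] V x) x₀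
    (mem_coordDomain_end.2 hA)

theorem exists_endChart_symm {x₀ : M} {z : EM} (hz : z ∈ coordTarget EM F V x₀) :
    ∃ y ∈ coordDomain EM F V x₀, extChartAt 𝓘(ℝ, EM) x₀ y = z ∧ ∀ X : F →L[ℝ] F,
      ∃ A : V y →L[ℝ] V y, (endChart EM F V x₀).symm (z, X) = ⟨y, A⟩ ∧ endCoord x₀ y A = X := by
  obtain ⟨y, hy, rfl⟩ := hz
  refine ⟨y, hy, rfl, fun X => ?_⟩
  let A : EndTotal F V := ⟨y, (trivializationAt (F →L[ℝ] F) (fun x => V x →L[ℝ] V x) x₀).symmL ℝ y X⟩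
  have hX : endCoord x₀ A.1 A.2 = X :=
    trivialization_symmL_apply (F' := F →L[ℝ] F) (W := fun x => V x →L[ℝ] V x)
      (mem_coordDomain_end.2 hy) X
  refine ⟨A.2, ?_, hX⟩
  have h := (endChart EM F V x₀).left_inv (mem_endChart_source (A := A) hy)
  rwa [endChart_apply (A := A) hy, hX] at h

theorem mem_endChart_target {x₀ : M} {z : EM} (hz : z ∈ coordTarget EM F V x₀) (X : F →L[ℝ] F) :
    (z, X) ∈ (endChart EM F V x₀).target := by
  obtain ⟨y, hy, rfl, h⟩ := exists_endChart_symm hz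
  obtain ⟨A, -, rfl⟩ := h X
  exact (congrArg (· ∈ _) (endChart_apply (A := ⟨y, A⟩) hy)).mp
    ((endChart EM F V x₀).map_source (mem_endChart_source (A := ⟨y, A⟩) hy))

theorem continuousOn_endChart (x₀ : M) :
    ContinuousOn (endChart EM F V x₀) {A | A.1 ∈ coordDomain EM F V x₀} := fun _ hA =>
  ((continuousOn_extChartAt (I := endModel EM F) (⟨x₀, 0⟩ : EndTotal F V)) _
    (mem_endChart_source hA)).mono_of_mem_nhdsWithin (mem_nhdsWithin_of_mem_nhds
      ((isOpen_extChartAt_source (I := endModel EM F) (⟨x₀, 0⟩ : EndTotal F V)).mem_nhds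
        (mem_endChart_source hA)))

theorem contMDiffOn_endChart_symm (x₀ : M) :
    ContMDiffOn 𝓘(ℝ, EM × (F →L[ℝ] F)) (endModel EM F) ∞ (endChart EM F V x₀).symm
      (endChart EM F V x₀).target := by
  have h := contMDiffOn_extChartAt_symm (I := endModel EM F) (n := ∞) (⟨x₀, 0⟩ : EndTotal F V)
  exact h

theorem mem_twistorSpace_iff {g : ContMDiffRiemannianMetric 𝓘(ℝ, EM) ∞ F V} {x₀ : M}
    {A : EndTotal F V} (hA : A.1 ∈ coordDomain EM F V x₀) : A ∈ twistorSpace g ↔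
      (∀ w : F, endCoord x₀ A.1 A.2 (endCoord x₀ A.1 A.2 w) = -w) ∧
      ∀ u w : F, localMetric g x₀ (extChartAt 𝓘(ℝ, EM) x₀ A.1) (endCoord x₀ A.1 A.2 u)
        (endCoord x₀ A.1 A.2 w) = localMetric g x₀ (extChartAt 𝓘(ℝ, EM) x₀ A.1) u w := by
  rw [localMetric_extChartAt g hA.1]
  have hsurj := (fibreEquiv x₀ hA).surjective
  constructor
  · rintro ⟨h1, h2⟩
    refine ⟨fun w => ?_, fun u w => ?_⟩
    · obtain ⟨a, rfl⟩ := hsurj w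
      rw [fibreEquiv_apply, endCoord_apply hA, endCoord_apply hA]
      have : A.2 (A.2 a) = -a := DFunLike.congr_fun h1 a
      rw [this, ← fibreEquiv_apply hA, map_neg, fibreEquiv_apply]
    · obtain ⟨a, rfl⟩ := hsurj u
      obtain ⟨c, rfl⟩ := hsurj w
      rw [fibreEquiv_apply, fibreEquiv_apply, endCoord_apply hA, endCoord_apply hA,
        fibreMetric_trivialization g hA, fibreMetric_trivialization g hA]
      exact h2 a c
  · rintro ⟨h1, h2⟩
    refine ⟨ContinuousLinearMap.ext fun a => (fibreEquiv x₀ hA).injective ?_, fun a c => ?_⟩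
    · have h := h1 (fibreEquiv x₀ hA a)
      rw [fibreEquiv_apply, endCoord_apply hA, endCoord_apply hA] at h
      change fibreEquiv x₀ hA (A.2 (A.2 a)) = fibreEquiv x₀ hA (-a)
      rw [map_neg]
      exact h
    · have h := h2 (fibreEquiv x₀ hA a) (fibreEquiv x₀ hA c)
      rwa [fibreEquiv_apply, fibreEquiv_apply, endCoord_apply hA, endCoord_apply hA,
        fibreMetric_trivialization g hA, fibreMetric_trivialization g hA] at h

variable {g : ContMDiffRiemannianMetric 𝓘(ℝ, EM) ∞ F V} {ι : Type*} [Fintype ι]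
  (b : Module.Basis ι ℂ F) {N : ℕ} (κ : IsotropicChart F (dualPairing b) N)

variable (g) in
/-- The coordinate expression of the family of complex structures parametrized by `κ`, in the
isometric frame defined by `β`. -/
def structCoord (x₀ : M) (β : EM → Alt2 F) (p : EM × (Fin N → ℂ)) : F →L[ℝ] F :=
  κ.struct (localFrame g b x₀ β p.1) p.2

variable (g) in
/-- The parametrization of the twistor space defined by `κ` and `β`. -/
def twistorParam (x₀ : M) (β : EM → Alt2 F) (p : EM × (Fin N → ℂ)) : EndTotal F V :=
  (endChart EM F V x₀).symm (p.1, structCoord g b κ x₀ β p)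

variable {κ} {b} {x₀ : M} {U : Set EM} {β : EM → Alt2 F}

theorem twistorParam_spec (hU : U ⊆ coordTarget EM F V x₀) {p : EM × (Fin N → ℂ)} (hp : p.1 ∈ U) :
    (twistorParam g b κ x₀ β p).1 ∈ coordDomain EM F V x₀ ∧
      extChartAt 𝓘(ℝ, EM) x₀ (twistorParam g b κ x₀ β p).1 = p.1 ∧
      endCoord x₀ (twistorParam g b κ x₀ β p).1 (twistorParam g b κ x₀ β p).2 =
        structCoord g b κ x₀ β p := by
  obtain ⟨y, hy, h1, h2⟩ := exists_endChart_symm (hU hp)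
  obtain ⟨A, h3, h4⟩ := h2 (structCoord g b κ x₀ β p)
  rw [twistorParam, h3]
  exact ⟨hy, h1, h4⟩

section Hermitian
variable (hg : IsHermitianMetric g) (hU : U ⊆ coordTarget EM F V x₀)
include hg hU

theorem contDiffOn_structCoord (hβ : ∀ c, ContDiffOn ℝ ∞ (fun z => β z c) U) :
    ContDiffOn ℝ ∞ (structCoord g b κ x₀ β) (U ×ˢ Set.univ) :=
  IsotropicChart.contDiffOn_struct (G := fun z u w => localMetric g x₀ z u w)
    (fun z _ => isIsometricFrame_localFrame b hg x₀ β z) (fun _ hz => localMetric_pos (hU hz))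
    (fun _ hz => isInvertible_cplxExt_localFrame b hg β (hU hz)) (contDiffOn_localFrame b hU hβ)

theorem twistorParam_mem {p : EM × (Fin N → ℂ)} (hp : p.1 ∈ U) :
    twistorParam g b κ x₀ β p ∈ twistorSpace g := by
  obtain ⟨h1, h2, h3⟩ := twistorParam_spec (g := g) (κ := κ) (β := β) hU hp
  rw [mem_twistorSpace_iff h1, h2, h3]
  have hT := isIsometricFrame_localFrame b hg x₀ β p.1
  have hG := localMetric_pos (g := g) (hU hp)
  have hI := isInvertible_cplxExt_localFrame b hg β (hU hp)
  exact ⟨IsotropicChart.struct_struct hT hG hI p.2, IsotropicChart.struct_isometry hT hG hI p.2⟩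

theorem contMDiffOn_twistorParam (hβ : ∀ c, ContDiffOn ℝ ∞ (fun z => β z c) U) :
    ContMDiffOn 𝓘(ℝ, EM × (Fin N → ℂ)) (endModel EM F) ∞ (twistorParam g b κ x₀ β)
      (U ×ˢ Set.univ) := by
  have h : ContDiffOn ℝ ∞ (fun p : EM × (Fin N → ℂ) => (p.1, structCoord g b κ x₀ β p))
      (U ×ˢ Set.univ) := contDiffOn_fst.prodMk (contDiffOn_structCoord hg hU hβ)
  exact (contMDiffOn_endChart_symm x₀).comp h.contMDiffOn fun p hp =>
    mem_endChart_target (hU hp.1) _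

/-- In the coordinates of `End E` the parametrization is `p ↦ (p.1, structCoord p)`. -/
theorem totalDeriv_mfderiv_twistorParam (hUo : IsOpen U)
    (hβ : ∀ c, ContDiffOn ℝ ∞ (fun z => β z c) U) {p : EM × (Fin N → ℂ)} (hp : p.1 ∈ U)
    (ξ : EM × (Fin N → ℂ)) :
    totalDeriv x₀ (twistorParam g b κ x₀ β p)
      (mfderiv 𝓘(ℝ, EM × (Fin N → ℂ)) (endModel EM F) (twistorParam g b κ x₀ β) p ξ) =
    (ξ.1, fderiv ℝ (structCoord g b κ x₀ β) p ξ) := by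
  have hO : U ×ˢ (Set.univ : Set (Fin N → ℂ)) ∈ 𝓝 p :=
    (hUo.prod isOpen_univ).mem_nhds ⟨hp, trivial⟩
  have h1 := (((contMDiffOn_twistorParam (b := b) (κ := κ) hg hU hβ).contMDiffAt hO).mdifferentiableAt
    (by simp)).hasMFDerivAt
  have h2 := (mdifferentiableAt_totalCoord (EM := EM) (F' := F →L[ℝ] F)
    (W := fun x => V x →L[ℝ] V x) x₀ (p := twistorParam g b κ x₀ β p)
    (mem_coordDomain_end.2 (twistorParam_spec hU hp).1)).1.hasMFDerivAt
  have h3 := (h2.comp p h1).hasFDerivAt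
  have h4 : HasFDerivAt (fun p : EM × (Fin N → ℂ) => (p.1, structCoord g b κ x₀ β p))
      ((ContinuousLinearMap.fst ℝ EM (Fin N → ℂ)).prod (fderiv ℝ (structCoord g b κ x₀ β) p)) p :=
    hasFDerivAt_fst.prodMk ((((contDiffOn_structCoord hg hU hβ).contDiffAt hO).differentiableAt
      (by simp)).hasFDerivAt)
  have h5 := h4.congr_of_eventuallyEq (f₁ := totalCoord EM (F →L[ℝ] F) (fun x => V x →L[ℝ] V x) x₀ ∘
      twistorParam g b κ x₀ β) (by
    filter_upwards [hO] with p' hp'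
    obtain ⟨-, e2, e3⟩ := twistorParam_spec (g := g) (κ := κ) (β := β) hU hp'.1
    exact Prod.ext e2 e3)
  exact (DFunLike.congr_fun (h5.unique h3) ξ).symm

end Hermitian

end TwistorCharts

/-! ### The holomorphic charts of the twistor space -/

noncomputable section TwistorAtlasCharts

set_option linter.unusedSectionVars false

variable {EM : Type*} [NormedAddCommGroup EM] [NormedSpace ℂ EM] [FiniteDimensional ℂ EM]
  {M : Type*} [TopologicalSpace M] [ChartedSpace EM M] [IsManifold 𝓘(ℂ, EM) ω M]
  {F : Type*} [NormedAddCommGroup F] [NormedSpace ℂ F] [FiniteDimensional ℂ F]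
  {V : M → Type*} [TopologicalSpace (TotalSpace F V)]
  [∀ x, AddCommGroup (V x)] [∀ x, Module ℂ (V x)] [∀ x, TopologicalSpace (V x)]
  [∀ x, IsTopologicalAddGroup (V x)] [∀ x, ContinuousSMul ℂ (V x)]
  [FiberBundle F V] [VectorBundle ℂ F V] [ContMDiffVectorBundle ω F V 𝓘(ℂ, EM)]
  {g : ContMDiffRiemannianMetric 𝓘(ℝ, EM) ∞ F V} {ι : Type*} [Fintype ι]
  (b : Module.Basis ι ℂ F) (κ : IsotropicChart F (dualPairing b) ((Module.finrank ℂ F).choose 2))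
  {x₀ : M} {U : Set EM} {β : EM → Alt2 F}

variable (g) in
/-- The coordinates on the twistor space inverse to `twistorParam`. -/
def twistorCoord (x₀ : M) (β : EM → Alt2 F) (A : EndTotal F V) : TwistorModel EM F :=
  (extChartAt 𝓘(ℝ, EM) x₀ A.1, κ.exists_leftInverse_S.choose
    (κ.skew (localFrame g b x₀ β (extChartAt 𝓘(ℝ, EM) x₀ A.1)) (endCoord x₀ A.1 A.2)))

variable (g) in
/-- The domain of `twistorCoord`. -/
def twistorDomain (x₀ : M) (U : Set EM) (β : EM → Alt2 F) : Set (EndTotal F V) :=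
  {A | A.1 ∈ coordDomain EM F V x₀} ∩ endChart EM F V x₀ ⁻¹'
    {p | p.1 ∈ U ∧ (κ.proj (localFrame g b x₀ β p.1) p.2).IsInvertible}

theorem isOpen_endDomain (x₀ : M) : IsOpen {A : EndTotal F V | A.1 ∈ coordDomain EM F V x₀} :=
  IsOpen.preimage (f := fun A : EndTotal F V => A.1)
    (FiberBundle.continuous_proj (F →L[ℝ] F) (fun x => V x →L[ℝ] V x)) (isOpen_coordDomain x₀)

theorem isOpen_isInvertible_proj {f : EM → F →L[ℝ] F × (ι → ℂ)} (hf : ContinuousOn f U)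
    (hU : IsOpen U) :
    IsOpen {p : EM × (F →L[ℝ] F) | p.1 ∈ U ∧ (κ.proj (f p.1) p.2).IsInvertible} := by
  have h0 : ContinuousOn (fun p : EM × (F →L[ℝ] F) => f p.1) (U ×ˢ Set.univ) :=
    hf.comp continuous_fst.continuousOn fun p hp => hp.1
  have h1 : ContinuousOn (fun p : EM × (F →L[ℝ] F) => κ.proj (f p.1) p.2) (U ×ˢ Set.univ) :=
    (IsotropicChart.continuous_proj (κ := κ)).comp_continuousOn
      (h0.prodMk continuous_snd.continuousOn)
  have h2 := h1.isOpen_inter_preimage (hU.prod isOpen_univ) IsotropicChart.isOpen_isInvertible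
  have h3 : {p : EM × (F →L[ℝ] F) | p.1 ∈ U ∧ (κ.proj (f p.1) p.2).IsInvertible} =
      U ×ˢ Set.univ ∩ (fun p : EM × (F →L[ℝ] F) => κ.proj (f p.1) p.2) ⁻¹' {p | p.IsInvertible} :=
    Set.ext fun p => ⟨fun h => ⟨⟨h.1, trivial⟩, h.2⟩, fun h => ⟨h.1.1, h.2⟩⟩
  rwa [← h3] at h2

theorem isOpen_twistorDomain (hU : U ⊆ coordTarget EM F V x₀) (hUo : IsOpen U)
    (hβ : ∀ c, ContDiffOn ℝ ∞ (fun z => β z c) U) : IsOpen (twistorDomain g b κ x₀ U β) :=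
  (continuousOn_endChart x₀).isOpen_inter_preimage (isOpen_endDomain x₀)
    (isOpen_isInvertible_proj b κ (contDiffOn_localFrame (g := g) b hU hβ).continuousOn hUo)

variable {b κ}

theorem twistorParam_twistorCoord (hg : IsHermitianMetric g) (hU : U ⊆ coordTarget EM F V x₀)
    {A : EndTotal F V} (hA : A ∈ twistorSpace g) (hA' : A ∈ twistorDomain g b κ x₀ U β) :
    twistorParam g b κ x₀ β (twistorCoord g b κ x₀ β A) = A := by
  obtain ⟨h0, h1⟩ := hA'
  rw [Set.mem_preimage, endChart_apply h0] at h1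
  obtain ⟨h2, h3⟩ := (mem_twistorSpace_iff h0).1 hA
  obtain ⟨c, hc, hc'⟩ := IsotropicChart.exists_skew_eq
    (isIsometricFrame_localFrame b hg x₀ β (extChartAt 𝓘(ℝ, EM) x₀ A.1)) (localMetric_pos (hU h1.1))
    (isInvertible_cplxExt_localFrame b hg β (hU h1.1)) h2 h3 h1.2
  have hs : twistorCoord g b κ x₀ β A = (extChartAt 𝓘(ℝ, EM) x₀ A.1, c) := by
    rw [twistorCoord, hc, κ.exists_leftInverse_S.choose_spec]
  rw [hs, twistorParam, structCoord, hc', ← endChart_apply h0]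
  exact (endChart EM F V x₀).left_inv (mem_endChart_source h0)

theorem twistorCoord_twistorParam (hg : IsHermitianMetric g) (hU : U ⊆ coordTarget EM F V x₀)
    {p : TwistorModel EM F} (hp : p.1 ∈ U) :
    twistorParam g b κ x₀ β p ∈ twistorDomain g b κ x₀ U β ∧
      twistorCoord g b κ x₀ β (twistorParam g b κ x₀ β p) = p := by
  obtain ⟨h1, h2, h3⟩ := twistorParam_spec (g := g) (κ := κ) (β := β) hU hp
  have hT := isIsometricFrame_localFrame b hg x₀ β p.1
  have hG := localMetric_pos (g := g) (hU hp)
  have hI := isInvertible_cplxExt_localFrame b hg β (hU hp)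
  refine ⟨⟨h1, ?_⟩, ?_⟩
  · rw [Set.mem_preimage, endChart_apply h1, h2, h3]
    exact ⟨hp, (IsotropicChart.isInvertible_of_comp_τ
      (IsotropicChart.proj_struct_frame (κ := κ) hT hG hI p.2)).1⟩
  · rw [twistorCoord, h2, h3, structCoord, IsotropicChart.skew_struct hT hG hI,
      κ.exists_leftInverse_S.choose_spec]

theorem continuousOn_twistorCoord (hU : U ⊆ coordTarget EM F V x₀) (hUo : IsOpen U)
    (hβ : ∀ c, ContDiffOn ℝ ∞ (fun z => β z c) U) :
    ContinuousOn (twistorCoord g b κ x₀ β) (twistorDomain g b κ x₀ U β) := by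
  intro A hA
  have h0 : ContinuousAt (fun A : EndTotal F V =>
      ((extChartAt 𝓘(ℝ, EM) x₀ A.1, endCoord x₀ A.1 A.2) : EM × (F →L[ℝ] F))) A := by
    have hD : {A : EndTotal F V | A.1 ∈ coordDomain EM F V x₀} ∈ 𝓝 A :=
      (isOpen_endDomain x₀).mem_nhds hA.1
    refine ((continuousOn_endChart x₀).continuousAt hD).congr ?_
    filter_upwards [hD] with A' hA' using endChart_apply hA'
  have h1 := hA.2
  rw [Set.mem_preimage, endChart_apply hA.1] at h1
  have h2 : ContinuousAt (localFrame g b x₀ β) (extChartAt 𝓘(ℝ, EM) x₀ A.1) :=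
    (contDiffOn_localFrame b hU hβ).continuousOn.continuousAt (hUo.mem_nhds h1.1)
  have h3 : ContinuousAt (fun A : EndTotal F V => extChartAt 𝓘(ℝ, EM) x₀ A.1) A :=
    h0.fst
  have h4 : ContinuousAt (fun A : EndTotal F V => (endCoord x₀ A.1 A.2 : F →L[ℝ] F)) A :=
    h0.snd
  have h5 : ContinuousAt (fun A : EndTotal F V => (localFrame g b x₀ β (extChartAt 𝓘(ℝ, EM) x₀ A.1),
      (endCoord x₀ A.1 A.2 : F →L[ℝ] F))) A :=
    (ContinuousAt.comp (g := localFrame g b x₀ β) (x := A)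
      (f := fun A : EndTotal F V => extChartAt 𝓘(ℝ, EM) x₀ A.1) h2 h3).prodMk h4
  have h6 := ContinuousAt.comp (x := A) (f := fun A : EndTotal F V =>
    (localFrame g b x₀ β (extChartAt 𝓘(ℝ, EM) x₀ A.1), (endCoord x₀ A.1 A.2 : F →L[ℝ] F)))
    (IsotropicChart.continuousAt_skew (κ := κ) h1.2) h5
  exact (h3.prodMk ((κ.exists_leftInverse_S.choose.continuous.continuousAt).comp h6)).continuousWithinAt

open Classical in
/-- The chart of the twistor space with inverse `twistorParam`. -/
def twistorChart (hg : IsHermitianMetric g) (hU : U ⊆ coordTarget EM F V x₀) (hUo : IsOpen U)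
    (hβ : ∀ c, ContDiffOn ℝ ∞ (fun z => β z c) U)
    (κ : IsotropicChart F (dualPairing b) ((Module.finrank ℂ F).choose 2)) (A₀ : twistorSpace g) :
    OpenPartialHomeomorph (twistorSpace g) (TwistorModel EM F) where
  toFun A := twistorCoord g b κ x₀ β A
  -- Outside `U` the value is immaterial; `A₀` only supplies some element.
  invFun p := if hp : p.1 ∈ U then ⟨twistorParam g b κ x₀ β p, twistorParam_mem hg hU hp⟩ else A₀
  source := Subtype.val ⁻¹' twistorDomain g b κ x₀ U β
  target := U ×ˢ Set.univ
  map_source' A hA := by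
    have h := hA.2
    rw [Set.mem_preimage, endChart_apply hA.1] at h
    exact ⟨h.1, trivial⟩
  map_target' p hp := by
    rw [dif_pos hp.1]
    exact (twistorCoord_twistorParam hg hU hp.1).1
  left_inv' A hA := by
    have h := hA.2
    rw [Set.mem_preimage, endChart_apply hA.1] at h
    rw [dif_pos (show (twistorCoord g b κ x₀ β A.1).1 ∈ U from h.1)]
    exact Subtype.ext (twistorParam_twistorCoord hg hU A.2 hA)
  right_inv' p hp := by
    rw [dif_pos hp.1]
    exact (twistorCoord_twistorParam hg hU hp.1).2
  open_source := (isOpen_twistorDomain b κ hU hUo hβ).preimage continuous_subtype_val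
  open_target := hUo.prod isOpen_univ
  continuousOn_toFun := (continuousOn_twistorCoord hU hUo hβ).comp continuous_subtype_val.continuousOn
    fun _ h => h
  continuousOn_invFun := by
    rw [Topology.IsInducing.subtypeVal.continuousOn_iff]
    refine ((contMDiffOn_twistorParam (b := b) (κ := κ) hg hU hβ).continuousOn).congr fun p hp => ?_
    rw [Function.comp_apply, dif_pos hp.1]

section Chart
variable (hg : IsHermitianMetric g) (hU : U ⊆ coordTarget EM F V x₀) (hUo : IsOpen U)
  (hβ : ∀ c, ContDiffOn ℝ ∞ (fun z => β z c) U) (A₀ : twistorSpace g)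

theorem twistorChart_symm {p : TwistorModel EM F} (hp : p.1 ∈ U) :
    ((twistorChart hg hU hUo hβ κ A₀).symm p : EndTotal F V) = twistorParam g b κ x₀ β p :=
  congrArg Subtype.val (dif_pos hp)

theorem twistorChart_symm_eventuallyEq {p : TwistorModel EM F} (hp : p.1 ∈ U) :
    (fun p => ((twistorChart hg hU hUo hβ κ A₀).symm p : EndTotal F V)) =ᶠ[𝓝 p]
      twistorParam g b κ x₀ β := by
  filter_upwards [(hUo.prod isOpen_univ).mem_nhds (show p ∈ U ×ˢ Set.univ from ⟨hp, trivial⟩)]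
    with p' hp' using twistorChart_symm hg hU hUo hβ A₀ hp'.1

/-- The tangent space depends on the base point, so the point and the derivative must be replaced
together; the predicate `R` on pairs makes this possible. -/
theorem mfderiv_eventuallyEq {f f' : TwistorModel EM F → EndTotal F V} {p : TwistorModel EM F}
    (h : f =ᶠ[𝓝 p] f') (R : EndTotal F V →
      (TwistorModel EM F →L[ℝ] EM × (F →L[ℝ] F)) → Prop)
    (h' : R (f' p) (mfderiv 𝓘(ℝ, TwistorModel EM F) (endModel EM F) f' p)) :
    R (f p) (mfderiv 𝓘(ℝ, TwistorModel EM F) (endModel EM F) f p) := by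
  rw [h.mfderiv_eq, h.self_of_nhds]
  exact h'

theorem isSmoothChart_twistorChart :
    IsSmoothChart (twistorSpace g) (twistorChart hg hU hUo hβ κ A₀) where
  smooth := (contMDiffOn_twistorParam (b := b) (κ := κ) hg hU hβ).congr fun p hp =>
    twistorChart_symm hg hU hUo hβ A₀ hp.1
  immersion p hp := by
    refine mfderiv_eventuallyEq (twistorChart_symm_eventuallyEq hg hU hUo hβ A₀ hp.1)
      (fun _ L => Function.Injective L) ?_
    refine (injective_iff_map_eq_zero _).2 fun ξ hξ => ?_
    have h1 := totalDeriv_mfderiv_twistorParam (b := b) (κ := κ) hg hU hUo hβ hp.1 ξ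
    rw [show mfderiv 𝓘(ℝ, TwistorModel EM F) (endModel EM F) (twistorParam g b κ x₀ β) p ξ = 0
      from hξ, (totalDeriv x₀ _).map_zero] at h1
    -- The base component of a vector in the kernel vanishes at once; the rest is
    -- `struct_fderiv_inj`.
    have h2 : ξ.1 = 0 := (congrArg Prod.fst h1).symm
    have h3 : ξ = (0, ξ.2) := Prod.ext h2 rfl
    have h4 := (congrArg Prod.snd h1).symm
    rw [h3]
    refine Prod.ext rfl (IsotropicChart.struct_fderiv_inj (κ := κ) (G := fun z u w => localMetric g x₀ z u w)
      (fun z _ => isIsometricFrame_localFrame b hg x₀ β z) (fun _ hz => localMetric_pos (hU hz))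
      (fun _ hz => isInvertible_cplxExt_localFrame b hg β (hU hz)) hUo
      (contDiffOn_localFrame b hU hβ) hp.1 p.2 ξ.2 ?_)
    rw [← h3]
    exact h4

theorem isTwistorImage_of_totalDeriv {cov : CovariantDerivative 𝓘(ℝ, EM) F V} {A : EndTotal F V}
    (hy : A.1 ∈ coordDomain EM F V x₀) {Γ : EM →L[ℝ] F →L[ℝ] F} (hΓ : IsConnectionForm cov x₀ A.1 Γ)
    {X Y : TangentSpace (endModel EM F) A} {v w : EM} {a c : F →L[ℝ] F}
    (hX : totalDeriv x₀ A X = (v, a)) (hY : totalDeriv x₀ A Y = (w, c)) (hw : w = Complex.I • v)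
    (hc : c = endCoord x₀ A.1 A.2 ∘L (a + (Γ v ∘L endCoord x₀ A.1 A.2 -
      endCoord x₀ A.1 A.2 ∘L Γ v)) - (Γ (Complex.I • v) ∘L endCoord x₀ A.1 A.2 -
        endCoord x₀ A.1 A.2 ∘L Γ (Complex.I • v))) : IsTwistorImage cov A X Y := by
  rw [isTwistorImage_iff hy hΓ, hX, hY]
  exact ⟨hw, hc⟩

/-- For a potential of `D`, `fderiv_localFrame` supplies the hypothesis of `struct_fderiv_I`, whose
conclusion is the description of `𝒥` in `isTwistorImage_iff`. -/
theorem twistorChart_mem_twistorAtlas {cov : CovariantDerivative 𝓘(ℝ, EM) F V}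
    (hc : IsChernConnection g cov) {D : Π x : M, TangentSpace 𝓘(ℂ, EM) x →ₗ⋆[ℂ] Alt2 (V x)}
    (hD : IsPotential D x₀ U β) :
    twistorChart hg hU hUo hD.contDiffOn κ A₀ ∈ twistorAtlas g (twistedConnection g cov D) := by
  refine ⟨isSmoothChart_twistorChart hg hU hUo hD.contDiffOn A₀, fun p hp ξ => ?_⟩
  refine mfderiv_eventuallyEq (twistorChart_symm_eventuallyEq hg hU hUo hD.contDiffOn A₀ hp.1)
    (fun A L => IsTwistorImage (twistedConnection g cov D) A (L ξ) (L (Complex.I • ξ))) ?_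
  obtain ⟨h1, h2, h3⟩ := twistorParam_spec (g := g) (κ := κ) (β := β) hU hp.1
  obtain ⟨Γ, hΓ⟩ := exists_isConnectionForm (twistedConnection g cov D) h1
  have hT := contDiffOn_localFrame (g := g) b hU hD.contDiffOn
  have hz := hUo.mem_nhds hp.1
  have key := IsotropicChart.struct_fderiv_I (κ := κ) (G := fun z u w => localMetric g x₀ z u w)
    (fun z _ => isIsometricFrame_localFrame b hg x₀ β z) (fun _ hz => localMetric_pos (hU hz))
    (fun _ hz => isInvertible_cplxExt_localFrame b hg β (hU hz)) hUo hT hp.1 p.2 (Γ := Γ)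
    (by
      have h := fderiv_localFrame b hg hc h1 hΓ (β := β)
        (fun c => by
          rw [h2]
          exact ((hD.contDiffOn c).contDiffAt hz).differentiableAt (by simp))
        (by
          rw [h2]
          exact (hT.contDiffAt hz).differentiableAt (by simp))
        (fun v c => by
          rw [hD.dbar_eq _ h1 (by rw [h2]; exact hp.1), formCoord_apply]
          exact congrArg (fun w => D (twistorParam g b κ x₀ β p).1 w fun i =>
            constSection F V x₀ (c i) (twistorParam g b κ x₀ β p).1) (constSection_chartDeriv h1.1 v))
      rwa [h2] at h) ξ
  have hX := totalDeriv_mfderiv_twistorParam (b := b) (κ := κ) hg hU hUo hD.contDiffOn hp.1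
  refine isTwistorImage_of_totalDeriv h1 hΓ (hX ξ) (hX (Complex.I • ξ)) rfl ?_
  rw [h3]
  exact key

end Chart

/-- A potential near the base point of `A`, and an isotropic chart centred at `A` itself. -/
theorem exists_mem_twistorChart_source (hg : IsHermitianMetric g)
    {D : Π x : M, TangentSpace 𝓘(ℂ, EM) x →ₗ⋆[ℂ] Alt2 (V x)} (hD : D ∈ closedForms EM F V)
    (A : twistorSpace g) : ∃ (x₀ : M) (U : Set EM) (hU : U ⊆ coordTarget EM F V x₀) (hUo : IsOpen U)
      (β : EM → Alt2 F) (hβ : IsPotential D x₀ U β)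
      (κ : IsotropicChart F (dualPairing (Module.finBasis ℂ F)) ((Module.finrank ℂ F).choose 2)),
      A ∈ (twistorChart hg hU hUo hβ.contDiffOn κ A).source := by
  obtain ⟨U, hU, hUo, hx, β, hβ⟩ := exists_isPotential hD A.1.1
  have h0 := mem_coordDomain (EM := EM) (F' := F) (W := V) A.1.1
  obtain ⟨h1, h2⟩ := (mem_twistorSpace_iff h0).1 A.2
  obtain ⟨κ, hκ⟩ := exists_isotropicChart (dualPairing_nondegenerate (Module.finBasis ℂ F))
    (dualPairing_symm _)
    (isIsometricFrame_localFrame (g := g) (Module.finBasis ℂ F) hg A.1.1 β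
      (extChartAt 𝓘(ℝ, EM) A.1.1 A.1.1))
    (isInvertible_cplxExt_localFrame _ hg β (hU hx)) h1 h2
  refine ⟨A.1.1, U, hU, hUo, β, hβ, κ, h0, ?_⟩
  rw [Set.mem_preimage, endChart_apply h0]
  exact ⟨hx, hκ⟩

end TwistorAtlasCharts

/-! ### Transition maps are holomorphic -/

noncomputable section Transitions

set_option linter.unusedSectionVars false

section Immersion
variable {E E' G : Type*} [NormedAddCommGroup E] [NormedSpace ℂ E] [NormedAddCommGroup E']
  [NormedSpace ℂ E'] [FiniteDimensional ℂ E'] [NormedAddCommGroup G] [NormedSpace ℝ G]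
  [FiniteDimensional ℝ G]

-- Let `k` be a linear left inverse of the derivative of the immersion `f'`. Then `k ∘ f'` is
-- locally invertible, and near `z` the continuous map `τ` is its local inverse applied to `k ∘ f`.
omit [NormedSpace ℂ E] in
theorem differentiableAt_of_comp_immersion [NormedSpace ℝ E] {f : E → G} {f' : E' → G} {τ : E → E'}
    {z : E} (hf : DifferentiableAt ℝ f z) (hf' : ContDiffAt ℝ ∞ f' (τ z))
    (hinj : Function.Injective (fderiv ℝ f' (τ z))) (hτ : ContinuousAt τ z)
    (h : f =ᶠ[𝓝 z] f' ∘ τ) : DifferentiableAt ℝ τ z := by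
  have : FiniteDimensional ℝ E' := FiniteDimensional.complexToReal E'
  have : CompleteSpace E' := FiniteDimensional.complete ℝ E'
  obtain ⟨K, hK⟩ := (fderiv ℝ f' (τ z)).toLinearMap.exists_leftInverse_of_injective
    (LinearMap.ker_eq_bot.2 hinj)
  let k : G →L[ℝ] E' := LinearMap.toContinuousLinearMap K
  have h1 : HasStrictFDerivAt (fun w => k (f' w))
      ((ContinuousLinearEquiv.refl ℝ E' : E' ≃L[ℝ] E') : E' →L[ℝ] E') (τ z) := by
    have h2 := k.hasStrictFDerivAt.comp (τ z) (hf'.hasStrictFDerivAt (by simp))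
    have h3 : k ∘L fderiv ℝ f' (τ z) = (ContinuousLinearEquiv.refl ℝ E' : E' →L[ℝ] E') :=
      ContinuousLinearMap.ext fun w => DFunLike.congr_fun hK w
    rwa [h3] at h2
  have h4 := h1.to_localInverse.hasFDerivAt.differentiableAt
  have h5 : τ =ᶠ[𝓝 z] fun w => h1.localInverse _ _ _ (k (f w)) := by
    filter_upwards [hτ.eventually h1.eventually_left_inverse, h] with w hw hw'
    rw [hw']
    exact hw.symm
  refine DifferentiableAt.congr_of_eventuallyEq ?_ h5
  refine DifferentiableAt.comp (g := h1.localInverse _ _ _) z ?_ (k.differentiableAt.comp z hf)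
  rw [h.self_of_nhds]
  exact h4

/-- The derivative of `τ` commutes with `i` because `hI` says so after the injective derivative of
`f'`. -/
theorem differentiableAt_complex_of_comp_immersion {f : E → G} {f' : E' → G} {τ : E → E'} {z : E}
    [FiniteDimensional ℂ E]
    (hf : DifferentiableAt ℝ f z) (hf' : ContDiffAt ℝ ∞ f' (τ z))
    (hinj : Function.Injective (fderiv ℝ f' (τ z))) (hτ : ContinuousAt τ z)
    (h : f =ᶠ[𝓝 z] f' ∘ τ)
    (hI : ∀ ξ η, fderiv ℝ f z ξ = fderiv ℝ f' (τ z) η →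
      fderiv ℝ f z (Complex.I • ξ) = fderiv ℝ f' (τ z) (Complex.I • η)) :
    DifferentiableAt ℂ τ z := by
  have h1 := differentiableAt_of_comp_immersion hf hf' hinj hτ h
  have h2 : fderiv ℝ f z = fderiv ℝ f' (τ z) ∘L fderiv ℝ τ z := by
    rw [h.fderiv_eq]
    exact fderiv_comp z (hf'.differentiableAt (by simp)) h1
  have h3 : ∀ ξ, fderiv ℝ τ z (Complex.I • ξ) = Complex.I • fderiv ℝ τ z ξ := fun ξ => by
    apply hinj
    rw [← hI ξ (fderiv ℝ τ z ξ) (by rw [h2]; rfl), h2]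
    rfl
  exact (hasFDerivAt_of_restrictScalars ℝ h1.hasFDerivAt
    (f' := LinearMap.toContinuousLinearMap (cplxLinear (fderiv ℝ τ z).toLinearMap h3))
    (by ext; rfl)).differentiableAt

end Immersion

variable {EM : Type*} [NormedAddCommGroup EM] [NormedSpace ℂ EM] [FiniteDimensional ℂ EM]
  {M : Type*} [TopologicalSpace M] [ChartedSpace EM M] [IsManifold 𝓘(ℂ, EM) ω M]
  {F : Type*} [NormedAddCommGroup F] [NormedSpace ℂ F] [FiniteDimensional ℂ F]
  {V : M → Type*} [TopologicalSpace (TotalSpace F V)]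
  [∀ x, AddCommGroup (V x)] [∀ x, Module ℂ (V x)] [∀ x, TopologicalSpace (V x)]
  [∀ x, IsTopologicalAddGroup (V x)] [∀ x, ContinuousSMul ℂ (V x)]
  [FiberBundle F V] [VectorBundle ℂ F V] [ContMDiffVectorBundle ω F V 𝓘(ℂ, EM)]
  {g : ContMDiffRiemannianMetric 𝓘(ℝ, EM) ∞ F V} {cov : CovariantDerivative 𝓘(ℝ, EM) F V}

/-- The relation `IsTwistorImage` is single valued: by `isTwistorImage_iff` the image is a function
of the vector. The base points are only propositionally equal, so vectors are compared in
coordinates. -/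
theorem IsTwistorImage.totalDeriv_eq {x₀ : M} {A A' : EndTotal F V}
    {X Y : TangentSpace (endModel EM F) A} {X' Y' : TangentSpace (endModel EM F) A'}
    (h : IsTwistorImage cov A X Y) (h' : IsTwistorImage cov A' X' Y') (hA : A = A')
    (hy : A.1 ∈ coordDomain EM F V x₀) (hX : totalDeriv x₀ A X = totalDeriv x₀ A' X') :
    totalDeriv x₀ A Y = totalDeriv x₀ A' Y' := by
  subst hA
  obtain ⟨Γ, hΓ⟩ := exists_isConnectionForm cov hy
  obtain ⟨h1, h2⟩ := (isTwistorImage_iff hy hΓ _ _).1 h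
  obtain ⟨h1', h2'⟩ := (isTwistorImage_iff hy hΓ _ _).1 h'
  rw [hX, ← h1'] at h1
  rw [hX, ← h2'] at h2
  exact Prod.ext h1 h2

theorem contDiffAt_endChart_comp {E : Type*} [NormedAddCommGroup E] [NormedSpace ℝ E]
    {f : E → EndTotal F V} {z : E} (hf : ContMDiffAt 𝓘(ℝ, E) (endModel EM F) ∞ f z) {x₀ : M}
    (hy : (f z).1 ∈ coordDomain EM F V x₀) :
    ContDiffAt ℝ ∞ (fun w => endChart EM F V x₀ (f w)) z ∧
      ∀ ξ, fderiv ℝ (fun w => endChart EM F V x₀ (f w)) z ξ =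
        totalDeriv x₀ (f z) (mfderiv 𝓘(ℝ, E) (endModel EM F) f z ξ) := by
  have h0 : ContMDiffAt (endModel EM F) 𝓘(ℝ, EM × (F →L[ℝ] F)) ∞ (endChart EM F V x₀) (f z) := by
    have h := mem_endChart_source hy
    rw [endChart, extChartAt_source] at h
    exact contMDiffAt_extChartAt' h
  refine ⟨(h0.comp z hf).contDiffAt, fun ξ => ?_⟩
  have h1 : MDifferentiableAt 𝓘(ℝ, E) (endModel EM F) f z := hf.mdifferentiableAt (by simp)
  have h2 := (mdifferentiableAt_totalCoord (EM := EM) (F' := F →L[ℝ] F)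
    (W := fun x => V x →L[ℝ] V x) x₀ (p := f z) (mem_coordDomain_end.2 hy)).1.hasMFDerivAt
  have h3 := (h2.comp z h1.hasMFDerivAt).hasFDerivAt
  have h4 : (fun w => endChart EM F V x₀ (f w)) =ᶠ[𝓝 z]
      totalCoord EM (F →L[ℝ] F) (fun x => V x →L[ℝ] V x) x₀ ∘ f := by
    filter_upwards [hf.continuousAt.eventually ((isOpen_endDomain x₀).mem_nhds hy)] with w hw
    exact endChart_apply hw
  have h5 := ((h0.comp z hf).contDiffAt.differentiableAt (by simp)).hasFDerivAt.congr_of_eventuallyEq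
    h4.symm
  exact DFunLike.congr_fun (h5.unique h3) ξ

/-- Both inverse charts are immersions in `End E` that intertwine `i` with the same `𝒥`, so the
criterion for compositions with immersions applies in a chart of `End E`. -/
theorem differentiableAt_transition {φ φ' : OpenPartialHomeomorph (twistorSpace g) (TwistorModel EM F)}
    (hφ : φ ∈ twistorAtlas g cov) (hφ' : φ' ∈ twistorAtlas g cov) {z : TwistorModel EM F}
    (hz : z ∈ (φ.symm.trans φ').source) : DifferentiableAt ℂ (φ.symm.trans φ') z := by
  have hz1 : z ∈ φ.target := hz.1
  have hz2 : φ.symm z ∈ φ'.source := hz.2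
  set τ := φ.symm.trans φ' with hτ
  have hw : τ z ∈ φ'.target := φ'.map_source hz2
  have hfz : ∀ w ∈ τ.source, (φ.symm w : EndTotal F V) = φ'.symm (τ w) := fun w hw =>
    congrArg Subtype.val (φ'.left_inv hw.2).symm
  let x₀ : M := (φ.symm z : EndTotal F V).1
  have hy : (φ.symm z : EndTotal F V).1 ∈ coordDomain EM F V x₀ := mem_coordDomain _
  have hy' : (φ'.symm (τ z) : EndTotal F V).1 ∈ coordDomain EM F V x₀ := by
    rw [← hfz z hz]; exact hy
  obtain ⟨h1, h2⟩ := contDiffAt_endChart_comp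
    (hφ.1.smooth.contMDiffAt (φ.open_target.mem_nhds hz1)) hy
  obtain ⟨h3, h4⟩ := contDiffAt_endChart_comp
    (hφ'.1.smooth.contMDiffAt (φ'.open_target.mem_nhds hw)) hy'
  have : FiniteDimensional ℝ EM := FiniteDimensional.complexToReal EM
  have : FiniteDimensional ℝ F := FiniteDimensional.complexToReal F
  refine differentiableAt_complex_of_comp_immersion (h1.differentiableAt (by simp)) h3
    (fun ξ η h => ?_) (τ.continuousAt hz) ?_ fun ξ η h => ?_
  · rw [h4, h4] at h
    exact hφ'.1.immersion _ hw ((mdifferentiableAt_totalCoord (EM := EM) (F' := F →L[ℝ] F)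
      (W := fun x => V x →L[ℝ] V x) x₀ (mem_coordDomain_end.2 hy')).2.1 h)
  · filter_upwards [τ.open_source.mem_nhds hz] with w hw
    exact congrArg (endChart EM F V x₀) (hfz w hw)
  · rw [h2, h4] at h ⊢
    exact (hφ.2 z hz1 ξ).totalDeriv_eq (hφ'.2 _ hw η) (hfz z hz) hy h

theorem contDiffOn_transition {φ φ' : OpenPartialHomeomorph (twistorSpace g) (TwistorModel EM F)}
    (hφ : φ ∈ twistorAtlas g cov) (hφ' : φ' ∈ twistorAtlas g cov) :
    ContDiffOn ℂ ω (φ.symm.trans φ') (φ.symm.trans φ').source := by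
  have : CompleteSpace (TwistorModel EM F) := FiniteDimensional.complete ℂ _
  have h := analyticOnNhd_of_differentiableOn (φ.symm.trans φ').open_source fun z hz =>
    (differentiableAt_transition hφ hφ' hz).differentiableWithinAt
  exact h.analyticOn.contDiffOn (φ.symm.trans φ').open_source.uniqueDiffOn

variable (g cov) in
/-- The complex structure on the twistor space with atlas `twistorAtlas g cov`. -/
def twistorStructure (h : ∀ A : twistorSpace g, ∃ φ ∈ twistorAtlas g cov, A ∈ φ.source) :
    ComplexStructure g where
  charts :=
    { atlas := twistorAtlas g cov
      chartAt := fun A => (h A).choose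
      mem_chart_source := fun A => (h A).choose_spec.2
      chart_mem_atlas := fun A => (h A).choose_spec.1 }
  isManifold := by
    let _ : ChartedSpace (TwistorModel EM F) (twistorSpace g) :=
      { atlas := twistorAtlas g cov
        chartAt := fun A => (h A).choose
        mem_chart_source := fun A => (h A).choose_spec.2
        chart_mem_atlas := fun A => (h A).choose_spec.1 }
    refine isManifold_of_contDiffOn _ _ _ fun φ φ' hφ hφ' => ?_
    have h := contDiffOn_transition hφ hφ'
    simpa using h
  smooth _ hφ := hφ.1

theorem exists_complexStructure (hg : IsHermitianMetric g) (hc : IsChernConnection g cov)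
    {D : Π x : M, TangentSpace 𝓘(ℂ, EM) x →ₗ⋆[ℂ] Alt2 (V x)} (hD : D ∈ closedForms EM F V) :
    ∃ S : ComplexStructure g, S.charts.atlas = twistorAtlas g (twistedConnection g cov D) :=
  ⟨twistorStructure g (twistedConnection g cov D) fun A => by
    obtain ⟨x₀, U, hU, hUo, β, hβ, κ, hA⟩ := exists_mem_twistorChart_source hg hD A
    exact ⟨_, twistorChart_mem_twistorAtlas hg hU hUo A hc hβ, hA⟩, rfl⟩

end Transitions

/-! ### The map induced by `exp(-g⁻¹B)`, and the map on cohomology -/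

noncomputable section ExponentialMap

set_option linter.unusedSectionVars false

section LinearAlgebra
variable {W : Type*} [AddCommGroup W] [Module ℂ W] [FiniteDimensional ℝ W]

/-- The eigenspace is the graph `{a + i A a}`, from which `A` can be read off. -/
theorem eigen01_injective {A A' : W →ₗ[ℝ] W} (hA : ∀ a, A (A a) = -a) (hA' : ∀ a, A' (A' a) = -a)
    (h : eigen01 A = eigen01 A') : A = A' := by
  ext a
  have h1 : (1 : ℂ) ⊗ₜ[ℝ] a + Complex.I ⊗ₜ[ℝ] A a ∈ eigen01 A := (mem_eigen01_iff hA _).2 ⟨a, rfl⟩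
  rw [h] at h1
  obtain ⟨a', h2⟩ := (mem_eigen01_iff hA' _).1 h1
  obtain ⟨rfl, h3⟩ := cplx_decomp_inj h2
  exact h3

end LinearAlgebra

theorem contMDiffAt_of_eqOn_charts {H : Type*} [NormedAddCommGroup H] [NormedSpace ℂ H]
    {X Y : Type*} [TopologicalSpace X] [ChartedSpace H X] [IsManifold 𝓘(ℂ, H) ω X]
    [TopologicalSpace Y] [ChartedSpace H Y] [IsManifold 𝓘(ℂ, H) ω Y] {f : X → Y}
    {φ : OpenPartialHomeomorph X H} {φ' : OpenPartialHomeomorph Y H} (hφ : φ ∈ atlas H X)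
    (hφ' : φ' ∈ atlas H Y) {x : X} (hx : x ∈ φ.source) (hx' : φ x ∈ φ'.target)
    (h : ∀ y ∈ φ.source, f y = φ'.symm (φ y)) : ContMDiffAt 𝓘(ℂ, H) 𝓘(ℂ, H) ω f x := by
  have h1 := (contMDiffOn_of_mem_maximalAtlas (I := 𝓘(ℂ, H)) (n := ω)
    (IsManifold.subset_maximalAtlas hφ)).contMDiffAt (φ.open_source.mem_nhds hx)
  have h2 := (contMDiffOn_symm_of_mem_maximalAtlas (I := 𝓘(ℂ, H)) (n := ω)
    (IsManifold.subset_maximalAtlas hφ')).contMDiffAt (φ'.open_target.mem_nhds hx')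
  refine (h2.comp x h1).congr_of_eventuallyEq ?_
  filter_upwards [φ.open_source.mem_nhds hx] with y hy using h y hy

variable {EM : Type*} [NormedAddCommGroup EM] [NormedSpace ℂ EM] [FiniteDimensional ℂ EM]
  {M : Type*} [TopologicalSpace M] [ChartedSpace EM M] [IsManifold 𝓘(ℂ, EM) ω M]
  {F : Type*} [NormedAddCommGroup F] [NormedSpace ℂ F] [FiniteDimensional ℂ F]
  {V : M → Type*} [TopologicalSpace (TotalSpace F V)]
  [∀ x, AddCommGroup (V x)] [∀ x, Module ℂ (V x)] [∀ x, TopologicalSpace (V x)]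
  [∀ x, IsTopologicalAddGroup (V x)] [∀ x, ContinuousSMul ℂ (V x)]
  [FiberBundle F V] [VectorBundle ℂ F V] [ContMDiffVectorBundle ω F V 𝓘(ℂ, EM)]
  {g : ContMDiffRiemannianMetric 𝓘(ℝ, EM) ∞ F V}

theorem metricForm_hermitian (hg : IsHermitianMetric g) (x : M) (a c : V x) :
    metricForm g x (Complex.I • a) (Complex.I • c) = metricForm g x a c := hg x a c

theorem isExpImage_unique {B : Π x, Alt2 (V x)} {A : EndTotal F V} {A' A'' : twistorSpace g}
    (h' : IsExpImage g B A A') (h'' : IsExpImage g B A A'') : A' = A'' := by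
  obtain ⟨K', e', h'⟩ := h'
  obtain ⟨K'', e'', h''⟩ := h''
  have t' := A'.2
  have t'' := A''.2
  rw [e'] at t'
  rw [e''] at t''
  have := fibre_finiteDimensional F V A.1
  have h := eigen01_injective (W := V A.1) (A := (K' : V A.1 →ₗ[ℝ] V A.1))
    (A' := (K'' : V A.1 →ₗ[ℝ] V A.1)) (fun a => DFunLike.congr_fun t'.1 a)
    (fun a => DFunLike.congr_fun t''.1 a) (h'.trans h''.symm)
  have : K' = K'' := ContinuousLinearMap.coe_injective h
  exact Subtype.ext (by rw [e', e'', this])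

/-- `(1 + N)(1 - N) = 1` for `N = g⁻¹B`, as `N² = 0`. -/
theorem IsExpImage.neg (hg : IsHermitianMetric g) {B : Π x, Alt2 (V x)} {A A' : EndTotal F V}
    (h : IsExpImage g B A A') : IsExpImage g (-B) A' A := by
  obtain ⟨K', rfl, h⟩ := h
  refine ⟨A.2, rfl, ?_⟩
  dsimp only
  have := fibre_finiteDimensional F V A.1
  have hI := metricForm_hermitian hg A.1
  have e1 : IsNilpotent.exp (-metricRaise g A.1 (B A.1)) = 1 - metricRaise g A.1 (B A.1) :=
    exp_neg_raise (g.pos A.1) hI (B A.1)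
  have e2 : IsNilpotent.exp (-metricRaise g A.1 ((-B) A.1)) = 1 + metricRaise g A.1 (B A.1) := by
    have e3 : metricRaise g A.1 ((-B) A.1) = -metricRaise g A.1 (B A.1) := map_neg _ _
    refine (exp_neg_raise (g.pos A.1) hI ((-B) A.1)).trans ?_
    change 1 - metricRaise g A.1 ((-B) A.1) = _
    rw [e3, sub_neg_eq_add]
  have e4 : (1 + metricRaise g A.1 (B A.1)) ∘ₗ (1 - metricRaise g A.1 (B A.1)) = LinearMap.id := by
    refine LinearMap.ext fun z => ?_
    have e5 : metricRaise g A.1 (B A.1) (metricRaise g A.1 (B A.1) z) = 0 :=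
      raise_raise (g.pos A.1) hI (B A.1) (B A.1) z
    change (z - metricRaise g A.1 (B A.1) z) +
      metricRaise g A.1 (B A.1) (z - metricRaise g A.1 (B A.1) z) = z
    rw [map_sub, e5]
    abel
  rw [h, e1, e2, ← Submodule.map_comp, e4, Submodule.map_id]

variable {ι : Type*} [Fintype ι] {b : Module.Basis ι ℂ F} {N : ℕ}
  {κ : IsotropicChart F (dualPairing b) N} {x₀ : M} {U : Set EM} {β : EM → Alt2 F}

/-- Points with equal coordinates in the charts for `β` and `β + B` correspond under `exp(-g⁻¹B)`;
this is the fibrewise statement `eigen01_eq_map_exp`. -/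
theorem isExpImage_twistorParam (hg : IsHermitianMetric g) (hU : U ⊆ coordTarget EM F V x₀)
    (B : Π x, Alt2 (V x)) {p : EM × (Fin N → ℂ)} (hp : p.1 ∈ U) :
    IsExpImage g B (twistorParam g b κ x₀ β p) (twistorParam g b κ x₀
      (fun z => β z + sectionCoord B x₀ ((extChartAt 𝓘(ℝ, EM) x₀).symm z)) p) := by
  obtain ⟨y, hy, h1, h2⟩ := exists_endChart_symm (hU hp)
  obtain ⟨A, h3, h4⟩ := h2 (structCoord g b κ x₀ β p)
  obtain ⟨A', h3', h4'⟩ := h2 (structCoord g b κ x₀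
    (fun z => β z + sectionCoord B x₀ ((extChartAt 𝓘(ℝ, EM) x₀).symm z)) p)
  rw [twistorParam, twistorParam, h3, h3']
  refine ⟨A', rfl, ?_⟩
  have hfin := fibre_finiteDimensional F V y
  have h5 : (extChartAt 𝓘(ℝ, EM) x₀).symm p.1 = y := by
    rw [← h1]
    exact (extChartAt 𝓘(ℝ, EM) x₀).left_inv (by rw [extChartAt_source]; exact hy.1)
  have h6 : localMetric g x₀ p.1 = fibreMetric g x₀ y := by
    rw [← h1, localMetric_extChartAt g hy.1]
  have h7 : sectionCoord B x₀ y =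
      (B y).compLinearMap (fibreEquiv x₀ hy).symm.toLinearMap := by
    ext c
    rw [sectionCoord_apply, AlternatingMap.compLinearMap_apply]
    congr 1
    ext i
    exact (fibreEquiv_symm_apply hy (c i)).symm
  refine eigen01_eq_map_exp (g.pos y) b (fibreEquiv x₀ hy) (G := fibreMetric g x₀ y)
    (metricForm_hermitian hg y) (fun a c => g.symm y a c)
    (fun a c => fibreMetric_trivialization g hy a c) (β p.1) (B y) κ p.2 (fun a => ?_) fun a => ?_
  · have h8 := endCoord_apply hy A a
    rw [h4, structCoord, localFrame, h6] at h8
    exact h8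
  · have h8 := endCoord_apply hy A' a
    rw [h4', structCoord, localFrame, h6, h5, h7] at h8
    exact h8

/-- The claim concerns one fibre, and `B` need not be smooth. The charts of the zero form merely
provide coordinates for `A`, and the image is the point with the same coordinates in the frame
sheared by `B`. -/
theorem exists_isExpImage (hg : IsHermitianMetric g) (B : Π x, Alt2 (V x)) (A : twistorSpace g) :
    ∃ A' : twistorSpace g, IsExpImage g B A A' := by
  obtain ⟨x₀, U, hU, hUo, β, hβ, κ, hA⟩ :=
    exists_mem_twistorChart_source hg (zero_mem (closedForms EM F V)) A
  have hp := ((twistorChart hg hU hUo hβ.contDiffOn κ A).map_source hA).1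
  have h := isExpImage_twistorParam (b := Module.finBasis ℂ F) (κ := κ) (β := β) hg hU B hp
  refine ⟨⟨_, twistorParam_mem (b := Module.finBasis ℂ F) (κ := κ) (β := fun z => β z +
    sectionCoord B x₀ ((extChartAt 𝓘(ℝ, EM) x₀).symm z)) hg hU hp⟩, ?_⟩
  have h1 : twistorParam g (Module.finBasis ℂ F) κ x₀ β
      (twistorChart hg hU hUo hβ.contDiffOn κ A A) = A :=
    twistorParam_twistorCoord (b := Module.finBasis ℂ F) (κ := κ) (β := β) hg hU A.2 hA
  rwa [h1] at h

/-- The map of the twistor space induced by `exp (-g⁻¹B)`. -/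
def expMap (hg : IsHermitianMetric g) (B : Π x, Alt2 (V x)) (A : twistorSpace g) : twistorSpace g :=
  (exists_isExpImage hg B A).choose

theorem isExpImage_expMap (hg : IsHermitianMetric g) (B : Π x, Alt2 (V x)) (A : twistorSpace g) :
    IsExpImage g B A (expMap hg B A) :=
  (exists_isExpImage hg B A).choose_spec

theorem expMap_neg_expMap (hg : IsHermitianMetric g) (B : Π x, Alt2 (V x)) (A : twistorSpace g) :
    expMap hg (-B) (expMap hg B A) = A :=
  isExpImage_unique (isExpImage_expMap hg (-B) (expMap hg B A)) ((isExpImage_expMap hg B A).neg hg)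

variable {cov : CovariantDerivative 𝓘(ℝ, EM) F V}
  {D D' : Π x : M, TangentSpace 𝓘(ℂ, EM) x →ₗ⋆[ℂ] Alt2 (V x)}

/-- If `β` is a potential of `D`, then `β + B` is one of `D + ∂̄B`; in the two charts defined by
them the map is the identity, hence analytic. -/
theorem contMDiff_expMap (hg : IsHermitianMetric g) (hc : IsChernConnection g cov)
    (hD : D ∈ closedForms EM F V) (B : smoothSections EM F V) {S S' : ComplexStructure g}
    (hS : S.charts.atlas = twistorAtlas g (twistedConnection g cov D))
    (hS' : S'.charts.atlas = twistorAtlas g (twistedConnection g cov (D + dbar EM F V B))) :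
    @ContMDiff ℂ _ (TwistorModel EM F) _ _ (TwistorModel EM F) _ 𝓘(ℂ, TwistorModel EM F)
      (twistorSpace g) _ S.charts (TwistorModel EM F) _ _ (TwistorModel EM F) _
      𝓘(ℂ, TwistorModel EM F) (twistorSpace g) _ S'.charts ω (expMap hg B.1) := by
  intro A
  obtain ⟨x₀, U, hU, hUo, β, hβ, κ, hA⟩ := exists_mem_twistorChart_source hg hD A
  have hβ' := hβ.add_dbar hU hUo B
  set φ := twistorChart hg hU hUo hβ.contDiffOn κ A with hφ
  set φ' := twistorChart hg hU hUo hβ'.contDiffOn κ A with hφ'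
  have h1 : φ ∈ S.charts.atlas := hS ▸ twistorChart_mem_twistorAtlas hg hU hUo A hc hβ
  have h2 : φ' ∈ S'.charts.atlas := hS' ▸ twistorChart_mem_twistorAtlas hg hU hUo A hc hβ'
  have h3 : ∀ A' ∈ φ.source, expMap hg B.1 A' = φ'.symm (φ A') := fun A' hA' => by
    refine isExpImage_unique (isExpImage_expMap hg B.1 A') ?_
    have hp : (φ A').1 ∈ U := (φ.map_source hA').1
    have h := isExpImage_twistorParam (b := Module.finBasis ℂ F) (κ := κ) (β := β) hg hU B.1 hp
    rw [← twistorChart_symm hg hU hUo hβ.contDiffOn A hp, ← hφ, φ.left_inv hA'] at h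
    rwa [twistorChart_symm hg hU hUo hβ'.contDiffOn A hp]
  exact @contMDiffAt_of_eqOn_charts (TwistorModel EM F) _ _ (twistorSpace g) (twistorSpace g) _
    S.charts S.isManifold _ S'.charts S'.isManifold _ φ φ' h1 h2 A hA (φ.map_source hA) h3

/-- The biholomorphism induced by `exp (-g⁻¹B)`. -/
def expBiholomorphism (hg : IsHermitianMetric g) (hc : IsChernConnection g cov)
    (hD : D ∈ closedForms EM F V) (B : smoothSections EM F V) {S S' : ComplexStructure g}
    (hS : S.charts.atlas = twistorAtlas g (twistedConnection g cov D))
    (hS' : S'.charts.atlas = twistorAtlas g (twistedConnection g cov (D + dbar EM F V B))) :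
    Biholomorphism S S' :=
  @Diffeomorph.mk ℂ _ (TwistorModel EM F) _ _ (TwistorModel EM F) _ _ (TwistorModel EM F) _
    (TwistorModel EM F) _ 𝓘(ℂ, TwistorModel EM F) 𝓘(ℂ, TwistorModel EM F)
    (twistorSpace g) _ S.charts (twistorSpace g) _ S'.charts ω
    { toFun := expMap hg B.1
      invFun := expMap hg (-B.1)
      left_inv := expMap_neg_expMap hg B.1
      right_inv := fun A => by
        have h := expMap_neg_expMap hg (-B.1) A
        rwa [neg_neg] at h }
    (contMDiff_expMap hg hc hD B hS hS')
    -- The inverse is the same construction for `-B`, which leads from `D + ∂̄B` back to `D`.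
    (contMDiff_expMap hg hc (add_mem hD (dbar_mem_closedForms B)) (-B) hS' (by
      rw [map_neg, add_neg_cancel_right]
      exact hS))

theorem existsUnique_dolbeaultMap (hg : IsHermitianMetric g) (hc : IsChernConnection g cov) :
    ∃! f : DolbeaultH01 EM F V → ComplexStructureClass g,
      ∀ (D) (hD : D ∈ closedForms EM F V) (S : ComplexStructure g),
        S.charts.atlas = twistorAtlas g (twistedConnection g cov D) →
        f (QuotientAddGroup.mk ⟨D, hD⟩) = Quotient.mk (complexStructureSetoid g) S := by
  choose S hS using fun D : closedForms EM F V => exists_complexStructure hg hc D.2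
  -- This covers `D = D'` too: two complex structures with the same atlas may still differ as data
  -- in the preferred charts, and have to be shown isomorphic.
  have key : ∀ (D D' : closedForms EM F V) (S S' : ComplexStructure g),
      (QuotientAddGroup.mk D : DolbeaultH01 EM F V) = QuotientAddGroup.mk D' →
      S.charts.atlas = twistorAtlas g (twistedConnection g cov D) →
      S'.charts.atlas = twistorAtlas g (twistedConnection g cov D') →
      Quotient.mk (complexStructureSetoid g) S = Quotient.mk (complexStructureSetoid g) S' := by
    intro D D' S S' h hS hS'
    obtain ⟨B, hB⟩ := QuotientAddGroup.eq.1 h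
    have hB' : dbar EM F V B = -D.1 + D'.1 := hB
    refine Quotient.sound ⟨expBiholomorphism hg hc D.2 B hS ?_⟩
    rw [hB', add_neg_cancel_left]
    exact hS'
  -- Uniqueness holds because every class has a representative, and that representative has a
  -- complex structure by `exists_complexStructure`.
  refine ⟨fun q => Quotient.mk _ (S q.out), fun D hD S' hS' => ?_, fun f hf => funext fun q => ?_⟩
  · exact key _ ⟨D, hD⟩ _ _ (QuotientAddGroup.out_eq' _) (hS _) hS'
  · have h := hf q.out.1 q.out.2 (S q.out) (hS _)
    rwa [show (QuotientAddGroup.mk ⟨q.out.1, q.out.2⟩ : DolbeaultH01 EM F V) = q from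
      QuotientAddGroup.out_eq' q] at h

end ExponentialMap
-- The theorem
theorem mainTheorem7
    {EM : Type*} [NormedAddCommGroup EM] [NormedSpace ℂ EM] [FiniteDimensional ℂ EM]
    {M : Type*} [TopologicalSpace M] [T2Space M] [SecondCountableTopology M]
    [ChartedSpace EM M] [IsManifold 𝓘(ℂ, EM) ω M]
    {F : Type*} [NormedAddCommGroup F] [NormedSpace ℂ F] [FiniteDimensional ℂ F]
    {V : M → Type*} [TopologicalSpace (TotalSpace F V)]
    [∀ x, AddCommGroup (V x)] [∀ x, Module ℂ (V x)] [∀ x, TopologicalSpace (V x)]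
    [∀ x, IsTopologicalAddGroup (V x)] [∀ x, ContinuousSMul ℂ (V x)]
    [FiberBundle F V] [VectorBundle ℂ F V] [ContMDiffVectorBundle ω F V 𝓘(ℂ, EM)]
    (g : ContMDiffRiemannianMetric 𝓘(ℝ, EM) ∞ F V) (hg : IsHermitianMetric g) :
    (∃ cov : CovariantDerivative 𝓘(ℝ, EM) F V, IsChernConnection g cov) ∧
    ∀ cov : CovariantDerivative 𝓘(ℝ, EM) F V, IsChernConnection g cov →
      (∀ D ∈ closedForms EM F V, ∃ S : ComplexStructure g,
        S.charts.atlas = twistorAtlas g (twistedConnection g cov D)) ∧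
      (∀ D ∈ closedForms EM F V, ∀ B : smoothSections EM F V,
        D + dbar EM F V B ∈ closedForms EM F V ∧
        ∃ S S' : ComplexStructure g,
          S.charts.atlas = twistorAtlas g (twistedConnection g cov D) ∧
          S'.charts.atlas = twistorAtlas g (twistedConnection g cov (D + dbar EM F V B)) ∧
          ∃ Φ : Biholomorphism S S',
            ∀ J : twistorSpace g, IsExpImage g B.1 (J : EndTotal F V) (Φ J : EndTotal F V)) ∧
      (∃! f : DolbeaultH01 EM F V → ComplexStructureClass g,
        ∀ (D) (hD : D ∈ closedForms EM F V) (S : ComplexStructure g),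
          S.charts.atlas = twistorAtlas g (twistedConnection g cov D) →
          f (QuotientAddGroup.mk ⟨D, hD⟩) = Quotient.mk (complexStructureSetoid g) S) := by
  refine ⟨exists_isChernConnection hg, fun cov hc => ⟨fun D hD => exists_complexStructure hg hc hD,
    fun D hD B => ?_, existsUnique_dolbeaultMap hg hc⟩⟩
  have hD' := add_mem hD (dbar_mem_closedForms B)
  obtain ⟨S, hS⟩ := exists_complexStructure hg hc hD
  obtain ⟨S', hS'⟩ := exists_complexStructure hg hc hD'
  exact ⟨hD', S, S', hS, hS', expBiholomorphism hg hc hD B hS hS', isExpImage_expMap hg B.1⟩
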